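/- Let $n\ge 2$, $G=SE(n)=SO(n)\ltimes\mathbb R^n$, let $e_n$ be the last standard basis vector and $H=\{h\in SO(n): he_n=e_n\}\cong SO(n-1)$. Let $B_1,B_2\subset\mathbb R^n$ be bodies, i.e. closed connected $n$-dimensional submanifolds with smooth boundaries $N_j=\partial B_j$ (not necessarily bounded), with outward unit normals $\nu_j$ and shape operators $S^{(j)}_b v=-D_v\nu_j$ on $T_bN_j$. Let $M$ be the closure in $G\times G$ of $M_0=\{(g_1,g_2): g_1(B_1)\cap g_2(B_2)=\emptyset\}$, and $\partial M$ its boundary in $G\times G$ (the collision configurations). Let $\mathcal F_j^{\pm}=\{(b,\sigma): b\in N_j,\ \sigma\in SO(n),\ \sigma e_n=\pm\nu_j(b)\}$, $M_e=\mathcal F_1^+\times\mathcal F_2^-\times G\times[0,\infty)$, $\partial M_e=\{s=0\}$, and let $\Psi:M_e\to G\times G$, $$\Psi(b_1,\sigma_1,b_2,\sigma_2,(A,a),s)=\Big(\big(A\sigma_1^{-1},\,a-\tfrac s2Ae_n-A\sigma_1^{-1}b_1\big),\ \big(A\sigma_2^{-1},\,a+\tfrac s2Ae_n-A\sigma_2^{-1}b_2\big)\Big).$$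 $G$ and $H$ act on $M_e$ by $g(b_1,\sigma_1,b_2,\sigma_2,g',s)h=(b_1,\sigma_1h,b_2,\sigma_2h,gg'h,s)$; $\mathfrak h_q$ is the tangent space at $q$ of the $H$-orbit of $q$. At $q=(b_1,\sigma_1,b_2,\sigma_2,g,s)$ put $S_j=\sigma_j^{-1}S^{(j)}_{b_j}\sigma_j$ on $\mathbb R^{n-1}=e_n^\perp$, and $S_j^{(s)}=S_j(1-\tfrac s2S_j)^{-1}$, the shape operator of the parallel hypersurface of $N_j$ at distance $s/2$ (where $1-\frac s2S_j$ is invertible). Consider the conditions: 1. for every $q\in\partial M$ the set $g_1(B_1)\cap g_2(B_2)$ is a single point, and $S_1+S_2$ is nonsingular at all points of $\partial M_e$; let then $\mathcal R\subset M_e$ be the set of points where $S_1^{(s)},S_2^{(s)}$ are defined and $S_1^{(s)}+S_2^{(s)}$ is nonsingular; 2. for every $q\in\partial M$ the set $g_1(B_1)\cap g_2(B_2)$ is a single point, and on some neighborhood of $\partial M_e$ in $M_e$ one of $S_1,S_2$ is nonsingular and $S_1+S_2-sS_1S_2$ is nonsingular; let then $\mathcal R$ be the set of all points of $M_e$ where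 this holds; 3. for every $q\in\partial M$ the set $g_1(B_1)\cap g_2(B_2)$ is nonempty, both bodies are convex, and the boundary of one of them has nowhere vanishing Gauss–Kronecker curvature; let then $\mathcal R=M_e$. In each case $\mathcal R$ is a $G$-invariant open neighborhood of $\partial M_e$ in $M_e$, on which $\Psi$ is a submersion to $G\times G$ with $\ker d\Psi_q=\mathfrak h_q$ for all $q\in\mathcal R$. Moreover there is a $G$-invariant open subset $\mathcal U\subset\mathcal R$ of $M_e$ containing all points of $\partial M_e$ that $\Psi$ maps into $\partial M$ (so $\mathcal U$ is a neighborhood of $\partial M_e$ whenever $\Psi(\partial M_e)\subset\partial M$), such that $\Psi(\mathcal U)$ is an open neighborhood of $\partial M$ in $M$ and $\Psi|_{\mathcal U}:\mathcal U\to\Psi(\mathcal U)$ is a smooth principal $H$-bundle; under condition 3 one can take $\mathcal U=M_e$. In addition, in each case, $M$ is a smooth submanifold with boundary of $G\times G$ of full dimension $2\dim G$, its boundary $\partial M$ is a smooth hypersurface, and there are smooth functions $b_j:\partial M\to N_j$, $j=1,2$, such that $b_1(q),b_2(q)$ are the unique points of $B_1,B_2$ with $g_1(b_1(q))=g_2(b_2(q))$,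 for every $q=(g_1,g_2)\in\partial M$. -/

import Mathlib

open Set Topology
open scoped ContDiff InnerProductSpace

noncomputable section

namespace RigidBodies

/-! ### Euclidean space, rotations, rigid motions

The ambient space is `ℝⁿ` with `n = d + 1`.  The groups `SO(n)`, `SE(n)` and all the manifolds below
are given as (embedded) subsets of finite-dimensional normed spaces; smoothness of a map on such a
subset is `ContDiffOn ℝ ∞`, and tangent spaces are spans of Mathlib's tangent cones. -/

/-- `ℝⁿ`, `n = d + 1`. -/
abbrev E (d : ℕ) := EuclideanSpace ℝ (Fin (d + 1))

/-- Linear endomorphisms of `ℝⁿ`. -/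
abbrev L (d : ℕ) := E d →L[ℝ] E d

/-- The last vector `e_n` of the standard basis. -/
def e (d : ℕ) : E d := EuclideanSpace.single (Fin.last d) 1

/-- `ℝⁿ⁻¹ = e_n^⊥`. -/
abbrev Hyp (d : ℕ) : Submodule ℝ (E d) := (ℝ ∙ e d)ᗮ

/-- The inverse of a rotation, i.e. its adjoint (transpose). -/
abbrev inv {d : ℕ} (σ : L d) : L d := ContinuousLinearMap.adjoint σ

/-- `SO(n)`. -/
def SO (d : ℕ) : Set (L d) := {A | A ∈ unitary (L d) ∧ LinearMap.det (A : E d →ₗ[ℝ] E d) = 1}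

/-- `H = SO(n-1)`, the rotations that fix `e_n`. -/
def H (d : ℕ) : Set (L d) := {h | h ∈ SO d ∧ h (e d) = e d}

/-- Pairs `(A, a)`. -/
abbrev Aff (d : ℕ) := L d × E d

/-- `G = SE(n)`: the pairs `(A, a)` with `A ∈ SO(n)`. -/
def SE (d : ℕ) : Set (Aff d) := {g | g.1 ∈ SO d}

/-- The action `g(b) = A b + a`. -/
def act {d : ℕ} (g : Aff d) (b : E d) : E d := g.1 b + g.2

/-- The product `(A, a)(A', a') = (A A', A a' + a)`. -/
def mulAff {d : ℕ} (g g' : Aff d) : Aff d := (g.1 ∘L g'.1, g.1 g'.2 + g.2)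

/-- `G × G`. -/
def GG (d : ℕ) : Set (Aff d × Aff d) := SE d ×ˢ SE d

/-! ### General notions for subsets of normed spaces -/

/-- `U` is a (relatively) open subset of `X`. -/
def IsRelOpen {V : Type*} [TopologicalSpace V] (U X : Set V) : Prop :=
  ∃ O : Set V, IsOpen O ∧ U = X ∩ O

/-- The tangent space at `x` of an embedded submanifold `X` (possibly with boundary). -/
def tangentSpaceAt {V : Type*} [NormedAddCommGroup V] [NormedSpace ℝ V] (X : Set V) (x : V) :
    Submodule ℝ V :=
  Submodule.span ℝ (tangentConeAt ℝ X x)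

/-! ### Bodies, normals, shape operators -/

/-- On the open set `U ∋ b` the set `B` is the sublevel set `f ≤ 0` of a smooth function `f`
which is regular at `b`. -/
def IsDefiningFunction {d : ℕ} (B : Set (E d)) (b : E d) (U : Set (E d)) (f : E d → ℝ) : Prop :=
  IsOpen U ∧ b ∈ U ∧ ContDiffOn ℝ ∞ f U ∧ (∀ x ∈ U, x ∈ B ↔ f x ≤ 0) ∧ gradient f b ≠ 0

/-- A body: a connected closed `n`-dimensional submanifold of `ℝⁿ` with smooth boundary.
It may be unbounded. -/
structure IsBody {d : ℕ} (B : Set (E d)) : Prop where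
  isClosed : IsClosed B
  isConnected : IsConnected B
  smooth_boundary : ∀ b ∈ frontier B, ∃ U f, IsDefiningFunction B b U f

/-- `ν` is the outward unit normal vector of `B` at the boundary point `b`. -/
def IsOutwardNormal {d : ℕ} (B : Set (E d)) (b ν : E d) : Prop :=
  ‖ν‖ = 1 ∧ ∃ U f, IsDefiningFunction B b U f ∧ gradient f b = ‖gradient f b‖ • ν

open Classical in
/-- The outward unit normal field `ν` of `B` (`0` where there is none). -/
def normal {d : ℕ} (B : Set (E d)) (b : E d) : E d :=
  if h : ∃ ν, IsOutwardNormal B b ν then h.choose else 0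

/-- The tangent space `ν(b)^⊥` of the boundary of `B` at `b`. -/
abbrev Tan {d : ℕ} (B : Set (E d)) (b : E d) : Submodule ℝ (E d) := (ℝ ∙ normal B b)ᗮ

/-- The shape operator `S_b v = - D_v ν` on `ν(b)^⊥`.  The derivative is taken along `∂B`; it is
determined on tangent vectors.  (`D_v ν` is tangent, so that the projection only serves to restrict
the codomain.) -/
def shapeOperator {d : ℕ} (B : Set (E d)) (b : E d) : Tan B b →L[ℝ] Tan B b :=
  (Tan B b).orthogonalProjectionOnto ∘L (-(fderivWithin ℝ (normal B) (frontier B) b)) ∘L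
    (Tan B b).subtypeL

/-- The Gauss–Kronecker curvature of `∂B` at `b`. -/
def gaussKronecker {d : ℕ} (B : Set (E d)) (b : E d) : ℝ :=
  LinearMap.det (shapeOperator B b : Tan B b →ₗ[ℝ] Tan B b)

/-- The shape operator in the adapted frame `σ` at `b`, `S = σ⁻¹ S_b σ : ℝⁿ⁻¹ → ℝⁿ⁻¹`. (An adapted
frame maps `ℝⁿ⁻¹` onto the tangent space; the projections only serve to restrict codomains.) -/
def frameShape {d : ℕ} (B : Set (E d)) (b : E d) (σ : L d) : Hyp d →L[ℝ] Hyp d :=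
  (Hyp d).orthogonalProjectionOnto ∘L inv σ ∘L (Tan B b).subtypeL ∘L shapeOperator B b ∘L
    (Tan B b).orthogonalProjectionOnto ∘L σ ∘L (Hyp d).subtypeL

/-- The shape operator `S (1 - t S)⁻¹` of the parallel hypersurface at distance `t` of a hypersurface
with shape operator `S` (when `1 - t S` is invertible). -/
def parallelShape {d : ℕ} (S : Hyp d →L[ℝ] Hyp d) (t : ℝ) : Hyp d →L[ℝ] Hyp d :=
  S * Ring.inverse (1 - t • S)

/-! ### The configuration space -/

/-- The interior configurations: the bodies are disjoint. -/
def M₀ {d : ℕ} (B₁ B₂ : Set (E d)) : Set (Aff d × Aff d) :=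
  {q | q ∈ GG d ∧ Disjoint (act q.1 '' B₁) (act q.2 '' B₂)}

/-- The configuration space `M`, the closure of `M₀` (`G × G` is closed, so that this is the closure
in `G × G`). -/
def M {d : ℕ} (B₁ B₂ : Set (E d)) : Set (Aff d × Aff d) := closure (M₀ B₁ B₂)

/-- The boundary of `M` in `G × G`: the collision configurations. -/
def bdM {d : ℕ} (B₁ B₂ : Set (E d)) : Set (Aff d × Aff d) :=
  M B₁ B₂ ∩ closure (GG d \ M B₁ B₂)

/-! ### The extended configuration manifold and the map `Ψ` -/

/-- The adapted frames `(b, σ)` of sign `ε` over the boundary of `B`: `σ e_n = ε ν(b)`. -/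
def Frames {d : ℕ} (ε : ℝ) (B : Set (E d)) : Set (E d × L d) :=
  {p | p.1 ∈ frontier B ∧ p.2 ∈ SO d ∧ p.2 (e d) = ε • normal B p.1}

/-- The space of tuples `((b₁, σ₁), (b₂, σ₂), (A, a), s)`. -/
abbrev Amb (d : ℕ) := (E d × L d) × (E d × L d) × Aff d × ℝ

/-- `M_e = F₁⁺ × F₂⁻ × G × [0, ∞)`. -/
def Me {d : ℕ} (B₁ B₂ : Set (E d)) : Set (Amb d) :=
  Frames 1 B₁ ×ˢ Frames (-1) B₂ ×ˢ SE d ×ˢ Ici 0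

/-- The coordinate `s`. -/
abbrev gap {d : ℕ} (q : Amb d) : ℝ := q.2.2.2

/-- The boundary `s = 0` of `M_e`. -/
def bdMe {d : ℕ} (B₁ B₂ : Set (E d)) : Set (Amb d) := {q | q ∈ Me B₁ B₂ ∧ gap q = 0}

/-- `Ψ(b₁, σ₁, b₂, σ₂, (A, a), s) = ((A σ₁⁻¹, a - (s/2) A e_n - A σ₁⁻¹ b₁),
(A σ₂⁻¹, a + (s/2) A e_n - A σ₂⁻¹ b₂))`. -/
def Psi {d : ℕ} (q : Amb d) : Aff d × Aff d :=
  let b₁ := q.1.1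
  let σ₁ := q.1.2
  let b₂ := q.2.1.1
  let σ₂ := q.2.1.2
  let A := q.2.2.1.1
  let a := q.2.2.1.2
  let s := gap q
  ((A ∘L inv σ₁, a - (s / 2) • A (e d) - A (inv σ₁ b₁)),
   (A ∘L inv σ₂, a + (s / 2) • A (e d) - A (inv σ₂ b₂)))

/-- The left action of `g ∈ G` on `M_e`. -/
def leftAct {d : ℕ} (g : Aff d) (q : Amb d) : Amb d :=
  (q.1, q.2.1, mulAff g q.2.2.1, gap q)

/-- The right action of `h ∈ H` on `M_e`. -/
def rightAct {d : ℕ} (q : Amb d) (h : L d) : Amb d :=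
  ((q.1.1, q.1.2 ∘L h), (q.2.1.1, q.2.1.2 ∘L h), mulAff q.2.2.1 (h, 0), gap q)

/-- `𝔥_q`: the tangent space at `q` of the `H`-orbit of `q`. -/
def vertical {d : ℕ} (q : Amb d) : Submodule ℝ (Amb d) :=
  tangentSpaceAt (rightAct q '' H d) q

/-- `S₁` at `q`: the shape operator of `∂B₁` at `b₁` in the frame `σ₁`. -/
def S₁ {d : ℕ} (B₁ : Set (E d)) (q : Amb d) : Hyp d →L[ℝ] Hyp d := frameShape B₁ q.1.1 q.1.2

/-- `S₂` at `q`: the shape operator of `∂B₂` at `b₂` in the frame `σ₂`. -/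
def S₂ {d : ℕ} (B₂ : Set (E d)) (q : Amb d) : Hyp d →L[ℝ] Hyp d := frameShape B₂ q.2.1.1 q.2.1.2

/-- The points of `M_e` at which the sum of the shape operators of the level hypersurfaces at `s`
(the parallel hypersurfaces of `∂B₁`, `∂B₂` at distance `s/2`) is defined and nonsingular. -/
def region₁ {d : ℕ} (B₁ B₂ : Set (E d)) : Set (Amb d) :=
  {q | q ∈ Me B₁ B₂ ∧ IsUnit (1 - (gap q / 2) • S₁ B₁ q) ∧ IsUnit (1 - (gap q / 2) • S₂ B₂ q) ∧
    IsUnit (parallelShape (S₁ B₁ q) (gap q / 2) + parallelShape (S₂ B₂ q) (gap q / 2))}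

/-- The points of `M_e` at which one of `S₁`, `S₂` is nonsingular and `S₁ + S₂ - s S₁ S₂` is
nonsingular. -/
def region₂ {d : ℕ} (B₁ B₂ : Set (E d)) : Set (Amb d) :=
  {q | q ∈ Me B₁ B₂ ∧ (IsUnit (S₁ B₁ q) ∨ IsUnit (S₂ B₂ q)) ∧
    IsUnit (S₁ B₁ q + S₂ B₂ q - gap q • (S₁ B₁ q * S₂ B₂ q))}

/-! ### The conclusions -/

/-- `U` is a `G`-invariant open neighbourhood of `∂M_e` in `M_e`, on which `Ψ` is a submersion to
`G × G` and the kernel of `dΨ_q` is `𝔥_q`. -/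
structure IsSubmersionNhd {d : ℕ} (B₁ B₂ : Set (E d)) (U : Set (Amb d)) : Prop where
  relOpen : IsRelOpen U (Me B₁ B₂)
  bdMe_subset : bdMe B₁ B₂ ⊆ U
  leftAct_mem : ∀ g ∈ SE d, ∀ q ∈ U, leftAct g q ∈ U
  smooth : ContDiffOn ℝ ∞ (Psi (d := d)) U
  mapsTo : MapsTo Psi U (GG d)
  surjective : ∀ q ∈ U,
    (tangentSpaceAt (Me B₁ B₂) q).map (fderiv ℝ Psi q : Amb d →ₗ[ℝ] Aff d × Aff d) =
      tangentSpaceAt (GG d) (Psi q)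
  kernel : ∀ q ∈ U,
    tangentSpaceAt (Me B₁ B₂) q ⊓ LinearMap.ker (fderiv ℝ Psi q : Amb d →ₗ[ℝ] Aff d × Aff d) =
      vertical q

/-- `π : U → π(U)` is a smooth principal `H`-bundle with respect to the right action of `H`: the
action preserves `U` and is free, its orbits are the fibres, and there are smooth `H`-equivariant
local trivializations `(π, τ) : U ∩ π⁻¹(W) ≃ W × H`, with smooth inverse `χ`. -/
structure IsPrincipalHBundle {d : ℕ} (π : Amb d → Aff d × Aff d) (U : Set (Amb d)) : Prop where
  smooth : ContDiffOn ℝ ∞ π U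
  rightAct_mem : ∀ q ∈ U, ∀ h ∈ H d, rightAct q h ∈ U
  free : ∀ q ∈ U, ∀ h ∈ H d, rightAct q h = q → h = 1
  fibre : ∀ q ∈ U, ∀ q' ∈ U, π q = π q' ↔ ∃ h ∈ H d, q' = rightAct q h
  locallyTrivial : ∀ x ∈ π '' U, ∃ W, IsRelOpen W (π '' U) ∧ x ∈ W ∧
    ∃ (τ : Amb d → L d) (χ : (Aff d × Aff d) × L d → Amb d),
      ContDiffOn ℝ ∞ τ (U ∩ π ⁻¹' W) ∧ ContDiffOn ℝ ∞ χ (W ×ˢ H d) ∧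
      (∀ q ∈ U ∩ π ⁻¹' W, τ q ∈ H d ∧ χ (π q, τ q) = q ∧
        ∀ h ∈ H d, τ (rightAct q h) = τ q ∘L h) ∧
      (∀ y ∈ W, ∀ h ∈ H d, χ (y, h) ∈ U ∧ π (χ (y, h)) = y ∧ τ (χ (y, h)) = h)

/-- `U` is a `G`-invariant open subset of `M_e` containing every point of `∂M_e` that represents a
collision configuration; `Ψ` maps `U` onto an open neighbourhood of `∂M` in `M`, and
`Ψ : U → Ψ(U)` is a principal `H`-bundle. -/
structure IsCollisionBundle {d : ℕ} (B₁ B₂ : Set (E d)) (U : Set (Amb d)) : Prop where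
  relOpen : IsRelOpen U (Me B₁ B₂)
  bdMe_subset : ∀ q ∈ bdMe B₁ B₂, Psi q ∈ bdM B₁ B₂ → q ∈ U
  leftAct_mem : ∀ g ∈ SE d, ∀ q ∈ U, leftAct g q ∈ U
  image_relOpen : IsRelOpen (Psi '' U) (M B₁ B₂)
  bdM_subset : bdM B₁ B₂ ⊆ Psi '' U
  principal : IsPrincipalHBundle Psi U

/-- `M` is a smooth codimension-zero submanifold with boundary of `G × G`, whose boundary `bdM` is a
smooth hypersurface: near each boundary point `M` is `f ≥ 0` and `bdM` is `f = 0` for a smooth `f`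
with nonzero differential on the tangent space of `G × G`. -/
def HasSmoothBoundary {d : ℕ} (B₁ B₂ : Set (E d)) : Prop :=
  ∀ q ∈ bdM B₁ B₂, ∃ (O : Set (Aff d × Aff d)) (f : Aff d × Aff d → ℝ),
    IsOpen O ∧ q ∈ O ∧ ContDiffOn ℝ ∞ f O ∧
    (∀ x ∈ GG d ∩ O, x ∈ M B₁ B₂ ↔ 0 ≤ f x) ∧
    (∀ x ∈ GG d ∩ O, x ∈ bdM B₁ B₂ ↔ f x = 0) ∧
    ∃ v ∈ tangentSpaceAt (GG d) q, fderiv ℝ f q v ≠ 0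

/-- There are smooth functions `b₁, b₂` on `∂M` with values in the boundaries of the bodies, such
that `b₁(q)`, `b₂(q)` are the unique points of the bodies that are in contact in the collision
configuration `q`. -/
def HasSmoothContactPoints {d : ℕ} (B₁ B₂ : Set (E d)) : Prop :=
  ∃ b₁ b₂ : Aff d × Aff d → E d,
    ContDiffOn ℝ ∞ b₁ (bdM B₁ B₂) ∧ ContDiffOn ℝ ∞ b₂ (bdM B₁ B₂) ∧
    ∀ q ∈ bdM B₁ B₂, b₁ q ∈ frontier B₁ ∧ b₂ q ∈ frontier B₂ ∧ act q.1 (b₁ q) = act q.2 (b₂ q) ∧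
      ∀ x₁ ∈ B₁, ∀ x₂ ∈ B₂, act q.1 x₁ = act q.2 x₂ → x₁ = b₁ q ∧ x₂ = b₂ q

/-! ### The hypotheses -/

/-- In every collision configuration the two bodies meet. -/
def ContactAtBoundary {d : ℕ} (B₁ B₂ : Set (E d)) : Prop :=
  ∀ q ∈ bdM B₁ B₂, (act q.1 '' B₁ ∩ act q.2 '' B₂).Nonempty

/-- In every collision configuration the two bodies meet in exactly one point. -/
def SingleContactAtBoundary {d : ℕ} (B₁ B₂ : Set (E d)) : Prop :=
  ∀ q ∈ bdM B₁ B₂, ∃ x, act q.1 '' B₁ ∩ act q.2 '' B₂ = {x}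

/-- Condition 1: `S₁ + S₂` is nonsingular at all points of `∂M_e`. -/
def Condition₁ {d : ℕ} (B₁ B₂ : Set (E d)) : Prop :=
  SingleContactAtBoundary B₁ B₂ ∧ ∀ q ∈ bdMe B₁ B₂, IsUnit (S₁ B₁ q + S₂ B₂ q)

/-- Condition 2: there is a neighbourhood `N` of `∂M_e` in `M_e` on which one of the `S_j` is
nonsingular and `S₁ + S₂ - s S₁ S₂` is nonsingular. -/
def Condition₂ {d : ℕ} (B₁ B₂ : Set (E d)) : Prop :=
  SingleContactAtBoundary B₁ B₂ ∧
    ∃ N, IsRelOpen N (Me B₁ B₂) ∧ bdMe B₁ B₂ ⊆ N ∧ N ⊆ region₂ B₁ B₂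

/-- Condition 3: the bodies are convex and the boundary of one of them has nonvanishing
Gauss–Kronecker curvature. -/
def Condition₃ {d : ℕ} (B₁ B₂ : Set (E d)) : Prop :=
  ContactAtBoundary B₁ B₂ ∧ Convex ℝ B₁ ∧ Convex ℝ B₂ ∧
    ((∀ b ∈ frontier B₁, gaussKronecker B₁ b ≠ 0) ∨ (∀ b ∈ frontier B₂, gaussKronecker B₂ b ≠ 0))

end RigidBodies

end

open Filter

noncomputable section

namespace RigidBodies

section

variable {d : ℕ}

/-! ### Rotations -/

/-! A point of `Me` is a configuration together with boundary points b₁, b₂ whose outward normals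
are opposite in that configuration, which lie on a common normal line at distance s, plus a frame
adapted to that line. `Psi` keeps only the configuration. Everything therefore depends on how
uniquely the contact equations, `IsSolution`, can be solved for (b₁, b₂, s).

Infinitesimally: a tangent vector of `Me` consists of x₁, x₂ in e^⊥, skew maps K₁, K₂, K with K₁e =
-S₁x₁ and K₂e = S₂x₂, a translation and a number r. If it is killed by dΨ, then K₁ = K₂ = K, r = 0,
x₂ = x₁ - sS₁x₁, and what remains is (S₁ + S₂ - sS₂S₁)x₁ = 0. So invertibility of `combined` yields
`Psi_kernel` and `Psi_surjective`. Under condition 1 this operator is the sum of the parallel shape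
operators multiplied by invertible factors; under condition 2 it is the adjoint of the given
operator; under condition 3 it is injective because both shape operators are negative semidefinite
and one is definite.

Locally: the implicit function theorem turns the same invertibility into a smooth, locally unique
solution of the contact equations (`exists_localSolution`), and moving frames turn that into smooth
sections of `Psi` (`exists_section`). By `isCollisionBundle_of` a set U then carries the bundle as
soon as configurations determine b₁ and b₂ on U, `Psi` maps U into M, and the image contains the
boundary of M.

Globally: for convex bodies supporting hyperplanes give these three properties on all of `Me`. In
general the danger is that parts of unbounded bodies far from the contact point almost touch as
well; `exists_eventually_near_contact` excludes it. Holes not involved in the contact are filled in,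
after which the boundaries are connected, by unicoherence of ℝⁿ. The sum of the largest eigenvalues
of the two shape operators never vanishes, since otherwise a rotated frame would make S₁ + S₂
singular, and it is negative at the contact; hence it is negative for all pairs of boundary points.
Suppose almost touching points escape to infinity. Then both bodies are unbounded. If one largest
eigenvalue were positive somewhere, the other body would be uniformly strictly convex and so
bounded. Hence both bodies are convex, and the direction of escape is a common recession direction,
along which the contact point can be moved to a second contact point: a contradiction.

With this compactness the signed gap of the local solution decides membership: M is gap ≥ 0 and its
boundary is gap = 0 (`exists_collisionChart`). Sliding the second body along the common normal
changes the gap at unit rate, so the gap is a regular defining function. Conditions 2 and 3 imply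
condition 1, which is all that the boundary statements need. -/

theorem contDiff_inv {n : WithTop ℕ∞} : ContDiff ℝ n (fun σ : L d => inv σ) :=
  (IsBoundedLinearMap.contDiff (𝕜 := ℝ)
    (IsLinearMap.with_bound ⟨fun x y => by simp [inv], fun c x => by simp [inv]⟩ 1
      (fun x => by simp [inv])))

theorem continuous_inv : Continuous (fun σ : L d => inv σ) := contDiff_inv (n := 0).continuous

theorem inv_one : inv (1 : L d) = 1 := ContinuousLinearMap.adjoint_id

theorem inv_inv (σ : L d) : inv (inv σ) = σ := ContinuousLinearMap.adjoint_adjoint σ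

theorem inv_comp (σ τ : L d) : inv (σ ∘L τ) = inv τ ∘L inv σ := ContinuousLinearMap.adjoint_comp σ τ

theorem inner_inv_left (σ : L d) (x y : E d) : ⟪inv σ x, y⟫_ℝ = ⟪x, σ y⟫_ℝ :=
  ContinuousLinearMap.adjoint_inner_left σ y x

theorem inner_inv_right (σ : L d) (x y : E d) : ⟪x, inv σ y⟫_ℝ = ⟪σ x, y⟫_ℝ :=
  ContinuousLinearMap.adjoint_inner_right σ x y

theorem mem_SO_iff {A : L d} :
    A ∈ SO d ↔ inv A ∘L A = 1 ∧ A ∘L inv A = 1 ∧ LinearMap.det (A : E d →ₗ[ℝ] E d) = 1 := by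
  simp only [SO, mem_ofPred_eq, Unitary.mem_iff, ContinuousLinearMap.star_eq_adjoint, and_assoc]
  rfl

section SO

variable {A A' : L d} (hA : A ∈ SO d)

include hA

theorem SO_inv_comp : inv A ∘L A = 1 := (mem_SO_iff.1 hA).1

theorem SO_comp_inv : A ∘L inv A = 1 := (mem_SO_iff.1 hA).2.1

theorem SO_inv_apply (x : E d) : inv A (A x) = x := by
  simpa using congrArg (fun T : L d => T x) (SO_inv_comp hA)

theorem SO_apply_inv (x : E d) : A (inv A x) = x := by
  simpa using congrArg (fun T : L d => T x) (SO_comp_inv hA)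

theorem SO_inner (x y : E d) : ⟪A x, A y⟫_ℝ = ⟪x, y⟫_ℝ := by
  rw [← inner_inv_left, SO_inv_apply hA]

theorem SO_norm (x : E d) : ‖A x‖ = ‖x‖ := by
  rw [← sq_eq_sq₀ (norm_nonneg _) (norm_nonneg _), ← real_inner_self_eq_norm_sq,
    ← real_inner_self_eq_norm_sq, SO_inner hA]

theorem SO_inv_mem : inv A ∈ SO d := by
  refine mem_SO_iff.2 ⟨by rw [inv_inv]; exact SO_comp_inv hA, by rw [inv_inv]; exact SO_inv_comp hA, ?_⟩
  have h := congrArg (fun T : L d => LinearMap.det (T : E d →ₗ[ℝ] E d)) (SO_inv_comp hA)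
  have h3 := (mem_SO_iff.1 hA).2.2
  simp only [ContinuousLinearMap.toLinearMap_comp, LinearMap.det_comp, h3, mul_one] at h
  rw [h]
  exact LinearMap.det_id

theorem SO_comp_mem (hA' : A' ∈ SO d) : A ∘L A' ∈ SO d := by
  refine ⟨(unitary (L d)).mul_mem hA.1 hA'.1, ?_⟩
  rw [ContinuousLinearMap.toLinearMap_comp, LinearMap.det_comp, hA.2, hA'.2, one_mul]

theorem SO_inv_norm (x : E d) : ‖inv A x‖ = ‖x‖ := SO_norm (SO_inv_mem hA) x

theorem SO_eq_inv_apply {x y : E d} (h : A x = y) : x = inv A y := by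
  rw [← h, SO_inv_apply hA]

end SO

theorem one_mem_SO : (1 : L d) ∈ SO d :=
  ⟨one_mem _, LinearMap.det_id⟩

theorem isClosed_SO : IsClosed (SO d) := by
  have h : SO d = {A : L d | inv A ∘L A = 1} ∩ ({A | A ∘L inv A = 1} ∩
      {A | LinearMap.det (A : E d →ₗ[ℝ] E d) = 1}) := by
    ext A; exact mem_SO_iff
  rw [h]
  refine (isClosed_eq (continuous_inv.clm_comp continuous_id) continuous_const).inter
    ((isClosed_eq (continuous_id.clm_comp continuous_inv) continuous_const).inter
      (isClosed_eq ?_ continuous_const))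
  exact ContinuousLinearMap.continuous_det

theorem norm_e : ‖e d‖ = 1 := by simp [e]

theorem H_subset_SO : H d ⊆ SO d := fun _ h => h.1

theorem H_inv_mem {h : L d} (hh : h ∈ H d) : inv h ∈ H d :=
  ⟨SO_inv_mem hh.1, by
    have := SO_inv_apply hh.1 (e d)
    rwa [hh.2] at this⟩

/-- The reflection in the hyperplane orthogonal to `a`. -/
def hrefl (a : E d) : L d := 1 - (2 / ‖a‖ ^ 2) • (innerSL ℝ a).smulRight a

theorem hrefl_apply (a x : E d) : hrefl a x = x - (2 / ‖a‖ ^ 2 * ⟪a, x⟫_ℝ) • a := by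
  simp [hrefl, smul_smul]

theorem hrefl_eq (a : E d) : hrefl a = ((ℝ ∙ a)ᗮ.reflection : E d →L[ℝ] E d) := by
  ext1 x
  have h : (ℝ ∙ a)ᗮ.reflection x = -(ℝ ∙ a).reflection x := by
    rw [Submodule.reflection_orthogonal_apply]
  rw [hrefl_apply]
  change _ = (ℝ ∙ a)ᗮ.reflection x
  rw [h, Submodule.reflection_singleton_apply]
  simp only [RCLike.ofReal_real_eq_id, id]
  rw [neg_sub, ← smul_assoc]
  congr 2
  simp only [nsmul_eq_mul, Nat.cast_ofNat]; ring

theorem hrefl_hrefl (a x : E d) : hrefl a (hrefl a x) = x := by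
  rw [hrefl_eq]; exact Submodule.reflection_reflection _ x

theorem hrefl_comp_self (a : E d) : hrefl a ∘L hrefl a = 1 := by
  ext1 x; exact hrefl_hrefl a x

theorem inv_hrefl (a : E d) : inv (hrefl a) = hrefl a := by
  refine (ContinuousLinearMap.eq_adjoint_iff _ _).2 (fun x y => ?_) |>.symm
  simp only [hrefl_apply, inner_sub_left, inner_sub_right, inner_smul_left, inner_smul_right,
    RCLike.conj_to_real]
  rw [real_inner_comm x a]; ring

theorem det_hrefl {a : E d} (ha : a ≠ 0) :
    LinearMap.det (hrefl a : E d →ₗ[ℝ] E d) = -1 := by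
  rw [hrefl_eq]
  have h := Submodule.det_reflection (𝕜 := ℝ) (K := (ℝ ∙ a)ᗮ)
  rw [Submodule.orthogonal_orthogonal, finrank_span_singleton ha, pow_one] at h
  exact h

theorem hrefl_self {a : E d} (ha : a ≠ 0) : hrefl a a = -a := by
  have : ‖a‖ ≠ 0 := norm_ne_zero_iff.2 ha
  rw [hrefl_apply, real_inner_self_eq_norm_sq]
  rw [div_mul_cancel₀ _ (pow_ne_zero 2 this), two_smul]; abel

theorem hrefl_of_orthogonal {a x : E d} (h : ⟪a, x⟫_ℝ = 0) : hrefl a x = x := by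
  rw [hrefl_apply, h]; simp

/-- A rotation that takes the unit vector `u` to the unit vector `v ≠ -u`. -/
def rot (u v : E d) : L d := hrefl (u + v) ∘L hrefl u

theorem rot_mem_SO {u v : E d} (hu : u ≠ 0) (huv : u + v ≠ 0) : rot u v ∈ SO d := by
  refine mem_SO_iff.2 ⟨?_, ?_, ?_⟩
  · rw [rot, inv_comp, inv_hrefl, inv_hrefl]
    ext1 x; simp [hrefl_hrefl]
  · rw [rot, inv_comp, inv_hrefl, inv_hrefl]
    ext1 x; simp [hrefl_hrefl]
  · rw [rot, ContinuousLinearMap.toLinearMap_comp, LinearMap.det_comp, det_hrefl hu, det_hrefl huv]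
    norm_num

theorem rot_apply {u v : E d} (hu : ‖u‖ = 1) (hv : ‖v‖ = 1) (huv : u + v ≠ 0) : rot u v u = v := by
  have hu0 : u ≠ 0 := by rintro rfl; simp at hu
  rw [rot, ContinuousLinearMap.comp_apply, hrefl_self hu0, map_neg, hrefl_apply]
  have h1 : ⟪u + v, u⟫_ℝ = 1 + ⟪u, v⟫_ℝ := by
    rw [inner_add_left, real_inner_self_eq_norm_sq, hu, real_inner_comm]; norm_num
  have h2 : ‖u + v‖ ^ 2 = 2 * (1 + ⟪u, v⟫_ℝ) := by
    rw [norm_add_sq_real, hu, hv]; ring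
  have h3 : (1 + ⟪u, v⟫_ℝ) ≠ 0 := by
    intro h; rw [h, mul_zero] at h2
    exact huv (norm_eq_zero.1 (by simpa using h2))
  rw [h1, h2]
  have : 2 / (2 * (1 + ⟪u, v⟫_ℝ)) * (1 + ⟪u, v⟫_ℝ) = 1 := by field_simp
  rw [this, one_smul]; abel

theorem rot_self {u : E d} (hu : ‖u‖ = 1) : rot u u = 1 := by
  ext1 x
  have : hrefl (u + u) = hrefl u := by
    ext1 y
    rw [hrefl_apply, hrefl_apply, ← two_smul ℝ u, norm_smul, inner_smul_left, hu, smul_smul]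
    congr 2
    simp only [RCLike.conj_to_real]
    norm_num
    ring
  rw [rot, this, hrefl_comp_self]

theorem contDiffAt_hrefl {a : E d} (ha : a ≠ 0) {n : WithTop ℕ∞} :
    ContDiffAt ℝ n (fun a : E d => hrefl a) a := by
  have h1 : ContDiffAt ℝ n (fun a : E d => 2 / ‖a‖ ^ 2) a :=
    contDiffAt_const.div (contDiff_norm_sq ℝ).contDiffAt (pow_ne_zero 2 (norm_ne_zero_iff.2 ha))
  have h2 : ContDiff ℝ n (fun a : E d => (innerSL ℝ a, a)) :=
    (innerSL ℝ (E := E d)).contDiff.prodMk contDiff_id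
  have h3 : ContDiffAt ℝ n (fun a : E d => (innerSL ℝ a).smulRight a) a :=
    ((ContinuousLinearMap.smulRightL ℝ (E d) (E d)).isBoundedBilinearMap.contDiff.comp
      h2).contDiffAt
  exact contDiffAt_const.sub (h1.smul h3)

/-- This makes moving frames smooth: composing a frame adapted at one boundary point with `rot` from
the normal there to the normal at a nearby point gives a frame adapted at the nearby point, and by
`rot_self` the original frame at the base point. -/
theorem contDiffAt_rot {u v : E d} (huv : u + v ≠ 0) {n : WithTop ℕ∞} :
    ContDiffAt ℝ n (fun v : E d => rot u v) v := by
  unfold rot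
  refine ContDiffAt.clm_comp ?_ contDiffAt_const
  have h : ContDiffAt ℝ n (fun v : E d => u + v) v := contDiffAt_const.add contDiffAt_id
  exact ContDiffAt.comp (g := fun a : E d => hrefl a) v (contDiffAt_hrefl huv) h

theorem add_ne_zero_of_ne_neg {u v : E d} (h : v ≠ -u) : u + v ≠ 0 := by
  intro h'; exact h (eq_neg_of_add_eq_zero_right h')

theorem exists_unit_orthogonal (hd : 1 ≤ d) (u : E d) : ∃ w : E d, ‖w‖ = 1 ∧ ⟪u, w⟫_ℝ = 0 := by
  have h : (ℝ ∙ u)ᗮ ≠ ⊥ := by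
    intro h
    have h1 := Submodule.finrank_add_finrank_orthogonal (ℝ ∙ u)
    rw [h, finrank_bot, add_zero, finrank_euclideanSpace_fin] at h1
    have h2 := finrank_span_le_card (R := ℝ) ({u} : Set (E d))
    simp at h2; omega
  obtain ⟨w, hw, hw0⟩ := Submodule.exists_mem_ne_zero_of_ne_bot h
  refine ⟨‖w‖⁻¹ • w, ?_, ?_⟩
  · rw [norm_smul, norm_inv, norm_norm, inv_mul_cancel₀ (norm_ne_zero_iff.2 hw0)]
  · rw [inner_smul_right, Submodule.mem_orthogonal_singleton_iff_inner_right.1 hw, mul_zero]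

theorem exists_SO_apply (hd : 1 ≤ d) {u v : E d} (hu : ‖u‖ = 1) (hv : ‖v‖ = 1) :
    ∃ σ ∈ SO d, σ u = v := by
  have hu0 : u ≠ 0 := by rintro rfl; simp at hu
  by_cases h : v = -u
  -- Antipodal vectors are joined through a unit vector orthogonal to both, which exists because n ≥
  -- 2.
  · obtain ⟨w, hw, huw⟩ := exists_unit_orthogonal hd u
    have hw0 : w ≠ 0 := by rintro rfl; simp at hw
    have h1 : u + w ≠ 0 := by
      intro h'
      have := congrArg (fun y => ⟪u, y⟫_ℝ) h'
      simp [inner_add_right, huw, hu] at this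
    have h2 : w + v ≠ 0 := by
      intro h'
      have := congrArg (fun y => ⟪w, y⟫_ℝ) h'
      rw [h] at this
      simp [inner_add_right, real_inner_comm, huw, hw] at this
    exact ⟨_, SO_comp_mem (rot_mem_SO hw0 h2) (rot_mem_SO hu0 h1), by
      simp [rot_apply hu hw h1, rot_apply hw hv h2]⟩
  · have h1 := add_ne_zero_of_ne_neg h
    exact ⟨_, rot_mem_SO hu0 h1, rot_apply hu hv h1⟩

/-! ### Skew maps -/

/-- Skew-symmetric endomorphisms. -/
def IsSkew (K : L d) : Prop := inv K = -K

theorem IsSkew.inner_swap {K : L d} (h : IsSkew K) (x y : E d) : ⟪K x, y⟫_ℝ = -⟪x, K y⟫_ℝ := by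
  rw [← inner_inv_right, h]; simp

theorem isSkew_of_inner {K : L d} (h : ∀ x y : E d, ⟪K x, y⟫_ℝ = -⟪x, K y⟫_ℝ) : IsSkew K := by
  refine ((ContinuousLinearMap.eq_adjoint_iff _ _).2 (fun x y => ?_)).symm
  simp [h]

theorem IsSkew.inner_self {K : L d} (h : IsSkew K) (x : E d) : ⟪x, K x⟫_ℝ = 0 := by
  have := h.inner_swap x x
  rw [real_inner_comm] at this; linarith

theorem IsSkew.sub {K K' : L d} (h : IsSkew K) (h' : IsSkew K') : IsSkew (K - K') :=
  isSkew_of_inner fun x y => by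
    simp only [sub_apply, inner_sub_left, inner_sub_right, h.inner_swap x y,
      h'.inner_swap x y]
    ring

theorem IsSkew.add {K K' : L d} (h : IsSkew K) (h' : IsSkew K') : IsSkew (K + K') :=
  isSkew_of_inner fun x y => by
    simp only [add_apply, inner_add_left, inner_add_right, h.inner_swap x y,
      h'.inner_swap x y]
    ring

theorem IsSkew.smul {K : L d} (h : IsSkew K) (c : ℝ) : IsSkew (c • K) :=
  isSkew_of_inner fun x y => by simp [inner_smul_left, inner_smul_right, h.inner_swap x y]

theorem IsSkew.conj {K : L d} (h : IsSkew K) (σ : L d) : IsSkew (inv σ ∘L K ∘L σ) :=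
  isSkew_of_inner fun x y => by
    simp [inner_inv_left, inner_inv_right, h.inner_swap]

/-- The exponential is orthogonal, so its determinant squares to one; being itself the square of the
exponential of K/2, it has determinant 1. -/
theorem IsSkew.exp_mem_SO {K : L d} (h : IsSkew K) : NormedSpace.exp K ∈ SO d := by
  let _ : NormedAlgebra ℚ (L d) := NormedAlgebra.restrictScalars ℚ ℝ (L d)
  have hu : ∀ {K : L d}, IsSkew K → NormedSpace.exp K ∈ unitary (L d) := fun h =>
    NormedSpace.exp_mem_unitary_of_mem_skewAdjoint h
  refine ⟨hu h, ?_⟩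
  have h2 : NormedSpace.exp K =
      NormedSpace.exp ((1 / 2 : ℝ) • K) ∘L NormedSpace.exp ((1 / 2 : ℝ) • K) := by
    have hK : K = (1 / 2 : ℝ) • K + (1 / 2 : ℝ) • K := by module
    conv_lhs => rw [hK]
    exact NormedSpace.exp_add_of_commute (Commute.refl _)
  have hdet : ∀ {U : L d}, U ∈ unitary (L d) → LinearMap.det (U : E d →ₗ[ℝ] E d) ^ 2 = 1 := by
    intro U hU
    have hn : ∀ x, ‖U x‖ = ‖x‖ := ContinuousLinearMap.norm_map_of_mem_unitary hU
    let V : E d →ₗᵢ[ℝ] E d := ⟨U, hn⟩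
    have h1 := V.normDet_eq_one
    rw [LinearMap.normDet_eq_abs_det] at h1
    rw [← sq_abs]
    have h3 : |LinearMap.det (U : E d →ₗ[ℝ] E d)| = 1 := h1
    rw [h3]; norm_num
  rw [h2, ContinuousLinearMap.toLinearMap_comp, LinearMap.det_comp, ← sq]
  exact hdet (hu (h.smul _))

theorem exp_zero_smul (K : L d) : NormedSpace.exp ((0 : ℝ) • K) = 1 := by
  have h : (0 : ℝ) • K = 0 := by ext1 x; simp
  rw [h, NormedSpace.exp_zero]

theorem IsSkew.hasDerivAt_exp (K : L d) :
    HasDerivAt (fun t : ℝ => NormedSpace.exp (t • K)) K 0 := by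
  have := hasDerivAt_exp_smul_const (𝕂 := ℝ) K (0 : ℝ)
  rwa [exp_zero_smul, one_mul] at this

/-- The skew map `x ↦ ⟨e, x⟩ y - ⟨y, x⟩ e`. -/
def skewOf (y : E d) : L d := (innerSL ℝ (e d)).smulRight y - (innerSL ℝ y).smulRight (e d)

theorem skewOf_apply (y x : E d) : skewOf y x = ⟪e d, x⟫_ℝ • y - ⟪y, x⟫_ℝ • e d := by
  simp [skewOf]

theorem isSkew_skewOf (y : E d) : IsSkew (skewOf y) :=
  isSkew_of_inner fun a b => by
    simp only [skewOf_apply, inner_sub_left, inner_sub_right, inner_smul_left, inner_smul_right,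
      RCLike.conj_to_real]
    rw [real_inner_comm a y, real_inner_comm a (e d)]; ring

/-- Supplies a skew map with prescribed value at e, the only freedom needed for the surjectivity of
dΨ. -/
theorem skewOf_e {y : E d} (hy : y ∈ Hyp d) : skewOf y (e d) = y := by
  have h := Submodule.mem_orthogonal_singleton_iff_inner_left.1 hy
  rw [skewOf_apply, h, real_inner_self_eq_norm_sq, norm_e]; simp

theorem mem_Hyp {y : E d} : y ∈ Hyp d ↔ ⟪e d, y⟫_ℝ = 0 :=
  Submodule.mem_orthogonal_singleton_iff_inner_right

/-- An endomorphism that is skew and kills `e` exponentiates to `H`. -/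
theorem IsSkew.exp_mem_H {K : L d} (h : IsSkew K) (he : K (e d) = 0) :
    NormedSpace.exp K ∈ H d := by
  let _ : NormedAlgebra ℚ (L d) := NormedAlgebra.restrictScalars ℚ ℝ (L d)
  refine ⟨h.exp_mem_SO, ?_⟩
  have hs := NormedSpace.expSeries_summable' (𝕂 := ℝ) K
  rw [NormedSpace.exp_eq_tsum ℝ]
  have h1 := (ContinuousLinearMap.apply ℝ (E d) (e d)).map_tsum hs
  simp only [ContinuousLinearMap.apply_apply] at h1
  rw [h1, tsum_eq_single 0]
  · simp
  · intro n hn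
    obtain ⟨m, rfl⟩ := Nat.exists_eq_succ_of_ne_zero hn
    simp [pow_succ, he]

/-! ### Tangent cones -/

section TangentCone

variable {V V' : Type*} [NormedAddCommGroup V] [NormedSpace ℝ V] [NormedAddCommGroup V']
  [NormedSpace ℝ V']

theorem mem_tangentConeAt_of_curve {X : Set V} {x v : V} {γ : ℝ → V} (h0 : γ 0 = x)
    (hγ : HasDerivAt γ v 0) (hX : ∀ᶠ t in 𝓝[>] 0, γ t ∈ X) : v ∈ tangentConeAt ℝ X x := by
  refine mem_tangentConeAt_of_seq (𝓝[>] (0 : ℝ)) (fun t => t⁻¹) (fun t => γ t - x) ?_ ?_ ?_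
  · have := (hγ.continuousAt.tendsto.sub_const x).mono_left
      (nhdsWithin_le_nhds (a := (0 : ℝ)) (s := Ioi 0))
    simpa [h0] using this
  · filter_upwards [hX] with t ht; simpa using ht
  · have := (hasDerivAt_iff_tendsto_slope.1 hγ).mono_left
      (nhdsWithin_mono (0 : ℝ) (fun t (ht : 0 < t) => ht.ne'))
    refine this.congr fun t => ?_
    simp [slope_def_module, h0]

theorem tangentConeAt_map {X : Set V} {Y : Set V'} {x w : V} {F : V → V'} {F' : V →L[ℝ] V'}
    (hF : HasFDerivWithinAt F F' X x) (hY : ∀ᶠ y in 𝓝[X] x, F y ∈ Y)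
    (hw : w ∈ tangentConeAt ℝ X x) : F' w ∈ tangentConeAt ℝ Y (F x) := by
  obtain ⟨O, hO, hxO, hOY⟩ := mem_nhdsWithin.1 hY
  have hw' : w ∈ tangentConeAt ℝ (X ∩ O) x := by
    rwa [tangentConeAt_inter_nhds (hO.mem_nhds hxO)]
  refine tangentConeAt_mono ?_ ((hF.mono inter_subset_left).mapsTo_tangent_cone hw')
  rintro _ ⟨y, hy, rfl⟩; exact hOY ⟨hy.2, hy.1⟩

/-- The image vector lies in the tangent cone of a single point, which is trivial. The tangent
spaces below are bounded above by differentiating equations in this way, and below by exhibiting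
curves or maps into the set. -/
theorem tangentConeAt_ker {X : Set V} {x w : V} {F : V → V'} {F' : V →L[ℝ] V'}
    (hF : HasFDerivWithinAt F F' X x) (hY : ∀ᶠ y in 𝓝[X] x, F y = F x)
    (hw : w ∈ tangentConeAt ℝ X x) : F' w = 0 := by
  have h := tangentConeAt_map (Y := {F x}) hF hY hw
  have h2 := tangentConeAt_subset_zero (𝕜 := ℝ) (s := {F x}) (x := F x) (by
    rw [accPt_iff_frequently]; simp) h
  simpa using h2

theorem tangentSpaceAt_le {X : Set V} {x : V} {P : Submodule ℝ V}
    (h : ∀ w ∈ tangentConeAt ℝ X x, w ∈ P) : tangentSpaceAt X x ≤ P := Submodule.span_le.2 h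

theorem mem_tangentSpaceAt {X : Set V} {x w : V} (h : w ∈ tangentConeAt ℝ X x) :
    w ∈ tangentSpaceAt X x := Submodule.subset_span h

theorem tangentSpaceAt_prod {X : Set V} {Y : Set V'} {x : V} {y : V'} (hx : x ∈ X) (hy : y ∈ Y) :
    tangentSpaceAt (X ×ˢ Y) (x, y) = (tangentSpaceAt X x).prod (tangentSpaceAt Y y) := by
  apply le_antisymm
  · refine tangentSpaceAt_le fun w hw => ⟨?_, ?_⟩
    · exact mem_tangentSpaceAt (tangentConeAt_map (F := Prod.fst)
        (ContinuousLinearMap.fst ℝ V V').hasFDerivAt.hasFDerivWithinAt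
        (eventually_mem_nhdsWithin.mono fun p hp => hp.1) hw)
    · exact mem_tangentSpaceAt (tangentConeAt_map (F := Prod.snd)
        (ContinuousLinearMap.snd ℝ V V').hasFDerivAt.hasFDerivWithinAt
        (eventually_mem_nhdsWithin.mono fun p hp => hp.2) hw)
  · have h : _ ≤ Submodule.span ℝ (tangentConeAt ℝ (X ×ˢ Y) (x, y)) := Submodule.span_mono
      (union_subset (subset_tangentConeAt_prod_left (subset_closure hy))
        (subset_tangentConeAt_prod_right (subset_closure hx)))
    rwa [LinearMap.span_inl_union_inr] at h

theorem tangentSpaceAt_univ (x : V) : tangentSpaceAt univ x = ⊤ := by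
  simp [tangentSpaceAt]

theorem tangentSpaceAt_Ici {s : ℝ} (hs : 0 ≤ s) : tangentSpaceAt (Ici (0 : ℝ)) s = ⊤ := by
  have := (uniqueDiffOn_Ici (0 : ℝ) s hs).accPt
  rw [tangentSpaceAt, tangentConeAt_eq_univ this, Submodule.span_univ]

end TangentCone

/-- Differentiating the constant ⟨Bx, By⟩ makes A⁻¹T skew; conversely A exp(tK) is a curve of
rotations with velocity AK. -/
theorem mem_tangentSpaceAt_SO_iff {A T : L d} (hA : A ∈ SO d) :
    T ∈ tangentSpaceAt (SO d) A ↔ ∃ K, IsSkew K ∧ T = A ∘L K := by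
  constructor
  · intro hT
    refine ⟨inv A ∘L T, ?_, by rw [← ContinuousLinearMap.comp_assoc, SO_comp_inv hA]; rfl⟩
    let P : Submodule ℝ (L d) :=
      { carrier := {T | IsSkew (inv A ∘L T)}
        zero_mem' := isSkew_of_inner (by simp)
        add_mem' := fun {a b} ha hb => by
          have := IsSkew.add ha hb
          rwa [← ContinuousLinearMap.comp_add] at this
        smul_mem' := fun c a ha => by
          have := IsSkew.smul ha c
          rwa [← ContinuousLinearMap.comp_smul] at this }
    refine (tangentSpaceAt_le (P := P) fun w hw => ?_) hT
    refine isSkew_of_inner fun x y => ?_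
    have hF : HasFDerivAt (fun B : L d => ⟪B x, B y⟫_ℝ)
        ((fderivInnerCLM ℝ (A x, A y)).comp
          ((ContinuousLinearMap.apply ℝ (E d) x).prod (ContinuousLinearMap.apply ℝ (E d) y))) A :=
      ((ContinuousLinearMap.apply ℝ (E d) x).hasFDerivAt).inner ℝ
        ((ContinuousLinearMap.apply ℝ (E d) y).hasFDerivAt)
    have h := tangentConeAt_ker hF.hasFDerivWithinAt
      (eventually_mem_nhdsWithin.mono fun B hB => by
        simp only [SO_inner hB, SO_inner hA]) hw
    simp only [ContinuousLinearMap.comp_apply, ContinuousLinearMap.prod_apply,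
      ContinuousLinearMap.apply_apply, fderivInnerCLM_apply] at h
    simp only [ContinuousLinearMap.comp_apply, inner_inv_left, inner_inv_right]
    linarith
  · rintro ⟨K, hK, rfl⟩
    refine mem_tangentSpaceAt (mem_tangentConeAt_of_curve
      (γ := fun t : ℝ => A ∘L NormedSpace.exp (t • K)) (by
        rw [exp_zero_smul]; rfl) ?_ ?_)
    · exact ((ContinuousLinearMap.compL ℝ (E d) (E d) (E d) A).hasFDerivAt).comp_hasDerivAt 0
        (IsSkew.hasDerivAt_exp K)
    · exact Eventually.of_forall fun t => SO_comp_mem hA (hK.smul t).exp_mem_SO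

theorem SE_eq : SE d = SO d ×ˢ univ := by
  ext g; simp [SE]

theorem tangentSpaceAt_SE {g : Aff d} (hg : g ∈ SE d) :
    tangentSpaceAt (SE d) g = (tangentSpaceAt (SO d) g.1).prod ⊤ := by
  rw [SE_eq, ← tangentSpaceAt_univ g.2]
  exact tangentSpaceAt_prod (x := g.1) (y := g.2) hg (mem_univ _)

theorem tangentSpaceAt_GG {g : Aff d × Aff d} (hg : g ∈ GG d) :
    tangentSpaceAt (GG d) g =
      ((tangentSpaceAt (SO d) g.1.1).prod ⊤).prod ((tangentSpaceAt (SO d) g.2.1).prod ⊤) := by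
  rw [GG, ← tangentSpaceAt_SE hg.1, ← tangentSpaceAt_SE hg.2]
  exact tangentSpaceAt_prod (x := g.1) (y := g.2) hg.1 hg.2

end

section

variable {d : ℕ}

/-! ### Gradients and Hessians -/

section Gradient

variable {f k : E d → ℝ} {U : Set (E d)} {x : E d}

theorem contDiffAt_gradient (hf : ContDiffAt ℝ ∞ f x) : ContDiffAt ℝ ∞ (gradient f) x := by
  have h : ContDiffAt ℝ ∞ (fderiv ℝ f) x := hf.fderiv_right (m := ∞) (by simp)
  exact ((InnerProductSpace.toDual ℝ (E d)).symm.toContinuousLinearEquiv.contDiff).contDiffAt.comp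
    x h

theorem hasGradientAt (hf : ContDiffAt ℝ ∞ f x) : HasGradientAt f (gradient f x) x :=
  (hf.differentiableAt (by simp)).hasGradientAt

theorem fderiv_eq_inner (v : E d) :
    fderiv ℝ f x v = ⟪gradient f x, v⟫_ℝ := inner_gradient_left.symm

/-- The second derivative of `f` as a bilinear form. -/
def hess (f : E d → ℝ) (x v w : E d) : ℝ := ⟪fderiv ℝ (gradient f) x v, w⟫_ℝ

theorem hess_eq (hf : ContDiffAt ℝ ∞ f x) (v w : E d) :
    hess f x v w = fderiv ℝ (fderiv ℝ f) x v w := by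
  have h : DifferentiableAt ℝ (fderiv ℝ f) x :=
    (hf.fderiv_right (m := ∞) (by simp)).differentiableAt (by simp)
  have h2 := ((contDiffAt_gradient hf).differentiableAt (by simp)).hasFDerivAt
  have h3 : HasFDerivAt (fun y => ⟪gradient f y, w⟫_ℝ) _ x := h2.inner ℝ (hasFDerivAt_const w x)
  have h4 : HasFDerivAt (fun y => fderiv ℝ f y w) _ x :=
    h.hasFDerivAt.clm_apply (hasFDerivAt_const w x)
  have h5 : (fun y => ⟪gradient f y, w⟫_ℝ) = fun y => fderiv ℝ f y w :=
    funext fun y => (fderiv_eq_inner w).symm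
  rw [h5] at h3
  have h6 := congrArg (fun T : E d →L[ℝ] ℝ => T v) (h3.unique h4)
  simpa [fderivInnerCLM_apply, hess] using h6

theorem hess_symm (hf : ContDiffAt ℝ ∞ f x) (v w : E d) : hess f x v w = hess f x w v := by
  rw [hess_eq hf, hess_eq hf]
  exact (hf.isSymmSndFDerivAt (by
    rw [minSmoothness_of_isRCLikeNormedField]; exact WithTop.coe_le_coe.2 (le_top (a := (2 : ℕ∞))))) v w

theorem eventually_neg_of_deriv_neg {φ : ℝ → ℝ} {a : ℝ} (h : HasDerivAt φ a 0) (ha : a < 0)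
    (h0 : φ 0 = 0) : ∀ᶠ t in 𝓝[>] 0, φ t < 0 := by
  have := (hasDerivAt_iff_tendsto_slope.1 h).mono_left
      (nhdsWithin_mono (0 : ℝ) (fun t (ht : 0 < t) => ht.ne'))
  filter_upwards [this.eventually (gt_mem_nhds ha), self_mem_nhdsWithin] with t ht ht0
  have ht0 : 0 < t := ht0
  rw [slope_def_field, h0, sub_zero, sub_zero, div_lt_iff₀ ht0] at ht
  simpa using ht

theorem eventually_neg_of_deriv2_neg {φ φ' : ℝ → ℝ} {a : ℝ}
    (h : ∀ᶠ t in 𝓝 0, HasDerivAt φ (φ' t) t) (h0 : φ 0 = 0) (h0' : φ' 0 = 0)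
    (h' : HasDerivAt φ' a 0) (ha : a < 0) : ∀ᶠ t in 𝓝[>] 0, φ t < 0 := by
  have h1 := eventually_neg_of_deriv_neg h' ha h0'
  obtain ⟨ε, hε, hε'⟩ := Metric.eventually_nhds_iff.1 h
  obtain ⟨δ, hδ, hδ'⟩ := mem_nhdsGT_iff_exists_Ioo_subset.1 h1
  have hδ0 : 0 < δ := hδ
  have hm : 0 < min ε δ := lt_min hε hδ0
  filter_upwards [Ioo_mem_nhdsGT hm] with t ht
  have hd : ∀ s ∈ Icc 0 t, HasDerivAt φ (φ' s) s := fun s hs => hε' (by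
    rw [Real.dist_eq, sub_zero, abs_of_nonneg hs.1]
    exact hs.2.trans_lt (ht.2.trans_le (min_le_left _ _)))
  have hanti : StrictAntiOn φ (Icc 0 t) := by
    refine strictAntiOn_of_deriv_neg (convex_Icc 0 t)
      (fun s hs => (hd s hs).continuousAt.continuousWithinAt) fun s hs => ?_
    rw [interior_Icc] at hs
    rw [(hd s (Ioo_subset_Icc_self hs)).deriv]
    exact hδ' ⟨hs.1, hs.2.trans (ht.2.trans_le (min_le_right _ _))⟩
  have := hanti (left_mem_Icc.2 ht.1.le) (right_mem_Icc.2 ht.1.le) ht.1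
  rwa [h0] at this

theorem eventually_neg_along (hf : ContDiffAt ℝ ∞ f x) (h0 : f x = 0) {v : E d}
    (hv : ⟪gradient f x, v⟫_ℝ < 0) : ∀ᶠ t : ℝ in 𝓝[>] 0, f (x + t • v) < 0 := by
  have hl : HasDerivAt (fun t : ℝ => x + t • v) v 0 := by
    simpa using ((hasDerivAt_id (0 : ℝ)).smul_const v).const_add x
  have h1 : HasFDerivAt f (fderiv ℝ f x) ((fun t : ℝ => x + t • v) 0) := by
    simpa using (hf.differentiableAt (by simp)).hasFDerivAt
  have := h1.comp_hasDerivAt 0 hl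
  exact eventually_neg_of_deriv_neg this (by rwa [fderiv_eq_inner]) (by simp [h0])

/-- Behaviour of `f` along the parabola `x + t v + t² w`. -/
theorem eventually_neg_along_parabola (hf : ContDiffAt ℝ ∞ f x) (h0 : f x = 0) {v w : E d}
    (hv : ⟪gradient f x, v⟫_ℝ = 0) (hw : hess f x v v + 2 * ⟪gradient f x, w⟫_ℝ < 0) :
    ∀ᶠ t : ℝ in 𝓝[>] 0, f (x + t • v + t ^ 2 • w) < 0 := by
  have hl : ∀ t : ℝ, HasDerivAt (fun t : ℝ => x + t • v + t ^ 2 • w) (v + (2 * t) • w) t := by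
    intro t
    have h1 := ((hasDerivAt_id t).smul_const v).const_add x
    have h2 := (hasDerivAt_pow 2 t).smul_const w
    have h3 := h1.add h2
    simp only [one_smul, Nat.cast_ofNat, Nat.add_one_sub_one, pow_one] at h3
    exact h3
  have hx0 : x + (0 : ℝ) • v + (0 : ℝ) ^ 2 • w = x := by simp
  have hev : ∀ᶠ y in 𝓝 x, ContDiffAt ℝ 1 f y :=
    (hf.of_le (by simp)).eventually (by simp)
  have hc : Tendsto (fun t : ℝ => x + t • v + t ^ 2 • w) (𝓝 0) (𝓝 x) := by
    have := (hl 0).continuousAt.tendsto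
    rwa [hx0] at this
  refine eventually_neg_of_deriv2_neg (φ := fun t : ℝ => f (x + t • v + t ^ 2 • w))
    (φ' := fun t => ⟪gradient f (x + t • v + t ^ 2 • w), v + (2 * t) • w⟫_ℝ)
    ((hc.eventually hev).mono fun t ht => ?_) (by simp [h0]) (by simpa using hv) ?_ hw
  · have := (ht.differentiableAt (by simp)).hasFDerivAt.comp_hasDerivAt t (hl t)
    rwa [fderiv_eq_inner] at this
  · have hg : HasFDerivAt (gradient f) (fderiv ℝ (gradient f) x)
        ((fun t : ℝ => x + t • v + t ^ 2 • w) 0) := by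
      simp only [hx0]
      exact ((contDiffAt_gradient hf).differentiableAt (by simp)).hasFDerivAt
    have h1 := hg.comp_hasDerivAt 0 (hl 0)
    have h2 : HasDerivAt (fun t : ℝ => v + (2 * t) • w) ((2 : ℝ) • w) 0 := by
      simpa using (((hasDerivAt_id (0 : ℝ)).const_mul 2).smul_const w).const_add v
    have := h1.inner ℝ h2
    refine this.congr_deriv ?_
    rw [Function.comp_apply, hx0]
    simp only [mul_zero, zero_smul, add_zero, inner_smul_right, hess]
    ring

/-- If `f` and `k` have no common negative points near `x`, their unit gradients are opposite. -/
theorem unit_gradient_opposite (hf : ContDiffAt ℝ ∞ f x) (hk : ContDiffAt ℝ ∞ k x)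
    (hf0 : f x = 0) (hk0 : k x = 0) (hgf : gradient f x ≠ 0) (hgk : gradient k x ≠ 0)
    (hno : ∀ᶠ y in 𝓝 x, ¬ (f y < 0 ∧ k y < 0)) :
    ‖gradient k x‖⁻¹ • gradient k x = -(‖gradient f x‖⁻¹ • gradient f x) := by
  set p := ‖gradient f x‖⁻¹ • gradient f x with hp
  set q := ‖gradient k x‖⁻¹ • gradient k x with hq
  have hnf : 0 < ‖gradient f x‖ := norm_pos_iff.2 hgf
  have hnk : 0 < ‖gradient k x‖ := norm_pos_iff.2 hgk
  have hp1 : ‖p‖ = 1 := by rw [hp, norm_smul, norm_inv, norm_norm, inv_mul_cancel₀ hnf.ne']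
  have hq1 : ‖q‖ = 1 := by rw [hq, norm_smul, norm_inv, norm_norm, inv_mul_cancel₀ hnk.ne']
  by_contra hne
  have hpq : 0 < ‖p + q‖ ^ 2 := by
    have : p + q ≠ 0 := add_ne_zero_of_ne_neg hne
    positivity
  have hpq' : 0 < 1 + ⟪p, q⟫_ℝ := by
    rw [norm_add_sq_real, hp1, hq1] at hpq; linarith
  have hfp : gradient f x = ‖gradient f x‖ • p := by
    rw [hp, smul_smul, mul_inv_cancel₀ hnf.ne', one_smul]
  have hkq : gradient k x = ‖gradient k x‖ • q := by
    rw [hq, smul_smul, mul_inv_cancel₀ hnk.ne', one_smul]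
  -- Unit vectors p ≠ -q both have the positive inner product 1 + ⟨p, q⟩ with p + q, so both
  -- functions decrease in the direction -(p + q).
  have h1 := eventually_neg_along hf hf0 (v := -(p + q)) (by
    rw [hfp, inner_smul_left, inner_neg_right, inner_add_right, real_inner_self_eq_norm_sq, hp1]
    simp only [RCLike.conj_to_real]; nlinarith)
  have h2 := eventually_neg_along hk hk0 (v := -(p + q)) (by
    rw [hkq, inner_smul_left, inner_neg_right, inner_add_right, real_inner_self_eq_norm_sq, hq1,
      real_inner_comm]
    simp only [RCLike.conj_to_real]; nlinarith)
  have hc : Tendsto (fun t : ℝ => x + t • (-(p + q))) (𝓝[>] 0) (𝓝 x) := by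
    have : ContinuousAt (fun t : ℝ => x + t • (-(p + q))) 0 := by fun_prop
    have := this.tendsto.mono_left (nhdsWithin_le_nhds (s := Ioi 0))
    simpa using this
  obtain ⟨t, ht1, ht2, ht3⟩ := (h1.and (h2.and (hc.eventually hno))).exists
  exact ht3 ⟨ht1, ht2⟩

/-- If `f` and `k` have no common negative points near `x` and opposite gradients, then the sum of
the normalized Hessians is nonnegative on tangent vectors. -/
theorem hess_add_hess_nonneg (hf : ContDiffAt ℝ ∞ f x) (hk : ContDiffAt ℝ ∞ k x)
    (hf0 : f x = 0) (hk0 : k x = 0) {u : E d} (hu : ‖u‖ = 1) {α β : ℝ} (hα : 0 < α) (hβ : 0 < β)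
    (hgf : gradient f x = α • u) (hgk : gradient k x = -(β • u))
    (hno : ∀ᶠ y in 𝓝 x, ¬ (f y < 0 ∧ k y < 0)) {v : E d} (hv : ⟪u, v⟫_ℝ = 0) :
    0 ≤ hess f x v v / α + hess k x v v / β := by
  by_contra hneg
  rw [not_le] at hneg
  -- `c` is chosen so that both second derivatives along the parabola are negative
  set c := (hess k x v v / β - hess f x v v / α) / 4 with hc
  have hw1 : ⟪gradient f x, c • u⟫_ℝ = α * c := by
    rw [hgf, inner_smul_left, inner_smul_right, real_inner_self_eq_norm_sq, hu]; simp
  have hw2 : ⟪gradient k x, c • u⟫_ℝ = -(β * c) := by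
    rw [hgk, inner_neg_left, inner_smul_left, inner_smul_right, real_inner_self_eq_norm_sq, hu]
    simp
  have h1 := eventually_neg_along_parabola hf hf0 (v := v) (w := c • u)
    (by rw [hgf, inner_smul_left, hv, mul_zero]) (by
      rw [hw1]
      have : hess f x v v = α * (hess f x v v / α) := by field_simp
      rw [this]
      have : hess f x v v / α + 2 * c < 0 := by rw [hc]; linarith
      nlinarith)
  have h2 := eventually_neg_along_parabola hk hk0 (v := v) (w := c • u)
    (by rw [hgk, inner_neg_left, inner_smul_left, hv, mul_zero, neg_zero]) (by
      rw [hw2]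
      have : hess k x v v = β * (hess k x v v / β) := by field_simp
      rw [this]
      have : hess k x v v / β - 2 * c < 0 := by rw [hc]; linarith
      nlinarith)
  have hc : Tendsto (fun t : ℝ => x + t • v + t ^ 2 • (c • u)) (𝓝[>] 0) (𝓝 x) := by
    have : ContinuousAt (fun t : ℝ => x + t • v + t ^ 2 • (c • u)) 0 := by fun_prop
    have := this.tendsto.mono_left (nhdsWithin_le_nhds (s := Ioi 0))
    simpa using this
  obtain ⟨t, ht1, ht2, ht3⟩ := (h1.and (h2.and (hc.eventually hno))).exists
  exact ht3 ⟨ht1, ht2⟩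

/-- The unit gradient. -/
def unitGrad (f : E d → ℝ) (x : E d) : E d := ‖gradient f x‖⁻¹ • gradient f x

theorem norm_unitGrad (h : gradient f x ≠ 0) : ‖unitGrad f x‖ = 1 := by
  rw [unitGrad, norm_smul, norm_inv, norm_norm, inv_mul_cancel₀ (norm_ne_zero_iff.2 h)]

theorem gradient_eq_norm_smul (h : gradient f x ≠ 0) :
    gradient f x = ‖gradient f x‖ • unitGrad f x := by
  rw [unitGrad, smul_smul, mul_inv_cancel₀ (norm_ne_zero_iff.2 h), one_smul]

theorem contDiffAt_unitGrad (hf : ContDiffAt ℝ ∞ f x) (h : gradient f x ≠ 0) :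
    ContDiffAt ℝ ∞ (unitGrad f) x := by
  have hg := contDiffAt_gradient hf
  exact ((hg.norm ℝ h).inv (norm_ne_zero_iff.2 h)).smul hg

theorem inner_gradient_eq_zero_iff (h : gradient f x ≠ 0) {w : E d} :
    ⟪gradient f x, w⟫_ℝ = 0 ↔ ⟪unitGrad f x, w⟫_ℝ = 0 := by
  rw [unitGrad, inner_smul_left]
  simp [h]

/-- Differentiating the factor ‖∇f‖⁻¹ only produces a multiple of ∇f, and w is orthogonal to it. -/
theorem inner_fderiv_unitGrad (hf : ContDiffAt ℝ ∞ f x) (h : gradient f x ≠ 0) {w : E d}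
    (hw : ⟪unitGrad f x, w⟫_ℝ = 0) (v : E d) :
    ⟪fderiv ℝ (unitGrad f) x v, w⟫_ℝ = ‖gradient f x‖⁻¹ * hess f x v w := by
  have hg := contDiffAt_gradient hf
  have h1 : DifferentiableAt ℝ (fun y => ‖gradient f y‖⁻¹) x :=
    ((hg.norm ℝ h).inv (norm_ne_zero_iff.2 h)).differentiableAt (by simp)
  have h2 := (hg.differentiableAt (by simp)).hasFDerivAt
  have h3 : HasFDerivAt (unitGrad f) _ x := h1.hasFDerivAt.smul h2
  rw [h3.fderiv]
  simp [inner_add_left, inner_smul_left, (inner_gradient_eq_zero_iff h).2 hw, hess]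

theorem inner_fderiv_unitGrad_self (hf : ContDiffAt ℝ ∞ f x) (h : gradient f x ≠ 0) (v : E d) :
    ⟪unitGrad f x, fderiv ℝ (unitGrad f) x v⟫_ℝ = 0 := by
  have h1 := ((contDiffAt_unitGrad hf h).differentiableAt (by simp)).hasFDerivAt
  have h2 : ∀ᶠ y in 𝓝 x, ⟪unitGrad f y, unitGrad f y⟫_ℝ = 1 := by
    filter_upwards [(contDiffAt_gradient hf).continuousAt.eventually_ne h] with y hy
    rw [real_inner_self_eq_norm_sq, norm_unitGrad hy, one_pow]
  have h3 : HasFDerivAt (fun y => ⟪unitGrad f y, unitGrad f y⟫_ℝ) _ x := h1.inner ℝ h1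
  have h4 : HasFDerivAt (fun y => ⟪unitGrad f y, unitGrad f y⟫_ℝ) (0 : E d →L[ℝ] ℝ) x :=
    (hasFDerivAt_const (1 : ℝ) x).congr_of_eventuallyEq h2
  have h5 := congrArg (fun T : E d →L[ℝ] ℝ => T v) (h3.unique h4)
  simp only [ContinuousLinearMap.comp_apply, ContinuousLinearMap.prod_apply, fderivInnerCLM_apply,
    zero_apply] at h5
  rw [real_inner_comm (unitGrad f x)] at h5
  linarith

end Gradient


/-! ### Boundary charts of bodies -/

/-- On the open set `U` the set `B` is `f ≤ 0` for a smooth `f` without critical points. -/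
structure BoundaryChart (B : Set (E d)) (U : Set (E d)) (f : E d → ℝ) : Prop where
  isOpen : IsOpen U
  smooth : ContDiffOn ℝ ∞ f U
  mem_iff : ∀ x ∈ U, x ∈ B ↔ f x ≤ 0
  grad_ne : ∀ x ∈ U, gradient f x ≠ 0

section Chart

variable {B U : Set (E d)} {f : E d → ℝ} {b x v w : E d}

theorem BoundaryChart.contDiffAt (h : BoundaryChart B U f) (hx : x ∈ U) : ContDiffAt ℝ ∞ f x :=
  h.smooth.contDiffAt (h.isOpen.mem_nhds hx)

theorem BoundaryChart.mono (h : BoundaryChart B U f) {V : Set (E d)} (hV : IsOpen V) (hVU : V ⊆ U) :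
    BoundaryChart B V f :=
  ⟨hV, h.smooth.mono hVU, fun x hx => h.mem_iff x (hVU hx), fun x hx => h.grad_ne x (hVU hx)⟩

theorem IsDefiningFunction.exists_chart (h : IsDefiningFunction B b U f) :
    ∃ V ⊆ U, b ∈ V ∧ BoundaryChart B V f := by
  obtain ⟨hU, hb, hf, hm, hg⟩ := h
  have hc : ContinuousOn (gradient f) U := fun x hx =>
    (contDiffAt_gradient (hf.contDiffAt (hU.mem_nhds hx))).continuousAt.continuousWithinAt
  refine ⟨U ∩ gradient f ⁻¹' {0}ᶜ, inter_subset_left, ⟨hb, hg⟩,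
    hc.isOpen_inter_preimage hU isOpen_compl_singleton, hf.mono inter_subset_left,
    fun x hx => hm x hx.1, fun x hx => hx.2⟩

theorem BoundaryChart.defining (h : BoundaryChart B U f) (hb : b ∈ U) :
    IsDefiningFunction B b U f := ⟨h.isOpen, hb, h.smooth, h.mem_iff, h.grad_ne b hb⟩

theorem IsBody.exists_chart (hB : IsBody B) (hb : b ∈ frontier B) :
    ∃ U f, BoundaryChart B U f ∧ b ∈ U := by
  obtain ⟨U, f, h⟩ := hB.smooth_boundary b hb
  obtain ⟨V, -, hbV, hV⟩ := h.exists_chart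
  exact ⟨V, f, hV, hbV⟩

theorem tendsto_line (x v : E d) : Tendsto (fun t : ℝ => x + t • v) (𝓝[>] 0) (𝓝 x) := by
  have : ContinuousAt (fun t : ℝ => x + t • v) 0 := by fun_prop
  have := this.tendsto.mono_left (nhdsWithin_le_nhds (s := Ioi 0))
  simpa using this

theorem BoundaryChart.frequently_neg (h : BoundaryChart B U f) (hx : x ∈ U) (h0 : f x = 0) :
    ∃ᶠ y in 𝓝 x, f y < 0 := by
  have h1 := eventually_neg_along (h.contDiffAt hx) h0 (v := -gradient f x) (by
    rw [inner_neg_right, real_inner_self_eq_norm_sq]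
    have := norm_pos_iff.2 (h.grad_ne x hx)
    nlinarith)
  exact (tendsto_line _ _).frequently h1.frequently

theorem gradient_neg' (f : E d → ℝ) (x : E d) : gradient (fun y => -f y) x = -gradient f x := by
  have : fderiv ℝ (fun y => -f y) x = -fderiv ℝ f x := fderiv_fun_neg
  rw [gradient, this, map_neg, gradient]

theorem BoundaryChart.frequently_pos (h : BoundaryChart B U f) (hx : x ∈ U) (h0 : f x = 0) :
    ∃ᶠ y in 𝓝 x, 0 < f y := by
  have h1 := eventually_neg_along (f := fun y => -f y) (h.contDiffAt hx).neg (by simp [h0])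
    (v := gradient f x) (by
      rw [gradient_neg', inner_neg_left, real_inner_self_eq_norm_sq]
      have := norm_pos_iff.2 (h.grad_ne x hx)
      nlinarith)
  exact (tendsto_line _ _).frequently (h1.mono fun t ht => by simpa using ht).frequently

theorem BoundaryChart.mem_interior_iff (h : BoundaryChart B U f) (hx : x ∈ U) :
    x ∈ interior B ↔ f x < 0 := by
  rw [mem_interior_iff_mem_nhds]
  constructor
  · intro hB
    have h1 : f x ≤ 0 := (h.mem_iff x hx).1 (mem_of_mem_nhds hB)
    refine lt_of_le_of_ne h1 fun h0 => ?_
    obtain ⟨y, hy, hyB, hyU⟩ := ((h.frequently_pos hx h0).and_eventually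
      (Filter.inter_mem hB (h.isOpen.mem_nhds hx))).exists
    exact absurd ((h.mem_iff y hyU).1 hyB) (not_le.2 hy)
  · intro h0
    filter_upwards [h.isOpen.mem_nhds hx, (h.contDiffAt hx).continuousAt.eventually (gt_mem_nhds h0)]
      with y hy hy0
    exact (h.mem_iff y hy).2 (le_of_lt hy0)

theorem BoundaryChart.mem_frontier_iff (h : BoundaryChart B U f) (hx : x ∈ U) :
    x ∈ frontier B ↔ f x = 0 := by
  rw [frontier, Set.mem_sdiff, h.mem_interior_iff hx, not_lt]
  constructor
  · rintro ⟨h1, h2⟩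
    refine le_antisymm (not_lt.1 fun h3 => ?_) h2
    obtain ⟨y, ⟨hyU, hy⟩, hyB⟩ := mem_closure_iff_nhds.1 h1 _ (Filter.inter_mem
      (h.isOpen.mem_nhds hx) ((h.contDiffAt hx).continuousAt.eventually (lt_mem_nhds h3)))
    exact absurd ((h.mem_iff y hyU).1 hyB) (not_le.2 hy)
  · intro h0
    exact ⟨subset_closure ((h.mem_iff x hx).2 h0.le), h0.ge⟩

/-- The unit gradient does not depend on the defining function: for two of them, f and f', the
functions f and -f' are never negative together, because one says inside and the other outside. So
`unit_gradient_opposite` applies to this pair. -/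
theorem BoundaryChart.normal_eq (h : BoundaryChart B U f) (hx : x ∈ U) (h0 : f x = 0) :
    normal B x = unitGrad f x := by
  have hex : ∃ ν, IsOutwardNormal B x ν := ⟨unitGrad f x, norm_unitGrad (h.grad_ne x hx), U, f,
    h.defining hx, gradient_eq_norm_smul (h.grad_ne x hx)⟩
  rw [normal, dif_pos hex]
  obtain ⟨hν, U', f', hdef, hgrad⟩ := hex.choose_spec
  set ν := hex.choose
  obtain ⟨V, -, hxV, hV⟩ := hdef.exists_chart
  have h0' : f' x = 0 := (hV.mem_frontier_iff hxV).1 ((h.mem_frontier_iff hx).2 h0)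
  have hν' : ν = unitGrad f' x := by
    rw [unitGrad, hgrad, norm_smul, norm_norm, hν, mul_one, smul_smul, inv_mul_cancel₀
      (norm_ne_zero_iff.2 (hV.grad_ne x hxV)), one_smul]
  rw [hν']
  have := unit_gradient_opposite (f := f) (k := fun y => -f' y) (h.contDiffAt hx)
    (hV.contDiffAt hxV).neg h0 (by simp [h0']) (h.grad_ne x hx)
    (by rw [gradient_neg']; simpa using hV.grad_ne x hxV) (by
      filter_upwards [h.isOpen.mem_nhds hx, hV.isOpen.mem_nhds hxV] with y hy hyV
      rintro ⟨h1, h2⟩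
      have h3 := (hV.mem_iff y hyV).1 ((h.mem_iff y hy).2 h1.le)
      linarith)
  rw [gradient_neg', norm_neg, smul_neg, neg_inj] at this
  exact this

theorem BoundaryChart.norm_normal (h : BoundaryChart B U f) (hx : x ∈ U) (h0 : f x = 0) :
    ‖normal B x‖ = 1 := by
  rw [h.normal_eq hx h0, norm_unitGrad (h.grad_ne x hx)]

theorem IsBody.norm_normal (hB : IsBody B) (hb : b ∈ frontier B) : ‖normal B b‖ = 1 := by
  obtain ⟨U, f, h, hbU⟩ := hB.exists_chart hb
  exact h.norm_normal hbU ((h.mem_frontier_iff hbU).1 hb)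

/-- Tangent vectors belong to the tangent cone of the boundary. -/
theorem BoundaryChart.mem_tangentConeAt (h : BoundaryChart B U f) (hx : x ∈ U) (h0 : f x = 0)
    (hv : ⟪gradient f x, v⟫_ℝ = 0) : v ∈ tangentConeAt ℝ (frontier B) x := by
  set p := gradient f x with hp
  have hp0 : 0 < ‖p‖ := norm_pos_iff.2 (h.grad_ne x hx)
  -- solve `f (x + t v + u p) = 0` for `u`
  let F : ℝ × ℝ → ℝ := fun z => f (x + z.1 • v + z.2 • p)
  have hl : ContDiff ℝ ∞ (fun z : ℝ × ℝ => x + z.1 • v + z.2 • p) := by fun_prop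
  have hF : ContDiffAt ℝ ∞ F (0, 0) := by
    refine ContDiffAt.comp (g := f) (0, 0) ?_ hl.contDiffAt
    simpa using h.contDiffAt hx
  have hlin : HasFDerivAt (fun z : ℝ × ℝ => x + z.1 • v + z.2 • p)
      ((ContinuousLinearMap.fst ℝ ℝ ℝ).smulRight v + (ContinuousLinearMap.snd ℝ ℝ ℝ).smulRight p)
      (0, 0) := by
    have h1 := ((ContinuousLinearMap.fst ℝ ℝ ℝ).smulRight v).hasFDerivAt (x := ((0 : ℝ), (0 : ℝ)))
    have h2 := ((ContinuousLinearMap.snd ℝ ℝ ℝ).smulRight p).hasFDerivAt (x := ((0 : ℝ), (0 : ℝ)))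
    exact (h1.const_add x).add h2
  have hF' : HasFDerivAt F ((fderiv ℝ f x) ∘L
      ((ContinuousLinearMap.fst ℝ ℝ ℝ).smulRight v + (ContinuousLinearMap.snd ℝ ℝ ℝ).smulRight p))
      (0, 0) := by
    refine HasFDerivAt.comp (g := f) (0, 0) ?_ hlin
    simpa using ((h.contDiffAt hx).differentiableAt (by simp)).hasFDerivAt
  have hinr : fderiv ℝ F (0, 0) ∘L .inr ℝ ℝ ℝ = (‖p‖ ^ 2) • ContinuousLinearMap.id ℝ ℝ := by
    rw [hF'.fderiv]; ext
    simp [fderiv_eq_inner, ← hp]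
  have hinv : (fderiv ℝ F (0, 0) ∘L .inr ℝ ℝ ℝ).IsInvertible := by
    rw [hinr]
    refine ⟨ContinuousLinearEquiv.smulLeft (Units.mk0 (‖p‖ ^ 2) (by positivity)), ?_⟩
    ext; simp [Units.smul_def]
  set ψ := hF.implicitFunction (by simp) hinv
  have hψ0 : ψ 0 = 0 := hF.implicitFunction_apply_self (by simp) hinv
  have hψ := hF.eventually_apply_implicitFunction (by simp) hinv
  have hψ' : HasFDerivAt ψ _ (0 : ℝ) :=
    (hF.hasStrictFDerivAt_implicitFunction (by simp) hinv).hasFDerivAt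
  have hinl : fderiv ℝ F (0, 0) ∘L .inl ℝ ℝ ℝ = 0 := by
    rw [hF'.fderiv]; ext
    simp [fderiv_eq_inner, ← hp, hv]
  rw [hinl, ContinuousLinearMap.comp_zero] at hψ'
  -- Since v is orthogonal to the gradient, the correction ψ that returns the line to the boundary
  -- vanishes to first order, and the curve has velocity v.
  have hψd : HasDerivAt ψ 0 0 := by simpa using hψ'.hasDerivAt
  refine mem_tangentConeAt_of_curve (γ := fun t : ℝ => x + t • v + ψ t • p) (by simp [hψ0]) ?_ ?_
  · have h1 := ((hasDerivAt_id (0 : ℝ)).smul_const v).const_add x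
    have h3 := h1.add (hψd.smul_const p)
    simp only [one_smul, zero_smul, add_zero] at h3
    exact h3
  · have hc : Tendsto (fun t : ℝ => x + t • v + ψ t • p) (𝓝 0) (𝓝 x) := by
      have : ContinuousAt (fun t : ℝ => x + t • v + ψ t • p) 0 := by
        have := hψd.continuousAt; fun_prop
      simpa [hψ0] using this.tendsto
    filter_upwards [nhdsWithin_le_nhds hψ, nhdsWithin_le_nhds
      (hc.eventually (h.isOpen.mem_nhds hx))] with t ht htU
    refine (h.mem_frontier_iff htU).2 ?_
    have : F (t, ψ t) = F (0, 0) := ht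
    simpa [F, h0] using this

/-- The derivative of the normal field along the boundary. -/
theorem BoundaryChart.fderivWithin_normal (h : BoundaryChart B U f) (hx : x ∈ U) (h0 : f x = 0)
    (hv : ⟪normal B x, v⟫_ℝ = 0) :
    fderivWithin ℝ (normal B) (frontier B) x v = fderiv ℝ (unitGrad f) x v := by
  have hg := h.grad_ne x hx
  have h1 := ((contDiffAt_unitGrad (h.contDiffAt hx) hg).differentiableAt (by simp)).hasFDerivAt
  have h2 : HasFDerivWithinAt (normal B) (fderiv ℝ (unitGrad f) x) (frontier B) x := by
    refine h1.hasFDerivWithinAt.congr_of_eventuallyEq ?_ (h.normal_eq hx h0)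
    filter_upwards [self_mem_nhdsWithin, nhdsWithin_le_nhds (h.isOpen.mem_nhds hx)] with y hy hyU
    exact h.normal_eq hyU ((h.mem_frontier_iff hyU).1 hy)
  -- Along a hypersurface the derivative is not unique as a map on all of ℝⁿ; it is determined on
  -- vectors of the tangent cone, and v is one.
  refine h2.differentiableWithinAt.hasFDerivWithinAt.unique_on h2 (h.mem_tangentConeAt hx h0 ?_)
  rw [inner_gradient_eq_zero_iff hg, ← h.normal_eq hx h0, hv]

end Chart

end

section

variable {d : ℕ}

/-! ### Shape operators in adapted frames -/

section FrameShape

variable {B U : Set (E d)} {f : E d → ℝ} {b : E d} {σ : L d} {ε : ℝ}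

theorem inner_normal_frame (hσ : σ ∈ SO d) (hε : ε ^ 2 = 1) (he : σ (e d) = ε • normal B b)
    {x : E d} : ⟪normal B b, σ x⟫_ℝ = ε * ⟪e d, x⟫_ℝ := by
  have h1 : normal B b = ε • σ (e d) := by rw [he, smul_smul, ← sq, hε, one_smul]
  rw [h1, inner_smul_left, SO_inner hσ]; rfl

/-- Eliminates the projections in `frameShape`: a unit field has a tangential derivative, and an
adapted frame matches e^⊥ with the tangent space, so each projection acts on a vector already in its
range. -/
theorem BoundaryChart.frameShape_apply (h : BoundaryChart B U f) (hb : b ∈ U) (h0 : f b = 0)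
    (hσ : σ ∈ SO d) (hε : ε ^ 2 = 1) (he : σ (e d) = ε • normal B b) (x : Hyp d) :
    σ (frameShape B b σ x : E d) = -fderiv ℝ (unitGrad f) b (σ x) := by
  have hx : ⟪normal B b, σ x⟫_ℝ = 0 := by
    rw [inner_normal_frame hσ hε he, mem_Hyp.1 x.2, mul_zero]
  have hxT : σ x ∈ Tan B b := Submodule.mem_orthogonal_singleton_iff_inner_right.2 hx
  have hD := h.fderivWithin_normal hb h0 hx
  have hDn : ⟪normal B b, fderiv ℝ (unitGrad f) b (σ x)⟫_ℝ = 0 := by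
    rw [h.normal_eq hb h0]
    exact inner_fderiv_unitGrad_self (h.contDiffAt hb) (h.grad_ne b hb) _
  have hDT : -fderiv ℝ (unitGrad f) b (σ x) ∈ Tan B b :=
    neg_mem (Submodule.mem_orthogonal_singleton_iff_inner_right.2 hDn)
  have h1 : (Tan B b).orthogonalProjectionOnto (σ x) = ⟨σ x, hxT⟩ :=
    Submodule.orthogonalProjectionOnto_mem_subspace_eq_self (⟨σ x, hxT⟩ : Tan B b)
  have h2 : shapeOperator B b ⟨σ x, hxT⟩ = ⟨_, hDT⟩ := by
    have : shapeOperator B b ⟨σ x, hxT⟩ = (Tan B b).orthogonalProjectionOnto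
        (-(fderivWithin ℝ (normal B) (frontier B) b (σ x))) := rfl
    rw [this, hD]
    exact Submodule.orthogonalProjectionOnto_mem_subspace_eq_self
      (⟨-fderiv ℝ (unitGrad f) b (σ x), hDT⟩ : Tan B b)
  have h3 : inv σ (-fderiv ℝ (unitGrad f) b (σ x)) ∈ Hyp d := by
    rw [mem_Hyp, inner_inv_right, he, inner_smul_left, inner_neg_right, hDn]; simp
  have h4 : frameShape B b σ x = ⟨_, h3⟩ := by
    have : frameShape B b σ x = (Hyp d).orthogonalProjectionOnto (inv σ
      (shapeOperator B b ((Tan B b).orthogonalProjectionOnto (σ x)) : E d)) := rfl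
    rw [this, h1, h2]
    exact Submodule.orthogonalProjectionOnto_mem_subspace_eq_self (⟨_, h3⟩ : Hyp d)
  rw [h4]
  exact SO_apply_inv hσ _

theorem BoundaryChart.inner_frameShape (h : BoundaryChart B U f) (hb : b ∈ U) (h0 : f b = 0)
    (hσ : σ ∈ SO d) (hε : ε ^ 2 = 1) (he : σ (e d) = ε • normal B b) (x y : Hyp d) :
    ⟪frameShape B b σ x, y⟫_ℝ = -(‖gradient f b‖⁻¹ * hess f b (σ x) (σ y)) := by
  have hy : ⟪unitGrad f b, σ y⟫_ℝ = 0 := by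
    rw [← h.normal_eq hb h0, inner_normal_frame hσ hε he, mem_Hyp.1 y.2, mul_zero]
  rw [Submodule.coe_inner, ← SO_inner hσ, h.frameShape_apply hb h0 hσ hε he, inner_neg_left,
    inner_fderiv_unitGrad (h.contDiffAt hb) (h.grad_ne b hb) hy]

variable (hB : IsBody B)

include hB

theorem frameShape_symm {p : E d × L d} (hε : ε ^ 2 = 1) (hp : p ∈ Frames ε B) (x y : Hyp d) :
    ⟪frameShape B p.1 p.2 x, y⟫_ℝ = ⟪x, frameShape B p.1 p.2 y⟫_ℝ := by
  obtain ⟨U, f, h, hbU⟩ := hB.exists_chart hp.1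
  have h0 := (h.mem_frontier_iff hbU).1 hp.1
  have h1 := h.inner_frameShape hbU h0 hp.2.1 hε hp.2.2 x y
  have h2 := h.inner_frameShape hbU h0 hp.2.1 hε hp.2.2 y x
  rw [h1, real_inner_comm, h2, hess_symm (h.contDiffAt hbU)]

/-- Differentiating f(b) = 0 and σe = εν(b) bounds the tangent space from above. Conversely the
moving frame over the boundary lifts each tangent vector σx, and curves σ exp(tK) with Ke = 0 give
the vertical vectors. -/
theorem mem_tangentSpaceAt_Frames_iff {p w : E d × L d} (hε : ε ^ 2 = 1) (hp : p ∈ Frames ε B) :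
    w ∈ tangentSpaceAt (Frames ε B) p ↔ ∃ (x : Hyp d) (K : L d), IsSkew K ∧
      K (e d) = -(ε • (frameShape B p.1 p.2 x : E d)) ∧ w = (p.2 x, p.2 ∘L K) := by
  obtain ⟨b, σ⟩ := p
  obtain ⟨hb, hσ, he⟩ := hp
  dsimp only at hb hσ he
  obtain ⟨U, f, h, hbU⟩ := hB.exists_chart hb
  have h0 := (h.mem_frontier_iff hbU).1 hb
  have hf := h.contDiffAt hbU
  have hg := h.grad_ne b hbU
  have hn := contDiffAt_unitGrad hf hg
  have hnd := (hn.differentiableAt (by simp)).hasFDerivAt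
  have hn1 : ‖unitGrad f b‖ = 1 := norm_unitGrad hg
  have hnorm := h.normal_eq hbU h0
  have key : ∀ w ∈ tangentSpaceAt (Frames ε B) (b, σ), w.2 ∈ tangentSpaceAt (SO d) σ ∧
      ⟪unitGrad f b, w.1⟫_ℝ = 0 ∧ w.2 (e d) = ε • fderiv ℝ (unitGrad f) b w.1 := by
    let φ₁ : E d × L d →L[ℝ] ℝ := (fderiv ℝ f b) ∘L .fst ℝ _ _
    let φ₂ : E d × L d →L[ℝ] E d := (ContinuousLinearMap.apply ℝ (E d) (e d)) ∘L .snd ℝ _ _ -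
      ε • (fderiv ℝ (unitGrad f) b ∘L .fst ℝ _ _)
    let P : Submodule ℝ (E d × L d) := (tangentSpaceAt (SO d) σ).comap (LinearMap.snd ℝ _ _) ⊓
      (LinearMap.ker (φ₁ : E d × L d →ₗ[ℝ] ℝ) ⊓ LinearMap.ker (φ₂ : E d × L d →ₗ[ℝ] E d))
    have hUn : ∀ᶠ y : E d × L d in 𝓝[Frames ε B] (b, σ), y ∈ Frames ε B ∧ y.1 ∈ U :=
      (eventually_mem_nhdsWithin).and (nhdsWithin_le_nhds
        (continuous_fst.continuousAt.eventually (h.isOpen.mem_nhds hbU)))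
    have hP : tangentSpaceAt (Frames ε B) (b, σ) ≤ P := by
      refine tangentSpaceAt_le fun w hw => ⟨?_, ?_, ?_⟩
      · exact mem_tangentSpaceAt (tangentConeAt_map (F := Prod.snd)
          (ContinuousLinearMap.snd ℝ (E d) (L d)).hasFDerivAt.hasFDerivWithinAt
          (eventually_mem_nhdsWithin.mono fun p hp => hp.2.1) hw)
      · refine tangentConeAt_ker (F := fun p : E d × L d => f p.1) (F' := φ₁) ?_ ?_ hw
        · exact ((hf.differentiableAt (by simp)).hasFDerivAt.comp (b, σ)
            (ContinuousLinearMap.fst ℝ (E d) (L d)).hasFDerivAt).hasFDerivWithinAt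
        · filter_upwards [hUn] with y hy
          simp only [h0]
          exact (h.mem_frontier_iff hy.2).1 hy.1.1
      · refine tangentConeAt_ker (F := fun p : E d × L d => p.2 (e d) - ε • unitGrad f p.1)
          (F' := φ₂) ?_ ?_ hw
        · have h1 : HasFDerivAt (fun p : E d × L d => p.2 (e d)) _ (b, σ) :=
            ((ContinuousLinearMap.apply ℝ (E d) (e d)) ∘L .snd ℝ (E d) (L d)).hasFDerivAt
          have h2 : HasFDerivAt (fun p : E d × L d => unitGrad f p.1) _ (b, σ) :=
            HasFDerivAt.comp (g := unitGrad f) (b, σ) hnd (ContinuousLinearMap.fst ℝ (E d) (L d)).hasFDerivAt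
          exact (h1.sub (h2.const_smul ε)).hasFDerivWithinAt
        · filter_upwards [hUn] with y hy
          rw [← hnorm, ← h.normal_eq hy.2 ((h.mem_frontier_iff hy.2).1 hy.1.1), he, hy.1.2.2]
          simp
    intro w hw
    obtain ⟨h1, h2, h3⟩ := hP hw
    refine ⟨h1, ?_, sub_eq_zero.1 h3⟩
    rw [← inner_gradient_eq_zero_iff hg, ← fderiv_eq_inner]; exact h2
  have hS : ∀ v : E d, ⟪unitGrad f b, v⟫_ℝ = 0 → ∃ x : Hyp d, v = σ x ∧
      fderiv ℝ (unitGrad f) b v = -σ (frameShape B b σ x : E d) := by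
    intro v hv
    have hx : inv σ v ∈ Hyp d := by
      rw [mem_Hyp, inner_inv_right, he, inner_smul_left, hnorm, hv, mul_zero]
    refine ⟨⟨_, hx⟩, (SO_apply_inv hσ v).symm, ?_⟩
    rw [h.frameShape_apply hbU h0 hσ hε he]; simp [SO_apply_inv hσ]
  have hvert : ∀ K : L d, IsSkew K → K (e d) = 0 →
      ((0 : E d), σ ∘L K) ∈ tangentSpaceAt (Frames ε B) (b, σ) := by
    intro K hK hKe
    refine mem_tangentSpaceAt (mem_tangentConeAt_of_curve
      (γ := fun t : ℝ => (b, σ ∘L NormedSpace.exp (t • K))) ?_ ?_ ?_)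
    · rw [exp_zero_smul]; rfl
    · exact (hasDerivAt_const (0 : ℝ) b).prodMk
        (((ContinuousLinearMap.compL ℝ (E d) (E d) (E d) σ).hasFDerivAt).comp_hasDerivAt 0
          (IsSkew.hasDerivAt_exp K))
    · refine Eventually.of_forall fun t => ?_
      have hH := (hK.smul t).exp_mem_H (by simp [hKe])
      exact ⟨hb, SO_comp_mem hσ hH.1, by simp [hH.2, he]⟩
  constructor
  · intro hw
    obtain ⟨h1, h2, h3⟩ := key w hw
    obtain ⟨K, hK, hwK⟩ := (mem_tangentSpaceAt_SO_iff hσ).1 h1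
    obtain ⟨x, hx, hD⟩ := hS w.1 h2
    refine ⟨x, K, hK, ?_, Prod.ext hx hwK⟩
    rw [hD, hwK, ContinuousLinearMap.comp_apply] at h3
    have := congrArg (inv σ) h3
    rw [SO_inv_apply hσ] at this
    rw [this, smul_neg, map_neg, map_smul, SO_inv_apply hσ]
  · rintro ⟨x, K, hK, hKe, rfl⟩
    have hx0 : ⟪unitGrad f b, σ x⟫_ℝ = 0 := by
      rw [← hnorm, inner_normal_frame hσ hε he, mem_Hyp.1 x.2, mul_zero]
    have huv : unitGrad f b + unitGrad f b ≠ 0 := by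
      rw [← two_smul ℝ]
      refine smul_ne_zero two_ne_zero ?_
      intro h'; rw [h', norm_zero] at hn1; exact zero_ne_one hn1
    have hn0 : unitGrad f b ≠ 0 := by
      intro h'; rw [h', norm_zero] at hn1; exact zero_ne_one hn1
    let φ : E d → E d × L d := fun y => (y, rot (unitGrad f b) (unitGrad f y) ∘L σ)
    have hφ2 : ContDiffAt ℝ ∞ (fun y => rot (unitGrad f b) (unitGrad f y) ∘L σ) b :=
      (ContDiffAt.comp (g := fun v => rot (unitGrad f b) v) b (contDiffAt_rot huv) hn).clm_comp
        contDiffAt_const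
    have hφd := (hasFDerivAt_id b).prodMk (hφ2.differentiableAt (by simp)).hasFDerivAt
    have hφb : φ b = (b, σ) := by
      simp only [φ, rot_self hn1]; rfl
    have hmem : ∀ᶠ y in 𝓝[frontier B] b, φ y ∈ Frames ε B := by
      have hcont : ContinuousAt (fun y => unitGrad f b + unitGrad f y) b :=
        continuousAt_const.add hn.continuousAt
      filter_upwards [self_mem_nhdsWithin, nhdsWithin_le_nhds (h.isOpen.mem_nhds hbU),
        nhdsWithin_le_nhds (hcont.eventually_ne huv)] with y hy hyU hne
      refine ⟨hy, SO_comp_mem (rot_mem_SO hn0 hne) hσ, ?_⟩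
      have h3 := h.normal_eq hyU ((h.mem_frontier_iff hyU).1 hy)
      simp only [φ, ContinuousLinearMap.comp_apply, he, map_smul]
      rw [hnorm, rot_apply hn1 (norm_unitGrad (h.grad_ne y hyU)) hne, h3]
    have hcone := tangentConeAt_map hφd.hasFDerivWithinAt hmem
      (h.mem_tangentConeAt hbU h0 ((inner_gradient_eq_zero_iff hg).2 hx0))
    rw [show (id b, rot (unitGrad f b) (unitGrad f b) ∘L σ) = (b, σ) from hφb] at hcone
    have hT := mem_tangentSpaceAt hcone
    set T := fderiv ℝ (fun y => rot (unitGrad f b) (unitGrad f y) ∘L σ) b (σ x) with hTdef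
    have hTw : (σ x, T) ∈ tangentSpaceAt (Frames ε B) (b, σ) := hT
    obtain ⟨h1, h2, h3⟩ := key _ hTw
    obtain ⟨K', hK', hTK'⟩ := (mem_tangentSpaceAt_SO_iff hσ).1 h1
    have hK'e : K' (e d) = -(ε • (frameShape B b σ x : E d)) := by
      dsimp only at h3 hTK'
      rw [hTK', ContinuousLinearMap.comp_apply] at h3
      have h4 := congrArg (inv σ) h3
      have h5 := h.frameShape_apply hbU h0 hσ hε he x
      have h6 : fderiv ℝ (unitGrad f) b (σ x) = -σ (frameShape B b σ x : E d) := by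
        rw [h5, neg_neg]
      rw [SO_inv_apply hσ, h6, smul_neg, map_neg, map_smul, SO_inv_apply hσ] at h4
      exact h4
    -- Two skew maps with the same value at e differ by a skew map that kills e, so the required
    -- vector differs from the lifted one by a vertical vector.
    have hsum : ((σ x : E d), σ ∘L K) = (σ x, T) + (0, σ ∘L (K - K')) := by
      dsimp only at hTK'
      rw [Prod.mk_add_mk, add_zero, hTK', ← ContinuousLinearMap.comp_add]; congr 2; abel
    rw [hsum]
    exact add_mem hTw (hvert _ (hK.sub hK') (by simp [hKe, hK'e]))

end FrameShape

/-! ### Tangent spaces of `M_e` and of the orbits, and the differential of `Ψ` -/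

section Submersion

variable {B₁ B₂ : Set (E d)} {q : Amb d}

theorem tangentSpaceAt_Me (hq : q ∈ Me B₁ B₂) :
    tangentSpaceAt (Me B₁ B₂) q = (tangentSpaceAt (Frames 1 B₁) q.1).prod
      ((tangentSpaceAt (Frames (-1) B₂) q.2.1).prod
        (((tangentSpaceAt (SO d) q.2.2.1.1).prod ⊤).prod ⊤)) := by
  obtain ⟨h1, h2, h3, h4⟩ := hq
  rw [← tangentSpaceAt_SE h3, ← tangentSpaceAt_Ici h4]
  refine (tangentSpaceAt_prod (x := q.1) (y := q.2) h1
    (show q.2 ∈ Frames (-1) B₂ ×ˢ SE d ×ˢ Ici 0 from ⟨h2, h3, h4⟩)).trans ?_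
  congr 1
  refine (tangentSpaceAt_prod (x := q.2.1) (y := q.2.2) h2
    (show q.2.2 ∈ SE d ×ˢ Ici 0 from ⟨h3, h4⟩)).trans ?_
  congr 1
  exact tangentSpaceAt_prod (x := q.2.2.1) (y := q.2.2.2) h3 h4

/-- The linear part of `h ↦ rightAct q h`. -/
def rightActLin (q : Amb d) : L d →L[ℝ] Amb d :=
  let C := ContinuousLinearMap.compL ℝ (E d) (E d) (E d)
  ((0 : L d →L[ℝ] E d).prod (C q.1.2)).prod (((0 : L d →L[ℝ] E d).prod (C q.2.1.2)).prod
    (((C q.2.2.1.1).prod (0 : L d →L[ℝ] E d)).prod 0))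

theorem rightActLin_apply (q : Amb d) (h : L d) : rightActLin q h =
    ((0, q.1.2 ∘L h), (0, q.2.1.2 ∘L h), (q.2.2.1.1 ∘L h, 0), 0) := rfl

theorem rightAct_eq (q : Amb d) (h : L d) : rightAct q h =
    rightActLin q h + ((q.1.1, 0), (q.2.1.1, 0), (0, q.2.2.1.2), gap q) := by
  simp [rightActLin_apply, rightAct, mulAff]

theorem rightAct_one (q : Amb d) : rightAct q 1 = q := by
  obtain ⟨⟨b₁, σ₁⟩, ⟨b₂, σ₂⟩, ⟨A, a⟩, s⟩ := q
  simp only [rightAct, mulAff, map_zero, zero_add]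
  rfl

/-- The group element is recovered linearly from a point of the orbit, as A⁻¹ times its rotation
component (the map `G` in the proof), so the tangent cone of the orbit is carried back into that of
H. -/
theorem mem_vertical_iff (hA : q.2.2.1.1 ∈ SO d) {w : Amb d} :
    w ∈ vertical q ↔ ∃ K, IsSkew K ∧ K (e d) = 0 ∧ w = rightActLin q K := by
  have hd : ∀ h, HasFDerivAt (rightAct q) (rightActLin q) h := fun h => by
    have := (rightActLin q).hasFDerivAt (x := h) |>.add_const
      ((q.1.1, 0), (q.2.1.1, 0), (0, q.2.2.1.2), gap q)
    exact this.congr_of_eventuallyEq (Eventually.of_forall (rightAct_eq q))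
  constructor
  · intro hw
    let P : Submodule ℝ (Amb d) := (tangentSpaceAt (SO d) 1 ⊓ LinearMap.ker
      (ContinuousLinearMap.apply ℝ (E d) (e d) : L d →ₗ[ℝ] E d)).map
        (rightActLin q : L d →ₗ[ℝ] Amb d)
    have hP : vertical q ≤ P := by
      refine tangentSpaceAt_le fun w hw => ?_
      let G : Amb d →L[ℝ] L d := (ContinuousLinearMap.compL ℝ (E d) (E d) (E d) (inv q.2.2.1.1)) ∘L
        (.fst ℝ _ _) ∘L (.fst ℝ _ _) ∘L (.snd ℝ _ _) ∘L (.snd ℝ _ _)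
      have hG : ∀ h, G (rightAct q h) = h := by
        intro h
        change inv q.2.2.1.1 ∘L (q.2.2.1.1 ∘L h) = h
        rw [← ContinuousLinearMap.comp_assoc, SO_inv_comp hA]; rfl
      have hGq : G q = 1 := by
        have := hG 1; rwa [rightAct_one] at this
      have hGd := G.hasFDerivAt (x := q)
      have h1 : G w ∈ tangentConeAt ℝ (H d) 1 := by
        have := tangentConeAt_map (Y := H d) hGd.hasFDerivWithinAt
          (X := rightAct q '' H d) (eventually_mem_nhdsWithin.mono (by
            rintro _ ⟨h, hh, rfl⟩; rw [hG]; exact hh)) hw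
        rwa [hGq] at this
      refine ⟨G w, ⟨mem_tangentSpaceAt (tangentConeAt_mono H_subset_SO h1), ?_⟩, ?_⟩
      · refine tangentConeAt_ker (F := fun h : L d => h (e d))
          (ContinuousLinearMap.apply ℝ (E d) (e d)).hasFDerivAt.hasFDerivWithinAt ?_ h1
        filter_upwards [self_mem_nhdsWithin] with h hh
        rw [hh.2]; rfl
      · have h2 : HasFDerivAt (fun p => rightAct q (G p) - p)
            (rightActLin q ∘L G - ContinuousLinearMap.id ℝ (Amb d)) q :=
          ((hd (G q)).comp q hGd).sub (hasFDerivAt_id q)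
        have h3 := tangentConeAt_ker (X := rightAct q '' H d) h2.hasFDerivWithinAt
          (eventually_mem_nhdsWithin.mono (by
            rintro _ ⟨h, hh, rfl⟩; rw [hG, hGq, rightAct_one]; simp)) hw
        exact sub_eq_zero.1 h3
    obtain ⟨K, ⟨hK1, hK2⟩, rfl⟩ := hP hw
    obtain ⟨K', hK', rfl⟩ := (mem_tangentSpaceAt_SO_iff one_mem_SO).1 hK1
    exact ⟨_, hK', hK2, rfl⟩
  · rintro ⟨K, hK, hKe, rfl⟩
    refine mem_tangentSpaceAt (mem_tangentConeAt_of_curve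
      (γ := fun t : ℝ => rightAct q (NormedSpace.exp (t • K))) ?_ ?_ ?_)
    · rw [exp_zero_smul, rightAct_one]
    · exact (hd _).comp_hasDerivAt 0 (IsSkew.hasDerivAt_exp K)
    · exact Eventually.of_forall fun t => ⟨_, (hK.smul t).exp_mem_H (by simp [hKe]), rfl⟩

theorem contDiff_Psi : ContDiff ℝ ∞ (Psi (d := d)) := by
  have hi : ContDiff ℝ ∞ (fun σ : L d => inv σ) := contDiff_inv
  have h1 : ContDiff ℝ ∞ (fun q : Amb d => inv q.1.2) := hi.comp (by fun_prop)
  have h2 : ContDiff ℝ ∞ (fun q : Amb d => inv q.2.1.2) := hi.comp (by fun_prop)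
  have hA : ContDiff ℝ ∞ (fun q : Amb d => q.2.2.1.1) := by fun_prop
  have ha : ContDiff ℝ ∞ (fun q : Amb d => q.2.2.1.2) := by fun_prop
  have hs : ContDiff ℝ ∞ (fun q : Amb d => gap q / 2) := by unfold gap; fun_prop
  have hse := hs.smul (hA.clm_apply (contDiff_const (c := e d)))
  have hb1 : ContDiff ℝ ∞ (fun q : Amb d => q.1.1) := by fun_prop
  have hb2 : ContDiff ℝ ∞ (fun q : Amb d => q.2.1.1) := by fun_prop
  exact ((hA.clm_comp h1).prodMk ((ha.sub hse).sub (hA.clm_apply (h1.clm_apply hb1)))).prodMk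
    ((hA.clm_comp h2).prodMk ((ha.add hse).sub (hA.clm_apply (h2.clm_apply hb2))))

theorem hasDerivAt_line {V : Type*} [NormedAddCommGroup V] [NormedSpace ℝ V] (x y : V) :
    HasDerivAt (fun t : ℝ => x + t • y) y 0 := by
  simpa using ((hasDerivAt_id (0 : ℝ)).smul_const y).const_add x

theorem line_zero {V : Type*} [NormedAddCommGroup V] [NormedSpace ℝ V] (x y : V) :
    x + (0 : ℝ) • y = x := by simp

theorem hasDerivAt_inv_line (σ : L d) {K : L d} (hK : IsSkew K) :
    HasDerivAt (fun t : ℝ => inv (σ + t • (σ ∘L K))) (-(K ∘L inv σ)) 0 := by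
  have : ∀ t : ℝ, inv (σ + t • (σ ∘L K)) = inv σ + t • (-(K ∘L inv σ)) := by
    intro t
    have : inv (σ ∘L K) = -(K ∘L inv σ) := by
      rw [inv_comp, hK]; ext1 x; simp
    rw [← this]; simp [inv]
  simp only [this]
  exact hasDerivAt_line _ _

/-- One of the two components of the derivative of `Ψ`. -/
theorem hasDerivAt_Psi_component (A σ K K₁ : L d) (h₁ : IsSkew K₁) (b v c a : E d) (s r : ℝ) :
    HasDerivAt (fun t : ℝ => ((A + t • (A ∘L K)) ∘L inv (σ + t • (σ ∘L K₁)),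
      (c + t • a) + ((s + t • r) / 2) • (A + t • (A ∘L K)) (e d) -
        (A + t • (A ∘L K)) (inv (σ + t • (σ ∘L K₁)) (b + t • v))))
      (A ∘L (K - K₁) ∘L inv σ, a + ((r / 2) • A (e d) + (s / 2) • A (K (e d)))
        - (A ((K - K₁) (inv σ b)) + A (inv σ v))) 0 := by
  have hA := hasDerivAt_line A (A ∘L K)
  have hi1 := hasDerivAt_inv_line σ h₁
  have hs : HasDerivAt (fun t : ℝ => (s + t • r) / 2) (r / 2) 0 :=
    (hasDerivAt_line s r).div_const 2
  have hse := hs.smul (hA.clm_apply (hasDerivAt_const (0 : ℝ) (e d)))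
  have hb1 := hA.clm_apply (hi1.clm_apply (hasDerivAt_line b v))
  refine HasDerivAt.prodMk ?_ ?_
  · refine (hA.clm_comp hi1).congr_deriv ?_
    have hA0 : A + (0 : ℝ) • (A ∘L K) = A := line_zero _ _
    have hσ0 : σ + (0 : ℝ) • (σ ∘L K₁) = σ := line_zero _ _
    rw [hA0, hσ0]
    ext1 x; simp; abel
  · refine (((hasDerivAt_line c a).add hse).sub hb1).congr_deriv ?_
    have hA0 : A + (0 : ℝ) • (A ∘L K) = A := line_zero _ _
    have hσ0 : σ + (0 : ℝ) • (σ ∘L K₁) = σ := line_zero _ _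
    rw [hA0, hσ0, line_zero]
    simp
    abel

/-- `Psi` is smooth on the whole ambient space, so differentiating along straight lines suffices
although they leave the manifold. The two components are one formula with opposite signs of s and r.
-/
theorem fderiv_Psi_apply (q : Amb d) {v₁ v₂ a : E d} {K₁ K₂ K : L d} {r : ℝ} (h₁ : IsSkew K₁)
    (h₂ : IsSkew K₂) :
    fderiv ℝ Psi q ((v₁, q.1.2 ∘L K₁), (v₂, q.2.1.2 ∘L K₂), (q.2.2.1.1 ∘L K, a), r) =
      ((q.2.2.1.1 ∘L (K - K₁) ∘L inv q.1.2,
        a - ((r / 2) • q.2.2.1.1 (e d) + (gap q / 2) • q.2.2.1.1 (K (e d)))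
          - (q.2.2.1.1 ((K - K₁) (inv q.1.2 q.1.1)) + q.2.2.1.1 (inv q.1.2 v₁))),
       (q.2.2.1.1 ∘L (K - K₂) ∘L inv q.2.1.2,
        a + ((r / 2) • q.2.2.1.1 (e d) + (gap q / 2) • q.2.2.1.1 (K (e d)))
          - (q.2.2.1.1 ((K - K₂) (inv q.2.1.2 q.2.1.1)) + q.2.2.1.1 (inv q.2.1.2 v₂)))) := by
  obtain ⟨⟨b₁, σ₁⟩, ⟨b₂, σ₂⟩, ⟨A, c⟩, s⟩ := q
  simp only [gap]
  set w : Amb d := ((v₁, σ₁ ∘L K₁), (v₂, σ₂ ∘L K₂), (A ∘L K, a), r) with hw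
  set q : Amb d := ((b₁, σ₁), (b₂, σ₂), (A, c), s) with hq
  have h1 : HasDerivAt (fun t : ℝ => Psi (q + t • w)) (fderiv ℝ Psi q w) 0 := by
    have h0 : HasFDerivAt (Psi (d := d)) (fderiv ℝ Psi q) ((fun t : ℝ => q + t • w) 0) := by
      dsimp only
      have hq0 : q + (0 : ℝ) • w = q := line_zero _ _
      rw [hq0]
      exact (contDiff_Psi.differentiable (by simp) q).hasFDerivAt
    exact h0.comp_hasDerivAt 0 (hasDerivAt_line q w)
  have h2 := hasDerivAt_Psi_component A σ₁ K K₁ h₁ b₁ v₁ c a (-s) (-r)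
  have h3 := hasDerivAt_Psi_component A σ₂ K K₂ h₂ b₂ v₂ c a s r
  have h4 := h2.prodMk h3
  have h5 : (fun t : ℝ => Psi (q + t • w)) = fun t : ℝ =>
      (((A + t • (A ∘L K)) ∘L inv (σ₁ + t • (σ₁ ∘L K₁)),
        (c + t • a) + ((-s + t • -r) / 2) • (A + t • (A ∘L K)) (e d) -
          (A + t • (A ∘L K)) (inv (σ₁ + t • (σ₁ ∘L K₁)) (b₁ + t • v₁))),
       ((A + t • (A ∘L K)) ∘L inv (σ₂ + t • (σ₂ ∘L K₂)),
        (c + t • a) + ((s + t • r) / 2) • (A + t • (A ∘L K)) (e d) -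
          (A + t • (A ∘L K)) (inv (σ₂ + t • (σ₂ ∘L K₂)) (b₂ + t • v₂)))) := by
    funext t
    refine Prod.ext (Prod.ext rfl ?_) rfl
    have : (-s + t • -r) / 2 = -((s + t • r) / 2) := by simp only [smul_eq_mul]; ring
    dsimp only
    rw [this, neg_smul, ← sub_eq_add_neg]; rfl
  rw [h5] at h1
  rw [h1.unique h4]
  refine Prod.ext (Prod.ext rfl ?_) rfl
  dsimp only
  rw [neg_div, neg_div, neg_smul, neg_smul]; abel

end Submersion

end

/-! ### Kernel and image of the differential of Ψ -/

section

variable {d : ℕ}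

section Submersion

variable {B₁ B₂ : Set (E d)} {q : Amb d}

/-- The operator `S₁ + S₂ - s S₂ S₁`, whose invertibility makes `Ψ` a submersion. -/
def combined (B₁ B₂ : Set (E d)) (q : Amb d) : Hyp d →L[ℝ] Hyp d :=
  S₁ B₁ q + S₂ B₂ q - gap q • (S₂ B₂ q * S₁ B₁ q)

theorem combined_apply (x : Hyp d) : combined B₁ B₂ q x =
    S₁ B₁ q x + S₂ B₂ q x - gap q • S₂ B₂ q (S₁ B₁ q x) := rfl

theorem Psi_mem_GG (hq : q ∈ Me B₁ B₂) : Psi q ∈ GG d :=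
  ⟨SO_comp_mem hq.2.2.1 (SO_inv_mem hq.1.2.1), SO_comp_mem hq.2.2.1 (SO_inv_mem hq.2.1.2.1)⟩

theorem eq_zero_of_conj {A σ X : L d} (hA : A ∈ SO d) (hσ : σ ∈ SO d)
    (h : A ∘L X ∘L inv σ = 0) : X = 0 := by
  ext1 x
  have h1 := congrArg (fun T : L d => inv A (T (σ x))) h
  simpa [SO_inv_apply hA, SO_inv_apply hσ] using h1

theorem mem_tangentSpaceAt_Me_iff (hB₁ : IsBody B₁) (hB₂ : IsBody B₂) (hq : q ∈ Me B₁ B₂)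
    {w : Amb d} : w ∈ tangentSpaceAt (Me B₁ B₂) q ↔
      ∃ (x₁ x₂ : Hyp d) (K₁ K₂ K : L d) (a : E d) (r : ℝ), IsSkew K₁ ∧ IsSkew K₂ ∧ IsSkew K ∧
        K₁ (e d) = -(S₁ B₁ q x₁ : E d) ∧ K₂ (e d) = (S₂ B₂ q x₂ : E d) ∧
        w = ((q.1.2 x₁, q.1.2 ∘L K₁), (q.2.1.2 x₂, q.2.1.2 ∘L K₂), (q.2.2.1.1 ∘L K, a), r) := by
  rw [tangentSpaceAt_Me hq]
  constructor
  · rintro ⟨h1, h2, ⟨h3, -⟩, -⟩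
    obtain ⟨x₁, K₁, hK₁, he₁, hw₁⟩ := (mem_tangentSpaceAt_Frames_iff hB₁ (by norm_num) hq.1).1 h1
    obtain ⟨x₂, K₂, hK₂, he₂, hw₂⟩ := (mem_tangentSpaceAt_Frames_iff hB₂ (by norm_num) hq.2.1).1 h2
    obtain ⟨K, hK, hw⟩ := (mem_tangentSpaceAt_SO_iff hq.2.2.1).1 h3
    refine ⟨x₁, x₂, K₁, K₂, K, w.2.2.1.2, w.2.2.2, hK₁, hK₂, hK, ?_, ?_, ?_⟩
    · rw [he₁, one_smul]; rfl
    · rw [he₂, neg_smul, one_smul, neg_neg]; rfl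
    · refine Prod.ext hw₁ (Prod.ext hw₂ (Prod.ext (Prod.ext hw rfl) rfl))
  · rintro ⟨x₁, x₂, K₁, K₂, K, a, r, hK₁, hK₂, hK, he₁, he₂, rfl⟩
    refine ⟨(mem_tangentSpaceAt_Frames_iff hB₁ (by norm_num) hq.1).2 ⟨x₁, K₁, hK₁, ?_, rfl⟩,
      (mem_tangentSpaceAt_Frames_iff hB₂ (by norm_num) hq.2.1).2 ⟨x₂, K₂, hK₂, ?_, rfl⟩,
      ⟨(mem_tangentSpaceAt_SO_iff hq.2.2.1).2 ⟨K, hK, rfl⟩, trivial⟩, trivial⟩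
    · rw [he₁, one_smul]; rfl
    · rw [he₂, neg_smul, one_smul, neg_neg]; rfl

/-- The rotation components of dΨ = 0 force K₁ = K₂ = K, so Ke = -S₁x₁ = S₂x₂. The translation
components give x₂ = x₁ + sKe and r = 0. Eliminating x₂ leaves `combined` applied to x₁, whence x₁ =
0 and only an infinitesimal rotation fixing e survives. -/
theorem Psi_kernel (hB₁ : IsBody B₁) (hB₂ : IsBody B₂) (hq : q ∈ Me B₁ B₂)
    (hN : IsUnit (combined B₁ B₂ q)) :
    tangentSpaceAt (Me B₁ B₂) q ⊓ LinearMap.ker (fderiv ℝ Psi q : Amb d →ₗ[ℝ] Aff d × Aff d) =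
      vertical q := by
  have hA : q.2.2.1.1 ∈ SO d := hq.2.2.1
  have hσ₁ := hq.1.2.1
  have hσ₂ := hq.2.1.2.1
  ext w
  rw [mem_vertical_iff hA]
  constructor
  · rintro ⟨h1, h2⟩
    obtain ⟨x₁, x₂, K₁, K₂, K, a, r, hK₁, hK₂, hK, he₁, he₂, rfl⟩ :=
      (mem_tangentSpaceAt_Me_iff hB₁ hB₂ hq).1 h1
    have h3 := (fderiv_Psi_apply q hK₁ hK₂).symm.trans h2
    rw [Prod.mk_eq_zero, Prod.mk_eq_zero, Prod.mk_eq_zero] at h3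
    obtain ⟨⟨h4, h5⟩, h6, h7⟩ := h3
    have h8 := eq_zero_of_conj hA hσ₁ h4
    have h9 := eq_zero_of_conj hA hσ₂ h6
    rw [h8] at h5
    rw [h9] at h7
    rw [sub_eq_zero] at h8 h9
    subst h8 h9
    simp only [zero_apply, map_zero, zero_add, SO_inv_apply hσ₁, SO_inv_apply hσ₂] at h5 h7
    have h10 := congrArg (inv q.2.2.1.1) h5
    have h11 := congrArg (inv q.2.2.1.1) h7
    simp only [map_sub, map_add, map_smul, SO_inv_apply hA, map_zero] at h10 h11
    set α := inv q.2.2.1.1 a with hα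
    -- the normal component
    have hxe : ∀ x : Hyp d, ⟪e d, (x : E d)⟫_ℝ = 0 := fun x => mem_Hyp.1 x.2
    have hKe := hK.inner_self (e d)
    -- Subtracting the two translation equations eliminates the translation α; the e-component of
    -- the result is r, and the e^⊥-component determines x₂.
    have h12 : r • e d + gap q • K (e d) + x₁ - x₂ = 0 := by
      have : (α + ((r / 2) • e d + (gap q / 2) • K (e d)) - x₂) -
        (α - ((r / 2) • e d + (gap q / 2) • K (e d)) - x₁) = 0 := by rw [h10, h11, sub_zero]
      rw [← this]; module
    have hr : r = 0 := by
      have := congrArg (fun y => ⟪e d, y⟫_ℝ) h12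
      simpa [inner_add_right, inner_sub_right, inner_smul_right, hKe, hxe, norm_e] using this
    subst hr
    have hx₂ : x₂ = x₁ - gap q • S₁ B₁ q x₁ := by
      apply Subtype.ext
      rw [zero_smul, zero_add, he₁, sub_eq_zero] at h12
      rw [← h12]; simp only [Submodule.coe_sub, Submodule.coe_smul]; module
    have hS : S₂ B₂ q x₂ = -S₁ B₁ q x₁ := Subtype.ext (by
      rw [← he₂, he₁]; rfl)
    have hN0 : combined B₁ B₂ q x₁ = 0 := by
      rw [hx₂, map_sub, map_smul] at hS
      rw [combined_apply, add_sub_assoc, hS, add_neg_cancel]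
    have hx₁ : x₁ = 0 := by
      obtain ⟨u, hu⟩ := hN
      have := congrArg (fun z => (↑u⁻¹ : Hyp d →L[ℝ] Hyp d) z) hN0
      rw [← hu] at this
      simpa [← mul_apply_eq_comp] using this
    subst hx₁
    rw [map_zero, smul_zero, sub_zero] at hx₂
    subst hx₂
    have hKe0 : K (e d) = 0 := by simpa using he₁
    refine ⟨K, hK, hKe0, ?_⟩
    have ha : a = 0 := by
      have : α = 0 := by simpa [hKe0] using h10
      have h := congrArg (q.2.2.1.1) this
      rwa [hα, SO_apply_inv hA, map_zero] at h
    rw [rightActLin_apply, ha]; simp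
  · rintro ⟨K, hK, hKe, rfl⟩
    refine ⟨(mem_tangentSpaceAt_Me_iff hB₁ hB₂ hq).2 ⟨0, 0, K, K, K, 0, 0, hK, hK, hK, ?_, ?_, ?_⟩,
      ?_⟩
    · simp [hKe]
    · simp [hKe]
    · rw [rightActLin_apply]; simp
    · refine (fderiv_Psi_apply (v₁ := 0) (v₂ := 0) (a := 0) (K := K) (r := 0) q hK hK).trans ?_
      simp [hKe]

/-- The same linear system is solved with a right-hand side. The skew map K is chosen with Ke = y =
γ₁ - S₁x₁ and K_j = K - Γ_j; then x₂ = x₁ + sy + k', and S₂x₂ = y - γ₂ becomes an equation for x₁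
alone whose operator is `combined`. -/
theorem Psi_surjective (hB₁ : IsBody B₁) (hB₂ : IsBody B₂) (hq : q ∈ Me B₁ B₂)
    (hN : IsUnit (combined B₁ B₂ q)) :
    (tangentSpaceAt (Me B₁ B₂) q).map (fderiv ℝ Psi q : Amb d →ₗ[ℝ] Aff d × Aff d) =
      tangentSpaceAt (GG d) (Psi q) := by
  have hA : q.2.2.1.1 ∈ SO d := hq.2.2.1
  have hσ₁ := hq.1.2.1
  have hσ₂ := hq.2.1.2.1
  have hΨ := Psi_mem_GG hq
  rw [tangentSpaceAt_GG hΨ]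
  apply le_antisymm
  · rintro _ ⟨w, hw, rfl⟩
    obtain ⟨x₁, x₂, K₁, K₂, K, a, r, hK₁, hK₂, hK, he₁, he₂, rfl⟩ :=
      (mem_tangentSpaceAt_Me_iff hB₁ hB₂ hq).1 hw
    rw [ContinuousLinearMap.coe_coe, fderiv_Psi_apply q hK₁ hK₂]
    have conj : ∀ {X σ : L d}, IsSkew X → σ ∈ SO d → q.2.2.1.1 ∘L X ∘L inv σ ∈
        tangentSpaceAt (SO d) (q.2.2.1.1 ∘L inv σ) := by
      intro X σ hX hσ
      refine (mem_tangentSpaceAt_SO_iff (SO_comp_mem hA (SO_inv_mem hσ))).2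
        ⟨inv (inv σ) ∘L X ∘L inv σ, hX.conj _, ?_⟩
      ext1 y; simp [SO_inv_apply hσ]
    exact ⟨⟨conj (hK.sub hK₁) hσ₁, trivial⟩, conj (hK.sub hK₂) hσ₂, trivial⟩
  · rintro ⟨⟨T₁, c₁⟩, T₂, c₂⟩ ⟨⟨h1, -⟩, h2, -⟩
    obtain ⟨G₁, hG₁, hT₁⟩ := (mem_tangentSpaceAt_SO_iff hΨ.1).1 h1
    obtain ⟨G₂, hG₂, hT₂⟩ := (mem_tangentSpaceAt_SO_iff hΨ.2).1 h2
    set A := q.2.2.1.1 with hAdef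
    set Γ₁ := inv q.1.2 ∘L G₁ ∘L q.1.2 with hΓ₁
    set Γ₂ := inv q.2.1.2 ∘L G₂ ∘L q.2.1.2 with hΓ₂
    have hs₁ : IsSkew Γ₁ := hG₁.conj _
    have hs₂ : IsSkew Γ₂ := hG₂.conj _
    have hT₁' : T₁ = A ∘L Γ₁ ∘L inv q.1.2 := by
      dsimp only at hT₁
      rw [hT₁]; ext1 y; simp [Psi, hΓ₁, SO_apply_inv hσ₁, hAdef]
    have hT₂' : T₂ = A ∘L Γ₂ ∘L inv q.2.1.2 := by
      dsimp only at hT₂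
      rw [hT₂]; ext1 y; simp [Psi, hΓ₂, SO_apply_inv hσ₂, hAdef]
    let γ₁ : Hyp d := ⟨Γ₁ (e d), mem_Hyp.2 (hs₁.inner_self _)⟩
    let γ₂ : Hyp d := ⟨Γ₂ (e d), mem_Hyp.2 (hs₂.inner_self _)⟩
    set k : E d := inv A (c₁ - c₂) + Γ₁ (inv q.1.2 q.1.1) - Γ₂ (inv q.2.1.2 q.2.1.1) with hk
    -- The rate r of the gap absorbs the e-component of the relative translation k, so that the rest
    -- lies in e^⊥.
    set r : ℝ := -⟪e d, k⟫_ℝ with hr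
    have hk' : k + r • e d ∈ Hyp d := by
      rw [mem_Hyp, inner_add_right, inner_smul_right, real_inner_self_eq_norm_sq, norm_e, hr]; ring
    let k' : Hyp d := ⟨_, hk'⟩
    set s := gap q
    obtain ⟨u, hu⟩ := hN
    set x₁ : Hyp d := (↑u⁻¹ : Hyp d →L[ℝ] Hyp d) (γ₁ - γ₂ - S₂ B₂ q (s • γ₁ + k')) with hx₁
    have hx₁N : combined B₁ B₂ q x₁ = γ₁ - γ₂ - S₂ B₂ q (s • γ₁ + k') := by
      rw [hx₁, ← hu, ← mul_apply_eq_comp, Units.mul_inv]; rfl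
    set y : Hyp d := γ₁ - S₁ B₁ q x₁ with hy
    set x₂ : Hyp d := x₁ + s • y + k' with hx₂
    have hSx₂ : S₂ B₂ q x₂ = y - γ₂ := by
      rw [combined_apply] at hx₁N
      rw [hx₂, hy]
      simp only [map_add, map_smul, map_sub, smul_sub] at hx₁N ⊢
      have := hx₁N
      rw [← sub_eq_zero] at this ⊢
      rw [← this]; abel
    have hKe : skewOf (y : E d) (e d) = y := skewOf_e y.2
    refine ⟨((q.1.2 x₁, q.1.2 ∘L (skewOf y - Γ₁)), (q.2.1.2 x₂, q.2.1.2 ∘L (skewOf y - Γ₂)),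
      (A ∘L skewOf y, c₁ + ((r / 2) • A (e d) + (s / 2) • A y) + (A (Γ₁ (inv q.1.2 q.1.1)) + A x₁)),
      r), (mem_tangentSpaceAt_Me_iff hB₁ hB₂ hq).2 ⟨x₁, x₂, _, _, _, _, r,
        (isSkew_skewOf _).sub hs₁, (isSkew_skewOf _).sub hs₂, isSkew_skewOf _, ?_, ?_, rfl⟩, ?_⟩
    · rw [sub_apply, hKe, hy]; simp [γ₁]
    · rw [sub_apply, hKe, hSx₂]; rfl
    · rw [ContinuousLinearMap.coe_coe, hAdef, fderiv_Psi_apply q ((isSkew_skewOf _).sub hs₁)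
        ((isSkew_skewOf _).sub hs₂), sub_sub_cancel, sub_sub_cancel, ← hAdef, ← hT₁', ← hT₂', hKe,
        SO_inv_apply hσ₁, SO_inv_apply hσ₂]
      refine Prod.ext (Prod.ext rfl ?_) (Prod.ext rfl ?_)
      · dsimp only; abel
      · dsimp only
        have h3 : A x₂ = A x₁ + s • A y + (c₁ - c₂) + A (Γ₁ (inv q.1.2 q.1.1)) -
            A (Γ₂ (inv q.2.1.2 q.2.1.1)) + r • A (e d) := by
          have : (x₂ : E d) = x₁ + s • (y : E d) + (k + r • e d) := rfl
          rw [this, hk]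
          simp only [map_add, map_sub, map_smul, SO_apply_inv hA]; abel
        rw [h3]; module

end Submersion

end

section

variable {d : ℕ}

/-! ### Continuity of the shape operators and openness of the regions -/

theorem isRelOpen_of_nhdsWithin {V : Type*} [TopologicalSpace V] {U X : Set V} (hUX : U ⊆ X)
    (h : ∀ q ∈ U, U ∈ 𝓝[X] q) : IsRelOpen U X := by
  refine ⟨{x | ∀ᶠ y in 𝓝 x, y ∈ X → y ∈ U}, ?_, ?_⟩
  · exact isOpen_setOfPred_eventually_nhds
  · ext q
    constructor
    · intro hq
      exact ⟨hUX hq, eventually_nhdsWithin_iff.1 (h q hq)⟩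
    · rintro ⟨hq, hU⟩
      exact hU.self_of_nhds hq

theorem IsRelOpen.mem_nhdsWithin {V : Type*} [TopologicalSpace V] {U X : Set V} (h : IsRelOpen U X)
    {q : V} (hq : q ∈ U) : U ∈ 𝓝[X] q := by
  obtain ⟨O, hO, rfl⟩ := h
  exact Filter.inter_mem self_mem_nhdsWithin (nhdsWithin_le_nhds (hO.mem_nhds hq.2))

theorem IsRelOpen.subset {V : Type*} [TopologicalSpace V] {U X : Set V} (h : IsRelOpen U X) :
    U ⊆ X := by
  obtain ⟨O, -, rfl⟩ := h
  exact inter_subset_left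

section Shape

variable {B U : Set (E d)} {f : E d → ℝ} {b : E d} {ε : ℝ}

theorem BoundaryChart.continuousAt_fderiv_unitGrad (h : BoundaryChart B U f) (hb : b ∈ U) :
    ContinuousAt (fderiv ℝ (unitGrad f)) b :=
  ((contDiffAt_unitGrad (h.contDiffAt hb) (h.grad_ne b hb)).fderiv_right (m := ∞)
    (by simp)).continuousAt

/-- Locally the operator is expressed by the derivative of the unit gradient of one chart, which is
continuous in an ambient neighbourhood. -/
theorem continuousOn_frameShape (hB : IsBody B) (hε : ε ^ 2 = 1) :
    ContinuousOn (fun p : E d × L d => frameShape B p.1 p.2) (Frames ε B) := by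
  intro p hp
  obtain ⟨U, f, h, hbU⟩ := hB.exists_chart hp.1
  have h1 : ContinuousAt (fun p : E d × L d => (Hyp d).orthogonalProjectionOnto ∘L inv p.2 ∘L
      (-fderiv ℝ (unitGrad f) p.1) ∘L p.2 ∘L (Hyp d).subtypeL) p := by
    have h2 : ContinuousAt (fun p : E d × L d => fderiv ℝ (unitGrad f) p.1) p :=
      ContinuousAt.comp (g := fderiv ℝ (unitGrad f)) (h.continuousAt_fderiv_unitGrad hbU)
        continuous_fst.continuousAt
    have h3 : ContinuousAt (fun p : E d × L d => inv p.2) p :=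
      (continuous_inv.comp continuous_snd).continuousAt
    have h4 : ContinuousAt (fun p : E d × L d => p.2) p := continuous_snd.continuousAt
    exact continuousAt_const.clm_comp (h3.clm_comp (h2.neg.clm_comp (h4.clm_comp
      continuousAt_const)))
  refine h1.continuousWithinAt.congr_of_eventuallyEq_of_mem ?_ hp
  filter_upwards [self_mem_nhdsWithin, nhdsWithin_le_nhds
    (continuous_fst.continuousAt.eventually (h.isOpen.mem_nhds hbU))] with y hy hyU
  ext1 x
  have h5 := h.frameShape_apply hyU ((h.mem_frontier_iff hyU).1 hy.1) hy.2.1 hε hy.2.2 x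
  have h6 : inv y.2 (-fderiv ℝ (unitGrad f) y.1 (y.2 x)) = (frameShape B y.1 y.2 x : E d) := by
    rw [← h5, SO_inv_apply hy.2.1]
  change _ = (Hyp d).orthogonalProjectionOnto (inv y.2 (-fderiv ℝ (unitGrad f) y.1 (y.2 x)))
  rw [h6]
  exact (Submodule.orthogonalProjectionOnto_mem_subspace_eq_self _).symm

theorem BoundaryChart.shapeOperator_apply (h : BoundaryChart B U f) (hb : b ∈ U) (h0 : f b = 0)
    (v : Tan B b) : (shapeOperator B b v : E d) = -fderiv ℝ (unitGrad f) b v := by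
  have hx := Submodule.mem_orthogonal_singleton_iff_inner_right.1 v.2
  have hDT : -fderiv ℝ (unitGrad f) b v ∈ Tan B b := by
    refine neg_mem (Submodule.mem_orthogonal_singleton_iff_inner_right.2 ?_)
    rw [h.normal_eq hb h0]
    exact inner_fderiv_unitGrad_self (h.contDiffAt hb) (h.grad_ne b hb) _
  have : shapeOperator B b v = (Tan B b).orthogonalProjectionOnto
      (-(fderivWithin ℝ (normal B) (frontier B) b v)) := rfl
  rw [this, h.fderivWithin_normal hb h0 hx]
  exact congrArg Subtype.val (Submodule.orthogonalProjectionOnto_mem_subspace_eq_self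
    (⟨_, hDT⟩ : Tan B b))

theorem frameShape_injective (hB : IsBody B) (hε : ε ^ 2 = 1) {p : E d × L d}
    (hp : p ∈ Frames ε B) (hK : gaussKronecker B p.1 ≠ 0) :
    Function.Injective (frameShape B p.1 p.2) := by
  obtain ⟨U, f, h, hbU⟩ := hB.exists_chart hp.1
  have h0 := (h.mem_frontier_iff hbU).1 hp.1
  rw [injective_iff_map_eq_zero]
  intro x hx
  have h1 := h.frameShape_apply hbU h0 hp.2.1 hε hp.2.2 x
  rw [hx] at h1
  have hT : p.2 x ∈ Tan B p.1 := Submodule.mem_orthogonal_singleton_iff_inner_right.2 (by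
    rw [inner_normal_frame hp.2.1 hε hp.2.2, mem_Hyp.1 x.2, mul_zero])
  have h2 : shapeOperator B p.1 ⟨p.2 x, hT⟩ = 0 := by
    apply Subtype.ext
    rw [h.shapeOperator_apply hbU h0, ← h1]; simp
  have h3 : Function.Injective (shapeOperator B p.1) := by
    have := (LinearMap.isUnit_iff_isUnit_det
      (shapeOperator B p.1 : Tan B p.1 →ₗ[ℝ] Tan B p.1)).2 (isUnit_iff_ne_zero.2 hK)
    exact LinearMap.ker_eq_bot.1 ((LinearMap.isUnit_iff_ker_eq_bot _).1 this)
  have h4 := h3 (h2.trans (map_zero _).symm)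
  have h5 : p.2 x = 0 := congrArg Subtype.val h4
  have h6 := SO_eq_inv_apply hp.2.1 h5
  exact Subtype.ext (by simpa using h6)

/-- If y were strictly on the outer side, the segment from b to y would leave B immediately,
contrary to convexity. -/
theorem convex_support (hB : Convex ℝ B) (h : BoundaryChart B U f) (hb : b ∈ U) (h0 : f b = 0)
    {y : E d} (hy : y ∈ B) : ⟪unitGrad f b, y - b⟫_ℝ ≤ 0 := by
  by_contra hpos
  rw [not_le] at hpos
  have hgp : 0 < ⟪gradient f b, y - b⟫_ℝ := by
    rw [gradient_eq_norm_smul (h.grad_ne b hb), inner_smul_left]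
    exact mul_pos (norm_pos_iff.2 (h.grad_ne b hb)) hpos
  have h1 := eventually_neg_along (f := fun y => -f y) (h.contDiffAt hb).neg (by simp [h0])
    (v := y - b) (by rw [gradient_neg', inner_neg_left]; linarith)
  obtain ⟨t, ht, htU, ht0, ht1⟩ := (h1.and (((tendsto_line b (y - b)).eventually
    (h.isOpen.mem_nhds hb)).and (Ioo_mem_nhdsGT (zero_lt_one' ℝ)))).exists
  have hbB : b ∈ B := (h.mem_iff b hb).2 h0.le
  have h2 : b + t • (y - b) ∈ B := hB.add_smul_sub_mem hbB hy ⟨ht0.le, ht1.le⟩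
  have h3 := (h.mem_iff _ htU).1 h2
  linarith

theorem gradient_inner_sub (n b x : E d) :
    gradient (fun y : E d => -⟪n, y - b⟫_ℝ) x = -n := by
  have h1 : HasFDerivAt (fun y : E d => ⟪n, y - b⟫_ℝ) (innerSL ℝ n) x := by
    have := (innerSL ℝ n).hasFDerivAt (x := x - b) |>.comp x ((hasFDerivAt_id x).sub_const b)
    exact this
  rw [gradient_neg']
  congr 1
  have h2 : HasGradientAt (fun y : E d => ⟪n, y - b⟫_ℝ) n x := by
    rw [hasGradientAt_iff_hasFDerivAt]; exact h1
  exact h2.gradient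

/-- The second-order comparison `hess_add_hess_nonneg` is applied to f and the affine function of
the supporting half-space, whose Hessian is zero. -/
theorem hess_nonneg_of_convex (hB : Convex ℝ B) (h : BoundaryChart B U f) (hb : b ∈ U)
    (h0 : f b = 0) {v : E d} (hv : ⟪unitGrad f b, v⟫_ℝ = 0) : 0 ≤ hess f b v v := by
  set n := unitGrad f b with hn
  have hg := h.grad_ne b hb
  have hk : ContDiffAt ℝ ∞ (fun y : E d => -⟪n, y - b⟫_ℝ) b :=
    (contDiffAt_const.inner ℝ (contDiffAt_id.sub contDiffAt_const)).neg
  have hgr : gradient (fun y : E d => -⟪n, y - b⟫_ℝ) = fun _ => -n :=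
    funext fun x => gradient_inner_sub n b x
  have h1 := hess_add_hess_nonneg (h.contDiffAt hb) hk h0 (by simp) (norm_unitGrad hg)
    (norm_pos_iff.2 hg) one_pos (gradient_eq_norm_smul hg) (by rw [hgr, one_smul]) (by
      filter_upwards [h.isOpen.mem_nhds hb] with y hy
      rintro ⟨h2, h3⟩
      have := convex_support hB h hb h0 ((h.mem_iff y hy).2 h2.le)
      rw [← hn] at this
      linarith) hv
  have h2 : hess (fun y : E d => -⟪n, y - b⟫_ℝ) b v v = 0 := by
    rw [hess, hgr]; simp
  rw [h2, zero_div, add_zero] at h1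
  have := mul_nonneg h1 (norm_nonneg (gradient f b))
  rwa [div_mul_cancel₀ _ (norm_ne_zero_iff.2 hg)] at this

theorem frameShape_nonpos (hB : IsBody B) (hc : Convex ℝ B) (hε : ε ^ 2 = 1) {p : E d × L d}
    (hp : p ∈ Frames ε B) (x : Hyp d) : ⟪frameShape B p.1 p.2 x, x⟫_ℝ ≤ 0 := by
  obtain ⟨U, f, h, hbU⟩ := hB.exists_chart hp.1
  have h0 := (h.mem_frontier_iff hbU).1 hp.1
  rw [h.inner_frameShape hbU h0 hp.2.1 hε hp.2.2]
  have := hess_nonneg_of_convex hc h hbU h0 (v := p.2 x) (by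
    rw [← h.normal_eq hbU h0, inner_normal_frame hp.2.1 hε hp.2.2, mem_Hyp.1 x.2, mul_zero])
  have h2 : 0 ≤ ‖gradient f p.1‖⁻¹ := by positivity
  have := mul_nonneg h2 this
  linarith

end Shape

/-! ### Semidefinite and invertible operators -/

section LinearAlgebra

variable {V : Type*} [NormedAddCommGroup V] [InnerProductSpace ℝ V]

/-- Cauchy–Schwarz for a semidefinite form: expanding it at x + tSx gives 2t‖Sx‖² + t²c ≤ 0 for all
t, which forces ‖Sx‖ = 0. -/
theorem apply_eq_zero_of_nonpos {S : V →L[ℝ] V} (hsym : ∀ x y, ⟪S x, y⟫_ℝ = ⟪x, S y⟫_ℝ)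
    (hneg : ∀ x, ⟪S x, x⟫_ℝ ≤ 0) {x : V} (hx : ⟪S x, x⟫_ℝ = 0) : S x = 0 := by
  set a := ‖S x‖ ^ 2 with ha
  set c := ⟪S (S x), S x⟫_ℝ with hc
  have hc0 : c ≤ 0 := hneg _
  have key : ∀ t : ℝ, 2 * t * a + t ^ 2 * c ≤ 0 := by
    intro t
    have h1 := hneg (x + t • S x)
    have h2 : ⟪S (S x), x⟫_ℝ = a := by rw [hsym, real_inner_self_eq_norm_sq]
    rw [map_add, map_smul, inner_add_left, inner_add_right, inner_add_right, hx, inner_smul_left,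
      inner_smul_left, inner_smul_right, inner_smul_right, h2, real_inner_self_eq_norm_sq] at h1
    simp only [RCLike.conj_to_real, ← hc, ← ha] at h1
    nlinarith
  have ha0 : a ≤ 0 := by
    rcases eq_or_lt_of_le hc0 with h | h
    · have := key 1; rw [h] at this; linarith
    -- For c < 0 this t maximizes the quadratic 2ta + t²c; the maximum is -a²/c.
    · have := key (-a / c)
      have h3 : 2 * (-a / c) * a + (-a / c) ^ 2 * c = -(a ^ 2 / c) := by field_simp; ring
      rw [h3] at this
      have h4 : 0 ≤ a ^ 2 / c := by linarith
      by_contra hpos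
      rw [not_le] at hpos
      have : a ^ 2 / c < 0 := div_neg_of_pos_of_neg (by positivity) h
      linarith
  have : ‖S x‖ = 0 := by
    have := sq_nonneg ‖S x‖
    exact pow_eq_zero_iff (two_ne_zero) |>.1 (le_antisymm ha0 this)
  exact norm_eq_zero.1 this

theorem isUnit_of_injective [FiniteDimensional ℝ V] {S : V →L[ℝ] V}
    (h : Function.Injective S) : IsUnit S := by
  have h1 := LinearEquiv.ofInjectiveEndo (S : V →ₗ[ℝ] V) h
  let f : V ≃L[ℝ] V := (LinearEquiv.ofInjectiveEndo (S : V →ₗ[ℝ] V) h).toContinuousLinearEquiv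
  have hf : (f : V →L[ℝ] V) = S := by ext x; rfl
  refine ⟨⟨f, f.symm, ?_, ?_⟩, hf⟩
  · ext x; simp
  · ext x; simp

theorem injective_of_isUnit {S : V →L[ℝ] V} (h : IsUnit S) : Function.Injective S := by
  obtain ⟨u, rfl⟩ := h
  intro x y hxy
  have := congrArg (↑u⁻¹ : V →L[ℝ] V) hxy
  rwa [← mul_apply_eq_comp, ← mul_apply_eq_comp, Units.inv_mul] at this

end LinearAlgebra

end

section

/-! ### Operator algebra -/

section Operators

variable {R : Type*} [Ring R] [Algebra ℝ R]

theorem sub_zero_smul (S T : R) : S - (0 : ℝ) • T = S := by rw [zero_smul, sub_zero]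

/-- Each operator commutes with its own resolvent, so the outer factors cancel both inverses and
leave (1 - (s/2)T)S + T(1 - (s/2)S). S and T are not assumed to commute, so the sides on which the
factors stand decide that the product is TS. -/
theorem parallel_identity (S T : R) (s : ℝ) (hS : IsUnit (1 - (s / 2) • S))
    (hT : IsUnit (1 - (s / 2) • T)) :
    (1 - (s / 2) • T) * (S * Ring.inverse (1 - (s / 2) • S) + T * Ring.inverse (1 - (s / 2) • T)) *
      (1 - (s / 2) • S) = S + T - s • (T * S) := by
  have h1 : Ring.inverse (1 - (s / 2) • S) * (1 - (s / 2) • S) = 1 := Ring.inverse_mul_cancel _ hS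
  have h2 : (1 - (s / 2) • T) * Ring.inverse (1 - (s / 2) • T) = 1 := Ring.mul_inverse_cancel _ hT
  have h3 : (1 - (s / 2) • T) * T = T * (1 - (s / 2) • T) := by
    rw [sub_mul, mul_sub, one_mul, mul_one, smul_mul_assoc, mul_smul_comm]
  have e1 : (1 - (s / 2) • T) * (S * Ring.inverse (1 - (s / 2) • S)) * (1 - (s / 2) • S) =
      (1 - (s / 2) • T) * S := by
    rw [mul_assoc, mul_assoc S, h1, mul_one]
  have e2 : (1 - (s / 2) • T) * (T * Ring.inverse (1 - (s / 2) • T)) = T := by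
    rw [← mul_assoc, h3, mul_assoc, h2, mul_one]
  rw [mul_add, add_mul, e1, e2, sub_mul, mul_sub, one_mul, mul_one, smul_mul_assoc, mul_smul_comm]
  have : s • (T * S) = (s / 2) • (T * S) + (s / 2) • (T * S) := by rw [← add_smul]; ring_nf
  rw [this]; abel

theorem conj_combined (u : Rˣ) (S T : R) (s : ℝ) :
    (↑u⁻¹ * S * ↑u) + (↑u⁻¹ * T * ↑u) - s • ((↑u⁻¹ * T * ↑u) * (↑u⁻¹ * S * ↑u)) =
      ↑u⁻¹ * (S + T - s • (T * S)) * ↑u := by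
  have hm : (↑u⁻¹ * T * ↑u) * (↑u⁻¹ * S * ↑u) = ↑u⁻¹ * (T * S) * (u : R) := by
    simp only [mul_assoc, Units.mul_inv_cancel_left]
  rw [hm]
  simp only [mul_add, add_mul, mul_sub, sub_mul, smul_mul_assoc, mul_smul_comm]

theorem conj_one_sub_smul (u : Rˣ) (S : R) (s : ℝ) :
    1 - s • (↑u⁻¹ * S * ↑u) = ↑u⁻¹ * (1 - s • S) * ↑u := by
  simp only [mul_sub, sub_mul, mul_one, Units.inv_mul, smul_mul_assoc, mul_smul_comm]

theorem isUnit_conj_iff {A : Type*} [Ring A] (u : Aˣ) (S : A) : IsUnit (↑u⁻¹ * S * ↑u) ↔ IsUnit S := by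
  rw [Units.isUnit_mul_units, Units.isUnit_units_mul]

variable {V : Type*} [NormedAddCommGroup V] [InnerProductSpace ℝ V] [CompleteSpace V]

theorem isOpen_isUnit_clm : IsOpen {S : V →L[ℝ] V | IsUnit S} := Units.isOpen

/-- Taking adjoints reverses the product of two symmetric operators and preserves invertibility.
Condition 2 has S₁S₂, whereas `combined` has S₂S₁. -/
theorem isUnit_swap {S T : V →L[ℝ] V} (hS : ∀ x y, ⟪S x, y⟫_ℝ = ⟪x, S y⟫_ℝ)
    (hT : ∀ x y, ⟪T x, y⟫_ℝ = ⟪x, T y⟫_ℝ) {s : ℝ} (h : IsUnit (S + T - s • (S * T))) :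
    IsUnit (S + T - s • (T * S)) := by
  have hS' : star S = S := ((ContinuousLinearMap.eq_adjoint_iff _ _).2 hS).symm
  have hT' : star T = T := ((ContinuousLinearMap.eq_adjoint_iff _ _).2 hT).symm
  have := h.star
  rwa [star_sub, star_add, star_smul, star_mul, hS', hT', star_trivial] at this

end Operators

variable {d : ℕ} {B₁ B₂ : Set (E d)} {q : Amb d}

/-! ### The regions on which `Ψ` is a submersion -/

theorem continuousOn_S₁ (hB₁ : IsBody B₁) : ContinuousOn (S₁ B₁) (Me B₁ B₂) :=
  (continuousOn_frameShape (ε := 1) hB₁ (by norm_num)).comp continuous_fst.continuousOn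
    fun _ hq => hq.1

theorem continuousOn_S₂ (hB₂ : IsBody B₂) : ContinuousOn (S₂ B₂) (Me B₁ B₂) :=
  (continuousOn_frameShape (ε := -1) hB₂ (by norm_num)).comp
    (continuous_fst.comp continuous_snd).continuousOn fun _ hq => hq.2.1

theorem continuousOn_combined (hB₁ : IsBody B₁) (hB₂ : IsBody B₂) :
    ContinuousOn (combined B₁ B₂) (Me B₁ B₂) := by
  have h1 := continuousOn_S₁ (B₂ := B₂) hB₁
  have h2 := continuousOn_S₂ (B₁ := B₁) hB₂
  have hg : ContinuousOn (gap (d := d)) (Me B₁ B₂) := by unfold gap; fun_prop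
  exact (h1.add h2).sub (hg.smul (h2.clm_comp h1))

theorem isOpen_isUnit : IsOpen {S : Hyp d →L[ℝ] Hyp d | IsUnit S} := isOpen_isUnit_clm

theorem eventually_isUnit {X : Set (Amb d)} {T : Amb d → Hyp d →L[ℝ] Hyp d}
    (hT : ContinuousOn T X) (hq : q ∈ X) (hu : IsUnit (T q)) : ∀ᶠ p in 𝓝[X] q, IsUnit (T p) :=
  (hT q hq).eventually (isOpen_isUnit.mem_nhds hu)

theorem S₁_symm (hB₁ : IsBody B₁) (hq : q ∈ Me B₁ B₂) (x y : Hyp d) :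
    ⟪S₁ B₁ q x, y⟫_ℝ = ⟪x, S₁ B₁ q y⟫_ℝ := frameShape_symm (ε := 1) hB₁ (by norm_num) hq.1 x y

theorem S₂_symm (hB₂ : IsBody B₂) (hq : q ∈ Me B₁ B₂) (x y : Hyp d) :
    ⟪S₂ B₂ q x, y⟫_ℝ = ⟪x, S₂ B₂ q y⟫_ℝ := frameShape_symm (ε := -1) hB₂ (by norm_num) hq.2.1 x y

/-- The sum of the parallel shape operators, multiplied by invertible factors. -/
theorem parallelShape_add (S T : Hyp d →L[ℝ] Hyp d) (s : ℝ)
    (hS : IsUnit (1 - (s / 2) • S)) (hT : IsUnit (1 - (s / 2) • T)) :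
    (1 - (s / 2) • T) * (parallelShape S (s / 2) + parallelShape T (s / 2)) * (1 - (s / 2) • S) =
      S + T - s • (T * S) :=
  parallel_identity S T s hS hT

theorem mem_region₁_iff : q ∈ region₁ B₁ B₂ ↔ q ∈ Me B₁ B₂ ∧ IsUnit (1 - (gap q / 2) • S₁ B₁ q) ∧
    IsUnit (1 - (gap q / 2) • S₂ B₂ q) ∧ IsUnit (combined B₁ B₂ q) := by
  refine and_congr_right fun _ => and_congr_right fun h1 => and_congr_right fun h2 => ?_
  rw [combined, ← parallelShape_add _ _ _ h1 h2]
  obtain ⟨u, hu⟩ := h1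
  obtain ⟨v, hv⟩ := h2
  rw [← hu, ← hv, Units.isUnit_mul_units, Units.isUnit_units_mul]

theorem mem_region₂_iff (hB₁ : IsBody B₁) (hB₂ : IsBody B₂) : q ∈ region₂ B₁ B₂ ↔
    q ∈ Me B₁ B₂ ∧ (IsUnit (S₁ B₁ q) ∨ IsUnit (S₂ B₂ q)) ∧ IsUnit (combined B₁ B₂ q) := by
  refine and_congr_right fun hq => and_congr_right fun _ => ⟨fun h => ?_, fun h => ?_⟩
  · exact isUnit_swap (S₁_symm hB₁ hq) (S₂_symm hB₂ hq) h
  · have := isUnit_swap (S := S₂ B₂ q) (T := S₁ B₁ q) (S₂_symm hB₂ hq) (S₁_symm hB₁ hq)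
      (s := gap q) (by rw [add_comm (S₂ B₂ q)]; exact h)
    rwa [add_comm (S₂ B₂ q)] at this

theorem isRelOpen_region₁ (hB₁ : IsBody B₁) (hB₂ : IsBody B₂) :
    IsRelOpen (region₁ B₁ B₂) (Me B₁ B₂) := by
  have hg : ContinuousOn (fun q : Amb d => gap q / 2) (Me B₁ B₂) := by unfold gap; fun_prop
  refine isRelOpen_of_nhdsWithin (fun q hq => hq.1) fun q hq => ?_
  obtain ⟨h0, h1, h2, h3⟩ := mem_region₁_iff.1 hq
  filter_upwards [self_mem_nhdsWithin,
    eventually_isUnit (continuousOn_const.sub (hg.smul (continuousOn_S₁ hB₁))) h0 h1,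
    eventually_isUnit (continuousOn_const.sub (hg.smul (continuousOn_S₂ hB₂))) h0 h2,
    eventually_isUnit (continuousOn_combined hB₁ hB₂) h0 h3] with p hp hp1 hp2 hp3
  exact mem_region₁_iff.2 ⟨hp, hp1, hp2, hp3⟩

theorem isRelOpen_region₂ (hB₁ : IsBody B₁) (hB₂ : IsBody B₂) :
    IsRelOpen (region₂ B₁ B₂) (Me B₁ B₂) := by
  refine isRelOpen_of_nhdsWithin (fun q hq => hq.1) fun q hq => ?_
  obtain ⟨h0, h1, h2⟩ := (mem_region₂_iff hB₁ hB₂).1 hq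
  have h3 : ∀ᶠ p in 𝓝[Me B₁ B₂] q, IsUnit (S₁ B₁ p) ∨ IsUnit (S₂ B₂ p) := by
    rcases h1 with h1 | h1
    · exact (eventually_isUnit (continuousOn_S₁ hB₁) h0 h1).mono fun _ => Or.inl
    · exact (eventually_isUnit (continuousOn_S₂ hB₂) h0 h1).mono fun _ => Or.inr
  filter_upwards [self_mem_nhdsWithin, h3, eventually_isUnit (continuousOn_combined hB₁ hB₂) h0 h2]
    with p hp hp1 hp2
  exact (mem_region₂_iff hB₁ hB₂).2 ⟨hp, hp1, hp2⟩

/-! ### Invariance under the group actions -/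

theorem leftAct_mem_Me {g : Aff d} (hg : g ∈ SE d) (hq : q ∈ Me B₁ B₂) :
    leftAct g q ∈ Me B₁ B₂ :=
  ⟨hq.1, hq.2.1, SO_comp_mem hg hq.2.2.1, hq.2.2.2⟩

theorem Frames_comp {B : Set (E d)} {ε : ℝ} {p : E d × L d} (hp : p ∈ Frames ε B) {h : L d}
    (hh : h ∈ H d) : (p.1, p.2 ∘L h) ∈ Frames ε B :=
  ⟨hp.1, SO_comp_mem hp.2.1 hh.1, by
    change p.2 (h (e d)) = _
    rw [hh.2, hp.2.2]⟩

theorem rightAct_mem_Me {h : L d} (hh : h ∈ H d) (hq : q ∈ Me B₁ B₂) :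
    rightAct q h ∈ Me B₁ B₂ :=
  ⟨Frames_comp hq.1 hh, Frames_comp hq.2.1 hh, SO_comp_mem hq.2.2.1 hh.1, hq.2.2.2⟩

theorem H_apply_mem_Hyp {h : L d} (hh : h ∈ H d) {x : E d} (hx : x ∈ Hyp d) : h x ∈ Hyp d := by
  rw [mem_Hyp] at *
  have := SO_inner hh.1 (e d) x
  rwa [hh.2, hx] at this

/-- The restriction of `h ∈ H` to `e^⊥`. -/
def restrictHyp (h : L d) (hh : h ∈ H d) : Hyp d →L[ℝ] Hyp d :=
  (h ∘L (Hyp d).subtypeL).codRestrict (Hyp d) fun x => H_apply_mem_Hyp hh x.2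

/-- `h` acts invertibly on `e^⊥`. -/
def unitHyp (h : L d) (hh : h ∈ H d) : (Hyp d →L[ℝ] Hyp d)ˣ where
  val := restrictHyp h hh
  inv := restrictHyp (inv h) (H_inv_mem hh)
  val_inv := by ext1 x; exact Subtype.ext (SO_apply_inv hh.1 _)
  inv_val := by ext1 x; exact Subtype.ext (SO_inv_apply hh.1 _)

/-- Changing the frame by an element of H conjugates the shape operator by its restriction to e^⊥.
Hence all invertibility conditions on the regions are H-invariant. -/
theorem frameShape_comp {B : Set (E d)} (hB : IsBody B) {ε : ℝ} (hε : ε ^ 2 = 1) {p : E d × L d}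
    (hp : p ∈ Frames ε B) {h : L d} (hh : h ∈ H d) : frameShape B p.1 (p.2 ∘L h) =
      ↑(unitHyp h hh)⁻¹ * frameShape B p.1 p.2 * ↑(unitHyp h hh) := by
  obtain ⟨U, f, hc, hbU⟩ := hB.exists_chart hp.1
  have h0 := (hc.mem_frontier_iff hbU).1 hp.1
  have hp' := Frames_comp hp hh
  ext1 x
  have h1 := hc.frameShape_apply hbU h0 hp'.2.1 hε hp'.2.2 x
  have h2 := hc.frameShape_apply hbU h0 hp.2.1 hε hp.2.2 (restrictHyp h hh x)
  have h3 : p.2 (h (frameShape B p.1 (p.2 ∘L h) x : E d)) =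
      p.2 (frameShape B p.1 p.2 (restrictHyp h hh x) : E d) := h1.trans h2.symm
  have h4 := congrArg (fun z => inv h (inv p.2 z)) h3
  simp only [SO_inv_apply hp.2.1, SO_inv_apply hh.1] at h4
  exact Subtype.ext h4

theorem S₁_rightAct (hB₁ : IsBody B₁) (hq : q ∈ Me B₁ B₂) {h : L d} (hh : h ∈ H d) :
    S₁ B₁ (rightAct q h) = ↑(unitHyp h hh)⁻¹ * S₁ B₁ q * ↑(unitHyp h hh) :=
  frameShape_comp (ε := 1) hB₁ (by norm_num) hq.1 hh

theorem S₂_rightAct (hB₂ : IsBody B₂) (hq : q ∈ Me B₁ B₂) {h : L d} (hh : h ∈ H d) :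
    S₂ B₂ (rightAct q h) = ↑(unitHyp h hh)⁻¹ * S₂ B₂ q * ↑(unitHyp h hh) :=
  frameShape_comp (ε := -1) hB₂ (by norm_num) hq.2.1 hh

theorem combined_rightAct (hB₁ : IsBody B₁) (hB₂ : IsBody B₂) (hq : q ∈ Me B₁ B₂) {h : L d}
    (hh : h ∈ H d) : combined B₁ B₂ (rightAct q h) =
      ↑(unitHyp h hh)⁻¹ * combined B₁ B₂ q * ↑(unitHyp h hh) := by
  have hg : gap (rightAct q h) = gap q := rfl
  rw [combined, combined, S₁_rightAct hB₁ hq hh, S₂_rightAct hB₂ hq hh, hg]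
  exact conj_combined (unitHyp h hh) _ _ _

theorem region₁_rightAct (hB₁ : IsBody B₁) (hB₂ : IsBody B₂) (hq : q ∈ region₁ B₁ B₂) {h : L d}
    (hh : h ∈ H d) : rightAct q h ∈ region₁ B₁ B₂ := by
  obtain ⟨h0, h1, h2, h3⟩ := mem_region₁_iff.1 hq
  have key : ∀ S : Hyp d →L[ℝ] Hyp d, 1 - (gap q / 2) • (↑(unitHyp h hh)⁻¹ * S * ↑(unitHyp h hh)) =
      ↑(unitHyp h hh)⁻¹ * (1 - (gap q / 2) • S) * ↑(unitHyp h hh) :=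
    fun S => conj_one_sub_smul _ S _
  have hg : gap (rightAct q h) = gap q := rfl
  refine mem_region₁_iff.2 ⟨rightAct_mem_Me hh h0, ?_, ?_, ?_⟩
  · rw [S₁_rightAct hB₁ h0 hh, hg, key, isUnit_conj_iff]; exact h1
  · rw [S₂_rightAct hB₂ h0 hh, hg, key, isUnit_conj_iff]; exact h2
  · rw [combined_rightAct hB₁ hB₂ h0 hh, isUnit_conj_iff]; exact h3

theorem region₂_rightAct (hB₁ : IsBody B₁) (hB₂ : IsBody B₂) (hq : q ∈ region₂ B₁ B₂) {h : L d}
    (hh : h ∈ H d) : rightAct q h ∈ region₂ B₁ B₂ := by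
  obtain ⟨h0, h1, h2⟩ := (mem_region₂_iff hB₁ hB₂).1 hq
  refine (mem_region₂_iff hB₁ hB₂).2 ⟨rightAct_mem_Me hh h0, ?_, ?_⟩
  · rw [S₁_rightAct hB₁ h0 hh, S₂_rightAct hB₂ h0 hh, isUnit_conj_iff, isUnit_conj_iff]; exact h1
  · rw [combined_rightAct hB₁ hB₂ h0 hh, isUnit_conj_iff]; exact h2

theorem isSubmersionNhd_of (hB₁ : IsBody B₁) (hB₂ : IsBody B₂) {U : Set (Amb d)}
    (hU : IsRelOpen U (Me B₁ B₂)) (hbd : bdMe B₁ B₂ ⊆ U)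
    (hl : ∀ g ∈ SE d, ∀ q ∈ U, leftAct g q ∈ U) (hN : ∀ q ∈ U, IsUnit (combined B₁ B₂ q)) :
    IsSubmersionNhd B₁ B₂ U where
  relOpen := hU
  bdMe_subset := hbd
  leftAct_mem := hl
  smooth := contDiff_Psi.contDiffOn
  mapsTo := fun _ hq => Psi_mem_GG (hU.subset hq)
  surjective := fun q hq => Psi_surjective hB₁ hB₂ (hU.subset hq) (hN q hq)
  kernel := fun q hq => Psi_kernel hB₁ hB₂ (hU.subset hq) (hN q hq)

theorem region₁_leftAct {g : Aff d} (hg : g ∈ SE d) (hq : q ∈ region₁ B₁ B₂) :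
    leftAct g q ∈ region₁ B₁ B₂ := ⟨leftAct_mem_Me hg hq.1, hq.2⟩

theorem region₂_leftAct {g : Aff d} (hg : g ∈ SE d) (hq : q ∈ region₂ B₁ B₂) :
    leftAct g q ∈ region₂ B₁ B₂ := ⟨leftAct_mem_Me hg hq.1, hq.2⟩

theorem combined_of_gap_eq_zero (h : gap q = 0) : combined B₁ B₂ q = S₁ B₁ q + S₂ B₂ q := by
  rw [combined, h]; exact sub_zero_smul _ _

theorem isSubmersionNhd_region₁ (hB₁ : IsBody B₁) (hB₂ : IsBody B₂) (hc : Condition₁ B₁ B₂) :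
    IsSubmersionNhd B₁ B₂ (region₁ B₁ B₂) := by
  refine isSubmersionNhd_of hB₁ hB₂ (isRelOpen_region₁ hB₁ hB₂) (fun q hq => ?_)
    (fun g hg q hq => region₁_leftAct hg hq) fun q hq => (mem_region₁_iff.1 hq).2.2.2
  refine mem_region₁_iff.2 ⟨hq.1, ?_, ?_, ?_⟩
  · have h : 1 - ((0 : ℝ) / 2) • S₁ B₁ q = 1 := by rw [zero_div]; exact sub_zero_smul _ _
    rw [hq.2, h]; exact isUnit_one
  · have h : 1 - ((0 : ℝ) / 2) • S₂ B₂ q = 1 := by rw [zero_div]; exact sub_zero_smul _ _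
    rw [hq.2, h]; exact isUnit_one
  · rw [combined_of_gap_eq_zero hq.2]; exact hc.2 q hq

theorem isSubmersionNhd_region₂ (hB₁ : IsBody B₁) (hB₂ : IsBody B₂) (hc : Condition₂ B₁ B₂) :
    IsSubmersionNhd B₁ B₂ (region₂ B₁ B₂) := by
  obtain ⟨-, N, -, hN1, hN2⟩ := hc
  exact isSubmersionNhd_of hB₁ hB₂ (isRelOpen_region₂ hB₁ hB₂) (hN1.trans hN2)
    (fun g hg q hq => region₂_leftAct hg hq) fun q hq => ((mem_region₂_iff hB₁ hB₂).1 hq).2.2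

theorem condition₁_of_condition₂ (hc : Condition₂ B₁ B₂) : Condition₁ B₁ B₂ := by
  obtain ⟨h1, N, -, hN1, hN2⟩ := hc
  refine ⟨h1, fun q hq => ?_⟩
  have := (hN2 (hN1 hq)).2.2
  have h : S₁ B₁ q + S₂ B₂ q - (0 : ℝ) • (S₁ B₁ q * S₂ B₂ q) = S₁ B₁ q + S₂ B₂ q :=
    sub_zero_smul _ _
  rwa [hq.2, h] at this

/-- For convex bodies, one of which has nonvanishing curvature, `Ψ` is a submersion everywhere. -/
theorem isUnit_combined_of_convex (hB₁ : IsBody B₁) (hB₂ : IsBody B₂) (hc₁ : Convex ℝ B₁)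
    (hc₂ : Convex ℝ B₂) (hK : (∀ b ∈ frontier B₁, gaussKronecker B₁ b ≠ 0) ∨
      (∀ b ∈ frontier B₂, gaussKronecker B₂ b ≠ 0)) (hq : q ∈ Me B₁ B₂) :
    IsUnit (combined B₁ B₂ q) := by
  apply isUnit_of_injective
  rw [injective_iff_map_eq_zero]
  intro x hx
  rw [combined_apply] at hx
  have n1 : ∀ x, ⟪S₁ B₁ q x, x⟫_ℝ ≤ 0 := frameShape_nonpos (ε := 1) hB₁ hc₁ (by norm_num) hq.1
  have n2 : ∀ x, ⟪S₂ B₂ q x, x⟫_ℝ ≤ 0 := frameShape_nonpos (ε := -1) hB₂ hc₂ (by norm_num) hq.2.1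
  have hs : 0 ≤ gap q := hq.2.2.2
  set y := S₁ B₁ q x with hy
  set z := x - gap q • y with hz
  have h1 : y + S₂ B₂ q z = 0 := by rw [← hx, hz, map_sub, map_smul]; abel
  -- Pairing y + S₂z = 0 with z = x - sy, where y = S₁x, gives a sum of three nonpositive terms, so
  -- ⟨S₁x, x⟩ and ⟨S₂z, z⟩ vanish.
  have h2 : ⟪y, x⟫_ℝ - gap q * ‖y‖ ^ 2 + ⟪S₂ B₂ q z, z⟫_ℝ = 0 := by
    have h3 := congrArg (fun w => ⟪w, z⟫_ℝ) h1
    simp only [inner_add_left, inner_zero_left] at h3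
    rw [← h3]; congr 1
    rw [hz, inner_sub_right, inner_smul_right, real_inner_self_eq_norm_sq]
  have h4 : 0 ≤ gap q * ‖y‖ ^ 2 := by positivity
  have h5 := n1 x
  have h6 := n2 z
  have h7 : ⟪S₁ B₁ q x, x⟫_ℝ = 0 := by linarith
  have h8 : ⟪S₂ B₂ q z, z⟫_ℝ = 0 := by linarith
  have hy0 : y = 0 := apply_eq_zero_of_nonpos (S₁_symm hB₁ hq) n1 h7
  have hz0 : S₂ B₂ q z = 0 := apply_eq_zero_of_nonpos (S₂_symm hB₂ hq) n2 h8
  rcases hK with hK | hK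
  · exact (injective_iff_map_eq_zero _).1
      (frameShape_injective (ε := 1) hB₁ (by norm_num) hq.1 (hK _ hq.1.1)) x hy0
  · have : z = 0 := (injective_iff_map_eq_zero _).1
      (frameShape_injective (ε := -1) hB₂ (by norm_num) hq.2.1 (hK _ hq.2.1.1)) z hz0
    rw [hz, hy0, smul_zero, sub_zero] at this
    exact this

theorem isRelOpen_self {V : Type*} [TopologicalSpace V] (X : Set V) : IsRelOpen X X :=
  ⟨univ, isOpen_univ, by simp⟩

theorem isSubmersionNhd_Me (hB₁ : IsBody B₁) (hB₂ : IsBody B₂) (hc : Condition₃ B₁ B₂) :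
    IsSubmersionNhd B₁ B₂ (Me B₁ B₂) :=
  isSubmersionNhd_of hB₁ hB₂ (isRelOpen_self _) (fun _ hq => hq.1)
    (fun _ hg _ hq => leftAct_mem_Me hg hq)
    fun _ hq => isUnit_combined_of_convex hB₁ hB₂ hc.2.1 hc.2.2.1 hc.2.2.2 hq

end

section

/-! ### The implicit function theorem on a neighbourhood -/

section Implicit

variable {P Z W : Type*} [NormedAddCommGroup P] [NormedSpace ℝ P] [CompleteSpace P]
  [NormedAddCommGroup Z] [NormedSpace ℝ Z] [CompleteSpace Z]
  [NormedAddCommGroup W] [NormedSpace ℝ W] [CompleteSpace W]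

/-- Smoothness of the implicit function is first known at one point only. The theorem is therefore
applied again at every nearby point of the graph, and uniqueness identifies the new implicit
functions with the first one, which is then smooth on an open set. -/
theorem exists_implicitFunction {F : P × Z → W} {u : P × Z}
    (hF : ∀ᶠ p in 𝓝 u, ContDiffAt ℝ ∞ F p) (h0 : F u = 0)
    (hinv : (fderiv ℝ F u ∘L .inr ℝ P Z).IsInvertible) :
    ∃ (O : Set P) (φ : P → Z) (N : Set Z), IsOpen O ∧ u.1 ∈ O ∧ N ∈ 𝓝 u.2 ∧ ContDiffOn ℝ ∞ φ O ∧
      φ u.1 = u.2 ∧ (∀ g ∈ O, F (g, φ g) = 0) ∧ ∀ g ∈ O, ∀ z ∈ N, F (g, z) = 0 → z = φ g := by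
  have hu := hF.self_of_nhds
  have hne : (∞ : WithTop ℕ∞) ≠ 0 := by simp
  set φ := hu.implicitFunction hne hinv with hφ
  have hφu : φ u.1 = u.2 := hu.implicitFunction_apply_self hne hinv
  have hφc := hu.contDiffAt_implicitFunction hne hinv
  have hcont : ∀ᶠ g in 𝓝 u.1, ContinuousAt φ g :=
    (((hφc.of_le (m := 1) (by norm_num)).eventually (by simp)).mono fun g h => h.continuousAt)
  have hpair : Tendsto (fun g => (g, φ g)) (𝓝 u.1) (𝓝 u) := by
    have := (continuousAt_id (x := u.1)).prodMk hφc.continuousAt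
    have h2 : (u.1, φ u.1) = u := by rw [hφu]
    rw [← h2]; exact this
  have hD : ∀ᶠ p in 𝓝 u, (fderiv ℝ F p ∘L .inr ℝ P Z).IsInvertible := by
    obtain ⟨e, he⟩ := hinv
    have h1 : ContinuousAt (fun p => fderiv ℝ F p ∘L .inr ℝ P Z) u :=
      (hu.fderiv_right (m := ∞) (by simp)).continuousAt.clm_comp continuousAt_const
    have h2 := e.nhds
    rw [he] at h2
    exact h1.eventually h2
  have hev := hu.eventually_apply_implicitFunction hne hinv
  have hiff := hu.eventually_apply_eq_iff_implicitFunction hne hinv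
  rw [h0] at hev
  simp only [h0] at hiff
  have hiff' := hiff
  rw [nhds_prod_eq] at hiff'
  obtain ⟨pa, hpa, pb, hpb, hab⟩ := eventually_prod_iff.1 hiff'
  have hall := hcont.and ((hpair.eventually hF).and ((hpair.eventually hD).and (hev.and hpa)))
  obtain ⟨O, hO, hOo, huO⟩ := eventually_nhds_iff.1 hall
  refine ⟨O, φ, {z | pb z}, hOo, huO, hpb, fun g hg => ?_, hφu, fun g hg => (hO g hg).2.2.2.1,
    fun g hg z hz h => ((hab (hO g hg).2.2.2.2 hz).1 h).symm⟩
  obtain ⟨c1, c2, c3, c4, -⟩ := hO g hg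
  have h3 := c2.eventually_apply_eq_iff_implicitFunction hne c3
  have h4 : Tendsto (fun g' => (g', φ g')) (𝓝 g) (𝓝 (g, φ g)) :=
    (continuousAt_id (x := g)).prodMk c1
  have h5 : φ =ᶠ[𝓝 g] c2.implicitFunction hne c3 := by
    filter_upwards [h4.eventually h3, hOo.mem_nhds hg] with g' h6 h7
    rw [c4] at h6
    exact (h6.1 (hO g' h7).2.2.2.1).symm
  exact ((c2.contDiffAt_implicitFunction hne c3).congr_of_eventuallyEq h5).contDiffWithinAt

theorem isInvertible_of_injective {Z W : Type*} [NormedAddCommGroup Z] [NormedSpace ℝ Z]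
    [NormedAddCommGroup W] [NormedSpace ℝ W] [FiniteDimensional ℝ Z] [FiniteDimensional ℝ W]
    (hdim : Module.finrank ℝ Z = Module.finrank ℝ W) {T : Z →L[ℝ] W}
    (hT : ∀ z, T z = 0 → z = 0) : T.IsInvertible :=
  ⟨(LinearEquiv.ofInjectiveOfFinrankEq (T : Z →ₗ[ℝ] W)
    ((injective_iff_map_eq_zero _).2 hT) hdim).toContinuousLinearEquiv, by ext x; rfl⟩

end Implicit

/-! ### Solutions of the contact equations -/

variable {d : ℕ} {B₁ B₂ : Set (E d)} {q : Amb d} {g : Aff d × Aff d}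

/-- The boundary points `b₁`, `b₂` are opposite to each other at the signed distance `s` in the
configuration `g`. -/
structure IsSolution (B₁ B₂ : Set (E d)) (g : Aff d × Aff d) (b₁ b₂ : E d) (s : ℝ) : Prop where
  mem₁ : b₁ ∈ frontier B₁
  mem₂ : b₂ ∈ frontier B₂
  act_eq : act g.2 b₂ = act g.1 b₁ + s • g.1.1 (normal B₁ b₁)
  normal_eq : g.2.1 (normal B₂ b₂) = -g.1.1 (normal B₁ b₁)

theorem normal₁_eq (hq : q ∈ Me B₁ B₂) : normal B₁ q.1.1 = q.1.2 (e d) := by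
  rw [hq.1.2.2, one_smul]

theorem normal₂_eq (hq : q ∈ Me B₁ B₂) : normal B₂ q.2.1.1 = -q.2.1.2 (e d) := by
  rw [hq.2.1.2.2]; simp

theorem isSolution_Psi (hq : q ∈ Me B₁ B₂) : IsSolution B₁ B₂ (Psi q) q.1.1 q.2.1.1 (gap q) where
  mem₁ := hq.1.1
  mem₂ := hq.2.1.1
  act_eq := by
    rw [normal₁_eq hq]
    simp only [act, Psi, ContinuousLinearMap.comp_apply, SO_inv_apply hq.1.2.1]
    module
  normal_eq := by
    rw [normal₁_eq hq, normal₂_eq hq]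
    simp only [Psi, ContinuousLinearMap.comp_apply, SO_inv_apply hq.1.2.1, map_neg,
      SO_inv_apply hq.2.1.2.1]

/-- The point of the second body that is opposite to `b₁`. -/
def contactPoint (f₁ : E d → ℝ) (p : (Aff d × Aff d) × E d × ℝ × ℝ) : E d :=
  inv p.1.2.1 (act p.1.1 p.2.1 + p.2.2.1 • p.1.1.1 (unitGrad f₁ p.2.1) - p.1.2.2)

/-- The contact equations for the unknowns `b₁`, `s` and a multiplier, in terms of local defining
functions. -/
def contactEq (f₁ f₂ : E d → ℝ) (p : (Aff d × Aff d) × E d × ℝ × ℝ) : ℝ × ℝ × E d :=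
  (f₁ p.2.1, f₂ (contactPoint f₁ p),
    p.1.2.1 (unitGrad f₂ (contactPoint f₁ p)) + p.2.2.2 • p.1.1.1 (unitGrad f₁ p.2.1))

section Charts

variable {U₁ U₂ : Set (E d)} {f₁ f₂ : E d → ℝ} {p : (Aff d × Aff d) × E d × ℝ × ℝ}

theorem contDiffAt_contactPoint (h₁ : BoundaryChart B₁ U₁ f₁) (hp : p.2.1 ∈ U₁) :
    ContDiffAt ℝ ∞ (contactPoint f₁) p := by
  have hn : ContDiffAt ℝ ∞ (fun p : (Aff d × Aff d) × E d × ℝ × ℝ => unitGrad f₁ p.2.1) p :=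
    ContDiffAt.comp (g := unitGrad f₁) (f := fun p : (Aff d × Aff d) × E d × ℝ × ℝ => p.2.1) p
      (contDiffAt_unitGrad (h₁.contDiffAt hp) (h₁.grad_ne _ hp)) (by fun_prop)
  have hi : ContDiffAt ℝ ∞ (fun p : (Aff d × Aff d) × E d × ℝ × ℝ => inv p.1.2.1) p :=
    contDiff_inv.contDiffAt.comp p (by fun_prop)
  unfold contactPoint act
  refine hi.clm_apply ?_
  fun_prop

theorem contDiffAt_contactEq (h₁ : BoundaryChart B₁ U₁ f₁) (h₂ : BoundaryChart B₂ U₂ f₂)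
    (hp : p.2.1 ∈ U₁) (hp' : contactPoint f₁ p ∈ U₂) : ContDiffAt ℝ ∞ (contactEq f₁ f₂) p := by
  have hc := contDiffAt_contactPoint h₁ hp
  have hn₁ : ContDiffAt ℝ ∞ (fun p : (Aff d × Aff d) × E d × ℝ × ℝ => unitGrad f₁ p.2.1) p :=
    ContDiffAt.comp (g := unitGrad f₁) (f := fun p : (Aff d × Aff d) × E d × ℝ × ℝ => p.2.1) p
      (contDiffAt_unitGrad (h₁.contDiffAt hp) (h₁.grad_ne _ hp)) (by fun_prop)
  have hf₁ : ContDiffAt ℝ ∞ (fun p : (Aff d × Aff d) × E d × ℝ × ℝ => f₁ p.2.1) p :=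
    (h₁.contDiffAt hp).comp p (by fun_prop)
  have hn₂ := (contDiffAt_unitGrad (h₂.contDiffAt hp') (h₂.grad_ne _ hp')).comp p hc
  have hf₂ := (h₂.contDiffAt hp').comp p hc
  refine hf₁.prodMk (hf₂.prodMk (ContDiffAt.add (ContDiffAt.clm_apply ?_ hn₂) ?_))
  · fun_prop
  · fun_prop

theorem IsSolution.contactPoint_eq (h₁ : BoundaryChart B₁ U₁ f₁) (hg : g ∈ GG d) {b₁ b₂ : E d}
    {s t : ℝ} (hs : IsSolution B₁ B₂ g b₁ b₂ s) (hb₁ : b₁ ∈ U₁) :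
    contactPoint f₁ (g, b₁, s, t) = b₂ := by
  rw [contactPoint, ← h₁.normal_eq hb₁ ((h₁.mem_frontier_iff hb₁).1 hs.mem₁)]
  dsimp only
  rw [← hs.act_eq, act, add_sub_cancel_right, SO_inv_apply hg.2]

theorem IsSolution.contactEq_eq (h₁ : BoundaryChart B₁ U₁ f₁) (h₂ : BoundaryChart B₂ U₂ f₂)
    (hg : g ∈ GG d) {b₁ b₂ : E d} {s : ℝ} (hs : IsSolution B₁ B₂ g b₁ b₂ s) (hb₁ : b₁ ∈ U₁)
    (hb₂ : b₂ ∈ U₂) : contactEq f₁ f₂ (g, b₁, s, 1) = 0 := by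
  have hf₁ := (h₁.mem_frontier_iff hb₁).1 hs.mem₁
  have hf₂ := (h₂.mem_frontier_iff hb₂).1 hs.mem₂
  rw [contactEq, hs.contactPoint_eq h₁ hg hb₁, ← h₁.normal_eq hb₁ hf₁, ← h₂.normal_eq hb₂ hf₂]
  dsimp only
  rw [hf₁, hf₂, hs.normal_eq, one_smul, neg_add_cancel]; rfl

theorem isSolution_of_contactEq (h₁ : BoundaryChart B₁ U₁ f₁) (h₂ : BoundaryChart B₂ U₂ f₂)
    (hg : p.1 ∈ GG d) (h : contactEq f₁ f₂ p = 0) (hp : p.2.1 ∈ U₁) (hp' : contactPoint f₁ p ∈ U₂)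
    (hpos : 0 < p.2.2.2) : IsSolution B₁ B₂ p.1 p.2.1 (contactPoint f₁ p) p.2.2.1 := by
  obtain ⟨⟨g₁, g₂⟩, b₁, s, t⟩ := p
  set b₂ := contactPoint f₁ ((g₁, g₂), b₁, s, t) with hb₂
  have hf₁ : f₁ b₁ = 0 := congrArg Prod.fst h
  have hf₂ : f₂ b₂ = 0 := congrArg (fun z => z.2.1) h
  have h3 : g₂.1 (unitGrad f₂ b₂) + t • g₁.1 (unitGrad f₁ b₁) = 0 := congrArg (fun z => z.2.2) h
  have h4 : g₂.1 (unitGrad f₂ b₂) = -(t • g₁.1 (unitGrad f₁ b₁)) := eq_neg_of_add_eq_zero_left h3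
  -- Opposition of two unit vectors is n - 1 conditions written as n equations; the multiplier t
  -- restores the balance. Comparing norms gives |t| = 1, and positivity decides the sign.
  have ht : t = 1 := by
    have h5 := congrArg norm h4
    have hpos : 0 < t := hpos
    rwa [SO_norm hg.2, norm_neg, norm_smul, SO_norm hg.1, norm_unitGrad (h₁.grad_ne _ hp),
      norm_unitGrad (h₂.grad_ne _ hp'), mul_one, Real.norm_eq_abs, abs_of_pos hpos, eq_comm] at h5
  refine ⟨(h₁.mem_frontier_iff hp).2 hf₁, (h₂.mem_frontier_iff hp').2 hf₂, ?_, ?_⟩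
  · rw [h₁.normal_eq hp hf₁, hb₂, contactPoint, act]
    dsimp only
    rw [SO_apply_inv hg.2, sub_add_cancel]
  · rw [h₁.normal_eq hp hf₁, h₂.normal_eq hp' hf₂]
    dsimp only
    rw [h4, ht, one_smul]

/-- The linearization of the contact equations is injective. -/
theorem contactEq_deriv_injective (h₁ : BoundaryChart B₁ U₁ f₁) (h₂ : BoundaryChart B₂ U₂ f₂)
    (hq : q ∈ Me B₁ B₂) (hq₁ : q.1.1 ∈ U₁) (hq₂ : q.2.1.1 ∈ U₂) (hN : IsUnit (combined B₁ B₂ q))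
    (z : E d × ℝ × ℝ)
    (hz : fderiv ℝ (contactEq f₁ f₂) (Psi q, q.1.1, gap q, 1) (0, z) = 0) : z = 0 := by
  obtain ⟨v, s', t'⟩ := z
  have hsol := isSolution_Psi hq
  have hΨ := Psi_mem_GG hq
  have hf₁ := (h₁.mem_frontier_iff hq₁).1 hsol.mem₁
  have hf₂ := (h₂.mem_frontier_iff hq₂).1 hsol.mem₂
  have hcp : contactPoint f₁ (Psi q, q.1.1, gap q, 1) = q.2.1.1 := hsol.contactPoint_eq h₁ hΨ hq₁
  set R₁ := (Psi q).1.1 with hR₁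
  set R₂ := (Psi q).2.1 with hR₂
  set n₁ := unitGrad f₁ q.1.1 with hn₁
  set n₂ := unitGrad f₂ q.2.1.1 with hn₂
  set D₁ := fderiv ℝ (unitGrad f₁) q.1.1 with hD₁
  set D₂ := fderiv ℝ (unitGrad f₂) q.2.1.1 with hD₂
  have en₁ : normal B₁ q.1.1 = n₁ := h₁.normal_eq hq₁ hf₁
  have en₂ : normal B₂ q.2.1.1 = n₂ := h₂.normal_eq hq₂ hf₂
  have hop : R₂ n₂ = -R₁ n₁ := by rw [← en₁, ← en₂]; exact hsol.normal_eq
  -- derivative along the line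
  have hl : HasDerivAt (fun t : ℝ => ((Psi q, q.1.1 + t • v, gap q + t * s', 1 + t * t') :
      (Aff d × Aff d) × E d × ℝ × ℝ)) (0, v, s', t') 0 := by
    have a1 : HasDerivAt (fun t : ℝ => q.1.1 + t • v) v 0 := by
      simpa using ((hasDerivAt_id (0 : ℝ)).smul_const v).const_add q.1.1
    have a2 : HasDerivAt (fun t : ℝ => gap q + t * s') s' 0 := by
      simpa using ((hasDerivAt_id (0 : ℝ)).mul_const s').const_add (gap q)
    have a3 : HasDerivAt (fun t : ℝ => 1 + t * t') t' 0 := by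
      simpa using ((hasDerivAt_id (0 : ℝ)).mul_const t').const_add 1
    exact (hasDerivAt_const 0 (Psi q)).prodMk (a1.prodMk (a2.prodMk a3))
  have hl0 : ((Psi q, q.1.1 + (0 : ℝ) • v, gap q + 0 * s', 1 + 0 * t') :
      (Aff d × Aff d) × E d × ℝ × ℝ) = (Psi q, q.1.1, gap q, 1) := by simp
  have hn₁d : HasDerivAt (fun t : ℝ => unitGrad f₁ (q.1.1 + t • v)) (D₁ v) 0 := by
    have a1 : HasDerivAt (fun t : ℝ => q.1.1 + t • v) v 0 := by
      simpa using ((hasDerivAt_id (0 : ℝ)).smul_const v).const_add q.1.1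
    have a2 : HasFDerivAt (unitGrad f₁) D₁ (q.1.1 + (0 : ℝ) • v) := by
      rw [zero_smul, add_zero]
      exact ((contDiffAt_unitGrad (h₁.contDiffAt hq₁) (h₁.grad_ne _ hq₁)).differentiableAt
        (by simp)).hasFDerivAt
    exact a2.comp_hasDerivAt (0 : ℝ) a1
  set w : E d := inv R₂ (R₁ v + s' • R₁ n₁ + gap q • R₁ (D₁ v)) with hw
  have hcd : HasDerivAt (fun t : ℝ => contactPoint f₁
      (Psi q, q.1.1 + t • v, gap q + t * s', 1 + t * t')) w 0 := by
    have a1 : HasDerivAt (fun t : ℝ => q.1.1 + t • v) v 0 := by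
      simpa using ((hasDerivAt_id (0 : ℝ)).smul_const v).const_add q.1.1
    have a2 : HasDerivAt (fun t : ℝ => gap q + t * s') s' 0 := by
      simpa using ((hasDerivAt_id (0 : ℝ)).mul_const s').const_add (gap q)
    have a3 := R₁.hasFDerivAt.comp_hasDerivAt (0 : ℝ) a1
    have a4 := a2.smul (R₁.hasFDerivAt.comp_hasDerivAt (0 : ℝ) hn₁d)
    have a5 := (inv R₂).hasFDerivAt.comp_hasDerivAt (0 : ℝ)
      (((a3.add_const (Psi q).1.2).add a4).sub_const (Psi q).2.2)
    refine a5.congr_deriv ?_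
    rw [hw]; congr 1
    simp only [zero_mul, add_zero, Function.comp_apply, zero_smul]
    rw [hn₁]; abel
  have hF := ((contDiffAt_contactEq (p := (Psi q, q.1.1, gap q, 1)) h₁ h₂ hq₁
    (by rw [hcp]; exact hq₂)).differentiableAt (by simp)).hasFDerivAt
  rw [← hl0] at hF hz
  have hFd := hF.comp_hasDerivAt (0 : ℝ) hl
  have hz' : fderiv ℝ (contactEq f₁ f₂)
      (Psi q, q.1.1 + (0 : ℝ) • v, gap q + 0 * s', 1 + 0 * t') (0, v, s', t') = 0 := hz
  rw [hz'] at hFd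
  have e1 : ⟪n₁, v⟫_ℝ = 0 := by
    have a1 : HasDerivAt (fun t : ℝ => q.1.1 + t • v) v 0 := by
      simpa using ((hasDerivAt_id (0 : ℝ)).smul_const v).const_add q.1.1
    have a2 : HasFDerivAt f₁ (fderiv ℝ f₁ q.1.1) (q.1.1 + (0 : ℝ) • v) := by
      rw [zero_smul, add_zero]
      exact ((h₁.contDiffAt hq₁).differentiableAt (by simp)).hasFDerivAt
    have a3 := a2.comp_hasDerivAt (0 : ℝ) a1
    have a4 : HasDerivAt (f₁ ∘ fun t : ℝ => q.1.1 + t • v) 0 0 := hFd.fst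
    have a5 := a3.unique a4
    rw [fderiv_eq_inner] at a5
    exact (inner_gradient_eq_zero_iff (h₁.grad_ne _ hq₁)).1 a5
  have hcp0 : contactPoint f₁ (Psi q, q.1.1 + (0 : ℝ) • v, gap q + 0 * s', 1 + 0 * t') =
      q.2.1.1 := by rw [hl0, hcp]
  have e2 : ⟪n₂, w⟫_ℝ = 0 := by
    have a2 : HasFDerivAt f₂ (fderiv ℝ f₂ q.2.1.1)
        (contactPoint f₁ (Psi q, q.1.1 + (0 : ℝ) • v, gap q + 0 * s', 1 + 0 * t')) := by
      rw [hcp0]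
      exact ((h₂.contDiffAt hq₂).differentiableAt (by simp)).hasFDerivAt
    have a3 := a2.comp_hasDerivAt (0 : ℝ) hcd
    have a5 := a3.unique hFd.snd.fst
    rw [fderiv_eq_inner] at a5
    exact (inner_gradient_eq_zero_iff (h₂.grad_ne _ hq₂)).1 a5
  have e3 : R₂ (D₂ w) + (R₁ (D₁ v) + t' • R₁ n₁) = 0 := by
    have a2 : HasFDerivAt (unitGrad f₂) D₂
        (contactPoint f₁ (Psi q, q.1.1 + (0 : ℝ) • v, gap q + 0 * s', 1 + 0 * t')) := by
      rw [hcp0]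
      exact ((contDiffAt_unitGrad (h₂.contDiffAt hq₂) (h₂.grad_ne _ hq₂)).differentiableAt
        (by simp)).hasFDerivAt
    have a3 := R₂.hasFDerivAt.comp_hasDerivAt (0 : ℝ) (a2.comp_hasDerivAt (0 : ℝ) hcd)
    have a1 : HasDerivAt (fun t : ℝ => 1 + t * t') t' 0 := by
      simpa using ((hasDerivAt_id (0 : ℝ)).mul_const t').const_add 1
    have a4 := a1.smul (R₁.hasFDerivAt.comp_hasDerivAt (0 : ℝ) hn₁d)
    have a5 := (a3.add a4).unique hFd.snd.snd
    simp only [zero_mul, add_zero, Function.comp_apply, zero_smul, one_smul] at a5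
    exact a5
  have o₁ : ⟪n₁, D₁ v⟫_ℝ = 0 :=
    inner_fderiv_unitGrad_self (h₁.contDiffAt hq₁) (h₁.grad_ne _ hq₁) v
  have o₂ : ⟪n₂, D₂ w⟫_ℝ = 0 :=
    inner_fderiv_unitGrad_self (h₂.contDiffAt hq₂) (h₂.grad_ne _ hq₂) w
  have u₁ : ⟪n₁, n₁⟫_ℝ = 1 := by
    rw [real_inner_self_eq_norm_sq, hn₁, norm_unitGrad (h₁.grad_ne _ hq₁), one_pow]
  -- The normal component of w is read off: v and the derivative of the normal are tangential, so
  -- only s' contributes.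
  have es : s' = 0 := by
    rw [hw, inner_inv_right, hop, inner_neg_left, neg_eq_zero, inner_add_right, inner_add_right,
      inner_smul_right, inner_smul_right, SO_inner hΨ.1, SO_inner hΨ.1, SO_inner hΨ.1, e1, u₁, o₁]
      at e2
    simpa using e2
  have et : t' = 0 := by
    have h : ⟪R₁ n₁, _⟫_ℝ = ⟪R₁ n₁, _⟫_ℝ := congrArg (fun y => ⟪R₁ n₁, y⟫_ℝ) e3
    have h' : ⟪R₁ n₁, R₂ (D₂ w)⟫_ℝ = 0 := by
      rw [← neg_neg (R₁ n₁), ← hop, inner_neg_left, SO_inner hΨ.2, o₂, neg_zero]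
    rw [inner_zero_right] at h
    rw [← h, inner_add_right, inner_add_right, inner_smul_right, SO_inner hΨ.1, SO_inner hΨ.1, h',
      u₁, o₁]
    ring
  subst es
  subst et
  -- pass to the frame
  have hA : q.2.2.1.1 ∈ SO d := hq.2.2.1
  have hσ₁ := hq.1.2.1
  have hσ₂ := hq.2.1.2.1
  set A := q.2.2.1.1 with hAdef
  have hx : inv q.1.2 v ∈ Hyp d := by
    rw [mem_Hyp, inner_inv_right, ← normal₁_eq hq, en₁]; exact e1
  set x : Hyp d := ⟨inv q.1.2 v, hx⟩ with hxdef
  have hvx : v = q.1.2 x := (SO_apply_inv hσ₁ v).symm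
  have hS₁ : q.1.2 (S₁ B₁ q x : E d) = -D₁ v := by
    rw [hvx]; exact h₁.frameShape_apply (ε := 1) hq₁ hf₁ hσ₁ (by norm_num) hq.1.2.2 x
  have hR₁x : ∀ y, R₁ (q.1.2 y) = A y := fun y => by
    change A (inv q.1.2 (q.1.2 y)) = _
    rw [SO_inv_apply hσ₁]
  have hR₂x : ∀ y, R₂ (q.2.1.2 y) = A y := fun y => by
    change A (inv q.2.1.2 (q.2.1.2 y)) = _
    rw [SO_inv_apply hσ₂]
  have hD₁v : R₁ (D₁ v) = -A (S₁ B₁ q x) := by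
    rw [← hR₁x, hS₁, map_neg, neg_neg]
  have hwx : w = q.2.1.2 ((x - gap q • S₁ B₁ q x : Hyp d) : E d) := by
    have : R₂ w = R₂ (q.2.1.2 ((x - gap q • S₁ B₁ q x : Hyp d) : E d)) := by
      rw [hR₂x, hw, SO_apply_inv hΨ.2, hD₁v, hvx, hR₁x]
      simp only [Submodule.coe_sub, Submodule.coe_smul, map_sub, map_smul]
      module
    have h := congrArg (inv R₂) this
    rwa [SO_inv_apply hΨ.2, SO_inv_apply hΨ.2] at h
  have hS₂ : q.2.1.2 (S₂ B₂ q (x - gap q • S₁ B₁ q x) : E d) = -D₂ w := by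
    rw [hwx]; exact h₂.frameShape_apply (ε := -1) hq₂ hf₂ hσ₂ (by norm_num) hq.2.1.2.2 _
  have hD₂w : R₂ (D₂ w) = -A (S₂ B₂ q (x - gap q • S₁ B₁ q x)) := by
    rw [← hR₂x, hS₂, map_neg, neg_neg]
  have hcomb : combined B₁ B₂ q x = 0 := by
    rw [hD₁v, hD₂w, zero_smul, add_zero] at e3
    have h := congrArg (inv A) e3
    simp only [map_add, map_neg, SO_inv_apply hA, map_zero] at h
    have h' : -(S₂ B₂ q (x - gap q • S₁ B₁ q x)) + -(S₁ B₁ q x) = 0 := Subtype.ext h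
    rw [combined_apply, ← neg_eq_zero, ← h', map_sub, map_smul]; abel
  have hx0 : x = 0 := (injective_iff_map_eq_zero _).1 (injective_of_isUnit hN) x hcomb
  rw [hvx, hx0]; simp

end Charts

/-- `β` gives the smooth family of solutions near the configuration `Ψ q`. -/
structure IsLocalSolution (B₁ B₂ : Set (E d)) (q : Amb d) (O : Set (Aff d × Aff d))
    (β : Aff d × Aff d → E d × E d × ℝ) (N : Set (E d × E d × ℝ)) : Prop where
  isOpen : IsOpen O
  mem : Psi q ∈ O
  smooth : ContDiffOn ℝ ∞ β O
  base : β (Psi q) = (q.1.1, q.2.1.1, gap q)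
  solves : ∀ g ∈ GG d, g ∈ O → IsSolution B₁ B₂ g (β g).1 (β g).2.1 (β g).2.2
  nhds : N ∈ 𝓝 (q.1.1, q.2.1.1, gap q)
  unique : ∀ g ∈ GG d, g ∈ O → ∀ p ∈ N, IsSolution B₁ B₂ g p.1 p.2.1 p.2.2 → p = β g

theorem exists_localSolution (hB₁ : IsBody B₁) (hB₂ : IsBody B₂) (hq : q ∈ Me B₁ B₂)
    (hN : IsUnit (combined B₁ B₂ q)) : ∃ O β N, IsLocalSolution B₁ B₂ q O β N := by
  obtain ⟨U₁, f₁, h₁, hq₁⟩ := hB₁.exists_chart hq.1.1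
  obtain ⟨U₂, f₂, h₂, hq₂⟩ := hB₂.exists_chart hq.2.1.1
  have hsol := isSolution_Psi hq
  have hΨ := Psi_mem_GG hq
  set u : (Aff d × Aff d) × E d × ℝ × ℝ := (Psi q, q.1.1, gap q, 1) with hu
  have hcp : contactPoint f₁ u = q.2.1.1 := hsol.contactPoint_eq h₁ hΨ hq₁
  have hev : ∀ᶠ p in 𝓝 u, p.2.1 ∈ U₁ ∧ contactPoint f₁ p ∈ U₂ ∧ 0 < p.2.2.2 := by
    have c1 : ContinuousAt (fun p : (Aff d × Aff d) × E d × ℝ × ℝ => p.2.1) u := by fun_prop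
    have c2 : ContinuousAt (fun p : (Aff d × Aff d) × E d × ℝ × ℝ => p.2.2.2) u := by fun_prop
    have c3 := (contDiffAt_contactPoint (p := u) h₁ hq₁).continuousAt
    refine (c1.eventually (h₁.isOpen.mem_nhds hq₁)).and
      ((c3.eventually (h₂.isOpen.mem_nhds (by rw [hcp]; exact hq₂))).and
        (c2.eventually (lt_mem_nhds (by simp [hu]))))
  obtain ⟨O, φ, N, hO, huO, hNn, hφ, hφu, hsolv, huniq⟩ := exists_implicitFunction
    (F := contactEq f₁ f₂) (u := u) (hev.mono fun p hp => contDiffAt_contactEq h₁ h₂ hp.1 hp.2.1)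
    (hsol.contactEq_eq h₁ h₂ hΨ hq₁ hq₂)
    -- Unknowns and equations both have dimension d + 3, so injectivity of the partial derivative is
    -- enough.
    (isInvertible_of_injective (by simp; ring) fun z hz =>
      contactEq_deriv_injective h₁ h₂ hq hq₁ hq₂ hN z hz)
  have hpair : ContinuousAt (fun g => (g, φ g)) (Psi q) :=
    continuousAt_id.prodMk (hφ.contDiffAt (hO.mem_nhds huO)).continuousAt
  have hpu : (Psi q, φ (Psi q)) = u := by
    have : φ (Psi q) = u.2 := hφu
    rw [this]
  have hpair' : Tendsto (fun g => (g, φ g)) (𝓝 (Psi q)) (𝓝 u) := by rw [← hpu]; exact hpair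
  obtain ⟨O', hO'1, hO'o, hO'm⟩ := eventually_nhds_iff.1 (hpair'.eventually hev)
  refine ⟨O ∩ O', fun g => ((φ g).1, contactPoint f₁ (g, φ g), (φ g).2.1),
    -- A genuine solution satisfies the equations with multiplier exactly 1, so the uniqueness
    -- neighbourhood is cut at that value.
    {p | p.1 ∈ U₁ ∧ p.2.1 ∈ U₂ ∧ ((p.1, p.2.2, 1) : E d × ℝ × ℝ) ∈ N}, hO.inter hO'o, ⟨huO, hO'm⟩,
    ?_, ?_, ?_, ?_, ?_⟩
  · intro g hg
    have h3 := hφ.contDiffAt (hO.mem_nhds hg.1)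
    have h4 : ContDiffAt ℝ ∞ (fun g => contactPoint f₁ (g, φ g)) g :=
      ContDiffAt.comp (g := contactPoint f₁) (f := fun g => (g, φ g)) g
        (contDiffAt_contactPoint h₁ (hO'1 g hg.2).1) (contDiffAt_id.prodMk h3)
    exact (h3.fst.prodMk (h4.prodMk h3.snd.fst)).contDiffWithinAt
  · have : φ (Psi q) = u.2 := hφu
    rw [hpu, hcp, this]
  · rintro g hg ⟨hgO, hgO'⟩
    obtain ⟨a1, a2, a3⟩ := hO'1 g hgO'
    exact isSolution_of_contactEq (p := (g, φ g)) h₁ h₂ hg (hsolv g hgO) a1 a2 a3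
  · have c : ContinuousAt (fun p : E d × E d × ℝ => ((p.1, p.2.2, 1) : E d × ℝ × ℝ))
      (q.1.1, q.2.1.1, gap q) := by fun_prop
    have c1 : ContinuousAt (fun p : E d × E d × ℝ => p.1) (q.1.1, q.2.1.1, gap q) := by fun_prop
    have c2 : ContinuousAt (fun p : E d × E d × ℝ => p.2.1) (q.1.1, q.2.1.1, gap q) := by fun_prop
    exact (c1.eventually (h₁.isOpen.mem_nhds hq₁)).and
      ((c2.eventually (h₂.isOpen.mem_nhds hq₂)).and (c.eventually hNn))
  · rintro g hg ⟨hgO, -⟩ ⟨b₁, b₂, s⟩ ⟨hp1, hp2, hp3⟩ hs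
    have h5 := huniq g hgO _ hp3 (hs.contactEq_eq h₁ h₂ hg hp1 hp2)
    have h6 : contactPoint f₁ (g, φ g) = b₂ := by rw [← h5]; exact hs.contactPoint_eq h₁ hg hp1
    rw [h6, ← h5]

end

section

variable {d : ℕ} {B B₁ B₂ U : Set (E d)} {f : E d → ℝ} {b : E d} {q : Amb d} {g : Aff d × Aff d}

theorem eventually_mem_open {X Y : Type*} [TopologicalSpace X] [TopologicalSpace Y] {F : X → Y}
    {x : X} {y : Y} {s : Set Y} (hF : ContinuousAt F x) (hs : IsOpen s) (hxy : F x = y)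
    (hy : y ∈ s) : ∀ᶠ z in 𝓝 x, F z ∈ s :=
  hF.eventually (hs.mem_nhds (hxy ▸ hy))

/-! ### Overlapping bodies -/

theorem isClosed_GG : IsClosed (GG d) :=
  (isClosed_SO.preimage continuous_fst).prod (isClosed_SO.preimage continuous_fst)

theorem M₀_subset_GG : M₀ B₁ B₂ ⊆ GG d := fun _ h => h.1

theorem M_subset_GG : M B₁ B₂ ⊆ GG d := closure_minimal M₀_subset_GG isClosed_GG

theorem continuous_inv_act (x : E d) :
    Continuous (fun g : Aff d => inv g.1 (x - g.2)) :=
  (continuous_inv.comp continuous_fst).clm_apply (continuous_const.sub continuous_snd)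

theorem inv_act_eq {g : Aff d} (hg : g.1 ∈ SO d) {x y : E d} (h : act g y = x) :
    inv g.1 (x - g.2) = y := by
  rw [← h, act, add_sub_cancel_right, SO_inv_apply hg]

theorem act_inv_act {g : Aff d} (hg : g.1 ∈ SO d) (x : E d) : act g (inv g.1 (x - g.2)) = x := by
  rw [act, SO_apply_inv hg, sub_add_cancel]

/-- Bodies with a common interior point cannot be made disjoint by a small motion. -/
theorem not_mem_M_of_overlap (hg : g ∈ GG d) {y₁ y₂ : E d} (h₁ : y₁ ∈ interior B₁)
    (h₂ : y₂ ∈ interior B₂) (h : act g.1 y₁ = act g.2 y₂) : g ∉ M B₁ B₂ := by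
  intro hM
  set x := act g.1 y₁ with hx
  have c1 : ContinuousAt (fun g : Aff d × Aff d => inv g.1.1 (x - g.1.2)) g :=
    ((continuous_inv_act x).comp continuous_fst).continuousAt
  have c2 : ContinuousAt (fun g : Aff d × Aff d => inv g.2.1 (x - g.2.2)) g :=
    ((continuous_inv_act x).comp continuous_snd).continuousAt
  have e1 := eventually_mem_open c1 isOpen_interior (inv_act_eq hg.1 hx.symm) h₁
  have e2 := eventually_mem_open c2 isOpen_interior (inv_act_eq hg.2 h.symm) h₂
  obtain ⟨g', ⟨hg', hdis⟩, a1, a2⟩ :=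
    ((mem_closure_iff_frequently.1 hM).and_eventually (e1.and e2)).exists
  exact Set.disjoint_left.1 hdis ⟨_, interior_subset a1, act_inv_act hg'.1 x⟩
    ⟨_, interior_subset a2, act_inv_act hg'.2 x⟩

/-- The sign of the defining function along the normal lines. -/
theorem BoundaryChart.eventually_along_normal (h : BoundaryChart B U f) (hb : b ∈ U) :
    ∀ᶠ p : E d × ℝ in 𝓝 (b, 0), f p.1 = 0 → p.1 + p.2 • unitGrad f p.1 ∈ U ∧
      (p.2 < 0 → f (p.1 + p.2 • unitGrad f p.1) < 0) ∧
      (0 < p.2 → 0 < f (p.1 + p.2 • unitGrad f p.1)) := by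
  have hn : ContinuousAt (fun p : E d × ℝ => unitGrad f p.1) (b, 0) :=
    ContinuousAt.comp (g := unitGrad f) (f := fun p : E d × ℝ => p.1)
      (contDiffAt_unitGrad (h.contDiffAt hb) (h.grad_ne b hb)).continuousAt (by fun_prop)
  have hl : ContinuousAt (fun p : E d × ℝ => p.1 + p.2 • unitGrad f p.1) (b, 0) := by fun_prop
  have hl0 : ((b, 0) : E d × ℝ).1 + ((b, 0) : E d × ℝ).2 • unitGrad f ((b, 0) : E d × ℝ).1 = b := by
    simp
  have hgr : ContinuousAt (fun p : E d × ℝ => ⟪gradient f (p.1 + p.2 • unitGrad f p.1),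
      unitGrad f p.1⟫_ℝ) (b, 0) := by
    refine ContinuousAt.inner (𝕜 := ℝ) (ContinuousAt.comp (g := gradient f) ?_ hl) hn
    rw [hl0]; exact (contDiffAt_gradient (h.contDiffAt hb)).continuousAt
  have hpos : 0 < ⟪gradient f (b + (0 : ℝ) • unitGrad f b), unitGrad f b⟫_ℝ := by
    rw [zero_smul, add_zero]
    nth_rewrite 1 [gradient_eq_norm_smul (h.grad_ne b hb)]
    rw [inner_smul_left, real_inner_self_eq_norm_sq, norm_unitGrad (h.grad_ne b hb)]
    simpa using h.grad_ne b hb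
  have hev := (eventually_mem_open hl h.isOpen hl0 hb).and
    (hgr.eventually (lt_mem_nhds hpos))
  obtain ⟨r, hr, hball⟩ := Metric.eventually_nhds_iff.1 hev
  refine Metric.eventually_nhds_iff.2 ⟨r, hr, ?_⟩
  rintro ⟨x, s⟩ hxs hx0
  -- The ball in the product metric contains, with (x, s), every (x, t) with |t| ≤ |s|. So the mean
  -- value theorem works along the normal segment uniformly in x.
  have hin : ∀ t : ℝ, |t| ≤ |s| → x + t • unitGrad f x ∈ U ∧
      0 < ⟪gradient f (x + t • unitGrad f x), unitGrad f x⟫_ℝ := fun t ht => by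
    refine hball (y := (x, t)) (lt_of_le_of_lt ?_ hxs)
    rw [Prod.dist_eq, Prod.dist_eq]
    refine max_le_max le_rfl ?_
    simpa [Real.dist_eq] using ht
  have hder : ∀ t : ℝ, |t| ≤ |s| → HasDerivAt (fun t : ℝ => f (x + t • unitGrad f x))
      ⟪gradient f (x + t • unitGrad f x), unitGrad f x⟫_ℝ t := fun t ht => by
    have a1 : HasDerivAt (fun t : ℝ => x + t • unitGrad f x) (unitGrad f x) t := by
      simpa using ((hasDerivAt_id t).smul_const (unitGrad f x)).const_add x
    have a2 := ((h.contDiffAt (hin t ht).1).differentiableAt (by simp)).hasFDerivAt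
    have a3 := a2.comp_hasDerivAt t a1
    rwa [fderiv_eq_inner] at a3
  have h00 : f (x + (0 : ℝ) • unitGrad f x) = 0 := by rw [zero_smul, add_zero]; exact hx0
  refine ⟨(hin s le_rfl).1, fun hs => ?_, fun hs => ?_⟩
  · have hs : s < 0 := hs
    have habs : ∀ t ∈ Icc s 0, |t| ≤ |s| := fun t ht => by
      rw [abs_of_nonpos ht.2, abs_of_neg hs]; linarith [ht.1]
    obtain ⟨c, hc, hc'⟩ := exists_hasDerivAt_eq_slope (fun t : ℝ => f (x + t • unitGrad f x)) _ hs
      (fun t ht => (hder t (habs t ht)).continuousAt.continuousWithinAt)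
      (fun t ht => hder t (habs t ⟨ht.1.le, ht.2.le⟩))
    have h3 := (hin c (habs c ⟨hc.1.le, hc.2.le⟩)).2
    rw [hc', h00, lt_div_iff₀ (by linarith)] at h3
    change f (x + s • unitGrad f x) < 0
    linarith
  · have hs : 0 < s := hs
    have habs : ∀ t ∈ Icc 0 s, |t| ≤ |s| := fun t ht => by
      rw [abs_of_nonneg ht.1, abs_of_pos hs]; exact ht.2
    obtain ⟨c, hc, hc'⟩ := exists_hasDerivAt_eq_slope (fun t : ℝ => f (x + t • unitGrad f x)) _ hs
      (fun t ht => (hder t (habs t ht)).continuousAt.continuousWithinAt)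
      (fun t ht => hder t (habs t ⟨ht.1.le, ht.2.le⟩))
    have h3 := (hin c (habs c ⟨hc.1.le, hc.2.le⟩)).2
    rw [hc', h00, lt_div_iff₀ (by linarith)] at h3
    change 0 < f (x + s • unitGrad f x)
    linarith

theorem frontier_subset_closure_interior (hB : IsBody B) (hb : b ∈ frontier B) :
    b ∈ closure (interior B) := by
  obtain ⟨U, f, h, hbU⟩ := hB.exists_chart hb
  refine mem_closure_iff_frequently.2 (((h.frequently_neg hbU
    ((h.mem_frontier_iff hbU).1 hb)).and_eventually (h.isOpen.mem_nhds hbU)).mono fun y hy => ?_)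
  exact (h.mem_interior_iff hy.2).2 hy.1

/-- If a boundary point of one body lies inside the other, the configuration is forbidden. -/
theorem not_mem_M_of_mem_interior (hB₂ : IsBody B₂) (hg : g ∈ GG d) {y₁ b₂ : E d}
    (h₁ : y₁ ∈ interior B₁) (h₂ : b₂ ∈ frontier B₂) (h : act g.1 y₁ = act g.2 b₂) :
    g ∉ M B₁ B₂ := by
  have c : Continuous (fun y : E d => inv g.1.1 (act g.2 y - g.1.2)) := by unfold act; fun_prop
  have e1 := eventually_mem_open (x := b₂) c.continuousAt isOpen_interior
    (inv_act_eq hg.1 h) h₁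
  obtain ⟨y₂, hy₂, hy₁⟩ := ((mem_closure_iff_frequently.1
    (frontier_subset_closure_interior hB₂ h₂)).and_eventually e1).exists
  exact not_mem_M_of_overlap hg hy₁ hy₂ (act_inv_act hg.1 _)

/-- Solutions with negative gap are forbidden configurations. -/
theorem eventually_not_mem_M (hB₁ : IsBody B₁) (hB₂ : IsBody B₂) {b₁ : E d}
    (hb₁ : b₁ ∈ frontier B₁) : ∀ᶠ p : E d × ℝ in 𝓝 (b₁, 0), ∀ g ∈ GG d, ∀ b₂,
      IsSolution B₁ B₂ g p.1 b₂ p.2 → p.2 < 0 → g ∉ M B₁ B₂ := by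
  obtain ⟨U, f, h, hbU⟩ := hB₁.exists_chart hb₁
  have c : ContinuousAt (fun p : E d × ℝ => p.1) (b₁, 0) := by fun_prop
  filter_upwards [h.eventually_along_normal hbU, c.eventually (h.isOpen.mem_nhds hbU)] with
    p hp hpU g hg b₂ hs hneg
  have h0 := (h.mem_frontier_iff hpU).1 hs.mem₁
  obtain ⟨a1, a2, -⟩ := hp h0
  -- With a negative gap, moving inward from b₁ along the normal reaches an interior point of the
  -- first body that coincides with the boundary point b₂ of the second.
  refine not_mem_M_of_mem_interior hB₂ hg ((h.mem_interior_iff a1).2 (a2 hneg)) hs.mem₂ ?_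
  rw [hs.act_eq, h.normal_eq hpU h0]
  simp only [act, map_add, map_smul]; abel

/-! ### Lifting solutions to the extended configuration manifold -/

/-- The point of the extended configuration manifold given by a solution and a frame. -/
def lift (g : Aff d × Aff d) (b₁ b₂ : E d) (s : ℝ) (σ : L d) : Amb d :=
  ((b₁, σ), (b₂, inv g.2.1 ∘L g.1.1 ∘L σ),
    (g.1.1 ∘L σ, act g.1 b₁ + (s / 2) • g.1.1 (σ (e d))), s)

section Lift

variable {b₁ b₂ : E d} {s : ℝ} {σ : L d} (hg : g ∈ GG d) (hs : IsSolution B₁ B₂ g b₁ b₂ s)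
  (hσ : σ ∈ SO d) (he : σ (e d) = normal B₁ b₁)
include hg hs hσ he

theorem lift_mem_Me (h0 : 0 ≤ s) : lift g b₁ b₂ s σ ∈ Me B₁ B₂ := by
  refine ⟨⟨hs.mem₁, hσ, by rw [one_smul]; exact he⟩, ⟨hs.mem₂,
    SO_comp_mem (SO_inv_mem hg.2) (SO_comp_mem hg.1 hσ), ?_⟩, SO_comp_mem hg.1 hσ, h0⟩
  change inv g.2.1 (g.1.1 (σ (e d))) = (-1 : ℝ) • normal B₂ b₂
  rw [he, ← neg_neg (g.1.1 _), ← hs.normal_eq, map_neg, SO_inv_apply hg.2]; simp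

theorem Psi_lift : Psi (lift g b₁ b₂ s σ) = g := by
  have h1 : ∀ x, σ (inv σ x) = x := SO_apply_inv hσ
  have h3 : ∀ x, (g.1.1 ∘L σ) (inv (inv g.2.1 ∘L g.1.1 ∘L σ) x) = g.2.1 x := fun x => by
    simp only [inv_comp, inv_inv, ContinuousLinearMap.comp_apply, h1, SO_apply_inv hg.1]
  refine Prod.ext (Prod.ext ?_ ?_) (Prod.ext ?_ ?_)
  · ext1 x
    change g.1.1 (σ (inv σ x)) = _
    rw [h1]
  · change act g.1 b₁ + (s / 2) • g.1.1 (σ (e d)) - (s / 2) • g.1.1 (σ (e d)) -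
      g.1.1 (σ (inv σ b₁)) = _
    rw [h1, act]; abel
  · ext1 x
    exact h3 x
  · change act g.1 b₁ + (s / 2) • g.1.1 (σ (e d)) + (s / 2) • g.1.1 (σ (e d)) -
      (g.1.1 ∘L σ) (inv (inv g.2.1 ∘L g.1.1 ∘L σ) b₂) = _
    rw [h3, he]
    have h4 := hs.act_eq
    have h5 : g.2.2 = act g.2 b₂ - g.2.1 b₂ := by rw [act]; abel
    rw [h5, h4]
    module

end Lift

theorem exists_lift (hd : 1 ≤ d) (hB₁ : IsBody B₁) (hg : g ∈ GG d) {b₁ b₂ : E d} {s : ℝ}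
    (hs : IsSolution B₁ B₂ g b₁ b₂ s) (h0 : 0 ≤ s) :
    ∃ q ∈ Me B₁ B₂, Psi q = g ∧ q.1.1 = b₁ ∧ q.2.1.1 = b₂ ∧ gap q = s := by
  obtain ⟨σ, hσ, he⟩ := exists_SO_apply hd norm_e (hB₁.norm_normal hs.mem₁)
  exact ⟨lift g b₁ b₂ s σ, lift_mem_Me hg hs hσ he h0, Psi_lift hg hs hσ he, rfl, rfl, rfl⟩

/-- Smooth local sections of `Ψ`. -/
theorem exists_section (hB₁ : IsBody B₁) (hB₂ : IsBody B₂) (hq : q ∈ Me B₁ B₂)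
    (hN : IsUnit (combined B₁ B₂ q)) : ∃ (O : Set (Aff d × Aff d)) (κ : Aff d × Aff d → Amb d),
      IsOpen O ∧ Psi q ∈ O ∧ ContDiffOn ℝ ∞ κ O ∧ κ (Psi q) = q ∧
      ∀ g ∈ M B₁ B₂, g ∈ O → κ g ∈ Me B₁ B₂ ∧ Psi (κ g) = g := by
  obtain ⟨O, β, N, hβ⟩ := exists_localSolution hB₁ hB₂ hq hN
  obtain ⟨U, f, h, hbU⟩ := hB₁.exists_chart hq.1.1
  have h0 := (h.mem_frontier_iff hbU).1 hq.1.1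
  have hβc : ContinuousAt β (Psi q) :=
    (hβ.smooth.contDiffAt (hβ.isOpen.mem_nhds hβ.mem)).continuousAt
  set n₀ := unitGrad f q.1.1 with hn₀
  have hn₀1 : ‖n₀‖ = 1 := norm_unitGrad (h.grad_ne _ hbU)
  have hn₀0 : n₀ ≠ 0 := by rintro h; rw [h] at hn₀1; simp at hn₀1
  have c1 : ContinuousAt (fun g => (β g).1) (Psi q) := hβc.fst
  have eU : ∀ᶠ g in 𝓝 (Psi q), (β g).1 ∈ U :=
    eventually_mem_open c1 h.isOpen (congrArg Prod.fst hβ.base) hbU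
  have cn : ContinuousAt (fun g => n₀ + unitGrad f (β g).1) (Psi q) := by
    refine continuousAt_const.add (ContinuousAt.comp (g := unitGrad f) ?_ c1)
    rw [hβ.base]
    exact (contDiffAt_unitGrad (h.contDiffAt hbU) (h.grad_ne _ hbU)).continuousAt
  have en : ∀ᶠ g in 𝓝 (Psi q), n₀ + unitGrad f (β g).1 ≠ 0 := by
    refine cn.eventually_ne ?_
    rw [hβ.base]
    change n₀ + n₀ ≠ 0
    rw [← two_smul ℝ]
    exact smul_ne_zero two_ne_zero hn₀0
  -- At a positive gap this is continuity; at gap zero it holds because nearby solutions with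
  -- negative gap are not in M.
  have es : ∀ᶠ g in 𝓝 (Psi q), g ∈ M B₁ B₂ → g ∈ O → 0 ≤ (β g).2.2 := by
    rcases (show 0 ≤ gap q from hq.2.2.2).lt_or_eq with hgap | hgap
    · have c2 : ContinuousAt (fun g => (β g).2.2) (Psi q) := hβc.snd.snd
      filter_upwards [eventually_mem_open c2 isOpen_Ioi
        (congrArg (fun p => p.2.2) hβ.base) hgap] with g hg _ _
      exact le_of_lt hg
    · have c2 : Tendsto (fun g => ((β g).1, (β g).2.2)) (𝓝 (Psi q)) (𝓝 (q.1.1, 0)) := by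
        have : ContinuousAt (fun g => ((β g).1, (β g).2.2)) (Psi q) := hβc.fst.prodMk hβc.snd.snd
        rw [ContinuousAt, hβ.base] at this
        rw [hgap]; exact this
      filter_upwards [c2.eventually (eventually_not_mem_M hB₁ hB₂ hq.1.1)] with g hg hgM hgO
      by_contra hneg
      exact hg g (M_subset_GG hgM) _ (hβ.solves g (M_subset_GG hgM) hgO) (not_le.1 hneg) hgM
  obtain ⟨O', hO', hO'o, hO'm⟩ := eventually_nhds_iff.1 (eU.and (en.and es))
  -- The frame of q is transported by `rot`, so it stays adapted while the boundary point moves, and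
  -- q itself is returned at the base configuration.
  refine ⟨O ∩ O', fun g => lift g (β g).1 (β g).2.1 (β g).2.2
    (rot n₀ (unitGrad f (β g).1) ∘L q.1.2), hβ.isOpen.inter hO'o, ⟨hβ.mem, hO'm⟩, ?_, ?_, ?_⟩
  · rintro g ⟨hgO, hgO'⟩
    obtain ⟨a1, a2, -⟩ := hO' g hgO'
    have s1 := hβ.smooth.contDiffAt (hβ.isOpen.mem_nhds hgO)
    have s2 : ContDiffAt ℝ ∞ (fun g => unitGrad f (β g).1) g :=
      ContDiffAt.comp (g := unitGrad f) g
        (contDiffAt_unitGrad (h.contDiffAt a1) (h.grad_ne _ a1)) s1.fst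
    have s3 : ContDiffAt ℝ ∞ (fun g => rot n₀ (unitGrad f (β g).1) ∘L q.1.2) g :=
      ContDiffAt.clm_comp (ContDiffAt.comp (g := fun v => rot n₀ v) g (contDiffAt_rot a2) s2)
        contDiffAt_const
    have s4 : ContDiffAt ℝ ∞ (fun g : Aff d × Aff d => g.1.1) g := by fun_prop
    have s5 : ContDiffAt ℝ ∞ (fun g : Aff d × Aff d => inv g.2.1) g :=
      ContDiffAt.comp (g := fun σ : L d => inv σ) g contDiff_inv.contDiffAt (by fun_prop)
    have s6 := s4.clm_comp s3
    have s7 : ContDiffAt ℝ ∞ (fun g : Aff d × Aff d => act g.1 (β g).1) g :=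
      (s4.clm_apply s1.fst).add (by fun_prop)
    have s8 : ContDiffAt ℝ ∞ (fun g : Aff d × Aff d => (β g).2.2 / 2) g := s1.snd.snd.div_const 2
    refine ContDiffAt.contDiffWithinAt (ContDiffAt.prodMk (s1.fst.prodMk s3)
      (ContDiffAt.prodMk (s1.snd.fst.prodMk (s5.clm_comp s6)) (ContDiffAt.prodMk
        (s6.prodMk (s7.add (s8.smul ?_))) s1.snd.snd)))
    exact s4.clm_apply (s3.clm_apply contDiffAt_const)
  · have hr : rot n₀ (unitGrad f (β (Psi q)).1) ∘L q.1.2 = q.1.2 := by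
      rw [hβ.base]
      change rot n₀ n₀ ∘L q.1.2 = q.1.2
      rw [rot_self hn₀1]; rfl
    have hR₁ : ∀ x, (Psi q).1.1 (q.1.2 x) = q.2.2.1.1 x := fun y => by
      change q.2.2.1.1 (inv q.1.2 (q.1.2 y)) = _
      rw [SO_inv_apply hq.1.2.1]
    have hR₂ : ∀ x, inv (Psi q).2.1 (q.2.2.1.1 x) = q.2.1.2 x := fun y => by
      change inv (q.2.2.1.1 ∘L inv q.2.1.2) _ = _
      rw [inv_comp, inv_inv, ContinuousLinearMap.comp_apply, SO_inv_apply hq.2.2.1]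
    dsimp only
    rw [hr, hβ.base]
    refine Prod.ext rfl (Prod.ext (Prod.ext rfl ?_) (Prod.ext (Prod.ext ?_ ?_) rfl))
    · ext1 x
      change inv (Psi q).2.1 ((Psi q).1.1 (q.1.2 x)) = _
      rw [hR₁, hR₂]
    · ext1 x
      exact hR₁ x
    · change act (Psi q).1 q.1.1 + (gap q / 2) • (Psi q).1.1 (q.1.2 (e d)) = _
      rw [hR₁]
      simp only [act, Psi, ContinuousLinearMap.comp_apply]
      abel
  · rintro g hgM ⟨hgO, hgO'⟩
    obtain ⟨a1, a2, a3⟩ := hO' g hgO'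
    have hg := M_subset_GG hgM
    have hs := hβ.solves g hg hgO
    have he : (rot n₀ (unitGrad f (β g).1) ∘L q.1.2) (e d) = normal B₁ (β g).1 := by
      rw [ContinuousLinearMap.comp_apply, ← normal₁_eq hq, h.normal_eq hbU h0,
        rot_apply hn₀1 (norm_unitGrad (h.grad_ne _ a1)) a2,
        h.normal_eq a1 ((h.mem_frontier_iff a1).1 hs.mem₁)]
    have hσ := SO_comp_mem (rot_mem_SO hn₀0 a2) hq.1.2.1
    exact ⟨lift_mem_Me hg hs hσ he (a3 hgM hgO), Psi_lift hg hs hσ he⟩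

/-! ### The bundle theorem -/

theorem Psi_rightAct (q : Amb d) {h : L d} (hh : h ∈ H d) : Psi (rightAct q h) = Psi q := by
  have h1 : ∀ x, h (inv h x) = x := SO_apply_inv hh.1
  have h2 := hh.2
  refine Prod.ext (Prod.ext ?_ ?_) (Prod.ext ?_ ?_)
  · ext1 x; simp [Psi, rightAct, mulAff, h1]
  · simp [Psi, rightAct, mulAff, h1, h2]
  · ext1 x; simp [Psi, rightAct, mulAff, h1]
  · simp [Psi, rightAct, mulAff, h1, h2]

/-- Points over the same configuration with the same boundary points lie in one orbit. -/
theorem exists_rightAct {q' : Amb d} (hB₁ : IsBody B₁) (hq : q ∈ Me B₁ B₂) (hq' : q' ∈ Me B₁ B₂)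
    (hΨ : Psi q = Psi q') (h1 : q.1.1 = q'.1.1) (h2 : q.2.1.1 = q'.2.1.1) :
    ∃ h ∈ H d, q' = rightAct q h := by
  have hσ := hq.1.2.1
  have hσ' := hq'.1.2.1
  -- The first frames leave no choice for h; it fixes e because both frames send e to the same
  -- normal. The remaining components follow by comparing the two values of `Psi`.
  set h := inv q.1.2 ∘L q'.1.2 with hh
  have hhH : h ∈ H d := by
    refine ⟨SO_comp_mem (SO_inv_mem hσ) hσ', ?_⟩
    rw [hh, ContinuousLinearMap.comp_apply, ← normal₁_eq hq', ← h1, normal₁_eq hq, SO_inv_apply hσ]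
  have e1 : ∀ x, q.2.2.1.1 (inv q.1.2 x) = q'.2.2.1.1 (inv q'.1.2 x) := fun x =>
    congrArg (fun g : Aff d × Aff d => g.1.1 x) hΨ
  have e2 : ∀ x, q.2.2.1.1 (inv q.2.1.2 x) = q'.2.2.1.1 (inv q'.2.1.2 x) := fun x =>
    congrArg (fun g : Aff d × Aff d => g.2.1 x) hΨ
  have hs₁ : q'.1.2 = q.1.2 ∘L h := by
    ext1 x; rw [hh]; exact (SO_apply_inv hσ _).symm
  have hA : q'.2.2.1.1 = q.2.2.1.1 ∘L h := by
    ext1 x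
    rw [hh, ContinuousLinearMap.comp_apply, ContinuousLinearMap.comp_apply, e1, SO_inv_apply hσ']
  have hs₂ : q'.2.1.2 = q.2.1.2 ∘L h := by
    ext1 x
    have h3 := e2 (q'.2.1.2 x)
    rw [SO_inv_apply hq'.2.1.2.1, hA, ContinuousLinearMap.comp_apply] at h3
    have h4 := congrArg (fun y => q.2.1.2 (inv q.2.2.1.1 y)) h3
    simp only [SO_inv_apply hq.2.2.1, SO_apply_inv hq.2.1.2.1] at h4
    exact h4
  have hgap : gap q = gap q' := by
    have s1 := (isSolution_Psi hq).act_eq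
    have s2 := (isSolution_Psi hq').act_eq
    rw [← hΨ, ← h1, ← h2, s1] at s2
    have s3 := add_left_cancel s2
    have hne : (Psi q).1.1 (normal B₁ q.1.1) ≠ 0 := by
      rw [← norm_ne_zero_iff, SO_norm (Psi_mem_GG hq).1, hB₁.norm_normal hq.1.1]; norm_num
    exact smul_left_injective ℝ hne s3
  have ha : q'.2.2.1.2 = q.2.2.1.2 := by
    have h3 : q.2.2.1.2 - (gap q / 2) • q.2.2.1.1 (e d) - q.2.2.1.1 (inv q.1.2 q.1.1) =
      q'.2.2.1.2 - (gap q' / 2) • q'.2.2.1.1 (e d) - q'.2.2.1.1 (inv q'.1.2 q'.1.1) :=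
      congrArg (fun g : Aff d × Aff d => g.1.2) hΨ
    rw [← e1, ← h1, hA, ContinuousLinearMap.comp_apply, hhH.2, hgap] at h3
    exact (sub_left_injective (sub_left_injective h3)).symm
  refine ⟨h, hhH, ?_⟩
  refine Prod.ext (Prod.ext h1.symm hs₁) (Prod.ext (Prod.ext h2.symm hs₂)
    (Prod.ext (Prod.ext hA ?_) hgap.symm))
  rw [ha]; simp [rightAct, mulAff]

theorem contDiff_rightAct : ContDiff ℝ ∞ (fun p : Amb d × L d => rightAct p.1 p.2) := by
  have c : ∀ {F G : Amb d × L d → L d}, ContDiff ℝ ∞ F → ContDiff ℝ ∞ G →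
      ContDiff ℝ ∞ (fun p => F p ∘L G p) := fun hF hG => hF.clm_comp hG
  have h2 : ContDiff ℝ ∞ (fun p : Amb d × L d => p.2) := contDiff_snd
  have h3 : ContDiff ℝ ∞ (fun p : Amb d × L d => p.1.2.2.1.1 (0 : E d) + p.1.2.2.1.2) := by fun_prop
  unfold rightAct mulAff
  refine ContDiff.prodMk (ContDiff.prodMk (by fun_prop) (c (by fun_prop) h2))
    (ContDiff.prodMk (ContDiff.prodMk (by fun_prop) (c (by fun_prop) h2))
      (ContDiff.prodMk (ContDiff.prodMk (c (by fun_prop) h2) h3) (by fun_prop)))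

/-- Once the configuration determines b₁ and b₂, fibres are single orbits by `exists_rightAct`. The
sections of `exists_section`, shrunk so as to land in U, show that the image is open in M and give
the local trivializations. -/
theorem isCollisionBundle_of (hB₁ : IsBody B₁) (hB₂ : IsBody B₂) {U : Set (Amb d)}
    (hU : IsRelOpen U (Me B₁ B₂)) (hbd : ∀ q ∈ bdMe B₁ B₂, Psi q ∈ bdM B₁ B₂ → q ∈ U)
    (hl : ∀ g ∈ SE d, ∀ q ∈ U, leftAct g q ∈ U) (hr : ∀ q ∈ U, ∀ h ∈ H d, rightAct q h ∈ U)
    (hN : ∀ q ∈ U, IsUnit (combined B₁ B₂ q))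
    (hinj : ∀ q ∈ U, ∀ q' ∈ U, Psi q = Psi q' → q.1.1 = q'.1.1 ∧ q.2.1.1 = q'.2.1.1)
    (hM : ∀ q ∈ U, Psi q ∈ M B₁ B₂) (hbdM : bdM B₁ B₂ ⊆ Psi '' U) :
    IsCollisionBundle B₁ B₂ U := by
  have key : ∀ q ∈ U, ∃ (O : Set (Aff d × Aff d)) (κ : Aff d × Aff d → Amb d),
      IsOpen O ∧ Psi q ∈ O ∧ ContDiffOn ℝ ∞ κ O ∧
      ∀ g ∈ M B₁ B₂, g ∈ O → κ g ∈ U ∧ Psi (κ g) = g := by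
    intro q hq
    obtain ⟨O, κ, hO, hqO, hκ, hκq, hκM⟩ := exists_section hB₁ hB₂ (hU.subset hq) (hN q hq)
    obtain ⟨O₁, hO₁, rfl⟩ := hU
    obtain ⟨O₂, hO₂o, hO₂⟩ := (continuousOn_iff'.1 hκ.continuousOn) O₁ hO₁
    refine ⟨O ∩ O₂, κ, hO.inter hO₂o, ⟨hqO, ?_⟩, hκ.mono inter_subset_left, ?_⟩
    · have : Psi q ∈ κ ⁻¹' O₁ ∩ O := ⟨by rw [mem_preimage, hκq]; exact hq.2, hqO⟩
      rw [hO₂] at this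
      exact this.1
    · rintro g hgM ⟨hgO, hgO₂⟩
      have : g ∈ O₂ ∩ O := ⟨hgO₂, hgO⟩
      rw [← hO₂] at this
      exact ⟨⟨(hκM g hgM hgO).1, this.1⟩, (hκM g hgM hgO).2⟩
  have hUM : Psi '' U ⊆ M B₁ B₂ := by
    rintro _ ⟨q, hq, rfl⟩
    exact hM q hq
  have hfib : ∀ q ∈ U, ∀ q' ∈ U, Psi q = Psi q' ↔ ∃ h ∈ H d, q' = rightAct q h := by
    intro q hq q' hq'
    constructor
    · intro h
      obtain ⟨h1, h2⟩ := hinj q hq q' hq' h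
      exact exists_rightAct hB₁ (hU.subset hq) (hU.subset hq') h h1 h2
    · rintro ⟨h, hh, rfl⟩
      exact (Psi_rightAct _ hh).symm
  refine ⟨hU, hbd, hl, isRelOpen_of_nhdsWithin hUM ?_, hbdM, contDiff_Psi.contDiffOn, hr, ?_, hfib, ?_⟩
  · rintro _ ⟨q, hq, rfl⟩
    obtain ⟨O, κ, hO, hqO, -, hκ⟩ := key q hq
    filter_upwards [self_mem_nhdsWithin, nhdsWithin_le_nhds (hO.mem_nhds hqO)] with g hgM hgO
    exact ⟨κ g, hκ g hgM hgO⟩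
  · intro q hq h hh heq
    have h1 : ∀ x, q.1.2 (h x) = q.1.2 x := fun x => congrArg (fun q : Amb d => q.1.2 x) heq
    ext1 x
    have h2 := congrArg (inv q.1.2) (h1 x)
    rwa [SO_inv_apply (hU.subset hq).1.2.1, SO_inv_apply (hU.subset hq).1.2.1] at h2
  · rintro _ ⟨q₀, hq₀, rfl⟩
    obtain ⟨O, κ, hO, hqO, hκs, hκ⟩ := key q₀ hq₀
    have hinvA : ∀ q ∈ U, ∀ T : L d, inv q.2.2.1.1 ∘L (q.2.2.1.1 ∘L T) = T := fun q hq T => by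
      ext1 x; exact SO_inv_apply (hU.subset hq).2.2.1 _
    refine ⟨Psi '' U ∩ O, ⟨O, hO, rfl⟩, ⟨⟨q₀, hq₀, rfl⟩, hqO⟩,
      -- H acts on the rotation A by right multiplication, so the group coordinate relative to the
      -- section κ is the quotient of the two rotations.
      fun q => inv (κ (Psi q)).2.2.1.1 ∘L q.2.2.1.1, fun p => rightAct (κ p.1) p.2, ?_, ?_, ?_, ?_⟩
    · have h1 : ContDiffOn ℝ ∞ (fun q => κ (Psi q)) (U ∩ Psi ⁻¹' (Psi '' U ∩ O)) :=
        hκs.comp contDiff_Psi.contDiffOn fun q hq => hq.2.2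
      have h2 : ContDiffOn ℝ ∞ (fun q => inv (κ (Psi q)).2.2.1.1)
          (U ∩ Psi ⁻¹' (Psi '' U ∩ O)) :=
        (contDiff_inv (d := d)).comp_contDiffOn h1.snd.snd.fst.fst
      exact h2.clm_comp (by fun_prop)
    · exact contDiff_rightAct.comp_contDiffOn (ContDiffOn.prodMk
        (hκs.comp contDiff_fst.contDiffOn fun p hp => hp.1.2) contDiff_snd.contDiffOn)
    · rintro q ⟨hq, -, hqO'⟩
      obtain ⟨k1, k2⟩ := hκ (Psi q) (hM q hq) hqO'
      obtain ⟨h, hh, hqh⟩ := (hfib _ k1 _ hq).1 k2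
      have hA : q.2.2.1.1 = (κ (Psi q)).2.2.1.1 ∘L h :=
        congrArg (fun q : Amb d => q.2.2.1.1) hqh
      have hτ : inv (κ (Psi q)).2.2.1.1 ∘L q.2.2.1.1 = h := by rw [hA, hinvA _ k1]
      dsimp only
      refine ⟨by rw [hτ]; exact hh, by rw [hτ]; exact hqh.symm, fun h' hh' => ?_⟩
      rw [Psi_rightAct _ hh']
      rfl
    · rintro y ⟨hyU, hyO⟩ h hh
      obtain ⟨k1, k2⟩ := hκ y (hUM hyU) hyO
      have k3 : Psi (rightAct (κ y) h) = y := by rw [Psi_rightAct _ hh, k2]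
      refine ⟨hr _ k1 h hh, k3, ?_⟩
      dsimp only
      rw [k3]
      exact hinvA _ k1 h

end

section

variable {d : ℕ} {B B₁ B₂ U : Set (E d)} {f : E d → ℝ} {b b₁ b₂ : E d} {q : Amb d}
  {g : Aff d × Aff d}

/-! ### The second fundamental form -/

/-- The second fundamental form of `∂B` with respect to the outward normal. -/
def II (B : Set (E d)) (b v w : E d) : ℝ := ⟪fderivWithin ℝ (normal B) (frontier B) b v, w⟫_ℝ

theorem BoundaryChart.II_eq (h : BoundaryChart B U f) (hb : b ∈ U) (h0 : f b = 0) {v w : E d}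
    (hv : ⟪normal B b, v⟫_ℝ = 0) (hw : ⟪normal B b, w⟫_ℝ = 0) :
    II B b v w = ‖gradient f b‖⁻¹ * hess f b v w := by
  rw [II, h.fderivWithin_normal hb h0 hv]
  rw [h.normal_eq hb h0] at hw
  exact inner_fderiv_unitGrad (h.contDiffAt hb) (h.grad_ne b hb) hw v

/-- Expresses the shape operator through a form that does not depend on the frame. With the outward
normal, convexity means II ≥ 0 and S ≤ 0. -/
theorem inner_frameShape_eq (hB : IsBody B) {ε : ℝ} (hε : ε ^ 2 = 1) {p : E d × L d}
    (hp : p ∈ Frames ε B) (x y : Hyp d) :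
    ⟪frameShape B p.1 p.2 x, y⟫_ℝ = -II B p.1 (p.2 x) (p.2 y) := by
  obtain ⟨U, f, h, hbU⟩ := hB.exists_chart hp.1
  have h0 := (h.mem_frontier_iff hbU).1 hp.1
  have ho : ∀ x : Hyp d, ⟪normal B p.1, p.2 x⟫_ℝ = 0 := fun x => by
    rw [inner_normal_frame hp.2.1 hε hp.2.2, mem_Hyp.1 x.2, mul_zero]
  rw [h.inner_frameShape hbU h0 hp.2.1 hε hp.2.2, h.II_eq hbU h0 (ho x) (ho y)]

theorem II_nonneg_of_convex (hB : IsBody B) (hc : Convex ℝ B) (hb : b ∈ frontier B) {v : E d}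
    (hv : ⟪normal B b, v⟫_ℝ = 0) : 0 ≤ II B b v v := by
  obtain ⟨U, f, h, hbU⟩ := hB.exists_chart hb
  have h0 := (h.mem_frontier_iff hbU).1 hb
  rw [h.II_eq hbU h0 hv hv]
  rw [h.normal_eq hbU h0] at hv
  exact mul_nonneg (by positivity) (hess_nonneg_of_convex hc h hbU h0 hv)

/-- If the second fundamental form is positive on `v`, the line in direction `v` leaves `B`. -/
theorem eventually_not_mem_of_II_pos (hB : IsBody B) (hb : b ∈ frontier B) {v : E d}
    (hv : ⟪normal B b, v⟫_ℝ = 0) (hII : 0 < II B b v v) : ∀ᶠ t : ℝ in 𝓝[>] 0, b + t • v ∉ B := by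
  obtain ⟨U, f, h, hbU⟩ := hB.exists_chart hb
  have h0 := (h.mem_frontier_iff hbU).1 hb
  rw [h.II_eq hbU h0 hv hv] at hII
  have hpos : 0 < hess f b v v := pos_of_mul_pos_right hII (by positivity)
  rw [h.normal_eq hbU h0] at hv
  have hgn : gradient (fun y => -f y) = fun y => -gradient f y := funext fun y => gradient_neg' f y
  have h1 := eventually_neg_along_parabola (f := fun y => -f y) (w := 0) (v := v)
    (h.contDiffAt hbU).neg (by simp [h0])
    (by rw [gradient_neg', inner_neg_left, (inner_gradient_eq_zero_iff (h.grad_ne b hbU)).2 hv,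
      neg_zero]) (by
      rw [hess, hgn, fderiv_fun_neg, neg_apply, inner_neg_left, inner_zero_right]
      change -hess f b v v + 2 * 0 < 0
      linarith)
  filter_upwards [h1, (tendsto_line b v).eventually (h.isOpen.mem_nhds hbU)] with t ht htU htB
  rw [smul_zero, add_zero] at ht
  have := (h.mem_iff _ htU).1 htB
  linarith

/-! ### Touching bodies -/

section Pull

variable {x : E d} {T : L d} {c : E d}

theorem contDiffAt_pull (hf : ContDiffAt ℝ ∞ f (T x + c)) :
    ContDiffAt ℝ ∞ (fun y => f (T y + c)) x :=
  ContDiffAt.comp (g := f) (f := fun y => T y + c) x hf (by fun_prop)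

theorem gradient_pull (hf : DifferentiableAt ℝ f (T x + c)) :
    gradient (fun y => f (T y + c)) x = inv T (gradient f (T x + c)) := by
  have h1 : HasFDerivAt (fun y => T y + c) T x := T.hasFDerivAt.add_const c
  have h2 : HasFDerivAt (fun y => f (T y + c)) (fderiv ℝ f (T x + c) ∘L T) x :=
    HasFDerivAt.comp (g := f) (f := fun y => T y + c) x hf.hasFDerivAt h1
  refine ext_inner_right ℝ fun v => ?_
  rw [inner_inv_left, ← fderiv_eq_inner, ← fderiv_eq_inner, h2.fderiv]; rfl

theorem hess_pull (hf : ContDiffAt ℝ ∞ f (T x + c)) (v w : E d) :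
    hess (fun y => f (T y + c)) x v w = hess f (T x + c) (T v) (T w) := by
  have h1 : HasFDerivAt (fun y => T y + c) T x := T.hasFDerivAt.add_const c
  have hd : ∀ᶠ z in 𝓝 (T x + c), DifferentiableAt ℝ f z :=
    (hf.of_le (m := 1) (by norm_num)).eventually (by simp) |>.mono
      fun z hz => hz.differentiableAt (by simp)
  have he : gradient (fun y => f (T y + c)) =ᶠ[𝓝 x] fun y => inv T (gradient f (T y + c)) :=
    (h1.continuousAt.eventually hd).mono fun y hy => gradient_pull hy
  have h2 := ((contDiffAt_gradient hf).differentiableAt (by simp)).hasFDerivAt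
  have h3 : HasFDerivAt (fun y => gradient f (T y + c)) (fderiv ℝ (gradient f) (T x + c) ∘L T) x :=
    HasFDerivAt.comp (g := gradient f) (f := fun y => T y + c) x h2 h1
  have h4 : HasFDerivAt (fun y => inv T (gradient f (T y + c)))
      (inv T ∘L fderiv ℝ (gradient f) (T x + c) ∘L T) x :=
    HasFDerivAt.comp (g := inv T) x (inv T).hasFDerivAt h3
  rw [hess, he.fderiv_eq, h4.fderiv, hess]
  exact inner_inv_left T _ w

end Pull

/-- The change of coordinates from the first to the second body. -/
theorem act_transition (hg : g ∈ GG d) (y : E d) :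
    act g.2 ((inv g.2.1 ∘L g.1.1) y + inv g.2.1 (g.1.2 - g.2.2)) = act g.1 y := by
  simp only [act, ContinuousLinearMap.comp_apply, map_add, SO_apply_inv hg.2]; abel

theorem transition_eq (hg : g ∈ GG d) (h : act g.1 b₁ = act g.2 b₂) :
    (inv g.2.1 ∘L g.1.1) b₁ + inv g.2.1 (g.1.2 - g.2.2) = b₂ := by
  have h1 := act_transition hg b₁
  rw [h] at h1
  have h2 := congrArg (inv g.2.1) (add_right_cancel h1)
  rwa [SO_inv_apply hg.2, SO_inv_apply hg.2] at h2

/-- Writes the second body in the coordinates of the first, which reduces touching bodies to two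
functions at one point with no common negative points nearby. -/
theorem eventually_not_overlap {U₁ U₂ : Set (E d)} {f₁ f₂ : E d → ℝ} (hg : g ∈ M B₁ B₂)
    (h₁ : BoundaryChart B₁ U₁ f₁) (h₂ : BoundaryChart B₂ U₂ f₂) (hb₁ : b₁ ∈ U₁) (hb₂ : b₂ ∈ U₂)
    (h : act g.1 b₁ = act g.2 b₂) : ∀ᶠ y in 𝓝 b₁,
      ¬ (f₁ y < 0 ∧ f₂ ((inv g.2.1 ∘L g.1.1) y + inv g.2.1 (g.1.2 - g.2.2)) < 0) := by
  have hG := M_subset_GG hg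
  have c : ContinuousAt (fun y => (inv g.2.1 ∘L g.1.1) y + inv g.2.1 (g.1.2 - g.2.2)) b₁ := by
    fun_prop
  filter_upwards [h₁.isOpen.mem_nhds hb₁, eventually_mem_open c h₂.isOpen (transition_eq hG h) hb₂]
    with y hy1 hy2
  rintro ⟨n1, n2⟩
  exact not_mem_M_of_overlap hG ((h₁.mem_interior_iff hy1).2 n1) ((h₂.mem_interior_iff hy2).2 n2)
    (act_transition hG y).symm hg

theorem M_swap : g.swap ∈ M B₂ B₁ ↔ g ∈ M B₁ B₂ := by
  have h : ∀ {B₁ B₂ : Set (E d)} {g : Aff d × Aff d}, g ∈ M B₁ B₂ → g.swap ∈ M B₂ B₁ := by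
    intro B₁ B₂ g hg
    have h1 : MapsTo Prod.swap (M₀ B₁ B₂) (M₀ B₂ B₁) := fun g hg =>
      ⟨⟨hg.1.2, hg.1.1⟩, hg.2.symm⟩
    exact map_mem_closure continuous_swap hg h1
  exact ⟨fun hg => by simpa using h hg, h⟩

/-- Bodies that touch in a configuration of `M` are opposite to each other at the contact point. -/
theorem isSolution_of_contact (hB₁ : IsBody B₁) (hB₂ : IsBody B₂) (hg : g ∈ M B₁ B₂)
    (hb₁ : b₁ ∈ B₁) (hb₂ : b₂ ∈ B₂) (h : act g.1 b₁ = act g.2 b₂) :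
    IsSolution B₁ B₂ g b₁ b₂ 0 := by
  have hG := M_subset_GG hg
  have split : ∀ {B : Set (E d)} {b : E d}, IsBody B → b ∈ B → b ∈ interior B ∨ b ∈ frontier B := by
    intro B b hB hb
    by_cases hi : b ∈ interior B
    · exact Or.inl hi
    · exact Or.inr ⟨subset_closure hb, hi⟩
  have m₁ : b₁ ∈ frontier B₁ := by
    rcases split hB₁ hb₁ with h1 | h1
    · rcases split hB₂ hb₂ with h2 | h2
      · exact absurd hg (not_mem_M_of_overlap hG h1 h2 h)
      · exact absurd hg (not_mem_M_of_mem_interior hB₂ hG h1 h2 h)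
    · exact h1
  have m₂ : b₂ ∈ frontier B₂ := by
    rcases split hB₂ hb₂ with h2 | h2
    · exact absurd (M_swap.2 hg)
        (not_mem_M_of_mem_interior (g := g.swap) hB₁ ⟨hG.2, hG.1⟩ h2 m₁ h.symm)
    · exact h2
  obtain ⟨U₁, f₁, h₁, hU₁⟩ := hB₁.exists_chart m₁
  obtain ⟨U₂, f₂, h₂, hU₂⟩ := hB₂.exists_chart m₂
  have z₁ := (h₁.mem_frontier_iff hU₁).1 m₁
  have z₂ := (h₂.mem_frontier_iff hU₂).1 m₂
  refine ⟨m₁, m₂, by rw [zero_smul, add_zero, h], ?_⟩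
  have ht := transition_eq hG h
  have hSO : inv g.2.1 ∘L g.1.1 ∈ SO d := SO_comp_mem (SO_inv_mem hG.2) hG.1
  have hf₂ : ContDiffAt ℝ ∞ f₂ ((inv g.2.1 ∘L g.1.1) b₁ + inv g.2.1 (g.1.2 - g.2.2)) := by
    rw [ht]; exact h₂.contDiffAt hU₂
  have hgr := gradient_pull (hf₂.differentiableAt (by simp))
  rw [ht] at hgr
  have h1 := unit_gradient_opposite (h₁.contDiffAt hU₁) (contDiffAt_pull hf₂) z₁
    (by rw [ht]; exact z₂) (h₁.grad_ne _ hU₁) (by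
      rw [hgr, ← norm_ne_zero_iff, SO_inv_norm hSO, norm_ne_zero_iff]
      exact h₂.grad_ne _ hU₂) (eventually_not_overlap hg h₁ h₂ hU₁ hU₂ h)
  rw [hgr, SO_inv_norm hSO, ← map_smul] at h1
  have h2 := congrArg g.1.1 h1
  rw [inv_comp, inv_inv, ContinuousLinearMap.comp_apply, SO_apply_inv hG.1, map_neg] at h2
  rw [h₁.normal_eq hU₁ z₁, h₂.normal_eq hU₂ z₂]
  exact h2

/-- The second-order contact condition: if the sum were negative on a tangent vector, a suitable
parabola in that direction would enter both interiors. -/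
theorem II_add_nonneg (hB₁ : IsBody B₁) (hB₂ : IsBody B₂) (hg : g ∈ M B₁ B₂)
    (hs : IsSolution B₁ B₂ g b₁ b₂ 0) {v : E d} (hv : ⟪normal B₁ b₁, v⟫_ℝ = 0) :
    0 ≤ II B₁ b₁ v v + II B₂ b₂ (inv g.2.1 (g.1.1 v)) (inv g.2.1 (g.1.1 v)) := by
  have hG := M_subset_GG hg
  have h : act g.1 b₁ = act g.2 b₂ := by rw [hs.act_eq, zero_smul, add_zero]
  obtain ⟨U₁, f₁, h₁, hU₁⟩ := hB₁.exists_chart hs.mem₁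
  obtain ⟨U₂, f₂, h₂, hU₂⟩ := hB₂.exists_chart hs.mem₂
  have z₁ := (h₁.mem_frontier_iff hU₁).1 hs.mem₁
  have z₂ := (h₂.mem_frontier_iff hU₂).1 hs.mem₂
  have ht := transition_eq hG h
  have hf₂ : ContDiffAt ℝ ∞ f₂ ((inv g.2.1 ∘L g.1.1) b₁ + inv g.2.1 (g.1.2 - g.2.2)) := by
    rw [ht]; exact h₂.contDiffAt hU₂
  have hgr := gradient_pull (hf₂.differentiableAt (by simp))
  rw [ht] at hgr
  have hn := hs.normal_eq
  have hw : ⟪normal B₂ b₂, inv g.2.1 (g.1.1 v)⟫_ℝ = 0 := by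
    rw [inner_inv_right, hn, inner_neg_left, SO_inner hG.1, hv, neg_zero]
  rw [h₁.II_eq hU₁ z₁ hv hv, h₂.II_eq hU₂ z₂ hw hw]
  rw [h₁.normal_eq hU₁ z₁, h₂.normal_eq hU₂ z₂] at hn
  rw [h₁.normal_eq hU₁ z₁] at hv
  have hgr' : inv (inv g.2.1 ∘L g.1.1) (gradient f₂ b₂) =
      -(‖gradient f₂ b₂‖ • unitGrad f₁ b₁) := by
    rw [inv_comp, inv_inv, ContinuousLinearMap.comp_apply]
    nth_rewrite 1 [gradient_eq_norm_smul (h₂.grad_ne _ hU₂)]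
    rw [map_smul, hn, map_smul, map_neg, SO_inv_apply hG.1, smul_neg]
  have h1 := hess_add_hess_nonneg (h₁.contDiffAt hU₁) (contDiffAt_pull hf₂) z₁
    (by rw [ht]; exact z₂) (norm_unitGrad (h₁.grad_ne _ hU₁))
    (norm_pos_iff.2 (h₁.grad_ne _ hU₁)) (norm_pos_iff.2 (h₂.grad_ne _ hU₂))
    (gradient_eq_norm_smul (h₁.grad_ne _ hU₁)) (hgr.trans hgr')
    (eventually_not_overlap hg h₁ h₂ hU₁ hU₂ h) hv
  rw [hess_pull hf₂, ht] at h1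
  rw [div_eq_inv_mul, div_eq_inv_mul] at h1
  exact h1

/-! ### Convex bodies -/

/-- Convexity makes the second fundamental form semidefinite and the nonzero determinant makes it
definite, so tangent lines leave the body to second order. -/
theorem eventually_not_mem_of_gaussKronecker (hd : 1 ≤ d) (hB : IsBody B) (hc : Convex ℝ B)
    (hb : b ∈ frontier B) (hK : gaussKronecker B b ≠ 0) {v : E d} (hv : ⟪normal B b, v⟫_ℝ = 0)
    (hv0 : v ≠ 0) : ∀ᶠ t : ℝ in 𝓝[>] 0, b + t • v ∉ B := by
  refine eventually_not_mem_of_II_pos hB hb hv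
    ((II_nonneg_of_convex hB hc hb hv).lt_of_ne fun h0 => hv0 ?_)
  obtain ⟨σ, hσ, he⟩ := exists_SO_apply hd norm_e (hB.norm_normal hb)
  have hp : (b, σ) ∈ Frames 1 B := ⟨hb, hσ, by rw [one_smul]; exact he⟩
  have hx : inv σ v ∈ Hyp d := by rw [mem_Hyp, inner_inv_right, he, hv]
  set x : Hyp d := ⟨inv σ v, hx⟩
  have hvx : σ x = v := SO_apply_inv hσ v
  have h1 : ⟪frameShape B b σ x, x⟫_ℝ = 0 := by
    have := inner_frameShape_eq (ε := 1) hB (by norm_num) hp x x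
    dsimp only at this
    rw [this, hvx, ← h0, neg_zero]
  have h2 := apply_eq_zero_of_nonpos
    (fun x y => frameShape_symm (ε := 1) hB (by norm_num) hp x y)
    (frameShape_nonpos (ε := 1) hB hc (by norm_num) hp) h1
  have h3 := (injective_iff_map_eq_zero _).1
    (frameShape_injective (ε := 1) hB (by norm_num) hp hK) x h2
  rw [← hvx, h3]; simp

theorem convex_support' (hB : IsBody B) (hc : Convex ℝ B) (hb : b ∈ frontier B) {y : E d}
    (hy : y ∈ B) : ⟪normal B b, y - b⟫_ℝ ≤ 0 := by
  obtain ⟨U, f, h, hbU⟩ := hB.exists_chart hb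
  have h0 := (h.mem_frontier_iff hbU).1 hb
  rw [h.normal_eq hbU h0]
  exact convex_support hc h hbU h0 hy

theorem act_sub (g : Aff d) (x y : E d) : act g x - act g y = g.1 (x - y) := by
  rw [act, act, map_sub]; abel

section Convex

variable {s : ℝ}

theorem IsSolution.separation₁ (hB₁ : IsBody B₁) (hc₁ : Convex ℝ B₁) (hg : g ∈ GG d)
    (hs : IsSolution B₁ B₂ g b₁ b₂ s) {x₁ : E d} (hx₁ : x₁ ∈ B₁) :
    ⟪g.1.1 (normal B₁ b₁), act g.1 x₁ - act g.1 b₁⟫_ℝ ≤ 0 := by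
  rw [act_sub, SO_inner hg.1]
  exact convex_support' hB₁ hc₁ hs.mem₁ hx₁

theorem IsSolution.separation₂ (hB₂ : IsBody B₂) (hc₂ : Convex ℝ B₂) (hg : g ∈ GG d)
    (hs : IsSolution B₁ B₂ g b₁ b₂ s) {x₂ : E d} (hx₂ : x₂ ∈ B₂) :
    0 ≤ ⟪g.1.1 (normal B₁ b₁), act g.2 x₂ - act g.2 b₂⟫_ℝ := by
  have h2 := convex_support' hB₂ hc₂ hs.mem₂ hx₂
  rw [← SO_inner hg.2, hs.normal_eq, ← act_sub, inner_neg_left] at h2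
  linarith

theorem IsSolution.inner_eq_one (hB₁ : IsBody B₁) (hg : g ∈ GG d)
    (hs : IsSolution B₁ B₂ g b₁ b₂ s) :
    ⟪g.1.1 (normal B₁ b₁), g.1.1 (normal B₁ b₁)⟫_ℝ = 1 := by
  rw [SO_inner hg.1, real_inner_self_eq_norm_sq, hB₁.norm_normal hs.mem₁, one_pow]

variable (hB₁ : IsBody B₁) (hB₂ : IsBody B₂) (hc₁ : Convex ℝ B₁) (hc₂ : Convex ℝ B₂)
  (hg : g ∈ GG d) (hs : IsSolution B₁ B₂ g b₁ b₂ s)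
include hB₁ hB₂ hc₁ hc₂ hg hs

theorem IsSolution.disjoint_of_pos (hpos : 0 < s) : Disjoint (act g.1 '' B₁) (act g.2 '' B₂) := by
  rw [Set.disjoint_left]
  rintro _ ⟨x₁, hx₁, rfl⟩ ⟨x₂, hx₂, heq⟩
  have h1 := hs.separation₁ hB₁ hc₁ hg hx₁
  have h2 := hs.separation₂ hB₂ hc₂ hg hx₂
  rw [heq, hs.act_eq, sub_add_eq_sub_sub, inner_sub_right, inner_smul_right,
    hs.inner_eq_one hB₁ hg] at h2
  linarith

/-- The two bodies lie on opposite sides of the slab of width s given by the first solution;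
evaluating this at the boundary points of the second solution bounds s. -/
theorem IsSolution.gap_le {b₁' b₂' : E d} {s' : ℝ} (hs' : IsSolution B₁ B₂ g b₁' b₂' s') :
    s ≤ s' * ⟪g.1.1 (normal B₁ b₁), g.1.1 (normal B₁ b₁')⟫_ℝ := by
  have h1 := hs.separation₁ hB₁ hc₁ hg (frontier_subset_iff_isClosed.2 hB₁.isClosed hs'.mem₁)
  have h2 := hs.separation₂ hB₂ hc₂ hg (frontier_subset_iff_isClosed.2 hB₂.isClosed hs'.mem₂)
  rw [hs.act_eq, hs'.act_eq, show ∀ a b c e : E d, a + b - (c + e) = (a - c) + b - e by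
    intros; abel, inner_sub_right, inner_add_right, inner_smul_right, inner_smul_right,
    hs.inner_eq_one hB₁ hg] at h2
  linarith

/-- For convex bodies, one of which has nonvanishing curvature, the solution is unique. -/
theorem IsSolution.unique_of_convex (hd : 1 ≤ d)
    (hK : (∀ b ∈ frontier B₁, gaussKronecker B₁ b ≠ 0) ∨
      (∀ b ∈ frontier B₂, gaussKronecker B₂ b ≠ 0)) {b₁' b₂' : E d} {s' : ℝ} (h0 : 0 ≤ s)
    (h0' : 0 ≤ s') (hs' : IsSolution B₁ B₂ g b₁' b₂' s') : b₁' = b₁ ∧ b₂' = b₂ := by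
  set u := g.1.1 (normal B₁ b₁) with hu
  set u' := g.1.1 (normal B₁ b₁') with hu'
  have nu : ‖u‖ = 1 := by rw [hu, SO_norm hg.1, hB₁.norm_normal hs.mem₁]
  have nu' : ‖u'‖ = 1 := by rw [hu', SO_norm hg.1, hB₁.norm_normal hs'.mem₁]
  have l1 : s ≤ s' * ⟪u, u'⟫_ℝ := hs.gap_le hB₁ hB₂ hc₁ hc₂ hg hs'
  have l2 : s' ≤ s * ⟪u', u⟫_ℝ := hs'.gap_le hB₁ hB₂ hc₁ hc₂ hg hs
  rw [real_inner_comm] at l2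
  have l3 : ⟪u, u'⟫_ℝ ≤ 1 := by
    have := real_inner_le_norm u u'
    rwa [nu, nu', one_mul] at this
  -- Each gap is at most the other times ⟨u, u'⟩ ≤ 1. So the gaps agree, and for a positive gap also
  -- the normals.
  have hss : s = s' := by nlinarith
  have hsu : s • u = s' • u' := by
    rcases h0.eq_or_lt with h | h
    · rw [← hss, ← h, zero_smul, zero_smul]
    · have : ⟪u, u'⟫_ℝ = 1 := by
        rw [← hss] at l1
        nlinarith
      rw [← hss, (inner_eq_one_iff_of_norm_eq_one nu nu').1 this]
  have m₁' := frontier_subset_iff_isClosed.2 hB₁.isClosed hs'.mem₁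
  have m₂' := frontier_subset_iff_isClosed.2 hB₂.isClosed hs'.mem₂
  have m₁ := frontier_subset_iff_isClosed.2 hB₁.isClosed hs.mem₁
  have m₂ := frontier_subset_iff_isClosed.2 hB₂.isClosed hs.mem₂
  have hδ : g.2.1 (b₂' - b₂) = g.1.1 (b₁' - b₁) := by
    rw [← act_sub, ← act_sub, hs.act_eq, hs'.act_eq, ← hu, ← hu', hsu]; abel
  have s1 := hs.separation₁ hB₁ hc₁ hg m₁'
  have s2 := hs.separation₂ hB₂ hc₂ hg m₂'
  rw [act_sub] at s1 s2
  rw [hδ] at s2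
  have hz := le_antisymm s1 s2
  have o₁ : ⟪normal B₁ b₁, b₁' - b₁⟫_ℝ = 0 := by rwa [SO_inner hg.1] at hz
  have o₂ : ⟪normal B₂ b₂, b₂' - b₂⟫_ℝ = 0 := by
    rw [← SO_inner hg.2, hs.normal_eq, hδ, inner_neg_left, hz, neg_zero]
  -- A tangential difference of two points would span a segment inside the convex body, while
  -- positive curvature makes the tangent line leave it. It is used for whichever body is curved;
  -- the other difference is then zero by `hδ`.
  have line : ∀ {B : Set (E d)} {b b' : E d}, IsBody B → Convex ℝ B → b ∈ frontier B → b' ∈ B →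
      gaussKronecker B b ≠ 0 → ⟪normal B b, b' - b⟫_ℝ = 0 → b' - b = 0 := by
    intro B b b' hB hc hb hb' hK ho
    by_contra hne
    obtain ⟨t, ht, ht0, ht1⟩ := ((eventually_not_mem_of_gaussKronecker hd hB hc hb hK ho hne).and
      (Ioo_mem_nhdsGT (zero_lt_one' ℝ))).exists
    exact ht (hc.add_smul_sub_mem (frontier_subset_iff_isClosed.2 hB.isClosed hb) hb'
      ⟨ht0.le, ht1.le⟩)
  rcases hK with hK | hK
  · have h1 := line hB₁ hc₁ hs.mem₁ m₁' (hK _ hs.mem₁) o₁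
    rw [h1, map_zero, ← norm_eq_zero, SO_norm hg.2, norm_eq_zero] at hδ
    exact ⟨sub_eq_zero.1 h1, sub_eq_zero.1 hδ⟩
  · have h1 := line hB₂ hc₂ hs.mem₂ m₂' (hK _ hs.mem₂) o₂
    rw [h1, map_zero, eq_comm, ← norm_eq_zero, SO_norm hg.1, norm_eq_zero] at hδ
    exact ⟨sub_eq_zero.1 hδ, sub_eq_zero.1 h1⟩

end Convex

/-- Translating the second body by `t` along the common normal. -/
def shift (g : Aff d × Aff d) (u : E d) (t : ℝ) : Aff d × Aff d := (g.1, (g.2.1, g.2.2 + t • u))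

theorem shift_mem_GG (hg : g ∈ GG d) (u : E d) (t : ℝ) : shift g u t ∈ GG d := hg

theorem act_shift (u : E d) (t : ℝ) (x : E d) :
    act (shift g u t).2 x = act g.2 x + t • u := by
  simp only [act, shift]; abel

theorem continuous_shift (g : Aff d × Aff d) (u : E d) : Continuous (shift g u) := by
  unfold shift; fun_prop

theorem shift_zero (g : Aff d × Aff d) (u : E d) : shift g u 0 = g := by
  simp [shift]

theorem IsSolution.shift {s : ℝ} (hs : IsSolution B₁ B₂ g b₁ b₂ s) (t : ℝ) :
    IsSolution B₁ B₂ (shift g (g.1.1 (normal B₁ b₁)) t) b₁ b₂ (s + t) where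
  mem₁ := hs.mem₁
  mem₂ := hs.mem₂
  act_eq := by
    rw [act_shift, hs.act_eq, add_smul, add_assoc]; rfl
  normal_eq := hs.normal_eq

/-- Separating the bodies by any t > 0 along the common normal makes the gap positive and hence the
bodies disjoint; then t tends to 0. -/
theorem Psi_mem_M_of_convex (hB₁ : IsBody B₁) (hB₂ : IsBody B₂) (hc₁ : Convex ℝ B₁)
    (hc₂ : Convex ℝ B₂) (hq : q ∈ Me B₁ B₂) : Psi q ∈ M B₁ B₂ := by
  have hs := isSolution_Psi hq
  have hg := Psi_mem_GG hq
  set u := (Psi q).1.1 (normal B₁ q.1.1)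
  have h1 : ∀ᶠ t : ℝ in 𝓝[>] 0, shift (Psi q) u t ∈ M₀ B₁ B₂ := by
    filter_upwards [self_mem_nhdsWithin] with t ht
    have h0 : 0 ≤ gap q := hq.2.2.2
    have ht : 0 < t := ht
    exact ⟨hg, (hs.shift t).disjoint_of_pos hB₁ hB₂ hc₁ hc₂ (shift_mem_GG hg u t) (by linarith)⟩
  have h2 : Tendsto (shift (Psi q) u) (𝓝[>] 0) (𝓝 (Psi q)) := by
    have := (continuous_shift (Psi q) u).tendsto 0
    rw [shift_zero] at this
    exact this.mono_left nhdsWithin_le_nhds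
  exact mem_closure_of_tendsto h2 h1

theorem isCollisionBundle_Me (hd : 1 ≤ d) (hB₁ : IsBody B₁) (hB₂ : IsBody B₂)
    (hc : Condition₃ B₁ B₂) : IsCollisionBundle B₁ B₂ (Me B₁ B₂) := by
  obtain ⟨hcon, hc₁, hc₂, hK⟩ := hc
  refine isCollisionBundle_of hB₁ hB₂ (isRelOpen_self _) (fun q hq _ => hq.1)
    (fun g hg q hq => leftAct_mem_Me hg hq) (fun q hq h hh => rightAct_mem_Me hh hq)
    (fun q hq => isUnit_combined_of_convex hB₁ hB₂ hc₁ hc₂ hK hq) ?_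
    (fun q hq => Psi_mem_M_of_convex hB₁ hB₂ hc₁ hc₂ hq) ?_
  · intro q hq q' hq' h
    have hs' := isSolution_Psi hq'
    rw [← h] at hs'
    obtain ⟨h1, h2⟩ := (isSolution_Psi hq).unique_of_convex hB₁ hB₂ hc₁ hc₂ (Psi_mem_GG hq) hd hK
      hq.2.2.2 hq'.2.2.2 hs'
    exact ⟨h1.symm, h2.symm⟩
  · intro g hg
    obtain ⟨_, ⟨b₁, hb₁, rfl⟩, b₂, hb₂, h⟩ := hcon g hg
    obtain ⟨q, hq, hq', -⟩ := exists_lift hd hB₁ (M_subset_GG hg.1)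
      (isSolution_of_contact hB₁ hB₂ hg.1 hb₁ hb₂ h.symm) le_rfl
    exact ⟨q, hq, hq'⟩

/-- Two contacts are two solutions with gap zero, which coincide for convex bodies. So the boundary
statements need only be proved under condition 1. -/
theorem condition₁_of_condition₃ (hd : 1 ≤ d) (hB₁ : IsBody B₁) (hB₂ : IsBody B₂)
    (hc : Condition₃ B₁ B₂) : Condition₁ B₁ B₂ := by
  obtain ⟨hcon, hc₁, hc₂, hK⟩ := hc
  constructor
  · intro g hg
    obtain ⟨_, ⟨b₁, hb₁, rfl⟩, b₂, hb₂, h⟩ := hcon g hg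
    refine ⟨act g.1 b₁, Subset.antisymm ?_ (singleton_subset_iff.2 ⟨⟨b₁, hb₁, rfl⟩, b₂, hb₂, h⟩)⟩
    rintro _ ⟨⟨b₁', hb₁', rfl⟩, b₂', hb₂', h'⟩
    rw [((isSolution_of_contact hB₁ hB₂ hg.1 hb₁ hb₂ h.symm).unique_of_convex hB₁ hB₂ hc₁ hc₂
      (M_subset_GG hg.1) hd hK le_rfl le_rfl
      (isSolution_of_contact hB₁ hB₂ hg.1 hb₁' hb₂' h'.symm)).1]
    exact mem_singleton _
  · intro q hq
    rw [← combined_of_gap_eq_zero hq.2]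
    exact isUnit_combined_of_convex hB₁ hB₂ hc₁ hc₂ hK hq.1

end

section

/-! ### The largest eigenvalue -/

section Top

variable {V : Type*} [NormedAddCommGroup V] [InnerProductSpace ℝ V]

/-- The largest eigenvalue of a symmetric operator, as the supremum of the Rayleigh quotient. -/
def top (S : V →L[ℝ] V) : ℝ := ⨆ x : {x : V // x ≠ 0}, ⟪S x, x⟫_ℝ / ‖(x : V)‖ ^ 2

theorem bddAbove_rayleigh (S : V →L[ℝ] V) :
    BddAbove (range fun x : {x : V // x ≠ 0} => ⟪S x, x⟫_ℝ / ‖(x : V)‖ ^ 2) := by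
  refine ⟨‖S‖, ?_⟩
  rintro _ ⟨x, rfl⟩
  have hx : 0 < ‖(x : V)‖ := norm_pos_iff.2 x.2
  dsimp only
  rw [div_le_iff₀ (by positivity)]
  calc ⟪S x, (x : V)⟫_ℝ ≤ ‖S x‖ * ‖(x : V)‖ := real_inner_le_norm _ _
    _ ≤ ‖S‖ * ‖(x : V)‖ * ‖(x : V)‖ := by gcongr; exact S.le_opNorm _
    _ = ‖S‖ * ‖(x : V)‖ ^ 2 := by ring

theorem inner_le_top (S : V →L[ℝ] V) (x : V) : ⟪S x, x⟫_ℝ ≤ top S * ‖x‖ ^ 2 := by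
  by_cases hx : x = 0
  · simp [hx]
  · have hx' : 0 < ‖x‖ := norm_pos_iff.2 hx
    rw [← div_le_iff₀ (by positivity)]
    exact le_ciSup (bddAbove_rayleigh S) ⟨x, hx⟩

variable [Nontrivial V]

theorem top_le {S : V →L[ℝ] V} {c : ℝ} (h : ∀ x, ⟪S x, x⟫_ℝ ≤ c * ‖x‖ ^ 2) : top S ≤ c := by
  have : Nonempty {x : V // x ≠ 0} := by
    obtain ⟨x, hx⟩ := exists_ne (0 : V)
    exact ⟨⟨x, hx⟩⟩
  refine ciSup_le fun x => ?_
  have hx : 0 < ‖(x : V)‖ := norm_pos_iff.2 x.2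
  rw [div_le_iff₀ (by positivity)]
  exact h x

/-- A supremum of Rayleigh quotients is 1-Lipschitz in the operator norm. -/
theorem continuous_top : Continuous (top : (V →L[ℝ] V) → ℝ) := by
  refine (LipschitzWith.of_le_add fun S T => top_le fun x => ?_).continuous
  have h1 : ⟪S x, x⟫_ℝ = ⟪T x, x⟫_ℝ + ⟪(S - T) x, x⟫_ℝ := by
    rw [sub_apply, inner_sub_left]; ring
  have h2 : ⟪(S - T) x, x⟫_ℝ ≤ dist S T * ‖x‖ ^ 2 := by
    rw [dist_eq_norm]
    calc ⟪(S - T) x, x⟫_ℝ ≤ ‖(S - T) x‖ * ‖x‖ := real_inner_le_norm _ _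
      _ ≤ ‖S - T‖ * ‖x‖ * ‖x‖ := by gcongr; exact (S - T).le_opNorm _
      _ = ‖S - T‖ * ‖x‖ ^ 2 := by ring
  have h3 := inner_le_top T x
  rw [h1]; linarith

theorem exists_top [FiniteDimensional ℝ V] {S : V →L[ℝ] V}
    (hS : ∀ x y, ⟪S x, y⟫_ℝ = ⟪x, S y⟫_ℝ) : ∃ x, ‖x‖ = 1 ∧ S x = top S • x := by
  have h1 : (S : V →ₗ[ℝ] V).IsSymmetric := hS
  have h2 := h1.hasEigenvalue_iSup_of_finiteDimensional
  obtain ⟨x, hx⟩ := h2.exists_hasEigenvector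
  have hx1 : S x = top S • x := hx.apply_eq_smul
  have hx0 : x ≠ 0 := hx.2
  refine ⟨‖x‖⁻¹ • x, ?_, ?_⟩
  · rw [norm_smul, norm_inv, norm_norm, inv_mul_cancel₀ (norm_ne_zero_iff.2 hx0)]
  · rw [map_smul, hx1, smul_comm]

theorem continuousOn_const_add_clm {V X : Type*} [NormedAddCommGroup V] [NormedSpace ℝ V]
    [TopologicalSpace X] {S : V →L[ℝ] V} {T : X → V →L[ℝ] V} {s : Set X} (hT : ContinuousOn T s) :
    ContinuousOn (fun x => S + T x) s := continuousOn_const.add hT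

theorem top_ne_zero [FiniteDimensional ℝ V] {S : V →L[ℝ] V}
    (hS : ∀ x y, ⟪S x, y⟫_ℝ = ⟪x, S y⟫_ℝ) (hu : IsUnit S) : top S ≠ 0 := by
  intro h
  obtain ⟨x, hx, hSx⟩ := exists_top hS
  rw [h, zero_smul] at hSx
  have := (injective_iff_map_eq_zero _).1 (injective_of_isUnit hu) x hSx
  rw [this, norm_zero] at hx
  exact zero_ne_one hx

end Top

/-! ### The largest principal curvature -/

variable {d : ℕ} {B B₁ B₂ U : Set (E d)} {f : E d → ℝ} {b b₁ b₂ : E d} {q : Amb d}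
  {g : Aff d × Aff d}

theorem nontrivial_Hyp (hd : 1 ≤ d) : Nontrivial (Hyp d) := by
  obtain ⟨w, hw, hew⟩ := exists_unit_orthogonal hd (e d)
  refine ⟨⟨w, mem_Hyp.2 hew⟩, 0, fun h => ?_⟩
  have : w = 0 := congrArg Subtype.val h
  rw [this, norm_zero] at hw
  exact zero_ne_one hw

/-- Some adapted frame. -/
def frameAt (B : Set (E d)) (b : E d) : L d :=
  Classical.epsilon fun σ => σ ∈ SO d ∧ σ (e d) = (1 : ℝ) • normal B b

theorem frameAt_mem (hd : 1 ≤ d) (hB : IsBody B) (hb : b ∈ frontier B) :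
    (b, frameAt B b) ∈ Frames 1 B := by
  obtain ⟨σ, hσ, he⟩ := exists_SO_apply hd norm_e (hB.norm_normal hb)
  exact ⟨hb, Classical.epsilon_spec (p := fun σ => σ ∈ SO d ∧ σ (e d) = (1 : ℝ) • normal B b)
    ⟨σ, hσ, by rw [one_smul]; exact he⟩⟩

/-- The largest eigenvalue of the shape operator at `b`. -/
def maxCurv (B : Set (E d)) (b : E d) : ℝ := top (frameShape B b (frameAt B b))

theorem top_frameShape_le (hd : 1 ≤ d) (hB : IsBody B) {ε ε' : ℝ} (hε : ε ^ 2 = 1)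
    (hε' : ε' ^ 2 = 1) {σ σ' : L d} (hp : (b, σ) ∈ Frames ε B) (hp' : (b, σ') ∈ Frames ε' B) :
    top (frameShape B b σ) ≤ top (frameShape B b σ') := by
  have := nontrivial_Hyp hd
  refine top_le fun x => ?_
  have hx : inv σ' (σ x) ∈ Hyp d := by
    have h1 : ⟪normal B b, σ x⟫_ℝ = 0 := by
      rw [inner_normal_frame hp.2.1 hε hp.2.2, mem_Hyp.1 x.2, mul_zero]
    rw [mem_Hyp, inner_inv_right, hp'.2.2, inner_smul_left, h1, mul_zero]
  set x' : Hyp d := ⟨inv σ' (σ x), hx⟩ with hx'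
  have e1 : σ' x' = σ x := SO_apply_inv hp'.2.1 _
  have e2 : ‖x'‖ = ‖x‖ := by
    change ‖(x' : E d)‖ = ‖(x : E d)‖
    rw [← SO_norm hp'.2.1 (x' : E d), e1, SO_norm hp.2.1]
  have h2 := inner_frameShape_eq hB hε hp x x
  have h3 := inner_frameShape_eq hB hε' hp' x' x'
  dsimp only at h2 h3
  rw [h2, ← e1, ← h3, ← e2]
  exact inner_le_top _ _

/-- Adapted frames of either sign give the same set of Rayleigh quotients, namely the values of -II
on unit tangent vectors. -/
theorem top_frameShape (hd : 1 ≤ d) (hB : IsBody B) {ε : ℝ} (hε : ε ^ 2 = 1) {σ : L d}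
    (hp : (b, σ) ∈ Frames ε B) : top (frameShape B b σ) = maxCurv B b :=
  le_antisymm (top_frameShape_le hd hB hε (by norm_num) hp (frameAt_mem hd hB hp.1))
    (top_frameShape_le hd hB (by norm_num) hε (frameAt_mem hd hB hp.1) hp)

theorem neg_maxCurv_le_II (hd : 1 ≤ d) (hB : IsBody B) (hb : b ∈ frontier B) {v : E d}
    (hv : ⟪normal B b, v⟫_ℝ = 0) : -maxCurv B b * ‖v‖ ^ 2 ≤ II B b v v := by
  have hp := frameAt_mem hd hB hb
  set σ := frameAt B b
  have he : σ (e d) = normal B b := by rw [hp.2.2, one_smul]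
  have hx : inv σ v ∈ Hyp d := by rw [mem_Hyp, inner_inv_right, he, hv]
  set x : Hyp d := ⟨inv σ v, hx⟩
  have hvx : σ x = v := SO_apply_inv hp.2.1 v
  have h1 := inner_frameShape_eq (ε := 1) hB (by norm_num) hp x x
  have h2 := inner_le_top (frameShape B b σ) x
  dsimp only at h1
  have hn : ‖x‖ = ‖v‖ := SO_inv_norm hp.2.1 v
  rw [h1, hvx, top_frameShape hd hB (ε := 1) (by norm_num) hp, hn] at h2
  linarith

/-- `frameAt` is an arbitrary choice and need not be continuous; near b it is replaced by a
continuous moving frame, which does not change the largest eigenvalue. -/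
theorem continuousOn_maxCurv (hd : 1 ≤ d) (hB : IsBody B) :
    ContinuousOn (maxCurv B) (frontier B) := by
  intro b hb
  have := nontrivial_Hyp hd
  obtain ⟨U, f, h, hbU⟩ := hB.exists_chart hb
  have h0 := (h.mem_frontier_iff hbU).1 hb
  have hp := frameAt_mem hd hB hb
  set σ := frameAt B b with hσ
  set n := unitGrad f b with hn
  have hn1 : ‖n‖ = 1 := norm_unitGrad (h.grad_ne _ hbU)
  have hn0 : n ≠ 0 := by rintro h; rw [h] at hn1; simp at hn1
  have hnn : n + n ≠ 0 := by rw [← two_smul ℝ]; exact smul_ne_zero two_ne_zero hn0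
  have cu : ContinuousAt (unitGrad f) b :=
    (contDiffAt_unitGrad (h.contDiffAt hbU) (h.grad_ne _ hbU)).continuousAt
  have cr : ContinuousAt (fun y => rot n (unitGrad f y) ∘L σ) b :=
    (ContinuousAt.comp (g := fun v => rot n v) (f := unitGrad f)
      (contDiffAt_rot (n := 0) hnn).continuousAt cu).clm_comp
      continuousAt_const
  have en : ∀ᶠ y in 𝓝 b, n + unitGrad f y ≠ 0 := (continuousAt_const.add cu).eventually_ne hnn
  have hmem : ∀ᶠ y in 𝓝[frontier B] b, (y, rot n (unitGrad f y) ∘L σ) ∈ Frames 1 B := by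
    filter_upwards [nhdsWithin_le_nhds en, nhdsWithin_le_nhds (h.isOpen.mem_nhds hbU),
      self_mem_nhdsWithin] with y hy hyU hyB
    refine ⟨hyB, SO_comp_mem (rot_mem_SO hn0 hy) hp.2.1, ?_⟩
    change rot n (unitGrad f y) (σ (e d)) = _
    have hz := (h.mem_frontier_iff hyU).1 hyB
    rw [hp.2.2, one_smul, one_smul, h.normal_eq hyU hz]
    dsimp only
    rw [h.normal_eq hbU h0, ← hn, rot_apply hn1 (norm_unitGrad (h.grad_ne _ hyU)) hy]
  have hbase : rot n (unitGrad f b) ∘L σ = σ := by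
    rw [← hn, rot_self hn1]; rfl
  have ct : Tendsto (fun y => (y, rot n (unitGrad f y) ∘L σ)) (𝓝[frontier B] b)
      (𝓝[Frames 1 B] (b, σ)) := by
    refine tendsto_nhdsWithin_iff.2 ⟨?_, hmem⟩
    have := (continuousAt_id (x := b)).prodMk cr
    rw [ContinuousAt, hbase] at this
    exact this.mono_left nhdsWithin_le_nhds
  have c1 := ((continuousOn_frameShape (ε := 1) hB (by norm_num)) (b, σ) hp).tendsto.comp ct
  have c2 := (continuous_top.tendsto _).comp c1
  change Tendsto (maxCurv B) _ (𝓝 (top (frameShape B b σ)))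
  refine c2.congr' (hmem.mono fun y hy => ?_)
  exact top_frameShape hd hB (by norm_num) hy

/-! ### The sign of the sum of the principal curvatures -/

/-- The sum of the shape operators is nonsingular for all pairs of frames. -/
def Nonsingular (B₁ B₂ : Set (E d)) : Prop := ∀ q ∈ bdMe B₁ B₂, IsUnit (S₁ B₁ q + S₂ B₂ q)

theorem Nonsingular.isUnit (h : Nonsingular B₁ B₂) {σ₁ σ₂ : L d} (h₁ : (b₁, σ₁) ∈ Frames 1 B₁)
    (h₂ : (b₂, σ₂) ∈ Frames (-1) B₂) : IsUnit (frameShape B₁ b₁ σ₁ + frameShape B₂ b₂ σ₂) :=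
  h ((b₁, σ₁), (b₂, σ₂), (1, 0), 0) ⟨⟨h₁, h₂, one_mem_SO, le_refl (0 : ℝ)⟩, rfl⟩

theorem frame_sum_symm (hB₁ : IsBody B₁) (hB₂ : IsBody B₂) {σ₁ σ₂ : L d}
    (h₁ : (b₁, σ₁) ∈ Frames 1 B₁) (h₂ : (b₂, σ₂) ∈ Frames (-1) B₂) (x y : Hyp d) :
    ⟪(frameShape B₁ b₁ σ₁ + frameShape B₂ b₂ σ₂) x, y⟫_ℝ =
      ⟪x, (frameShape B₁ b₁ σ₁ + frameShape B₂ b₂ σ₂) y⟫_ℝ := by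
  have e1 := frameShape_symm (ε := 1) hB₁ (by norm_num) h₁ x y
  have e2 := frameShape_symm (ε := -1) hB₂ (by norm_num) h₂ x y
  rw [add_apply, add_apply, inner_add_left, inner_add_right]
  exact congrArg₂ _ e1 e2

theorem rot_mem_H {x y : Hyp d} (hx : x ≠ 0) (hxy : (x : E d) + y ≠ 0) : rot (x : E d) y ∈ H d := by
  have hx0 : (x : E d) ≠ 0 := fun h => hx (Subtype.ext h)
  refine ⟨rot_mem_SO hx0 hxy, ?_⟩
  have h1 : ⟪(x : E d), e d⟫_ℝ = 0 := by rw [real_inner_comm]; exact mem_Hyp.1 x.2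
  have h2 : ⟪(x : E d) + y, e d⟫_ℝ = 0 := by
    rw [real_inner_comm]; exact mem_Hyp.1 (x + y).2
  rw [rot, ContinuousLinearMap.comp_apply, hrefl_of_orthogonal h1, hrefl_of_orthogonal h2]

/-- Eigenvectors for the largest eigenvalues that are not opposite to each other. -/
theorem exists_top_pair {V : Type*} [NormedAddCommGroup V] [InnerProductSpace ℝ V] [Nontrivial V]
    [FiniteDimensional ℝ V] {S T : V →L[ℝ] V} (hS : ∀ x y, ⟪S x, y⟫_ℝ = ⟪x, S y⟫_ℝ)
    (hT : ∀ x y, ⟪T x, y⟫_ℝ = ⟪x, T y⟫_ℝ) : ∃ x y, ‖x‖ = 1 ∧ ‖y‖ = 1 ∧ S x = top S • x ∧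
      T y = top T • y ∧ y ≠ -x := by
  obtain ⟨x, hx, hSx⟩ := exists_top hS
  obtain ⟨y, hy, hTy⟩ := exists_top hT
  by_cases h : y = -x
  · refine ⟨x, -y, hx, by rw [norm_neg, hy], hSx, by rw [map_neg, hTy, smul_neg], fun h' => ?_⟩
    rw [h] at h'
    have h2 : x = -x := by simpa using h'
    have : x = 0 := by
      have := congrArg (fun z => (2 : ℝ)⁻¹ • (z + x)) h2
      simp only [neg_add_cancel, smul_zero, ← two_smul ℝ x, smul_smul] at this
      simpa using this
    rw [this, norm_zero] at hx
    exact zero_ne_one hx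
  · exact ⟨x, y, hx, hy, hSx, hTy, h⟩

/-- Rotate one frame by an element of H so that the eigenvectors for the two largest eigenvalues
coincide. If these eigenvalues added up to zero, the common eigenvector would be in the kernel of
the sum, contrary to nonsingularity for all pairs of frames. -/
theorem maxCurv_add_ne_zero (hd : 1 ≤ d) (hB₁ : IsBody B₁) (hB₂ : IsBody B₂)
    (hN : Nonsingular B₁ B₂) (hb₁ : b₁ ∈ frontier B₁) (hb₂ : b₂ ∈ frontier B₂) :
    maxCurv B₁ b₁ + maxCurv B₂ b₂ ≠ 0 := by
  intro hz
  have := nontrivial_Hyp hd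
  have hp₁ := frameAt_mem hd hB₁ hb₁
  obtain ⟨σ₂, hσ₂, he₂⟩ := exists_SO_apply hd norm_e
    (show ‖(-1 : ℝ) • normal B₂ b₂‖ = 1 by rw [norm_smul, hB₂.norm_normal hb₂]; norm_num)
  have hp₂ : (b₂, σ₂) ∈ Frames (-1) B₂ := ⟨hb₂, hσ₂, he₂⟩
  set σ₁ := frameAt B₁ b₁
  obtain ⟨x, y, hx, hy, hSx, hTy, hxy⟩ := exists_top_pair
    (fun x y => frameShape_symm (ε := 1) hB₁ (by norm_num) hp₁ x y)
    (fun x y => frameShape_symm (ε := -1) hB₂ (by norm_num) hp₂ x y)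
  dsimp only at hSx hTy
  rw [top_frameShape hd hB₁ (ε := 1) (by norm_num) hp₁] at hSx
  rw [top_frameShape hd hB₂ (ε := -1) (by norm_num) hp₂] at hTy
  have hx0 : x ≠ 0 := by rintro rfl; simp at hx
  have hxy' : (x : E d) + y ≠ 0 := fun h => hxy (eq_neg_of_add_eq_zero_right (Subtype.ext h))
  have hh := rot_mem_H hx0 hxy'
  have hp₃ := Frames_comp hp₂ hh
  have hrx : rot (x : E d) y x = y := rot_apply hx hy hxy'
  have hT' : frameShape B₂ b₂ (σ₂ ∘L rot (x : E d) y) x = maxCurv B₂ b₂ • x := by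
    have h1 := frameShape_comp (ε := -1) hB₂ (by norm_num) hp₂ hh
    dsimp only at h1
    rw [h1]
    have h2 : (↑(unitHyp _ hh) : Hyp d →L[ℝ] Hyp d) x = y := Subtype.ext hrx
    have h3 : (↑(unitHyp _ hh)⁻¹ : Hyp d →L[ℝ] Hyp d) y = x := by
      have h := congrArg (↑(unitHyp _ hh)⁻¹ : Hyp d →L[ℝ] Hyp d) h2
      rw [← mul_apply_eq_comp, Units.inv_mul] at h
      exact h.symm
    change (↑(unitHyp _ hh)⁻¹ : Hyp d →L[ℝ] Hyp d) (frameShape B₂ b₂ σ₂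
      ((↑(unitHyp _ hh) : Hyp d →L[ℝ] Hyp d) x)) = _
    rw [h2, hTy, map_smul, h3]
  have h4 : (frameShape B₁ b₁ σ₁ + frameShape B₂ b₂ (σ₂ ∘L rot (x : E d) y)) x = 0 := by
    rw [add_apply, hSx, hT', ← add_smul, hz, zero_smul]
  exact hx0 ((injective_iff_map_eq_zero _).1
    (injective_of_isUnit (hN.isUnit hp₁ hp₃)) x h4)

/-- A path of rotations in `H` from the identity to a rotation that takes `x` to `y`. -/
theorem exists_path_H {x y : Hyp d} (hx : ‖x‖ = 1) (hy : ‖y‖ = 1) (hxy : y ≠ -x) :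
    ∃ ρ : ℝ → L d, ContinuousOn ρ (Icc 0 1) ∧ (∀ t ∈ Icc (0 : ℝ) 1, ρ t ∈ H d) ∧ ρ 0 = 1 ∧
      ρ 1 x = y := by
  have hx0 : x ≠ 0 := by rintro rfl; simp at hx
  have hne : ∀ t ∈ Icc (0 : ℝ) 1, (1 - t) • x + t • y ≠ 0 := by
    intro t ht h0
    have h1 : (1 - t) • x = -(t • y) := eq_neg_of_add_eq_zero_left h0
    have h2 := congrArg norm h1
    rw [norm_neg, norm_smul, norm_smul, hx, hy, mul_one, mul_one, Real.norm_eq_abs,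
      Real.norm_eq_abs, abs_of_nonneg (by linarith [ht.2]), abs_of_nonneg ht.1] at h2
    have h3 : t = 1 / 2 := by linarith
    rw [h3, ← smul_neg, show (1 : ℝ) - 1 / 2 = 1 / 2 by norm_num] at h1
    have h4 := smul_right_injective (Hyp d) (show (1 / 2 : ℝ) ≠ 0 by norm_num) h1
    exact hxy (by rw [h4, neg_neg])
  -- The normalized chord from x to y: it never passes through 0, since y ≠ -x, and never meets -x,
  -- so `rot` from x to its points is continuous.
  set γ : ℝ → Hyp d := fun t => ‖(1 - t) • x + t • y‖⁻¹ • ((1 - t) • x + t • y) with hγ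
  have hγc : ContinuousOn γ (Icc 0 1) := by
    have h1 : Continuous (fun t : ℝ => (1 - t) • x + t • y) := by fun_prop
    exact (h1.norm.continuousOn.inv₀ fun t ht => norm_ne_zero_iff.2 (hne t ht)).smul h1.continuousOn
  have hγn : ∀ t ∈ Icc (0 : ℝ) 1, ‖γ t‖ = 1 := fun t ht => by
    rw [hγ]; dsimp only
    rw [norm_smul, norm_inv, norm_norm, inv_mul_cancel₀ (norm_ne_zero_iff.2 (hne t ht))]
  have hxγ : ∀ t ∈ Icc (0 : ℝ) 1, (x : E d) + γ t ≠ 0 := by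
    intro t ht h0
    have h1 : x + γ t = 0 := Subtype.ext h0
    set m := ‖(1 - t) • x + t • y‖ with hm
    have hm0 : 0 < m := norm_pos_iff.2 (hne t ht)
    have h2 : m • x + ((1 - t) • x + t • y) = 0 := by
      have h3 : m • γ t = (1 - t) • x + t • y := smul_inv_smul₀ hm0.ne' _
      rw [← h3, ← smul_add, h1, smul_zero]
    have h4 : (m + (1 - t)) • x = -(t • y) := by
      rw [add_smul]; exact eq_neg_of_add_eq_zero_left (by rw [← h2]; abel)
    have h5 := congrArg norm h4
    rw [norm_neg, norm_smul, norm_smul, hx, hy, mul_one, mul_one, Real.norm_eq_abs,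
      Real.norm_eq_abs, abs_of_nonneg (by linarith [ht.2]), abs_of_nonneg ht.1] at h5
    rw [h5, ← smul_neg] at h4
    have ht0 : t ≠ 0 := by
      intro h
      rw [h] at h5
      linarith
    have h6 := smul_right_injective _ ht0 h4
    exact hxy (by rw [h6, neg_neg])
  have hγ0 : γ 0 = x := by
    rw [hγ]; dsimp only
    rw [sub_zero, one_smul, zero_smul, add_zero, hx, _root_.inv_one, one_smul]
  have hγ1 : γ 1 = y := by
    rw [hγ]; dsimp only
    rw [sub_self, zero_smul, one_smul, zero_add, hy, _root_.inv_one, one_smul]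
  refine ⟨fun t => rot (x : E d) (γ t), fun t ht => ?_, fun t ht => rot_mem_H hx0 (hxγ t ht), ?_, ?_⟩
  · have h2 : ContinuousWithinAt (fun t => (γ t : E d)) (Icc 0 1) t :=
      continuous_subtype_val.continuousAt.comp_continuousWithinAt (hγc t ht)
    exact ContinuousAt.comp_continuousWithinAt (g := fun v => rot (x : E d) v)
      (contDiffAt_rot (n := 0) (hxγ t ht)).continuousAt h2
  · have h2 : rot (x : E d) x = 1 := rot_self hx
    dsimp only
    rw [hγ0, h2]
  · have h2 : rot (x : E d) (γ 1) x = γ 1 :=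
      rot_apply hx (hγn 1 ⟨zero_le_one, le_rfl⟩) (hxγ 1 ⟨zero_le_one, le_rfl⟩)
    dsimp only
    rw [h2, hγ1]

/-- At a contact point the sum of the largest principal curvatures is negative. -/
theorem maxCurv_add_neg_of_contact (hd : 1 ≤ d) (hB₁ : IsBody B₁) (hB₂ : IsBody B₂)
    (hN : Nonsingular B₁ B₂) (hg : g ∈ M B₁ B₂) (hs : IsSolution B₁ B₂ g b₁ b₂ 0) :
    maxCurv B₁ b₁ + maxCurv B₂ b₂ < 0 := by
  have := nontrivial_Hyp hd
  by_contra hpos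
  have hG := M_subset_GG hg
  have hp₁ := frameAt_mem hd hB₁ hs.mem₁
  set σ₁ := frameAt B₁ b₁ with hσ₁
  have hlift := lift_mem_Me hG hs hp₁.2.1 (by rw [hp₁.2.2, one_smul]) le_rfl
  set σ₂ := inv g.2.1 ∘L g.1.1 ∘L σ₁ with hσ₂
  have hp₂ : (b₂, σ₂) ∈ Frames (-1) B₂ := hlift.2.1
  obtain ⟨x, y, hx, hy, hSx, hTy, hxy⟩ := exists_top_pair
    (fun x y => frameShape_symm (ε := 1) hB₁ (by norm_num) hp₁ x y)
    (fun x y => frameShape_symm (ε := -1) hB₂ (by norm_num) hp₂ x y)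
  dsimp only at hSx hTy
  rw [top_frameShape hd hB₁ (ε := 1) (by norm_num) hp₁] at hSx
  rw [top_frameShape hd hB₂ (ε := -1) (by norm_num) hp₂] at hTy
  obtain ⟨ρ, hρc, hH, hρ0, hρ1⟩ := exists_path_H hx hy hxy
  have hFr : ∀ t ∈ Icc (0 : ℝ) 1, (b₂, σ₂ ∘L ρ t) ∈ Frames (-1) B₂ :=
    fun t ht => Frames_comp hp₂ (hH t ht)
  set T : ℝ → Hyp d →L[ℝ] Hyp d := fun t =>
    frameShape B₁ b₁ σ₁ + frameShape B₂ b₂ (σ₂ ∘L ρ t) with hT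
  have hTc : ContinuousOn T (Icc 0 1) := by
    refine continuousOn_const_add_clm ?_
    have h1 : ContinuousOn (fun t => (b₂, σ₂ ∘L ρ t)) (Icc (0 : ℝ) 1) :=
      continuousOn_const.prodMk (continuousOn_const.clm_comp hρc)
    exact ContinuousOn.comp (f := fun t => (b₂, σ₂ ∘L ρ t))
      (g := fun p : E d × L d => frameShape B₂ p.1 p.2)
      (continuousOn_frameShape (ε := -1) hB₂ (by norm_num)) h1 hFr
  have htop : ContinuousOn (fun t => top (T t)) (Icc 0 1) :=
    continuous_top.comp_continuousOn hTc
  -- At time 0 the frames are matched by the contact, where the second-order condition makes S₁ + S₂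
  -- negative semidefinite.
  have h0 : top (T 0) ≤ 0 := by
    refine top_le fun z => ?_
    have hr : σ₂ ∘L ρ 0 = σ₂ := by rw [hρ0]; rfl
    rw [hT]; dsimp only
    rw [hr, add_apply, inner_add_left]
    have e1 := inner_frameShape_eq (ε := 1) hB₁ (by norm_num) hp₁ z z
    have e2 := inner_frameShape_eq (ε := -1) hB₂ (by norm_num) hp₂ z z
    dsimp only at e1 e2
    rw [e1, e2]
    have := II_add_nonneg hB₁ hB₂ hg hs (v := σ₁ z) (by
      rw [inner_normal_frame (ε := 1) hp₁.2.1 (by norm_num) hp₁.2.2, mem_Hyp.1 z.2, mul_zero])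
    have e3 : σ₂ z = inv g.2.1 (g.1.1 (σ₁ z)) := rfl
    rw [e3]; linarith
  -- At time 1 the vector x is a maximal eigenvector of both summands, so its Rayleigh quotient is
  -- the sum of the largest eigenvalues, assumed nonnegative.
  have h1 : 0 ≤ top (T 1) := by
    have h2 := inner_le_top (T 1) x
    have e2 := inner_frameShape_eq (ε := -1) hB₂ (by norm_num) (hFr 1 ⟨zero_le_one, le_rfl⟩) x x
    have e3 := inner_frameShape_eq (ε := -1) hB₂ (by norm_num) hp₂ y y
    dsimp only at e2 e3
    rw [ContinuousLinearMap.comp_apply, hρ1, ← e3, hTy] at e2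
    rw [hT] at h2 ⊢
    dsimp only at h2 ⊢
    rw [add_apply, inner_add_left, e2, hSx, inner_smul_left, inner_smul_left,
      real_inner_self_eq_norm_sq, real_inner_self_eq_norm_sq, hx, hy] at h2
    simp at h2
    linarith
  -- Somewhere on the path the largest eigenvalue is zero, and there the sum of the shape operators
  -- is singular.
  obtain ⟨t, ht, ht0⟩ := intermediate_value_Icc (zero_le_one' ℝ) htop ⟨h0, h1⟩
  exact top_ne_zero (frame_sum_symm hB₁ hB₂ hp₁ (hFr t ht)) (hN.isUnit hp₁ (hFr t ht)) ht0

/-- A continuous function without zeros on the connected product of the two boundaries keeps the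
sign it has at the contact. Connectedness of the boundaries is the reason for filling in the bodies.
-/
theorem maxCurv_add_neg (hd : 1 ≤ d) (hB₁ : IsBody B₁) (hB₂ : IsBody B₂) (hN : Nonsingular B₁ B₂)
    (hc₁ : IsPreconnected (frontier B₁)) (hc₂ : IsPreconnected (frontier B₂)) (hg : g ∈ M B₁ B₂)
    (hs : IsSolution B₁ B₂ g b₁ b₂ 0) {y₁ y₂ : E d} (hy₁ : y₁ ∈ frontier B₁)
    (hy₂ : y₂ ∈ frontier B₂) : maxCurv B₁ y₁ + maxCurv B₂ y₂ < 0 := by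
  by_contra hpos
  have hc : ContinuousOn (fun p : E d × E d => maxCurv B₁ p.1 + maxCurv B₂ p.2)
      (frontier B₁ ×ˢ frontier B₂) :=
    ((continuousOn_maxCurv hd hB₁).comp continuousOn_fst fun p hp => hp.1).add
      ((continuousOn_maxCurv hd hB₂).comp continuousOn_snd fun p hp => hp.2)
  obtain ⟨p, hp, h0⟩ := (hc₁.prod hc₂).intermediate_value (a := (b₁, b₂)) (b := (y₁, y₂))
    ⟨hs.mem₁, hs.mem₂⟩ ⟨hy₁, hy₂⟩ hc
    ⟨(maxCurv_add_neg_of_contact hd hB₁ hB₂ hN hg hs).le, not_lt.1 hpos⟩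
  exact maxCurv_add_ne_zero hd hB₁ hB₂ hN hp.1 hp.2 h0

end

section

/-! ### Connectedness of the two sides of a smooth boundary -/

section Topology

theorem IsPreconnected.eq_of_int_valued {X : Type*} [TopologicalSpace X] {s : Set X} {φ : X → ℝ}
    (hs : IsPreconnected s) (hφ : ContinuousOn φ s) (hi : ∀ x ∈ s, ∃ m : ℤ, φ x = m) {x y : X}
    (hx : x ∈ s) (hy : y ∈ s) : φ x = φ y := by
  have : DiscreteTopology (range ((↑) : ℤ → ℝ)) :=
    Int.isClosedEmbedding_coe_real.isEmbedding.toHomeomorph.symm.isEmbedding.discreteTopology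
  exact hs.constant_of_mapsTo ⟨this⟩ hφ (T := range ((↑) : ℤ → ℝ))
    (fun x hx => (hi x hx).imp fun _ h => h.symm) hx hy

open Classical in
/-- Unicoherence of contractible spaces. -/
theorem isPreconnected_inter_of_union_eq_univ {X : Type*} [TopologicalSpace X] [NormalSpace X]
    [ContractibleSpace X] [LocallyPathConnectedSpace X] {P Q : Set X} (hP : IsClosed P)
    (hQ : IsClosed Q) (hP' : IsPreconnected P) (hQ' : IsPreconnected Q) (hPQ : P ∪ Q = univ) :
    IsPreconnected (P ∩ Q) := by
  rw [isPreconnected_closed_iff]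
  rintro t t' ht ht' htt ⟨x, hx, hxt⟩ ⟨y, hy, hyt⟩
  by_contra hne
  rw [not_nonempty_iff_eq_empty] at hne
  obtain ⟨u, hu0, hu1, -⟩ := exists_continuous_zero_one_of_isClosed
    ((hP.inter hQ).inter ht) ((hP.inter hQ).inter ht') (by
      rw [Set.disjoint_iff]
      rintro z ⟨⟨hz, hz1⟩, -, hz2⟩
      rw [← hne]; exact ⟨hz, hz1, hz2⟩)
  -- If P ∩ Q splits into two closed parts with a Urysohn function u, the half turns exp(iπu) on P
  -- and exp(-iπu) on Q agree on the intersection, where u is 0 or 1. A path through P and back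
  -- through Q would wind once.
  set F : X → Circle := fun z => if z ∈ P then Circle.exp (Real.pi * u z)
    else Circle.exp (-(Real.pi * u z)) with hF
  have hFP : ∀ z ∈ P, F z = Circle.exp (Real.pi * u z) := fun z hz => if_pos hz
  have hFQ : ∀ z ∈ Q, F z = Circle.exp (-(Real.pi * u z)) := by
    intro z hz
    by_cases hzP : z ∈ P
    · rw [hFP z hzP]
      rcases htt ⟨hzP, hz⟩ with h | h
      · have : u z = 0 := hu0 ⟨⟨hzP, hz⟩, h⟩
        simp [this]
      · have : u z = 1 := hu1 ⟨⟨hzP, hz⟩, h⟩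
        rw [this, mul_one]
        exact Circle.exp_eq_exp.2 ⟨1, by push_cast; ring⟩
    · exact if_neg hzP
  have hc : Continuous F := by
    rw [← continuousOn_univ, ← hPQ]
    refine ContinuousOn.union_of_isClosed ?_ ?_ hP hQ
    · exact ContinuousOn.congr (by fun_prop) hFP
    · exact ContinuousOn.congr (by fun_prop) hFQ
  obtain ⟨φ, ⟨-, hφ⟩, -⟩ := Circle.isCoveringMap_exp.existsUnique_continuousMap_lifts
    (⟨F, hc⟩ : C(X, Circle)) x (Real.pi * u x) (by simp [hFP x hx.1])
  have hφ' : ∀ z, Circle.exp (φ z) = F z := fun z => congrFun hφ z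
  have hpi := Real.pi_pos
  -- The real lift φ differs from πu on P, and from -πu on Q, by an integral multiple of 2π, which
  -- is constant by connectedness. Between x and y it would thus increase by π and decrease by π.
  have h1 := IsPreconnected.eq_of_int_valued (φ := fun z => (φ z - Real.pi * u z) / (2 * Real.pi))
    hP' (by fun_prop) (fun z hz => by
      obtain ⟨m, hm⟩ := Circle.exp_eq_exp.1 ((hφ' z).trans (hFP z hz))
      exact ⟨m, by rw [hm]; field_simp; ring⟩) hx.1 hy.1
  have h2 := IsPreconnected.eq_of_int_valued (φ := fun z => (φ z + Real.pi * u z) / (2 * Real.pi))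
    hQ' (by fun_prop) (fun z hz => by
      obtain ⟨m, hm⟩ := Circle.exp_eq_exp.1 ((hφ' z).trans (hFQ z hz))
      exact ⟨m, by rw [hm]; field_simp; ring⟩) hx.2 hy.2
  have hux : u x = 0 := hu0 ⟨hx, hxt⟩
  have huy : u y = 1 := hu1 ⟨hy, hyt⟩
  simp only [hux, huy] at h1 h2
  rw [div_left_inj' (by positivity)] at h1 h2
  linarith

end Topology

variable {d : ℕ} {B B₁ B₂ U : Set (E d)} {f : E d → ℝ} {b b₁ b₂ : E d} {q : Amb d}
  {g : Aff d × Aff d}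

theorem lt_of_inner_gradient_pos {y n : E d} {T : ℝ} (hT : 0 < T)
    (hf : ∀ t ∈ Icc 0 T, DifferentiableAt ℝ f (y + t • n))
    (hpos : ∀ t ∈ Icc 0 T, 0 < ⟪gradient f (y + t • n), n⟫_ℝ) : f y < f (y + T • n) := by
  have hd : ∀ t ∈ Icc 0 T, HasDerivAt (fun t : ℝ => f (y + t • n))
      ⟪gradient f (y + t • n), n⟫_ℝ t := by
    intro t ht
    have h1 : HasDerivAt (fun t : ℝ => y + t • n) n t := by
      simpa using ((hasDerivAt_id t).smul_const n).const_add y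
    have h2 := (hf t ht).hasFDerivAt.comp_hasDerivAt t h1
    rwa [fderiv_eq_inner] at h2
  have hm := strictMonoOn_of_deriv_pos (convex_Icc 0 T)
    (f := fun t : ℝ => f (y + t • n)) (fun t ht => (hd t ht).continuousAt.continuousWithinAt)
    (fun t ht => by
      rw [interior_Icc] at ht
      rw [(hd t (Ioo_subset_Icc_self ht)).deriv]; exact hpos t (Ioo_subset_Icc_self ht))
  simpa using hm (left_mem_Icc.2 hT.le) (right_mem_Icc.2 hT.le) hT

theorem eventually_inner_gradient_pos (hf : ContDiffAt ℝ ∞ f b) {n : E d}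
    (hn : 0 < ⟪gradient f b, n⟫_ℝ) :
    ∀ᶠ y in 𝓝 b, DifferentiableAt ℝ f y ∧ 0 < ⟪gradient f y, n⟫_ℝ := by
  have h1 : ∀ᶠ y in 𝓝 b, ContDiffAt ℝ 1 f y := (hf.of_le (by norm_cast)).eventually (by simp)
  have h2 : ContinuousAt (fun y => ⟪gradient f y, n⟫_ℝ) b :=
    ContinuousAt.inner (𝕜 := ℝ) (contDiffAt_gradient hf).continuousAt continuousAt_const
  filter_upwards [h1, h2.tendsto.eventually_const_lt hn] with y hy hy2
  exact ⟨hy.differentiableAt (by simp), hy2⟩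

/-- Near a regular point of its zero set, the set where `f` is positive is connected. -/
theorem exists_joinedIn_pos (hf : ContDiffAt ℝ ∞ f b) (h0 : f b = 0) (hg : gradient f b ≠ 0)
    {V : Set (E d)} (hV : V ∈ 𝓝 b) : ∃ p ∈ V, 0 < f p ∧ ∃ V' ∈ 𝓝 b, V' ⊆ V ∧
      ∀ y ∈ V', 0 < f y → JoinedIn (V ∩ {y | 0 < f y}) y p := by
  set n := unitGrad f b with hn
  have hn1 : ‖n‖ = 1 := norm_unitGrad hg
  have hpos : 0 < ⟪gradient f b, n⟫_ℝ := by
    rw [gradient_eq_norm_smul hg, inner_smul_left, ← hn, real_inner_self_eq_norm_sq, hn1]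
    simpa using hg
  obtain ⟨ε, hε, hεV⟩ := Metric.mem_nhds_iff.1
    (inter_mem hV (eventually_inner_gradient_pos hf hpos))
  set r := ε / 3 with hr
  have hr0 : 0 < r := by positivity
  have hin : ∀ y, dist y b < r → ∀ t ∈ Icc 0 r, y + t • n ∈ Metric.ball b ε := by
    intro y hy t ht
    rw [Metric.mem_ball]
    have h1 : dist (y + t • n) y = t := by
      rw [dist_eq_norm]; simp [norm_smul, hn1, abs_of_nonneg ht.1]
    have h2 := dist_triangle (y + t • n) y b
    rw [h1] at h2
    have := ht.2
    linarith
  have hlt : ∀ y, dist y b < r → ∀ t ∈ Ioc 0 r, f y < f (y + t • n) := by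
    intro y hy t ht
    refine lt_of_inner_gradient_pos ht.1 ?_ ?_ <;> intro τ hτ
    · exact (hεV (hin y hy τ ⟨hτ.1, hτ.2.trans ht.2⟩)).2.1
    · exact (hεV (hin y hy τ ⟨hτ.1, hτ.2.trans ht.2⟩)).2.2
  have hbb : dist b b < r := by simpa using hr0
  have hp : 0 < f (b + r • n) := by
    have := hlt b hbb r ⟨hr0, le_rfl⟩
    rwa [h0] at this
  have hpin := hin b hbb r ⟨hr0.le, le_rfl⟩
  have hcont : ContinuousAt f (b + r • n) := (hεV hpin).2.1.continuousAt
  obtain ⟨δ, hδ, hδV⟩ := Metric.mem_nhds_iff.1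
    (inter_mem (Metric.isOpen_ball.mem_nhds hpin) (hcont.tendsto.eventually_const_lt hp))
  refine ⟨b + r • n, (hεV hpin).1, hp, Metric.ball b (min δ r),
    Metric.ball_mem_nhds _ (lt_min hδ hr0), fun y hy => (hεV (Metric.ball_subset_ball
      ((min_le_right _ _).trans (by linarith)) hy)).1, fun y hy hy0 => ?_⟩
  have hyr : dist y b < r := (Metric.mem_ball.1 hy).trans_le (min_le_right _ _)
  have hyδ : dist y b < δ := (Metric.mem_ball.1 hy).trans_le (min_le_left _ _)
  -- The path first rises along the normal, which increases f, and then goes straight to p inside a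
  -- small ball around p where f is positive.
  refine (JoinedIn.of_segment_subset (y := y + r • n) ?_).trans
    (JoinedIn.of_segment_subset (y := b + r • n) ?_)
  · rintro z hz
    rw [segment_eq_image'] at hz
    obtain ⟨θ, hθ, rfl⟩ := hz
    have hz : y + θ • (y + r • n - y) = y + (θ * r) • n := by
      rw [add_sub_cancel_left, smul_smul]
    simp only [hz]
    have hθr : θ * r ∈ Icc 0 r := ⟨mul_nonneg hθ.1 hr0.le, mul_le_of_le_one_left hr0.le hθ.2⟩
    refine ⟨(hεV (hin y hyr _ hθr)).1, ?_⟩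
    rcases hθr.1.eq_or_lt with h | h
    · change 0 < f _; rw [← h]; simpa using hy0
    · exact hy0.trans (hlt y hyr _ ⟨h, hθr.2⟩)
  · refine Subset.trans ((convex_ball (b + r • n) δ).segment_subset ?_ (Metric.mem_ball_self hδ))
      (fun z hz => ⟨(hεV (hδV hz).1).1, (hδV hz).2⟩)
    rw [Metric.mem_ball]; simpa using hyδ

end

section

/-! ### Filling in a body -/

variable {d : ℕ} {B B' B₁ B₂ U : Set (E d)} {f : E d → ℝ} {b b₁ b₂ : E d} {q : Amb d}
  {g : Aff d × Aff d}

/-- The complement of the component of the complement of `B` that contains `p`. -/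
def fill (B : Set (E d)) (p : E d) : Set (E d) := (connectedComponentIn Bᶜ p)ᶜ

/-- `B'` arises from `B` by adding some components of the complement, and its boundary is
connected. -/
structure IsFill (B B' : Set (E d)) : Prop where
  subset : B ⊆ B'
  isBody : IsBody B'
  mem_frontier : ∀ b ∈ frontier B', b ∈ frontier B
  eventually : ∀ b ∈ frontier B', ∀ᶠ y in 𝓝 b, y ∈ B ↔ y ∈ B'
  isPreconnected : IsPreconnected (frontier B')

/-- Near a boundary point the complement is the positive side of a regular function and is locally
connected, so only one component of it is seen there. -/
theorem eventually_mem_connectedComponentIn (hB : IsBody B) (hb : b ∈ frontier B) :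
    ∃ p ∉ B, ∀ᶠ y in 𝓝 b, y ∉ B → y ∈ connectedComponentIn Bᶜ p := by
  obtain ⟨U, f, h, hbU⟩ := hB.exists_chart hb
  obtain ⟨p, hpU, hp, V, hV, hVU, hj⟩ := exists_joinedIn_pos (h.contDiffAt hbU)
    ((h.mem_frontier_iff hbU).1 hb) (h.grad_ne b hbU) (h.isOpen.mem_nhds hbU)
  have hnot : ∀ y ∈ U, y ∉ B ↔ 0 < f y := fun y hy => by rw [h.mem_iff y hy, not_le]
  refine ⟨p, (hnot p hpU).2 hp, ?_⟩
  filter_upwards [hV] with y hy hyB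
  have hj' := (hj y hy ((hnot y (hVU hy)).1 hyB)).symm
  have hpF : p ∈ U ∩ {y | 0 < f y} := ⟨hpU, hp⟩
  exact (isPathConnected_pathComponentIn hpF).isConnected.isPreconnected.subset_connectedComponentIn
    (mem_pathComponentIn_self hpF) (pathComponentIn_subset.trans fun z hz => (hnot z hz.1).2 hz.2) hj'

theorem disjoint_or_eq_connectedComponentIn {X : Type*} [TopologicalSpace X] {s : Set X} {x y z : X}
    (hx : z ∈ connectedComponentIn s x) (hy : z ∈ connectedComponentIn s y) :
    connectedComponentIn s x = connectedComponentIn s y := by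
  rw [connectedComponentIn_eq hx, connectedComponentIn_eq hy]

theorem mem_of_mem_closure_connectedComponentIn (hB : IsClosed B) {p y : E d} (hy : y ∉ B)
    (hc : y ∈ closure (connectedComponentIn Bᶜ p)) : y ∈ connectedComponentIn Bᶜ p := by
  obtain ⟨z, hz, hz'⟩ := mem_closure_iff.1 hc _ (hB.isOpen_compl.connectedComponentIn (x := y))
    (mem_connectedComponentIn hy)
  rw [disjoint_or_eq_connectedComponentIn hz' hz]
  exact mem_connectedComponentIn hy

theorem isOpen_connectedComponentIn_compl (hB : IsClosed B) (p : E d) :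
    IsOpen (connectedComponentIn Bᶜ p) := hB.isOpen_compl.connectedComponentIn

/-- The fill consists of B and the other components of its complement; the closure of each of these
meets B, so adding it to B keeps the set connected. -/
theorem isPreconnected_fill (hB : IsClosed B) (hB' : IsConnected B) (p : E d) :
    IsPreconnected (fill B p) := by
  obtain ⟨x, hx⟩ := hB'.nonempty
  have hsub : B ⊆ fill B p := fun y hy hy' => connectedComponentIn_subset _ _ hy' hy
  refine isPreconnected_of_forall x fun y hy => ?_
  by_cases hyB : y ∈ B
  · exact ⟨B, hsub, hx, hyB, hB'.isPreconnected⟩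
  set V := connectedComponentIn Bᶜ y with hV
  have hyV : y ∈ V := mem_connectedComponentIn hyB
  -- A component whose closure misses B would be open and closed, hence the whole space, although B
  -- is nonempty.
  have hne : (B ∩ closure V).Nonempty := by
    by_contra hne
    have hcl : closure V = V := by
      refine Subset.antisymm (fun z hz => ?_) subset_closure
      exact mem_of_mem_closure_connectedComponentIn hB (fun hzB => hne ⟨z, hzB, hz⟩) hz
    have hclopen : IsClopen V := ⟨hcl ▸ isClosed_closure, isOpen_connectedComponentIn_compl hB y⟩
    have := hclopen.eq_univ ⟨y, hyV⟩
    exact connectedComponentIn_subset _ _ (this ▸ mem_univ x : x ∈ V) hx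
  refine ⟨B ∪ closure V, union_subset hsub (fun z hz hz' => ?_), Or.inl hx,
    Or.inr (subset_closure hyV), ?_⟩
  · obtain ⟨w, hw, hw'⟩ := mem_closure_iff.1 hz _ (isOpen_connectedComponentIn_compl hB p) hz'
    exact hy (disjoint_or_eq_connectedComponentIn hw hw' ▸ hyV)
  · obtain ⟨z, hz, hz'⟩ := hne
    exact hB'.isPreconnected.union z hz hz' isPreconnected_connectedComponentIn.closure

theorem isFill_fill (hB : IsBody B) (p : E d) : IsFill B (fill B p) := by
  have hWo := isOpen_connectedComponentIn_compl hB.isClosed p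
  have hsub : B ⊆ fill B p := fun y hy hy' => connectedComponentIn_subset _ _ hy' hy
  have hfr : frontier (fill B p) = closure (connectedComponentIn Bᶜ p) ∩ fill B p := by
    rw [fill, frontier_compl, hWo.frontier_eq]; rfl
  have hmem : ∀ b ∈ frontier (fill B p), b ∈ frontier B := by
    intro b hb
    rw [hfr] at hb
    have hbB : b ∈ B := by
      by_contra hbB
      exact hb.2 (mem_of_mem_closure_connectedComponentIn hB.isClosed hbB hb.1)
    rw [frontier_eq_closure_inter_closure]
    exact ⟨subset_closure hbB, closure_mono (connectedComponentIn_subset _ _) hb.1⟩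
  have hev : ∀ b ∈ frontier (fill B p), ∀ᶠ y in 𝓝 b, y ∈ B ↔ y ∈ fill B p := by
    intro b hb
    obtain ⟨p', hp', hev⟩ := eventually_mem_connectedComponentIn hB (hmem b hb)
    rw [hfr] at hb
    obtain ⟨y, hy, hyW⟩ := (mem_closure_iff_frequently.1 hb.1).and_eventually hev |>.exists
    -- The removed component accumulates at b, so it is the only component visible near b; hence B
    -- and its fill agree there.
    have heq := disjoint_or_eq_connectedComponentIn (hyW (connectedComponentIn_subset _ _ hy)) hy
    filter_upwards [hev] with z hz
    refine ⟨fun h => hsub h, fun h => ?_⟩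
    by_contra hzB
    exact h (heq ▸ hz hzB)
  refine ⟨hsub, ⟨hWo.isClosed_compl, ⟨hB.isConnected.nonempty.mono hsub,
    isPreconnected_fill hB.isClosed hB.isConnected p⟩, fun b hb => ?_⟩, hmem, hev, ?_⟩
  · obtain ⟨U, f, h, hbU⟩ := hB.exists_chart (hmem b hb)
    obtain ⟨V, hV, hVo, hbV⟩ := eventually_nhds_iff.1 (hev b hb)
    refine ⟨U ∩ V, f, h.isOpen.inter hVo, ⟨hbU, hbV⟩, h.smooth.mono inter_subset_left,
      fun x hx => ?_, h.grad_ne b hbU⟩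
    rw [← hV x hx.2, h.mem_iff x hx.1]
  · rw [hfr]
    -- The boundary of the fill is the intersection of the closed component with its complement, two
    -- connected closed sets that cover ℝⁿ.
    refine isPreconnected_inter_of_union_eq_univ isClosed_closure hWo.isClosed_compl
      isPreconnected_connectedComponentIn.closure
      (isPreconnected_fill hB.isClosed hB.isConnected p) ?_
    refine eq_univ_of_forall fun x => ?_
    by_cases hx : x ∈ connectedComponentIn Bᶜ p
    exacts [Or.inl (subset_closure hx), Or.inr hx]

theorem IsFill.exists_chart (h : IsFill B B') (hb : b ∈ frontier B') :
    ∃ U f, BoundaryChart B U f ∧ BoundaryChart B' U f ∧ b ∈ U := by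
  obtain ⟨U, f, hc, hbU⟩ := h.isBody.exists_chart hb
  obtain ⟨V, hV, hVo, hbV⟩ := eventually_nhds_iff.1 (h.eventually b hb)
  have hc' := hc.mono (hc.isOpen.inter hVo) inter_subset_left
  exact ⟨U ∩ V, f, ⟨hc'.isOpen, hc'.smooth, fun x hx => (hV x hx.2).trans (hc'.mem_iff x hx),
    hc'.grad_ne⟩, hc', hbU, hbV⟩

theorem IsFill.normal_eq (h : IsFill B B') (hb : b ∈ frontier B') : normal B b = normal B' b := by
  obtain ⟨U, f, hc, hc', hbU⟩ := h.exists_chart hb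
  have h0 := (hc'.mem_frontier_iff hbU).1 hb
  rw [hc.normal_eq hbU h0, hc'.normal_eq hbU h0]

theorem IsFill.Frames_subset (h : IsFill B B') {ε : ℝ} {p : E d × L d} (hp : p ∈ Frames ε B') :
    p ∈ Frames ε B :=
  ⟨h.mem_frontier _ hp.1, hp.2.1, by rw [h.normal_eq hp.1]; exact hp.2.2⟩

theorem Frames.inner_normal {ε : ℝ} (hε : ε ^ 2 = 1) {p : E d × L d} (hp : p ∈ Frames ε B)
    (x : Hyp d) : ⟪normal B p.1, p.2 x⟫_ℝ = 0 := by
  have hn : normal B p.1 = ε • p.2 (e d) := by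
    rw [hp.2.2, smul_smul, ← sq, hε, one_smul]
  rw [hn, inner_smul_left, SO_inner hp.2.1, mem_Hyp.1 x.2, mul_zero]

theorem IsFill.frameShape_eq (hB : IsBody B) (h : IsFill B B') {ε : ℝ} (hε : ε ^ 2 = 1)
    {p : E d × L d} (hp : p ∈ Frames ε B') : frameShape B p.1 p.2 = frameShape B' p.1 p.2 := by
  obtain ⟨U, f, hc, hc', hbU⟩ := h.exists_chart hp.1
  have h0 := (hc'.mem_frontier_iff hbU).1 hp.1
  ext1 x
  refine ext_inner_right ℝ fun y => ?_
  rw [inner_frameShape_eq hB hε (h.Frames_subset hp), inner_frameShape_eq h.isBody hε hp,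
    hc.II_eq hbU h0 (Frames.inner_normal hε (h.Frames_subset hp) x)
      (Frames.inner_normal hε (h.Frames_subset hp) y),
    hc'.II_eq hbU h0 (Frames.inner_normal hε hp x) (Frames.inner_normal hε hp y)]

theorem Nonsingular.fill {B₁' B₂' : Set (E d)} (hB₁ : IsBody B₁) (hB₂ : IsBody B₂)
    (hN : Nonsingular B₁ B₂) (h₁ : IsFill B₁ B₁') (h₂ : IsFill B₂ B₂') : Nonsingular B₁' B₂' := by
  intro q hq
  have hq₁ := hq.1.1
  have hq₂ := hq.1.2.1
  have h := hN.isUnit (h₁.Frames_subset hq₁) (h₂.Frames_subset hq₂)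
  rw [h₁.frameShape_eq hB₁ (by norm_num) hq₁, h₂.frameShape_eq hB₂ (by norm_num) hq₂] at h
  exact h

/-- Seen from the first body, C₂ is connected and avoids C₁, so it lies in one component of the
complement. A single point of it in the component left out of the fill decides which one. -/
theorem forall_mem_of_disjoint {C₁ C₂ : Set (E d)} (hg : g ∈ GG d) (hC₂ : IsPreconnected C₂)
    (hdisj : ∀ x ∈ C₁, ∀ y ∈ C₂, act g.1 x ≠ act g.2 y) {p y₀ : E d} (hy₀ : y₀ ∈ C₂)
    (hp : inv g.1.1 (act g.2 y₀ - g.1.2) ∈ connectedComponentIn C₁ᶜ p) {x y : E d}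
    (hx : x ∈ fill C₁ p) (hy : y ∈ C₂) : act g.1 x ≠ act g.2 y := by
  have hpre : IsPreconnected ((fun y => inv g.1.1 (act g.2 y - g.1.2)) '' C₂) :=
    hC₂.image _ (by unfold act; fun_prop)
  have hsub := hpre.subset_connectedComponentIn (F := C₁ᶜ) (mem_image_of_mem _ hy₀) (by
    rintro _ ⟨z, hz, rfl⟩ hzC
    exact hdisj _ hzC z hz (act_inv_act hg.1 _))
  rw [← connectedComponentIn_eq hp] at hsub
  intro hxy
  refine hx ?_
  have : inv g.1.1 (act g.2 y - g.1.2) ∈ connectedComponentIn C₁ᶜ p :=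
    hsub (mem_image_of_mem _ hy)
  rwa [inv_act_eq hg.1 hxy] at this

theorem swap_mem_GG (hg : g ∈ GG d) : g.swap ∈ GG d := ⟨hg.2, hg.1⟩

/-- Each body loses all complementary components except the one next to its contact point. In
disjoint configurations near g the other body's contact point lies in exactly this component, so the
filled bodies are still disjoint and g stays in the closure. -/
theorem exists_fill (hB₁ : IsBody B₁) (hB₂ : IsBody B₂) (hg : g ∈ M B₁ B₂)
    (hs : IsSolution B₁ B₂ g b₁ b₂ 0) : ∃ B₁' B₂', IsFill B₁ B₁' ∧ IsFill B₂ B₂' ∧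
      g ∈ M B₁' B₂' ∧ IsSolution B₁' B₂' g b₁ b₂ 0 := by
  have hgG := M_subset_GG hg
  have hact : act g.2 b₂ = act g.1 b₁ := by simpa using hs.act_eq
  obtain ⟨p₁, -, hp₁⟩ := eventually_mem_connectedComponentIn hB₁ hs.mem₁
  obtain ⟨p₂, -, hp₂⟩ := eventually_mem_connectedComponentIn hB₂ hs.mem₂
  have h₁ := isFill_fill hB₁ p₁
  have h₂ := isFill_fill hB₂ p₂
  have hb₁ : b₁ ∈ B₁ := hB₁.isClosed.frontier_subset hs.mem₁
  have hb₂ : b₂ ∈ B₂ := hB₂.isClosed.frontier_subset hs.mem₂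
  have hM : g ∈ M (fill B₁ p₁) (fill B₂ p₂) := by
    have hc₁ : ContinuousAt (fun g : Aff d × Aff d => inv g.1.1 (act g.2 b₂ - g.1.2)) g := by
      unfold act
      exact (((continuous_inv.comp (continuous_fst.comp continuous_fst)).clm_apply
        (by fun_prop))).continuousAt
    have hc₂ : ContinuousAt (fun g : Aff d × Aff d => inv g.2.1 (act g.1 b₁ - g.2.2)) g := by
      unfold act
      exact (((continuous_inv.comp (continuous_fst.comp continuous_snd)).clm_apply
        (by fun_prop))).continuousAt
    have e₁ : inv g.1.1 (act g.2 b₂ - g.1.2) = b₁ := inv_act_eq hgG.1 hact.symm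
    have e₂ : inv g.2.1 (act g.1 b₁ - g.2.2) = b₂ := inv_act_eq hgG.2 hact
    rw [← e₁] at hp₁
    rw [← e₂] at hp₂
    refine mem_closure_iff_frequently.2 (((mem_closure_iff_frequently.1 hg).and_eventually
      ((hc₁.eventually hp₁).and (hc₂.eventually hp₂))).mono ?_)
    rintro k ⟨⟨hk, hkd⟩, hk₁, hk₂⟩
    have hdis : ∀ x ∈ B₁, ∀ y ∈ B₂, act k.1 x ≠ act k.2 y := fun x hx y hy hxy =>
      Set.disjoint_left.1 hkd (mem_image_of_mem _ hx) (hxy ▸ mem_image_of_mem _ hy)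
    have hW₁ := hk₁ (fun h => hdis _ h b₂ hb₂ (act_inv_act hk.1 _))
    have hW₂ := hk₂ (fun h => hdis b₁ hb₁ _ h (act_inv_act hk.2 _).symm)
    -- The bodies are filled one after the other; the second step uses connectedness of the already
    -- filled first body.
    have hdis₁ : ∀ x ∈ fill B₁ p₁, ∀ y ∈ B₂, act k.1 x ≠ act k.2 y := fun x hx y hy =>
      forall_mem_of_disjoint hk hB₂.isConnected.isPreconnected hdis hb₂ hW₁ hx hy
    refine ⟨hk, Set.disjoint_left.2 ?_⟩
    rintro _ ⟨x, hx, rfl⟩ ⟨y, hy, hxy⟩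
    exact forall_mem_of_disjoint (g := k.swap) (swap_mem_GG hk)
      h₁.isBody.isConnected.isPreconnected (fun y hy x hx h => hdis₁ x hx y hy h.symm)
      (h₁.subset hb₁) hW₂ hy hx hxy
  exact ⟨_, _, h₁, h₂, hM, isSolution_of_contact h₁.isBody h₂.isBody hM (h₁.subset hb₁)
    (h₂.subset hb₂) hact.symm⟩

end

section

/-! ### A body with nonnegative second fundamental form is convex -/

variable {d : ℕ} {B B' B₁ B₂ U : Set (E d)} {f : E d → ℝ} {b b₁ b₂ z : E d} {q : Amb d}
  {g : Aff d × Aff d}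

theorem hess_neg' (f : E d → ℝ) (x v w : E d) : hess (fun y => -f y) x v w = -hess f x v w := by
  have : gradient (fun y => -f y) = fun y => -gradient f y := funext (gradient_neg' f)
  rw [hess, this, hess]
  have h2 : fderiv ℝ (fun y => -gradient f y) x = -fderiv ℝ (gradient f) x := fderiv_neg
  rw [h2, neg_apply, inner_neg_left]

theorem hasDerivAt_comp_parabola (hf : ContDiffAt ℝ ∞ f z) (v w : E d) :
    HasDerivAt (fun t : ℝ => f (z + t • v + t ^ 2 • w)) ⟪gradient f z, v⟫_ℝ 0 := by
  have h1 : HasDerivAt (fun t : ℝ => z + t • v + t ^ 2 • w) v 0 := by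
    have h3 := (((hasDerivAt_id (0 : ℝ)).smul_const v).const_add z).add
      (((hasDerivAt_id (0 : ℝ)).pow 2).smul_const w)
    refine h3.congr_deriv ?_
    simp
  have h4 : HasFDerivAt f (fderiv ℝ f z) (z + (0 : ℝ) • v + (0 : ℝ) ^ 2 • w) := by
    simpa using (hf.differentiableAt (by simp)).hasFDerivAt
  have := h4.comp_hasDerivAt (0 : ℝ) h1
  rwa [fderiv_eq_inner] at this

theorem BoundaryChart.not_isMax_parabola (h : BoundaryChart B U f) (hz : z ∈ U) (h0 : f z = 0)
    {v w : E d} (hv : ⟪gradient f z, v⟫_ℝ = 0) (hII : 0 ≤ hess f z v v)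
    (hw : 0 < ⟪gradient f z, w⟫_ℝ) : ∀ᶠ t : ℝ in 𝓝[>] 0, 0 < f (z + t • v + t ^ 2 • w) := by
  have := eventually_neg_along_parabola (f := fun y => -f y) (v := v) (w := w)
    (h.contDiffAt hz).neg (by simp [h0]) (by rw [gradient_neg', inner_neg_left, hv, neg_zero])
    (by rw [gradient_neg', inner_neg_left, hess_neg']; linarith)
  exact this.mono fun t ht => by linarith

/-- Assume that a point y of B near z lies strictly beyond the tangent plane. Join z to y by a
slightly sagging parabola and lower it into B; at the last height at which it meets the boundary it
touches from inside. But the parabola bends outward strictly while II ≥ 0, so it cannot stay inside.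
The sag is what makes the nonstrict inequality sufficient. -/
theorem BoundaryChart.eventually_support (h : BoundaryChart B U f) (hz : z ∈ U) (h0 : f z = 0)
    (hII : ∀ x ∈ U, f x = 0 → ∀ v, ⟪gradient f x, v⟫_ℝ = 0 → 0 ≤ hess f x v v) :
    ∀ᶠ y in 𝓝 z, y ∈ B → ⟪unitGrad f z, y - z⟫_ℝ ≤ 0 := by
  set n := unitGrad f z with hn
  have hgz := h.grad_ne z hz
  have hn1 : ‖n‖ = 1 := norm_unitGrad hgz
  have hpos : 0 < ⟪gradient f z, n⟫_ℝ := by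
    rw [gradient_eq_norm_smul hgz, inner_smul_left, ← hn, real_inner_self_eq_norm_sq, hn1]
    simpa using hgz
  obtain ⟨R, hR, hRV⟩ := Metric.mem_nhds_iff.1 (inter_mem (h.isOpen.mem_nhds hz)
    (eventually_inner_gradient_pos (h.contDiffAt hz) hpos))
  set S := R / 2 with hS
  have hS0 : 0 < S := by positivity
  have hdown : ∀ x s, 0 < s → dist x z + s < R → f (x - s • n) < f x := by
    intro x s hs hxs
    have hin : ∀ t ∈ Icc 0 s, x - s • n + t • n ∈ Metric.ball z R := by
      intro t ht
      rw [Metric.mem_ball]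
      have h1 : dist (x - s • n + t • n) x = s - t := by
        rw [dist_eq_norm, show x - s • n + t • n - x = (t - s) • n by module, norm_smul, hn1,
          mul_one, Real.norm_eq_abs, abs_sub_comm, abs_of_nonneg (by linarith [ht.2])]
      have h2 := dist_triangle (x - s • n + t • n) x z
      have := ht.1
      linarith
    have := lt_of_inner_gradient_pos hs (fun t ht => (hRV (hin t ht)).2.1)
      (fun t ht => (hRV (hin t ht)).2.2)
    simpa using this
  have hSn : f (z - S • n) < 0 := by
    have := hdown z S hS0 (by rw [dist_self]; linarith)
    rwa [h0] at this
  have hSin : z - S • n ∈ Metric.ball z R := by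
    rw [Metric.mem_ball, dist_eq_norm]
    simp only [sub_sub_cancel_left, norm_neg, norm_smul, hn1, mul_one, Real.norm_eq_abs,
      abs_of_pos hS0]
    linarith
  obtain ⟨δ, hδ, hδV⟩ := Metric.mem_nhds_iff.1
    ((hRV hSin).2.1.continuousAt.tendsto.eventually_lt_const hSn)
  filter_upwards [Metric.ball_mem_nhds z (show 0 < min δ S / 2 by positivity)] with y hy hyB
  by_contra hcon
  rw [not_le] at hcon
  set w := y - z with hw
  -- Half the height of y: the sagging curve then still starts with outward speed ε, so at s = 0 it
  -- leaves B at once.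
  set ε := ⟪n, w⟫_ℝ / 2 with hε
  have hε0 : 0 < ε := by positivity
  have hwn : ‖w‖ < min δ S / 2 := by rwa [Metric.mem_ball, dist_eq_norm] at hy
  have hεw : 2 * ε ≤ ‖w‖ := by
    have := real_inner_le_norm n w
    rw [hn1, one_mul] at this
    linarith
  have hmδ := min_le_left δ S
  have hmS := min_le_right δ S
  set γ : ℝ × ℝ → E d := fun p => z + p.2 • w - (p.1 + ε * p.2 * (1 - p.2)) • n with hγ
  have hγc : Continuous γ := by fun_prop
  have hsag : ∀ t ∈ Icc (0 : ℝ) 1, ‖t • w‖ ≤ ‖w‖ ∧ 0 ≤ ε * t * (1 - t) ∧ ε * t * (1 - t) ≤ ε := by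
    intro t ht
    refine ⟨?_, mul_nonneg (mul_nonneg hε0.le ht.1) (by linarith [ht.2]), ?_⟩
    · rw [norm_smul, Real.norm_eq_abs, abs_of_nonneg ht.1]
      exact mul_le_of_le_one_left (norm_nonneg _) ht.2
    · nlinarith [ht.1, ht.2, sq_nonneg t]
  have hγin : ∀ p : ℝ × ℝ, p.1 ∈ Icc 0 S → p.2 ∈ Icc (0 : ℝ) 1 → γ p ∈ Metric.ball z R := by
    intro p hp1 hp2
    obtain ⟨ha, hb, hc⟩ := hsag _ hp2
    rw [Metric.mem_ball, dist_eq_norm]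
    have : γ p - z = p.2 • w - (p.1 + ε * p.2 * (1 - p.2)) • n := by simp only [hγ]; abel
    rw [this]
    refine (norm_sub_le _ _).trans_lt ?_
    rw [norm_smul (p.1 + ε * p.2 * (1 - p.2)), hn1, mul_one, Real.norm_eq_abs,
      abs_of_nonneg (by linarith [hp1.1])]
    linarith [hp1.2]
  set K : Set (ℝ × ℝ) := (Icc 0 S ×ˢ Icc 0 1) ∩ {p | 0 ≤ f (γ p)} with hK
  have hfc : ContinuousOn (fun p => f (γ p)) (Icc 0 S ×ˢ Icc 0 1) := fun p hp =>
    ((hRV (hγin p hp.1 hp.2)).2.1.continuousAt.comp (f := γ)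
      hγc.continuousAt).continuousWithinAt
  have hKc : IsCompact K := by
    refine (isCompact_Icc.prod isCompact_Icc).of_isClosed_subset ?_ inter_subset_left
    exact hfc.preimage_isClosed_of_isClosed (isClosed_Icc.prod isClosed_Icc) isClosed_Ici
  -- the curve for `s = 0` leaves `B` at once
  obtain ⟨s₁, hs₁, t₁, ht₁⟩ : ∃ s₁ > 0, ∃ t₁, (s₁, t₁) ∈ K := by
    have h1 : ∀ᶠ t : ℝ in 𝓝[>] 0, 0 < f (z + t • (w - ε • n) + t ^ 2 • (ε • n)) := by
      have hd := hasDerivAt_comp_parabola (h.contDiffAt hz) (w - ε • n) (ε • n)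
      have hpos' : 0 < ⟪gradient f z, w - ε • n⟫_ℝ := by
        rw [gradient_eq_norm_smul hgz, inner_smul_left, ← hn, inner_sub_right, inner_smul_right,
          real_inner_self_eq_norm_sq, hn1]
        have : 0 < ‖gradient f z‖ := norm_pos_iff.2 hgz
        simp only [RCLike.conj_to_real]
        exact mul_pos this (by linarith)
      exact (eventually_neg_of_deriv_neg hd.neg (neg_lt_zero.2 hpos') (by simp [h0])).mono
        fun t ht => by simpa using ht
    obtain ⟨t₁, ht, ht0, ht1⟩ := (h1.and (Ioo_mem_nhdsGT (show (0 : ℝ) < 1 by norm_num))).exists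
    have hcont : ContinuousAt (fun s : ℝ => f (γ (s, t₁))) 0 := by
      refine ((hRV (hγin (0, t₁) ⟨le_rfl, hS0.le⟩ ⟨ht0.le, ht1.le⟩)).2.1.continuousAt).comp
        (f := fun s : ℝ => γ (s, t₁)) ?_
      exact (by fun_prop : Continuous fun s : ℝ => γ (s, t₁)).continuousAt
    have hp : 0 < f (γ (0, t₁)) := by
      convert ht using 2
      simp only [hγ]; module
    obtain ⟨s₁, hs, hs0, hs1⟩ := ((hcont.tendsto.eventually_const_lt hp).filter_mono
      nhdsWithin_le_nhds |>.and (Ioo_mem_nhdsGT hS0)).exists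
    exact ⟨s₁, hs0, t₁, ⟨⟨hs0.le, hs1.le⟩, ht0.le, ht1.le⟩, hs.le⟩
  -- The greatest lowering s at which the curve still has a point with f ≥ 0. Contact at t = 0 or t
  -- = 1 is impossible because z and y, lowered by s > 0, have f < 0.
  obtain ⟨⟨s, t⟩, ⟨⟨hs, ht⟩, hst⟩, hmax⟩ := hKc.exists_isMaxOn ⟨_, ht₁⟩ continuousOn_fst
  have hs0 : 0 < s := hs₁.trans_le (hmax ht₁)
  have hsS : s < S := by
    refine lt_of_le_of_ne hs.2 ?_
    rintro rfl
    refine absurd (show 0 ≤ f (γ (S, t)) from hst) (not_le.2 (hδV ?_))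
    obtain ⟨ha, hb, hc⟩ := hsag _ ht
    rw [Metric.mem_ball, dist_eq_norm]
    have : γ (S, t) - (z - S • n) = t • w - (ε * t * (1 - t)) • n := by simp only [hγ]; module
    rw [this]
    refine (norm_sub_le _ _).trans_lt ?_
    rw [norm_smul (ε * t * (1 - t)), hn1, mul_one, Real.norm_eq_abs, abs_of_nonneg hb]
    linarith
  have hle : ∀ τ ∈ Icc (0 : ℝ) 1, f (γ (s, τ)) ≤ 0 := by
    intro τ hτ
    by_contra hneg
    rw [not_le] at hneg
    have hcont : ContinuousAt (fun s : ℝ => f (γ (s, τ))) s := by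
      refine ((hRV (hγin (s, τ) hs hτ)).2.1.continuousAt).comp
        (f := fun s : ℝ => γ (s, τ)) ?_
      exact (by fun_prop : Continuous fun s : ℝ => γ (s, τ)).continuousAt
    obtain ⟨s', hs', hs0', hs1'⟩ := ((hcont.tendsto.eventually_const_lt hneg).filter_mono
      nhdsWithin_le_nhds |>.and (Ioo_mem_nhdsGT hsS)).exists
    have : (s', τ) ∈ K := ⟨⟨⟨(hs0.trans hs0').le, hs1'.le⟩, hτ⟩, hs'.le⟩
    exact absurd (hmax this) (not_le.2 hs0')
  have hst0 : f (γ (s, t)) = 0 := le_antisymm (hle t ht) hst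
  have ht0 : t ≠ 0 := by
    rintro rfl
    have h1 := hdown z s hs0 (by rw [dist_self]; linarith)
    rw [h0] at h1
    simp [hγ] at hst0
    linarith
  have ht1 : t ≠ 1 := by
    rintro rfl
    have h1 := hdown y s hs0 (by
      rw [Metric.mem_ball] at hy; linarith)
    have hfy : f y ≤ 0 := by
      refine (h.mem_iff y (hRV (Metric.ball_subset_ball ?_ hy)).1).1 hyB
      linarith
    simp [hγ, hw] at hst0
    linarith
  have htI : t ∈ Ioo (0 : ℝ) 1 := ⟨lt_of_le_of_ne ht.1 ht0.symm, lt_of_le_of_ne ht.2 ht1⟩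
  have hxU := hRV (hγin (s, t) hs ht)
  set v := w - (ε * (1 - 2 * t)) • n with hv
  have hγt : ∀ u : ℝ, γ (s, t + u) = γ (s, t) + u • v + u ^ 2 • (ε • n) := by
    intro u; simp only [hγ, hv]; module
  have hderiv : HasDerivAt (fun u : ℝ => f (γ (s, t + u))) ⟪gradient f (γ (s, t)), v⟫_ℝ 0 := by
    simp only [hγt]
    exact hasDerivAt_comp_parabola (h.contDiffAt hxU.1) v (ε • n)
  have hloc : ∀ᶠ u : ℝ in 𝓝 0, t + u ∈ Icc (0 : ℝ) 1 := by
    have : Tendsto (fun u : ℝ => t + u) (𝓝 0) (𝓝 t) := by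
      have := (by fun_prop : Continuous fun u : ℝ => t + u).tendsto 0
      rwa [add_zero] at this
    exact this (Icc_mem_nhds htI.1 htI.2)
  have hzero : ⟪gradient f (γ (s, t)), v⟫_ℝ = 0 := by
    refine IsLocalMax.hasDerivAt_eq_zero ?_ hderiv
    filter_upwards [hloc] with u hu
    simp only [add_zero, hst0]
    exact hle _ hu
  -- At the touching point the velocity is tangential and the acceleration is a positive multiple of
  -- n, so f becomes positive along the curve, contrary to the choice of s.
  have hfin := h.not_isMax_parabola hxU.1 hst0 (v := v) (w := ε • n) hzero (hII _ hxU.1 hst0 v hzero)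
    (by rw [inner_smul_right]; exact mul_pos hε0 hxU.2.2)
  obtain ⟨u, hu, hu'⟩ := (hfin.and (hloc.filter_mono nhdsWithin_le_nhds)).exists
  rw [← hγt] at hu
  exact absurd (hle _ hu') (not_le.2 hu)

theorem eventually_support (hB : IsBody B)
    (hII : ∀ x ∈ frontier B, ∀ v, ⟪normal B x, v⟫_ℝ = 0 → 0 ≤ II B x v v) (hz : z ∈ frontier B) :
    ∀ᶠ y in 𝓝 z, y ∈ B → ⟪normal B z, y - z⟫_ℝ ≤ 0 := by
  obtain ⟨U, f, h, hzU⟩ := hB.exists_chart hz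
  have h0 := (h.mem_frontier_iff hzU).1 hz
  rw [h.normal_eq hzU h0]
  refine h.eventually_support hzU h0 fun x hx hx0 v hv => ?_
  have hv' : ⟪normal B x, v⟫_ℝ = 0 := by
    rw [h.normal_eq hx hx0]; exact (inner_gradient_eq_zero_iff (h.grad_ne x hx)).1 hv
  have := hII x ((h.mem_frontier_iff hx).2 hx0) v hv'
  rw [h.II_eq hx hx0 hv' hv'] at this
  exact nonneg_of_mul_nonneg_right this (inv_pos.2 (norm_pos_iff.2 (h.grad_ne x hx)))

theorem eventually_mem_connectedComponentIn_interior (hB : IsBody B) (hb : b ∈ B) :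
    ∃ p ∈ interior B, ∀ᶠ y in 𝓝 b, y ∈ interior B → y ∈ connectedComponentIn (interior B) p := by
  by_cases hbi : b ∈ interior B
  · refine ⟨b, hbi, ?_⟩
    filter_upwards [(isOpen_interior.connectedComponentIn (x := b)).mem_nhds
      (mem_connectedComponentIn hbi)] with y hy _ using hy
  have hbf : b ∈ frontier B := ⟨subset_closure hb, hbi⟩
  obtain ⟨U, f, h, hbU⟩ := hB.exists_chart hbf
  obtain ⟨p, hpU, hp, V, hV, hVU, hj⟩ := exists_joinedIn_pos (f := fun y => -f y)
    (h.contDiffAt hbU).neg (by simp [(h.mem_frontier_iff hbU).1 hbf])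
    (by rw [gradient_neg']; exact neg_ne_zero.2 (h.grad_ne b hbU)) (h.isOpen.mem_nhds hbU)
  have hint : ∀ y ∈ U, y ∈ interior B ↔ 0 < -f y := fun y hy => by
    rw [h.mem_interior_iff hy, neg_pos]
  refine ⟨p, (hint p hpU).2 hp, ?_⟩
  filter_upwards [hV] with y hy hyB
  have hj' := (hj y hy ((hint y (hVU hy)).1 hyB)).symm
  have hpF : p ∈ U ∩ {y | 0 < -f y} := ⟨hpU, hp⟩
  exact (isPathConnected_pathComponentIn hpF).isConnected.isPreconnected.subset_connectedComponentIn
    (mem_pathComponentIn_self hpF) (pathComponentIn_subset.trans fun z hz => (hint z hz.1).2 hz.2) hj'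

theorem IsBody.mem_closure_interior (hB : IsBody B) (hb : b ∈ B) : b ∈ closure (interior B) := by
  by_cases hbi : b ∈ interior B
  · exact subset_closure hbi
  · exact frontier_subset_closure_interior hB ⟨subset_closure hb, hbi⟩

/-- Every point of B, including boundary points, has a neighbourhood that meets only one component
of the interior. Belonging to a given component is therefore a locally constant property on the
connected set B. -/
theorem isPreconnected_interior (hB : IsBody B) : IsPreconnected (interior B) := by
  rcases (interior B).eq_empty_or_nonempty with he | ⟨x, hx⟩
  · rw [he]; exact isPreconnected_empty
  set C := connectedComponentIn (interior B) x with hC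
  set u : Set (E d) := {y | ∀ᶠ y' in 𝓝 y, y' ∈ interior B → y' ∈ C} with hu
  set v : Set (E d) := {y | ∀ᶠ y' in 𝓝 y, y' ∈ interior B → y' ∉ C} with hv
  have huo : IsOpen u := isOpen_iff_mem_nhds.2 fun y hy => eventually_eventually_nhds.2 hy
  have hvo : IsOpen v := isOpen_iff_mem_nhds.2 fun y hy => eventually_eventually_nhds.2 hy
  have hxu : x ∈ u := by
    have : ∀ᶠ y in 𝓝 x, y ∈ C :=
      (isOpen_interior.connectedComponentIn (x := x)).mem_nhds (mem_connectedComponentIn hx)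
    exact this.mono fun y hy _ => hy
  have hcov : B ⊆ u ∪ v := by
    intro y hy
    obtain ⟨p, hp, hev⟩ := eventually_mem_connectedComponentIn_interior hB hy
    by_cases hpC : p ∈ C
    · left
      have hCp : C = connectedComponentIn (interior B) p := connectedComponentIn_eq hpC
      exact hev.mono fun z hz hzi => hCp ▸ hz hzi
    · right
      refine hev.mono fun z hz hzi hzC => hpC ?_
      rw [hC, disjoint_or_eq_connectedComponentIn hzC (hz hzi)]
      exact mem_connectedComponentIn hp
  have hBu : B ⊆ u := by
    intro y hy
    rcases hcov hy with h | h
    · exact h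
    · obtain ⟨w, hw, hwu, hwv⟩ := hB.isConnected.isPreconnected u v huo hvo hcov
        ⟨x, interior_subset hx, hxu⟩ ⟨y, hy, h⟩
      obtain ⟨k, hk, hk1, hk2⟩ := ((mem_closure_iff_frequently.1
        (hB.mem_closure_interior hw)).and_eventually (hwu.and hwv)).exists
      exact absurd (hk1 hk) (hk2 hk)
  have : interior B = C := Subset.antisymm
    (fun y hy => (hBu (interior_subset hy)).self_of_nhds hy) (connectedComponentIn_subset _ _)
  rw [this]; exact isPreconnected_connectedComponentIn

/-- A segment in `B` that joins two interior points consists of interior points. -/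
theorem segment_subset_interior (hB : IsBody B)
    (hsupp : ∀ z ∈ frontier B, ∀ᶠ y in 𝓝 z, y ∈ B → ⟪normal B z, y - z⟫_ℝ ≤ 0) {x y : E d}
    (hx : x ∈ interior B) (hy : y ∈ interior B) (hxy : ∀ t ∈ Icc (0 : ℝ) 1, x + t • (y - x) ∈ B) :
    ∀ t ∈ Icc (0 : ℝ) 1, x + t • (y - x) ∈ interior B := by
  set w := y - x with hw
  set γ : ℝ → E d := fun t => x + t • w with hγ
  have hγc : Continuous γ := by fun_prop
  refine isPreconnected_Icc.subset_of_closure_inter_subset (u := {t | γ t ∈ interior B})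
    (isOpen_interior.preimage hγc) ⟨0, left_mem_Icc.2 zero_le_one, by simpa [hγ] using hx⟩ ?_
  rintro t ⟨htc, ht⟩
  by_contra hti
  have hzf : γ t ∈ frontier B := ⟨subset_closure (hxy t ht), hti⟩
  have ht0 : t ≠ 0 := by rintro rfl; exact hti (by simpa [hγ] using hx)
  have ht1 : t ≠ 1 := by rintro rfl; exact hti (by simpa [hγ, hw] using hy)
  have htI : t ∈ Ioo (0 : ℝ) 1 := ⟨lt_of_le_of_ne ht.1 ht0.symm, lt_of_le_of_ne ht.2 ht1⟩
  set n := normal B (γ t) with hn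
  have hn1 : ‖n‖ = 1 := hB.norm_normal hzf
  have hsub : ∀ τ, γ τ - γ t = (τ - t) • w := fun τ => by simp only [hγ]; module
  have hev : ∀ᶠ τ in 𝓝 t, (τ - t) * ⟪n, w⟫_ℝ ≤ 0 := by
    filter_upwards [hγc.continuousAt.eventually (hsupp _ hzf), Icc_mem_nhds htI.1 htI.2]
      with τ h1 h2
    have := h1 (hxy τ h2)
    rwa [hsub, inner_smul_right] at this
  -- The segment passes through the boundary point in both directions and stays on one side of the
  -- supporting plane, so it lies in that plane.
  have hnw : ⟪n, w⟫_ℝ = 0 := by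
    obtain ⟨a, ha, ha'⟩ := ((hev.filter_mono nhdsWithin_le_nhds).and
      (self_mem_nhdsWithin : Ioi t ∈ 𝓝[>] t)).exists
    obtain ⟨b, hb, hb'⟩ := ((hev.filter_mono nhdsWithin_le_nhds).and
      (self_mem_nhdsWithin : Iio t ∈ 𝓝[<] t)).exists
    have ha'' : 0 < a - t := sub_pos.2 ha'
    have hb'' : 0 < t - b := sub_pos.2 hb'
    nlinarith
  -- An interior point of B on the segment close to γ(t) can be pushed a little along n without
  -- leaving B, which violates the local support at γ(t).
  obtain ⟨τ, hτ, hτ'⟩ := ((mem_closure_iff_frequently.1 htc).and_eventually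
    (hγc.continuousAt.eventually (eventually_eventually_nhds.2 (hsupp _ hzf)))).exists
  have hline : Tendsto (fun r : ℝ => γ τ + r • n) (𝓝[>] 0) (𝓝 (γ τ)) := tendsto_line _ _
  have hτB : ∀ᶠ y in 𝓝 (γ τ), y ∈ B := mem_interior_iff_mem_nhds.1 hτ
  obtain ⟨r, ⟨hr1, hr2⟩, hr⟩ := ((hline.eventually (hτ'.and hτB)).and
    (self_mem_nhdsWithin : Ioi (0 : ℝ) ∈ 𝓝[>] 0)).exists
  have := hr1 hr2
  rw [add_sub_right_comm, hsub, inner_add_right, inner_smul_right, ← hn, hnw, inner_smul_right,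
    real_inner_self_eq_norm_sq, hn1] at this
  have hr' : 0 < r := hr
  linarith

/-- Local support implies global convexity: the points visible from x through the interior form a
set that is open by compactness of segments and relatively closed by `segment_subset_interior`. As
the interior is connected, everything is visible. -/
theorem convex_of_II_nonneg (hB : IsBody B)
    (hII : ∀ x ∈ frontier B, ∀ v, ⟪normal B x, v⟫_ℝ = 0 → 0 ≤ II B x v v) : Convex ℝ B := by
  have hsupp := fun z hz => eventually_support (z := z) hB hII hz
  have hseg : ∀ x ∈ interior B, ∀ y ∈ interior B, ∀ t ∈ Icc (0 : ℝ) 1,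
      x + t • (y - x) ∈ interior B := by
    intro x hx
    set A : Set (E d) := {y | ∀ t ∈ Icc (0 : ℝ) 1, x + t • (y - x) ∈ interior B} with hA
    have hAo : IsOpen A := by
      refine isOpen_iff_mem_nhds.2 fun y hy =>
        isCompact_Icc.eventually_forall_of_forall_eventually fun t ht => ?_
      exact (by fun_prop : Continuous fun p : E d × ℝ => x + p.2 • (p.1 - x)).continuousAt
        (isOpen_interior.mem_nhds (hy t ht))
    refine (isPreconnected_interior hB).subset_of_closure_inter_subset hAo
      ⟨x, hx, fun t _ => by simpa using hx⟩ ?_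
    rintro y ⟨hyc, hy⟩
    refine segment_subset_interior hB hsupp hx hy fun t ht => ?_
    rw [← hB.isClosed.closure_eq]
    refine map_mem_closure (f := fun y => x + t • (y - x)) (by fun_prop) hyc fun k hk =>
      interior_subset (hk t ht)
  have hconv : Convex ℝ (interior B) := by
    rw [convex_iff_segment_subset]
    intro x hx y hy
    rw [segment_eq_image']
    rintro _ ⟨t, ht, rfl⟩
    exact hseg x hx y hy t ht
  have hcl : closure (interior B) = B := Subset.antisymm
    (closure_minimal interior_subset hB.isClosed) fun y hy => hB.mem_closure_interior hy
  rw [← hcl]; exact hconv.closure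

end

section

/-! ### A body whose boundary is uniformly curved is bounded -/

variable {d : ℕ} {B B' B₁ B₂ U : Set (E d)} {f : E d → ℝ} {b b₁ b₂ z : E d} {q : Amb d}
  {g : Aff d × Aff d}

theorem _root_.IsPreconnected.exists_mem_frontier {X : Type*} [TopologicalSpace X] {s C : Set X}
    (hs : IsPreconnected s) {x y : X} (hx : x ∈ s) (hxC : x ∈ interior C) (hy : y ∈ s)
    (hyC : y ∉ C) : ∃ z ∈ s, z ∈ frontier C := by
  by_contra! h
  refine hyC (interior_subset (hs.subset_of_closure_inter_subset isOpen_interior ⟨x, hx, hxC⟩ ?_ hy))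
  rintro z ⟨hz, hzs⟩
  by_contra hzi
  exact h z hzs ⟨closure_mono interior_subset hz, hzi⟩

section Ray

variable {V : Type*} [NormedAddCommGroup V] [NormedSpace ℝ V] {C : Set V}

/-- Limit directions of an unbounded sequence in a closed convex set are recession directions. -/
theorem ray_mem_of_tendsto {ι : Type*} {l : Filter ι} [l.NeBot] (hC : IsClosed C)
    (hc : Convex ℝ C) {θ : V} {r : ι → ℝ} {x : ι → V} (hx : ∀ᶠ i in l, x i ∈ C)
    (hr : Tendsto r l (𝓝 0)) (hr0 : ∀ i, 0 ≤ r i) (hθ : Tendsto (fun i => r i • x i) l (𝓝 θ))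
    {y : V} (hy : y ∈ C) {t : ℝ} (ht : 0 ≤ t) : y + t • θ ∈ C := by
  have hr' : Tendsto (fun i => t * r i) l (𝓝 0) := by simpa using hr.const_mul t
  have hlim : Tendsto (fun i => y + t • (r i • x i) - (t * r i) • y) l
      (𝓝 (y + t • θ - (0 : ℝ) • y)) := ((hθ.const_smul t).const_add y).sub (hr'.smul_const _)
  rw [zero_smul, sub_zero] at hlim
  refine hC.mem_of_tendsto hlim ?_
  filter_upwards [hx, hr'.eventually_le_const one_pos] with i hi hi2
  have := hc hy hi (a := 1 - t * r i) (b := t * r i) (by linarith) (mul_nonneg ht (hr0 i)) (by ring)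
  convert this using 1
  module

theorem exists_ray [FiniteDimensional ℝ V] (hC : IsClosed C) (hc : Convex ℝ C)
    (hb : ¬ Bornology.IsBounded C) : ∃ θ : V, ‖θ‖ = 1 ∧ ∀ y ∈ C, ∀ t : ℝ, 0 ≤ t → y + t • θ ∈ C := by
  have hex : ∀ k : ℕ, ∃ x ∈ C, (k : ℝ) < ‖x‖ := by
    intro k
    by_contra! h
    exact hb (isBounded_iff_forall_norm_le.2 ⟨k, h⟩)
  choose x hx hk using hex
  have hinf : Tendsto (fun k => ‖x k‖) atTop atTop :=
    tendsto_atTop_mono (fun k => (hk k).le) tendsto_natCast_atTop_atTop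
  have : ProperSpace V := FiniteDimensional.proper_real V
  obtain ⟨θ, hθ, φ, hφ, hlim⟩ := (isCompact_sphere (0 : V) 1).tendsto_subseq
    (x := fun k => ‖x k‖⁻¹ • x k) (fun k => by
      have : 0 < ‖x k‖ := lt_of_le_of_lt (Nat.cast_nonneg k) (hk k)
      simp only [mem_sphere_iff_norm, sub_zero, norm_smul, norm_inv, norm_norm]
      exact inv_mul_cancel₀ this.ne')
  refine ⟨θ, by simpa using hθ, fun y hy t ht => ?_⟩
  exact ray_mem_of_tendsto hC hc (x := x ∘ φ) (r := fun k => ‖x (φ k)‖⁻¹)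
    (Eventually.of_forall fun k => hx _)
    (tendsto_inv_atTop_zero.comp (hinf.comp hφ.tendsto_atTop)) (fun k => by positivity) hlim hy ht

end Ray

theorem gradient_normSq (m : ℝ) (x : E d) : gradient (fun y : E d => ‖y‖ ^ 2 - m) x = (2 : ℝ) • x := by
  refine ext_inner_right ℝ fun v => ?_
  rw [← fderiv_eq_inner]
  have h : HasFDerivAt (fun y : E d => ‖y‖ ^ 2 - m) (2 • (innerSL ℝ x)) x :=
    ((hasStrictFDerivAt_norm_sq x).hasFDerivAt).sub_const m
  rw [h.fderiv]
  simp [inner_smul_left]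

theorem hess_normSq (m : ℝ) (x v w : E d) :
    hess (fun y : E d => ‖y‖ ^ 2 - m) x v w = 2 * ⟪v, w⟫_ℝ := by
  have : gradient (fun y : E d => ‖y‖ ^ 2 - m) = fun x => (2 : ℝ) • x := funext (gradient_normSq m)
  rw [hess, this]
  have h : HasFDerivAt (fun x : E d => (2 : ℝ) • x) ((2 : ℝ) • ContinuousLinearMap.id ℝ (E d)) x :=
    (hasFDerivAt_id x).const_smul (2 : ℝ)
  rw [h.fderiv]
  simp [inner_smul_left]

/-- The ellipsoid lies in B, so the complement of B and the ellipsoid do not overlap near b. The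
first- and second-order comparisons then give a common tangent plane and an upper bound for the
curvature of B by that of the ellipsoid. -/
theorem BoundaryChart.hess_le_of_touching (h : BoundaryChart B U f) (hb : b ∈ U) (h0 : f b = 0)
    {T : L d} {p : E d} (hT : inv T (T (b - p)) ≠ 0)
    (hin : ∀ y, ‖T (y - p)‖ < ‖T (b - p)‖ → y ∈ B) {v : E d} (hv : ⟪T (b - p), T v⟫_ℝ = 0) :
    ⟪normal B b, v⟫_ℝ = 0 ∧ II B b v v * ‖inv T (T (b - p))‖ ≤ ‖T v‖ ^ 2 := by
  set N : E d → ℝ := fun y => ‖y‖ ^ 2 - ‖T (b - p)‖ ^ 2 with hN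
  have hNs : ∀ x, ContDiffAt ℝ ∞ N x := fun x => ((contDiff_norm_sq ℝ).sub contDiff_const).contDiffAt
  set k : E d → ℝ := fun y => N (T y + -T p) with hk
  have hkc : ContDiffAt ℝ ∞ k b := contDiffAt_pull (hNs _)
  have hsub : ∀ y, T y + -T p = T (y - p) := fun y => by rw [map_sub, sub_eq_add_neg]
  have hkg : gradient k b = (2 : ℝ) • inv T (T (b - p)) := by
    rw [hk, gradient_pull ((hNs _).differentiableAt (by simp)), gradient_normSq, map_smul, hsub]
  have hkh : hess k b v v = 2 * ‖T v‖ ^ 2 := by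
    rw [hk, hess_pull (hNs _), hess_normSq, real_inner_self_eq_norm_sq]
  have hk0 : k b = 0 := by simp only [hk, hN, hsub, sub_self]
  have hno : ∀ᶠ y in 𝓝 b, ¬ (-f y < 0 ∧ k y < 0) := by
    filter_upwards [h.isOpen.mem_nhds hb] with y hy
    rintro ⟨h1, h2⟩
    have : y ∈ B := hin y (by
      simp only [hk, hN, hsub, sub_neg] at h2
      exact lt_of_pow_lt_pow_left₀ 2 (norm_nonneg _) h2)
    have := (h.mem_iff y hy).1 this
    linarith
  have hgf := h.grad_ne b hb
  have hgk : gradient k b ≠ 0 := by rw [hkg]; exact smul_ne_zero two_ne_zero hT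
  have hng : gradient (fun y => -f y) b ≠ 0 := by rw [gradient_neg']; exact neg_ne_zero.2 hgf
  have hopp := unit_gradient_opposite (f := fun y => -f y) (h.contDiffAt hb).neg hkc (by simp [h0])
    hk0 hng hgk hno
  set u := ‖gradient (fun y => -f y) b‖⁻¹ • gradient (fun y => -f y) b with hu
  have hu1 : ‖u‖ = 1 := norm_unitGrad hng
  have hn : normal B b = -u := by
    rw [h.normal_eq hb h0, unitGrad, hu, gradient_neg', norm_neg, smul_neg, neg_neg]
  have hgk' : gradient k b = -(‖gradient k b‖ • u) := by
    rw [← smul_neg, ← hopp, smul_smul, mul_inv_cancel₀ (norm_ne_zero_iff.2 hgk), one_smul]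
  have huv : ⟪u, v⟫_ℝ = 0 := by
    have h1 : ⟪gradient k b, v⟫_ℝ = 0 := by
      rw [hkg, inner_smul_left, inner_inv_left, hv, mul_zero]
    rw [hgk', inner_neg_left, inner_smul_left, neg_eq_zero] at h1
    exact (mul_eq_zero.1 h1).resolve_left (by simpa using hgk)
  have hnv : ⟪normal B b, v⟫_ℝ = 0 := by rw [hn, inner_neg_left, huv, neg_zero]
  have key := hess_add_hess_nonneg (f := fun y => -f y) (h.contDiffAt hb).neg hkc (by simp [h0]) hk0
    hu1 (norm_pos_iff.2 hng) (norm_pos_iff.2 hgk) (gradient_eq_norm_smul hng) hgk' hno huv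
  rw [hess_neg', hkh, gradient_neg', norm_neg, hkg, norm_smul, Real.norm_eq_abs, abs_two] at key
  refine ⟨hnv, ?_⟩
  rw [h.II_eq hb h0 hnv hnv]
  have hpos : 0 < ‖inv T (T (b - p))‖ := norm_pos_iff.2 hT
  have hI : ‖gradient f b‖⁻¹ * hess f b v v = hess f b v v / ‖gradient f b‖ := by
    rw [div_eq_inv_mul]
  rw [hI]
  have h3 : 2 * ‖T v‖ ^ 2 / (2 * ‖inv T (T (b - p))‖) = ‖T v‖ ^ 2 / ‖inv T (T (b - p))‖ := by
    rw [mul_div_mul_left _ _ two_ne_zero]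
  rw [h3, neg_div] at key
  rw [← le_div_iff₀ hpos]
  linarith

/-- The largest ellipsoid `‖T(y - p)‖ ≤ r` in `B` touches the boundary; there the boundary is not
more curved than the ellipsoid. -/
theorem exists_touching (hB : IsBody B) (hfr : (frontier B).Nonempty) {p : E d}
    (hp : p ∈ interior B) {T : L d} {κ : ℝ} (hκ : 0 < κ) (hT : ∀ x, κ * ‖x‖ ≤ ‖T x‖) :
    ∃ y ∈ frontier B, (∀ y' ∈ frontier B, ‖T (y - p)‖ ≤ ‖T (y' - p)‖) ∧
      ∀ v, ⟪T (y - p), T v⟫_ℝ = 0 → ⟪normal B y, v⟫_ℝ = 0 ∧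
        II B y v v * ‖inv T (T (y - p))‖ ≤ ‖T v‖ ^ 2 := by
  obtain ⟨y₀, hy₀⟩ := hfr
  have hcont : Continuous (fun y => ‖T (y - p)‖) := by fun_prop
  have hcoer : Tendsto (fun y => ‖T (y - p)‖) (cocompact (E d)) atTop := by
    refine tendsto_atTop_mono (fun y => hT (y - p)) ?_
    refine Tendsto.const_mul_atTop hκ ?_
    have : Tendsto (fun y : E d => ‖y‖ - ‖p‖) (cocompact (E d)) atTop :=
      tendsto_atTop_add_const_right _ _ tendsto_norm_cocompact_atTop
    exact tendsto_atTop_mono (fun y => norm_sub_norm_le y p) this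
  obtain ⟨y, hy, hmin⟩ := hcont.continuousOn.exists_isMinOn' isClosed_frontier hy₀
    ((hcoer.eventually_ge_atTop _).filter_mono inf_le_left)
  have hinj : ∀ x, T x = 0 → x = 0 := by
    intro x hx
    have := hT x
    rw [hx, norm_zero] at this
    have h2 := norm_nonneg x
    exact norm_eq_zero.1 (le_antisymm (by nlinarith) h2)
  have hne : inv T (T (y - p)) ≠ 0 := by
    intro h0
    have h1 : ⟪T (y - p), T (y - p)⟫_ℝ = 0 := by
      rw [← inner_inv_left, h0, inner_zero_left]
    have h2 := hinj _ (inner_self_eq_zero.1 h1)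
    rw [sub_eq_zero] at h2
    exact hy.2 (h2 ▸ hp)
  obtain ⟨U, f, h, hyU⟩ := hB.exists_chart hy
  refine ⟨y, hy, fun y' hy' => hmin hy', fun v hv =>
    h.hess_le_of_touching hyU ((h.mem_frontier_iff hyU).1 hy) hne (fun x hx => ?_) hv⟩
  -- If the open ellipsoid were not contained in B, a segment from its centre would cross the
  -- boundary nearer to the centre than the minimum allows.
  by_contra hxB
  obtain ⟨w, hw, hwf⟩ := (convex_segment (𝕜 := ℝ) p x).isPreconnected.exists_mem_frontier
    (left_mem_segment ℝ p x) hp (right_mem_segment ℝ p x) hxB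
  rw [segment_eq_image'] at hw
  obtain ⟨s, hs, rfl⟩ := hw
  have h1 : ‖T (y - p)‖ ≤ ‖T (p + s • (x - p) - p)‖ := hmin hwf
  rw [add_sub_cancel_left, map_smul, norm_smul, Real.norm_eq_abs, abs_of_nonneg hs.1] at h1
  have := mul_le_of_le_one_left (norm_nonneg (T (x - p))) hs.2
  linarith

theorem norm_add_smul_sq {a θ : E d} (hθ : ‖θ‖ = 1) (ha : ⟪θ, a⟫_ℝ = 0) (μ : ℝ) :
    ‖a + μ • θ‖ ^ 2 = ‖a‖ ^ 2 + μ ^ 2 := by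
  rw [norm_add_sq_real, inner_smul_right, real_inner_comm, ha, norm_smul, hθ, mul_one,
    Real.norm_eq_abs, sq_abs]
  ring

/-- The map that multiplies the component along `θ` by `κ`. -/
def stretch (θ : E d) (κ : ℝ) : L d := 1 + (κ - 1) • (innerSL ℝ θ).smulRight θ

theorem stretch_apply {θ : E d} (hθ : ‖θ‖ = 1) (κ : ℝ) {a : E d} (ha : ⟪θ, a⟫_ℝ = 0) (μ : ℝ) :
    stretch θ κ (a + μ • θ) = a + (κ * μ) • θ := by
  have : stretch θ κ (a + μ • θ) = (a + μ • θ) + (κ - 1) • (⟪θ, a + μ • θ⟫_ℝ • θ) := rfl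
  rw [this, inner_add_right, ha, inner_smul_right, real_inner_self_eq_norm_sq, hθ]
  module

theorem inv_stretch (θ : E d) (κ : ℝ) : inv (stretch θ κ) = stretch θ κ := by
  refine ((ContinuousLinearMap.eq_adjoint_iff _ _).2 fun x y => ?_).symm
  have h : ∀ x, stretch θ κ x = x + (κ - 1) • (⟪θ, x⟫_ℝ • θ) := fun x => rfl
  rw [h, h, inner_add_left, inner_add_right, inner_smul_left, inner_smul_right, inner_smul_left,
    inner_smul_right, real_inner_comm x θ]
  simp only [RCLike.conj_to_real]
  ring

theorem exists_decomposition {θ : E d} (hθ : ‖θ‖ = 1) (x : E d) :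
    ∃ (a : E d) (μ : ℝ), ⟪θ, a⟫_ℝ = 0 ∧ x = a + μ • θ := by
  refine ⟨x - ⟪θ, x⟫_ℝ • θ, ⟪θ, x⟫_ℝ, ?_, by abel⟩
  rw [inner_sub_right, inner_smul_right, real_inner_self_eq_norm_sq, hθ]; ring

theorem le_norm_stretch {θ : E d} (hθ : ‖θ‖ = 1) {κ : ℝ} (hκ0 : 0 < κ) (hκ1 : κ < 1) (x : E d) :
    κ * ‖x‖ ≤ ‖stretch θ κ x‖ := by
  obtain ⟨a, μ, ha, rfl⟩ := exists_decomposition hθ x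
  rw [stretch_apply hθ κ ha]
  refine (sq_le_sq₀ (by positivity) (norm_nonneg _)).1 ?_
  rw [mul_pow, norm_add_smul_sq hθ ha, norm_add_smul_sq hθ ha]
  nlinarith [mul_nonneg (sq_nonneg ‖a‖) (show 0 ≤ 1 - κ ^ 2 by nlinarith)]

theorem norm_stretch_le {θ : E d} (hθ : ‖θ‖ = 1) {κ : ℝ} (hκ0 : 0 < κ) (hκ1 : κ < 1) (x : E d) :
    ‖stretch θ κ x‖ ≤ ‖x‖ := by
  obtain ⟨a, μ, ha, rfl⟩ := exists_decomposition hθ x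
  rw [stretch_apply hθ κ ha]
  refine (sq_le_sq₀ (norm_nonneg _) (norm_nonneg _)).1 ?_
  rw [norm_add_smul_sq hθ ha, norm_add_smul_sq hθ ha]
  nlinarith [mul_nonneg (sq_nonneg μ) (show 0 ≤ 1 - κ ^ 2 by nlinarith)]

/-- The arithmetic of the final comparison: A is the distance of the touching point from the axis, m
its position along the axis, and κ is so small that the long ellipsoid is flatter than the curvature
bound c permits. -/
theorem touching_contradiction {c ρ A κ m : ℝ} (hc : 0 < c) (hρ : 0 < ρ) (hA : ρ ≤ A)
    (hκ : κ ^ 2 * (1 + (c ^ 2 * ρ ^ 2)⁻¹) < c * ρ) (hm : (κ * m) ^ 2 ≤ c⁻¹ ^ 2)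
    (h : c * A ^ 4 * ρ ≤ (-(κ ^ 2 * m)) ^ 2 * A ^ 2 + (κ * A ^ 2) ^ 2) : False := by
  have hA2 : 0 < A ^ 2 := by have := hρ.trans_le hA; positivity
  have h2 : (-(κ ^ 2 * m)) ^ 2 ≤ κ ^ 2 * c⁻¹ ^ 2 := by
    have : (-(κ ^ 2 * m)) ^ 2 = κ ^ 2 * (κ * m) ^ 2 := by ring
    rw [this]
    exact mul_le_mul_of_nonneg_left hm (sq_nonneg _)
  have h3 : c * ρ * A ^ 2 ≤ κ ^ 2 * c⁻¹ ^ 2 + κ ^ 2 * A ^ 2 := by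
    refine le_of_mul_le_mul_right ?_ hA2
    have h5 := mul_le_mul_of_nonneg_right h2 hA2.le
    linarith
  have h4 : κ ^ 2 * c⁻¹ ^ 2 ≤ κ ^ 2 * (c ^ 2 * ρ ^ 2)⁻¹ * A ^ 2 := by
    rw [mul_assoc]
    refine mul_le_mul_of_nonneg_left ?_ (sq_nonneg _)
    rw [inv_pow, mul_inv, mul_assoc]
    refine le_mul_of_one_le_right (by positivity) ?_
    rw [← div_eq_inv_mul, le_div_iff₀ (by positivity), one_mul]
    exact pow_le_pow_left₀ hρ.le hA 2
  have h6 := mul_lt_mul_of_pos_right hκ hA2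
  linarith

-- An unbounded convex body contains a ray and hence a half-cylinder of some radius ρ around it.
-- Inscribed balls centred on the ray have radius at most 1/c. An inscribed ellipsoid stretched
-- along the ray therefore touches the boundary at distance at least ρ from the axis, where its
-- curvature in the plane through the axis is of order κ²; for small κ this is less than c.
set_option maxHeartbeats 400000 in
theorem isBounded_of_le_II (hd : 1 ≤ d) (hB : IsBody B) (hconv : Convex ℝ B)
    (hfr : (frontier B).Nonempty) {c : ℝ} (hc : 0 < c)
    (hII : ∀ b ∈ frontier B, ∀ v, ⟪normal B b, v⟫_ℝ = 0 → c * ‖v‖ ^ 2 ≤ II B b v v) :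
    Bornology.IsBounded B := by
  by_contra hbd
  obtain ⟨θ, hθ, hray⟩ := exists_ray hB.isClosed hconv hbd
  obtain ⟨p, hp⟩ : (interior B).Nonempty := by
    obtain ⟨b, hb⟩ := hfr
    exact closure_nonempty_iff.1 ⟨b, frontier_subset_closure_interior hB hb⟩
  obtain ⟨ρ, hρ, hball⟩ := Metric.isOpen_iff.1 isOpen_interior p hp
  have hcyl : ∀ s : ℝ, 0 ≤ s → ∀ a : E d, ‖a‖ < ρ → p + a + s • θ ∈ interior B := by
    intro s hs a ha
    have hsub : Metric.ball (p + s • θ) ρ ⊆ B := by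
      intro y hy
      have h1 : y - s • θ ∈ Metric.ball p ρ := by
        rw [Metric.mem_ball, dist_eq_norm] at hy ⊢
        rwa [sub_sub, add_comm (s • θ)]
      have := hray _ (interior_subset (hball h1)) s hs
      rwa [sub_add_cancel] at this
    refine interior_maximal hsub Metric.isOpen_ball ?_
    rw [Metric.mem_ball, dist_eq_norm]
    rwa [show p + a + s • θ - (p + s • θ) = a by abel]
  have hray' : ∀ s : ℝ, 0 ≤ s → p + s • θ ∈ interior B := fun s hs => by
    simpa using hcyl s hs 0 (by simpa using hρ)
  have hinr : ∀ s : ℝ, 0 ≤ s → ∃ y ∈ frontier B, ‖y - (p + s • θ)‖ ≤ c⁻¹ := by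
    intro s hs
    obtain ⟨y, hy, -, hv⟩ := exists_touching hB hfr (hray' s hs) (T := 1) one_pos (fun x => by simp)
    obtain ⟨v, hv1, hvo⟩ := exists_unit_orthogonal hd (y - (p + s • θ))
    refine ⟨y, hy, ?_⟩
    obtain ⟨h1, h2⟩ := hv v hvo
    have h3 := hII y hy v h1
    have h4 : ‖inv (1 : L d) ((1 : L d) (y - (p + s • θ)))‖ = ‖y - (p + s • θ)‖ := by
      rw [inv_one]; rfl
    have h5 : ‖(1 : L d) v‖ = 1 := hv1
    rw [h4, h5] at h2
    rw [hv1] at h3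
    rw [← one_div, le_div_iff₀ hc]
    nlinarith [norm_nonneg (y - (p + s • θ))]
  obtain ⟨κ, hκ0, hκ1, hκ⟩ : ∃ κ : ℝ, 0 < κ ∧ κ < 1 ∧ κ ^ 2 * (1 + (c ^ 2 * ρ ^ 2)⁻¹) < c * ρ := by
    have hcont : ContinuousAt (fun κ : ℝ => κ ^ 2 * (1 + (c ^ 2 * ρ ^ 2)⁻¹)) 0 := by fun_prop
    have h1 := hcont.tendsto.eventually_lt_const (u := c * ρ) (by simpa using mul_pos hc hρ)
    obtain ⟨κ, hκ, h0, h1⟩ := ((h1.filter_mono nhdsWithin_le_nhds).and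
      (Ioo_mem_nhdsGT (show (0 : ℝ) < 1 by norm_num))).exists
    exact ⟨κ, h0, h1, hκ⟩
  -- The centre is moved far enough along the ray: |κm| ≤ 1/c implies t + m ≥ 0, so the touching
  -- point is beside the half-cylinder and not behind its end.
  set t := (c * κ)⁻¹ with ht
  have ht0 : 0 < t := by positivity
  set T := stretch θ κ with hT
  obtain ⟨y, hy, hmin, hcurv⟩ := exists_touching hB hfr (hray' t ht0.le) (T := T) hκ0
    (le_norm_stretch hθ hκ0 hκ1)
  obtain ⟨y', hy', hyc⟩ := hinr t ht0.le
  have hle : ‖T (y - (p + t • θ))‖ ≤ c⁻¹ := (hmin y' hy').trans ((norm_stretch_le hθ hκ0 hκ1 _).trans hyc)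
  obtain ⟨a, m, ha, hz⟩ := exists_decomposition hθ (y - (p + t • θ))
  rw [hz] at hle hcurv
  have hTT : inv T (T (a + m • θ)) = a + (κ * (κ * m)) • θ := by
    rw [hT, inv_stretch, stretch_apply hθ κ ha, stretch_apply hθ κ ha]
  rw [hTT] at hcurv
  have hTz : T (a + m • θ) = a + (κ * m) • θ := stretch_apply hθ κ ha m
  rw [hTz] at hle hcurv
  have hsq : ‖a‖ ^ 2 + (κ * m) ^ 2 ≤ c⁻¹ ^ 2 := by
    rw [← norm_add_smul_sq hθ ha]; exact pow_le_pow_left₀ (norm_nonneg _) hle 2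
  have hm : 0 ≤ t + m := by
    have h1 : |κ * m| ≤ c⁻¹ := abs_le_of_sq_le_sq (by nlinarith [sq_nonneg ‖a‖]) (by positivity)
    have h2 := neg_le_of_abs_le h1
    have h3 : κ * t = c⁻¹ := by rw [ht]; field_simp
    by_contra hneg
    rw [not_le] at hneg
    nlinarith
  have hA : ρ ≤ ‖a‖ := by
    by_contra hlt
    rw [not_le] at hlt
    have h1 := hcyl (t + m) hm a hlt
    have h2 : y = p + a + (t + m) • θ := by
      rw [← sub_add_cancel y (p + t • θ), hz]; module
    rw [← h2] at h1
    exact hy.2 h1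
  set A := ‖a‖ with hAdef
  have hA0 : 0 < A := hρ.trans_le hA
  have hv : ∀ s : ℝ, ⟪θ, s • a⟫_ℝ = 0 := fun s => by rw [inner_smul_right, ha, mul_zero]
  have haa : ⟪a, a⟫_ℝ = A ^ 2 := real_inner_self_eq_norm_sq a
  -- The tangent vector of the ellipsoid in the plane spanned by a and θ: its image under T is
  -- orthogonal to the image of the touching point.
  have hTv : T (-(κ ^ 2 * m) • a + A ^ 2 • θ) = -(κ ^ 2 * m) • a + (κ * A ^ 2) • θ :=
    stretch_apply hθ κ (hv _) _
  have hor : ⟪a + (κ * m) • θ, -(κ ^ 2 * m) • a + (κ * A ^ 2) • θ⟫_ℝ = 0 := by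
    rw [inner_add_left, inner_add_right, inner_add_right]
    simp only [inner_smul_left, inner_smul_right, RCLike.conj_to_real, ha, real_inner_comm θ a, haa]
    rw [real_inner_self_eq_norm_sq θ, hθ]; ring
  obtain ⟨hnv, hkey⟩ := hcurv _ (hTv ▸ hor)
  have hII' := hII y hy _ hnv
  rw [hTv, norm_add_smul_sq hθ (hv _), norm_smul, mul_pow, Real.norm_eq_abs, sq_abs] at hkey
  rw [norm_add_smul_sq hθ (hv _), norm_smul, mul_pow, Real.norm_eq_abs, sq_abs] at hII'
  have hG : A ≤ ‖a + (κ * (κ * m)) • θ‖ := by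
    refine (sq_le_sq₀ (norm_nonneg _) (norm_nonneg _)).1 ?_
    rw [norm_add_smul_sq hθ ha]; nlinarith [sq_nonneg (κ * (κ * m))]
  set G := ‖a + (κ * (κ * m)) • θ‖ with hGdef
  have hG0 : 0 ≤ G := norm_nonneg _
  have h1 : c * A ^ 4 * ρ ≤ (-(κ ^ 2 * m)) ^ 2 * A ^ 2 + (κ * A ^ 2) ^ 2 := by
    refine le_trans ?_ hkey
    refine mul_le_mul ?_ (hA.trans hG) hρ.le ((by positivity : 0 ≤ c * A ^ 4).trans ?_)
    all_goals
      refine le_trans ?_ hII'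
      refine (mul_le_mul_of_nonneg_left ?_ hc.le)
      nlinarith [mul_nonneg (sq_nonneg (-(κ ^ 2 * m))) (sq_nonneg A)]
  exact touching_contradiction hc hρ hA hκ (by nlinarith [sq_nonneg A]) h1

end

section

/-! ### Almost touching points are near the contact point -/

variable {d : ℕ} {B B' B₁ B₂ U : Set (E d)} {f : E d → ℝ} {b b₁ b₂ z : E d} {q : Amb d}
  {g g₀ : Aff d × Aff d}

theorem convex_of_maxCurv_nonpos (hd : 1 ≤ d) (hB : IsBody B)
    (h : ∀ b ∈ frontier B, maxCurv B b ≤ 0) : Convex ℝ B :=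
  convex_of_II_nonneg hB fun b hb _ hv => le_trans
    (mul_nonneg (neg_nonneg.2 (h b hb)) (sq_nonneg _)) (neg_maxCurv_le_II hd hB hb hv)

theorem isBounded_of_maxCurv_le (hd : 1 ≤ d) (hB : IsBody B) (hfr : (frontier B).Nonempty) {c : ℝ}
    (hc : 0 < c) (h : ∀ b ∈ frontier B, maxCurv B b ≤ -c) : Bornology.IsBounded B :=
  isBounded_of_le_II hd hB
    (convex_of_maxCurv_nonpos hd hB fun b hb => (h b hb).trans (by linarith)) hfr hc
    fun b hb v hv => le_trans (mul_le_mul_of_nonneg_right (by linarith [h b hb]) (sq_nonneg _))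
      (neg_maxCurv_le_II hd hB hb hv)

section Limits

variable {ι : Type*} {l : Filter ι}

theorem tendsto_clm_apply {V W : Type*} [NormedAddCommGroup V] [NormedSpace ℝ V]
    [NormedAddCommGroup W] [NormedSpace ℝ W] {T : ι → V →L[ℝ] W} {T₀ : V →L[ℝ] W} {x : ι → V}
    {x₀ : V} (hT : Tendsto T l (𝓝 T₀)) (hx : Tendsto x l (𝓝 x₀)) :
    Tendsto (fun i => T i (x i)) l (𝓝 (T₀ x₀)) :=
  (isBoundedBilinearMap_apply (𝕜 := ℝ) (E := V) (F := W)).continuous.tendsto (T₀, x₀) |>.comp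
    (hT.prodMk_nhds hx)

theorem tendsto_act {h : ι → Aff d} {h₀ : Aff d} {x : ι → E d} {x₀ : E d} (hh : Tendsto h l (𝓝 h₀))
    (hx : Tendsto x l (𝓝 x₀)) : Tendsto (fun i => act (h i) (x i)) l (𝓝 (act h₀ x₀)) :=
  (tendsto_clm_apply ((continuous_fst.tendsto _).comp hh) hx).add
    ((continuous_snd.tendsto _).comp hh)

theorem tendsto_pull {h : ι → Aff d} {h₀ : Aff d} {x : ι → E d} {x₀ : E d}
    (hh : Tendsto h l (𝓝 h₀)) (hx : Tendsto x l (𝓝 x₀)) :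
    Tendsto (fun i => inv (h i).1 (x i - (h i).2)) l (𝓝 (inv h₀.1 (x₀ - h₀.2))) :=
  tendsto_clm_apply ((continuous_inv.tendsto _).comp ((continuous_fst.tendsto _).comp hh))
    (hx.sub ((continuous_snd.tendsto _).comp hh))

end Limits

section Sequence

variable {γ : ℕ → Aff d × Aff d} {x₁ x₂ : ℕ → E d} {V : Set (E d × E d)}

/-- A sequence of pairs of almost touching points of the bodies, in configurations that converge to
`g₀`. -/
structure IsAlmostContact (B₁ B₂ : Set (E d)) (g₀ : Aff d × Aff d) (γ : ℕ → Aff d × Aff d)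
    (x₁ x₂ : ℕ → E d) : Prop where
  tendsto : Tendsto γ atTop (𝓝 g₀)
  mem : ∀ k, γ k ∈ GG d
  mem₁ : ∀ k, x₁ k ∈ B₁
  mem₂ : ∀ k, x₂ k ∈ B₂
  dist : Tendsto (fun k => act (γ k).2 (x₂ k) - act (γ k).1 (x₁ k)) atTop (𝓝 0)

theorem IsAlmostContact.comp (h : IsAlmostContact B₁ B₂ g₀ γ x₁ x₂) {φ : ℕ → ℕ}
    (hφ : Tendsto φ atTop atTop) : IsAlmostContact B₁ B₂ g₀ (γ ∘ φ) (x₁ ∘ φ) (x₂ ∘ φ) :=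
  ⟨h.tendsto.comp hφ, fun _ => h.mem _, fun _ => h.mem₁ _, fun _ => h.mem₂ _, h.dist.comp hφ⟩

/-- Otherwise a subsequence would converge to a contact in the limit configuration, that is to (b₁,
b₂), although the pairs stay outside a neighbourhood of it. -/
theorem IsAlmostContact.not_bounded (h : IsAlmostContact B₁ B₂ g₀ γ x₁ x₂) (hB₁ : IsClosed B₁)
    (hB₂ : IsClosed B₂)
    (huniq : ∀ x₁ ∈ B₁, ∀ x₂ ∈ B₂, act g₀.1 x₁ = act g₀.2 x₂ → x₁ = b₁ ∧ x₂ = b₂)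
    (hV : V ∈ 𝓝 (b₁, b₂)) (hnV : ∀ k, (x₁ k, x₂ k) ∉ V) {R : ℝ} : ∀ᶠ k in atTop, R < ‖x₁ k‖ := by
  by_contra hfreq
  have hfreq' : ∃ᶠ k in atTop, x₁ k ∈ Metric.closedBall (0 : E d) R :=
    (not_eventually.1 hfreq).mono fun k hk => by simpa using hk
  obtain ⟨a, -, φ, hφ, ha⟩ := (isCompact_closedBall (0 : E d) R).tendsto_subseq' hfreq'
  have h' := h.comp hφ.tendsto_atTop
  have hg₀ : g₀ ∈ GG d := isClosed_GG.mem_of_tendsto h.tendsto (Eventually.of_forall h.mem)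
  have hγ₁ : Tendsto (fun k => (γ (φ k)).1) atTop (𝓝 g₀.1) := (continuous_fst.tendsto _).comp h'.tendsto
  have hγ₂ : Tendsto (fun k => (γ (φ k)).2) atTop (𝓝 g₀.2) := (continuous_snd.tendsto _).comp h'.tendsto
  have h1 : Tendsto (fun k => act (γ (φ k)).1 (x₁ (φ k))) atTop (𝓝 (act g₀.1 a)) :=
    tendsto_act hγ₁ ha
  have h2 : Tendsto (fun k => act (γ (φ k)).2 (x₂ (φ k))) atTop (𝓝 (act g₀.1 a)) := by
    have := h'.dist.add h1
    rw [zero_add] at this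
    exact this.congr fun k => sub_add_cancel _ _
  have h3 : Tendsto (fun k => x₂ (φ k)) atTop (𝓝 (inv g₀.2.1 (act g₀.1 a - g₀.2.2))) :=
    (tendsto_pull hγ₂ h2).congr fun k => inv_act_eq (h.mem _).2 rfl
  obtain ⟨e₁, e₂⟩ := huniq a (hB₁.mem_of_tendsto ha (Eventually.of_forall fun k => h.mem₁ _)) _
    (hB₂.mem_of_tendsto h3 (Eventually.of_forall fun k => h.mem₂ _)) (act_inv_act hg₀.2 _).symm
  rw [e₂] at h3
  rw [e₁] at ha
  obtain ⟨k, hk⟩ := ((ha.prodMk_nhds h3).eventually hV).exists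
  exact hnV _ hk

theorem IsAlmostContact.swap (h : IsAlmostContact B₁ B₂ g₀ γ x₁ x₂) :
    IsAlmostContact B₂ B₁ g₀.swap (fun k => (γ k).swap) x₂ x₁ :=
  ⟨(continuous_swap.tendsto _).comp h.tendsto, fun k => swap_mem_GG (h.mem k), h.mem₂, h.mem₁, by
    have := h.dist.neg
    simpa using this⟩

/-- The limit of the directions of escaping almost touching points is a recession direction of both
bodies. -/
theorem IsAlmostContact.exists_ray (h : IsAlmostContact B₁ B₂ g₀ γ x₁ x₂) (hB₁ : IsClosed B₁)
    (hB₂ : IsClosed B₂) (hc₁ : Convex ℝ B₁) (hc₂ : Convex ℝ B₂)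
    (hinf : Tendsto (fun k => ‖x₁ k‖) atTop atTop) : ∃ θ : E d, ‖θ‖ = 1 ∧
      (∀ y ∈ B₁, y + θ ∈ B₁) ∧ ∀ y ∈ B₂, y + inv g₀.2.1 (g₀.1.1 θ) ∈ B₂ := by
  have hex : ∀ᶠ k in atTop, ‖x₁ k‖⁻¹ • x₁ k ∈ Metric.sphere (0 : E d) 1 := by
    filter_upwards [hinf.eventually_gt_atTop 0] with k hk
    simp only [mem_sphere_iff_norm, sub_zero, norm_smul, norm_inv, norm_norm]
    exact inv_mul_cancel₀ hk.ne'
  obtain ⟨θ, hθ, φ, hφ, hlim⟩ := (isCompact_sphere (0 : E d) 1).tendsto_subseq' hex.frequently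
  have h' := h.comp hφ.tendsto_atTop
  have hγ := h'.tendsto
  have hr : Tendsto (fun k => ‖x₁ (φ k)‖⁻¹) atTop (𝓝 0) :=
    tendsto_inv_atTop_zero.comp (hinf.comp hφ.tendsto_atTop)
  refine ⟨θ, by simpa using hθ, fun y hy => ?_, fun y hy => ?_⟩
  · have := ray_mem_of_tendsto hB₁ hc₁ (Eventually.of_forall h'.mem₁) hr (fun k => by positivity)
      hlim hy zero_le_one
    rwa [one_smul] at this
  · have hR₁ : Tendsto (fun k => (γ (φ k)).1.1) atTop (𝓝 g₀.1.1) :=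
      ((continuous_fst.comp continuous_fst).tendsto _).comp hγ
    have ha₁ : Tendsto (fun k => (γ (φ k)).1.2) atTop (𝓝 g₀.1.2) :=
      ((continuous_snd.comp continuous_fst).tendsto _).comp hγ
    have hR₂ : Tendsto (fun k => inv (γ (φ k)).2.1) atTop (𝓝 (inv g₀.2.1)) :=
      ((continuous_inv.comp (continuous_fst.comp continuous_snd)).tendsto _).comp hγ
    have ha₂ : Tendsto (fun k => (γ (φ k)).2.2) atTop (𝓝 g₀.2.2) :=
      ((continuous_snd.comp continuous_snd).tendsto _).comp hγ
    have h1 := tendsto_clm_apply hR₂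
      ((tendsto_clm_apply hR₁ hlim).add (hr.smul ((h'.dist.add ha₁).sub ha₂)))
    rw [zero_smul, add_zero] at h1
    have h2 : Tendsto (fun k => ‖x₁ (φ k)‖⁻¹ • x₂ (φ k)) atTop (𝓝 (inv g₀.2.1 (g₀.1.1 θ))) := by
      refine h1.congr fun k => ?_
      have h3 := SO_inv_apply (h.mem (φ k)).2 (x₂ (φ k))
      simp only [Function.comp_apply, act, map_smul, ← smul_add]
      congr 1
      refine Eq.trans ?_ h3
      congr 1
      abel
    have := ray_mem_of_tendsto hB₂ hc₂ (Eventually.of_forall h'.mem₂) hr (fun k => by positivity)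
      h2 hy zero_le_one
    rwa [one_smul] at this

/-- Escaping pairs make both bodies unbounded. By the sign of the curvature sum both are then
convex, the direction of escape is a recession direction of both, and translating the contact point
along it produces a second contact. -/
theorem IsAlmostContact.false_of_isPreconnected (hd : 1 ≤ d)
    (h : IsAlmostContact B₁ B₂ g₀ γ x₁ x₂) (hB₁ : IsBody B₁) (hB₂ : IsBody B₂)
    (hN : Nonsingular B₁ B₂) (hc₁ : IsPreconnected (frontier B₁))
    (hc₂ : IsPreconnected (frontier B₂)) (hg : g₀ ∈ M B₁ B₂) (hs : IsSolution B₁ B₂ g₀ b₁ b₂ 0)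
    (huniq : ∀ x₁ ∈ B₁, ∀ x₂ ∈ B₂, act g₀.1 x₁ = act g₀.2 x₂ → x₁ = b₁ ∧ x₂ = b₂)
    (hV : V ∈ 𝓝 (b₁, b₂)) (hnV : ∀ k, (x₁ k, x₂ k) ∉ V) : False := by
  have hu₁ : ¬ Bornology.IsBounded B₁ := by
    intro hbd
    obtain ⟨R, hR⟩ := isBounded_iff_forall_norm_le.1 hbd
    obtain ⟨k, hk⟩ := (h.not_bounded hB₁.isClosed hB₂.isClosed huniq hV hnV (R := R)).exists
    exact absurd (hR _ (h.mem₁ k)) (not_le.2 hk)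
  have hu₂ : ¬ Bornology.IsBounded B₂ := by
    intro hbd
    obtain ⟨R, hR⟩ := isBounded_iff_forall_norm_le.1 hbd
    obtain ⟨k, hk⟩ := (h.swap.not_bounded hB₂.isClosed hB₁.isClosed (b₁ := b₂) (b₂ := b₁)
      (V := Prod.swap ⁻¹' V) (fun x hx y hy hxy => (huniq y hy x hx hxy.symm).symm)
      (continuous_swap.continuousAt (x := (b₂, b₁)) hV) hnV (R := R)).exists
    exact absurd (hR _ (h.mem₂ k)) (not_le.2 hk)
  have hsum : ∀ y₁ ∈ frontier B₁, ∀ y₂ ∈ frontier B₂, maxCurv B₁ y₁ + maxCurv B₂ y₂ < 0 :=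
    fun y₁ hy₁ y₂ hy₂ => maxCurv_add_neg hd hB₁ hB₂ hN hc₁ hc₂ hg hs hy₁ hy₂
  -- A positive value at one point of the first boundary bounds the largest eigenvalue on the whole
  -- second boundary away from zero by a negative constant, and so makes the second body bounded.
  have hm₁ : ∀ y ∈ frontier B₁, maxCurv B₁ y ≤ 0 := by
    intro y hy
    by_contra hpos
    exact hu₂ (isBounded_of_maxCurv_le hd hB₂ ⟨b₂, hs.mem₂⟩ (not_le.1 hpos) fun z hz => by
      linarith [hsum y hy z hz])
  have hm₂ : ∀ y ∈ frontier B₂, maxCurv B₂ y ≤ 0 := by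
    intro y hy
    by_contra hpos
    exact hu₁ (isBounded_of_maxCurv_le hd hB₁ ⟨b₁, hs.mem₁⟩ (not_le.1 hpos) fun z hz => by
      linarith [hsum z hz y hy])
  obtain ⟨θ, hθ, hr₁, hr₂⟩ := h.exists_ray hB₁.isClosed hB₂.isClosed
    (convex_of_maxCurv_nonpos hd hB₁ hm₁) (convex_of_maxCurv_nonpos hd hB₂ hm₂)
    (tendsto_atTop.2 fun R => (h.not_bounded hB₁.isClosed hB₂.isClosed huniq hV hnV (R := R)).mono
      fun k hk => hk.le)
  have hgG := M_subset_GG hg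
  have hact : act g₀.2 b₂ = act g₀.1 b₁ := by simpa using hs.act_eq
  have := (huniq _ (hr₁ b₁ (hB₁.isClosed.frontier_subset hs.mem₁)) _
    (hr₂ b₂ (hB₂.isClosed.frontier_subset hs.mem₂)) (by
      have e₁ : act g₀.1 (b₁ + θ) = act g₀.1 b₁ + g₀.1.1 θ := by simp only [act, map_add]; abel
      have e₂ : act g₀.2 (b₂ + inv g₀.2.1 (g₀.1.1 θ)) = act g₀.2 b₂ + g₀.1.1 θ := by
        simp only [act, map_add, SO_apply_inv hgG.2]; abel
      rw [e₁, e₂, hact])).1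
  rw [add_eq_left] at this
  rw [this, norm_zero] at hθ
  exact zero_ne_one hθ

end Sequence

/-- In configurations near `g₀`, almost touching points of the bodies are close to the unique points
of contact in the configuration `g₀`. -/
theorem exists_eventually_near_contact (hd : 1 ≤ d) (hB₁ : IsBody B₁) (hB₂ : IsBody B₂)
    (hN : Nonsingular B₁ B₂) (hg : g₀ ∈ M B₁ B₂) (hs : IsSolution B₁ B₂ g₀ b₁ b₂ 0)
    (huniq : ∀ x₁ ∈ B₁, ∀ x₂ ∈ B₂, act g₀.1 x₁ = act g₀.2 x₂ → x₁ = b₁ ∧ x₂ = b₂)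
    {V : Set (E d × E d)} (hV : V ∈ 𝓝 (b₁, b₂)) : ∃ ε > 0, ∀ᶠ g in 𝓝 g₀, g ∈ GG d →
      ∀ x₁ ∈ B₁, ∀ x₂ ∈ B₂, ‖act g.2 x₂ - act g.1 x₁‖ ≤ ε → (x₁, x₂) ∈ V := by
  by_contra! hcon
  have hex : ∀ k : ℕ, ∃ g : Aff d × Aff d, ∃ x₁ x₂ : E d, dist g g₀ < 1 / ((k : ℝ) + 1) ∧ g ∈ GG d ∧
      x₁ ∈ B₁ ∧ x₂ ∈ B₂ ∧ ‖act g.2 x₂ - act g.1 x₁‖ ≤ 1 / ((k : ℝ) + 1) ∧ (x₁, x₂) ∉ V := by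
    intro k
    have hk : (0 : ℝ) < 1 / ((k : ℝ) + 1) := Nat.one_div_pos_of_nat
    obtain ⟨g, ⟨hgG, x₁, hx₁, x₂, hx₂, h1, h2⟩, h3⟩ :=
      ((hcon _ hk).and_eventually (Metric.ball_mem_nhds g₀ hk)).exists
    exact ⟨g, x₁, x₂, h3, hgG, hx₁, hx₂, h1, h2⟩
  choose γ x₁ x₂ hγ hγG hx₁ hx₂ hdist hnV using hex
  -- The filled bodies have connected boundaries and contain the original ones, so almost touching
  -- points of the latter remain almost touching points.
  obtain ⟨C₁, C₂, h₁, h₂, hgC, hsC⟩ := exists_fill hB₁ hB₂ hg hs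
  have hac : IsAlmostContact C₁ C₂ g₀ γ x₁ x₂ := by
    refine ⟨tendsto_iff_dist_tendsto_zero.2 (squeeze_zero (fun _ => dist_nonneg)
      (fun k => (hγ k).le) tendsto_one_div_add_atTop_nhds_zero_nat), hγG,
      fun k => h₁.subset (hx₁ k), fun k => h₂.subset (hx₂ k), ?_⟩
    exact squeeze_zero_norm hdist tendsto_one_div_add_atTop_nhds_zero_nat
  refine hac.false_of_isPreconnected hd h₁.isBody h₂.isBody (hN.fill hB₁ hB₂ h₁ h₂)
    h₁.isPreconnected h₂.isPreconnected hgC hsC (fun y₁ hy₁ y₂ hy₂ hy => ?_) hV hnV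
  -- A contact of the filled bodies takes place at boundary points, and these belong to the original
  -- bodies; so the contact is still unique.
  have hys := isSolution_of_contact h₁.isBody h₂.isBody hgC hy₁ hy₂ hy
  exact huniq y₁ (hB₁.isClosed.frontier_subset (h₁.mem_frontier _ hys.mem₁)) y₂
    (hB₂.isClosed.frontier_subset (h₂.mem_frontier _ hys.mem₂)) hy

end

section

/-! ### The local structure of the configuration space at a collision -/

variable {d : ℕ} {B B' B₁ B₂ U : Set (E d)} {f : E d → ℝ} {b b₁ b₂ z : E d} {q : Amb d}
  {g g₀ : Aff d × Aff d}

theorem eventually_no_contact {K : Set (E d × E d)} (hK : IsCompact K)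
    (h : ∀ x ∈ K, act g.1 x.1 ≠ act g.2 x.2) :
    ∀ᶠ g' in 𝓝 g, ∀ x ∈ K, act g'.1 x.1 ≠ act g'.2 x.2 := by
  refine hK.eventually_forall_of_forall_eventually fun x hx => ?_
  have h1 : Tendsto (fun p : (Aff d × Aff d) × E d × E d => act p.1.1 p.2.1) (𝓝 (g, x))
      (𝓝 (act g.1 x.1)) := tendsto_act
    ((continuous_fst.comp continuous_fst).tendsto (g, x))
    ((continuous_fst.comp continuous_snd).tendsto (g, x))
  have h2 : Tendsto (fun p : (Aff d × Aff d) × E d × E d => act p.1.2 p.2.2) (𝓝 (g, x))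
      (𝓝 (act g.2 x.2)) := tendsto_act
    ((continuous_snd.comp continuous_fst).tendsto (g, x))
    ((continuous_snd.comp continuous_snd).tendsto (g, x))
  exact ((h1.sub h2).eventually_ne (sub_ne_zero.2 (h x hx))).mono fun p hp => sub_ne_zero.1 hp

theorem mem_M₀_iff : g ∈ M₀ B₁ B₂ ↔
    g ∈ GG d ∧ ∀ x₁ ∈ B₁, ∀ x₂ ∈ B₂, act g.1 x₁ ≠ act g.2 x₂ := by
  refine and_congr_right fun _ => ?_
  rw [Set.disjoint_left]
  constructor
  · intro h x₁ hx₁ x₂ hx₂ hx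
    exact h (mem_image_of_mem _ hx₁) (hx ▸ mem_image_of_mem _ hx₂)
  · rintro h _ ⟨x₁, hx₁, rfl⟩ ⟨x₂, hx₂, hx⟩
    exact h x₁ hx₁ x₂ hx₂ hx.symm

/-- If the bodies meet now, but not after the second one has been moved along `T • u`, then there is
a last instant at which they meet. -/
theorem exists_last_contact {K : Set (E d × E d)} (hK : IsCompact K)
    (hg : g ∈ GG d) {u : E d} {T : ℝ} (hT : 0 ≤ T)
    (hloc : ∀ t ∈ Icc 0 T, ∀ x₁ ∈ B₁, ∀ x₂ ∈ B₂,
      act (shift g u t).1 x₁ = act (shift g u t).2 x₂ → (x₁, x₂) ∈ K)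
    (hend : ∀ x ∈ K, act (shift g u T).1 x.1 ≠ act (shift g u T).2 x.2)
    (h0 : ∃ x ∈ K, act g.1 x.1 = act g.2 x.2) :
    ∃ t ∈ Icc 0 T, shift g u t ∈ M B₁ B₂ ∧
      ∃ x ∈ K, act (shift g u t).1 x.1 = act (shift g u t).2 x.2 := by
  set J : Set ℝ := Icc 0 T ∩ {t | ∃ x ∈ K, act (shift g u t).1 x.1 = act (shift g u t).2 x.2} with hJ
  have hJc : IsCompact J := by
    refine isCompact_Icc.inter_right (isOpen_compl_iff.1 (isOpen_iff_mem_nhds.2 fun t ht => ?_))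
    have h1 : ∀ x ∈ K, act (shift g u t).1 x.1 ≠ act (shift g u t).2 x.2 := fun x hx hx' =>
      ht ⟨x, hx, hx'⟩
    filter_upwards [(continuous_shift g u).continuousAt.eventually (eventually_no_contact hK h1)]
      with t' ht'
    rintro ⟨x, hx, hx'⟩
    exact ht' x hx hx'
  obtain ⟨t, ⟨ht, x, hx, hxt⟩, hmax⟩ := hJc.exists_isGreatest ⟨0, left_mem_Icc.2 hT, by
    rw [mem_ofPred_eq, shift_zero]; exact h0⟩
  have htT : t < T := lt_of_le_of_ne ht.2 (by rintro rfl; exact hend x hx hxt)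
  refine ⟨t, ht, ?_, x, hx, hxt⟩
  refine mem_closure_of_tendsto (((continuous_shift g u).tendsto t).mono_left
    (nhdsWithin_le_nhds (s := Ioi t))) ?_
  filter_upwards [Ioo_mem_nhdsGT htT] with τ hτ
  refine mem_M₀_iff.2 ⟨shift_mem_GG hg u τ, fun x₁ hx₁ x₂ hx₂ hx12 => ?_⟩
  have hτI : τ ∈ Icc 0 T := ⟨ht.1.trans hτ.1.le, hτ.2.le⟩
  exact absurd (hmax ⟨hτI, (x₁, x₂), hloc τ hτI x₁ hx₁ x₂ hx₂ hx12, hx12⟩) (not_le.2 hτ.1)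

theorem not_mem_M_of_interior_of_mem (hB₁ : IsBody B₁) (hg : g ∈ GG d) {y₁ y₂ : E d}
    (h₁ : y₁ ∈ B₁) (h₂ : y₂ ∈ interior B₂) (h : act g.1 y₁ = act g.2 y₂) : g ∉ M B₁ B₂ := by
  by_cases hi : y₁ ∈ interior B₁
  · exact not_mem_M_of_overlap hg hi h₂ h
  · rw [← M_swap]
    exact not_mem_M_of_mem_interior hB₁ (swap_mem_GG hg) h₂ ⟨subset_closure h₁, hi⟩ h.symm

/-- Moving the bodies apart along the contact normal removes the contact. -/
theorem exists_no_contact_shift (hB₁ : IsBody B₁) (hB₂ : IsBody B₂) (hg : g ∈ M B₁ B₂)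
    (hs : IsSolution B₁ B₂ g b₁ b₂ 0) : ∃ ρ > 0, ∀ T ∈ Ioo 0 ρ, ∀ x₁ ∈ B₁, ∀ x₂ ∈ B₂,
      dist x₂ b₂ < ρ → act (shift g (g.1.1 (normal B₁ b₁)) T).1 x₁ ≠
        act (shift g (g.1.1 (normal B₁ b₁)) T).2 x₂ := by
  have hgG := M_subset_GG hg
  obtain ⟨U, f, h, hbU⟩ := hB₂.exists_chart hs.mem₂
  have h0 := (h.mem_frontier_iff hbU).1 hs.mem₂
  set n := normal B₂ b₂ with hn
  have hn1 : ‖n‖ = 1 := hB₂.norm_normal hs.mem₂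
  have hpos : 0 < ⟪gradient f b₂, n⟫_ℝ := by
    rw [gradient_eq_norm_smul (h.grad_ne _ hbU), hn, h.normal_eq hbU h0, inner_smul_left,
      real_inner_self_eq_norm_sq, norm_unitGrad (h.grad_ne _ hbU)]
    simpa using h.grad_ne _ hbU
  obtain ⟨r, hr, hrV⟩ := Metric.mem_nhds_iff.1 (inter_mem (h.isOpen.mem_nhds hbU)
    (eventually_inner_gradient_pos (h.contDiffAt hbU) hpos))
  refine ⟨r / 2, by positivity, fun T hT x₁ hx₁ x₂ hx₂ hd hcon => ?_⟩
  have hin : ∀ t ∈ Icc 0 T, x₂ - T • n + t • n ∈ Metric.ball b₂ r := by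
    intro t ht
    rw [Metric.mem_ball]
    have h1 : dist (x₂ - T • n + t • n) x₂ = T - t := by
      rw [dist_eq_norm, show x₂ - T • n + t • n - x₂ = (t - T) • n by module, norm_smul, hn1,
        mul_one, Real.norm_eq_abs, abs_sub_comm, abs_of_nonneg (by linarith [ht.2])]
    have h2 := dist_triangle (x₂ - T • n + t • n) x₂ b₂
    linarith [ht.1, hT.2]
  have hx₂U : x₂ ∈ U := (hrV (Metric.ball_subset_ball (by linarith) hd)).1
  have hlt := lt_of_inner_gradient_pos hT.1 (fun t ht => (hrV (hin t ht)).2.1)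
    (fun t ht => (hrV (hin t ht)).2.2)
  rw [sub_add_cancel] at hlt
  have hyU : x₂ - T • n ∈ U := by
    have := (hrV (hin 0 (left_mem_Icc.2 hT.1.le))).1
    rwa [zero_smul, add_zero] at this
  -- A contact that survives the shift by T would, in the unshifted configuration, be a contact of
  -- x₁ with x₂ - Tn, which is interior to the second body.
  have hint : x₂ - T • n ∈ interior B₂ :=
    (h.mem_interior_iff hyU).2 (hlt.trans_le ((h.mem_iff _ hx₂U).1 hx₂))
  refine not_mem_M_of_interior_of_mem hB₁ hgG hx₁ hint ?_ hg
  rw [act_shift] at hcon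
  have hnn : g.1.1 (normal B₁ b₁) = -g.2.1 n := by rw [hs.normal_eq, neg_neg]
  change act g.1 x₁ = _ at hcon
  rw [hcon, hnn]
  simp only [act, map_sub, map_smul]
  module

/-- B avoids the open ball around a through the nearest point. Hence that point is on the boundary,
and comparing unit gradients of the ball and the chart shows that a lies on the outward normal. -/
theorem nearest_point (hB : IsBody B) {h : Aff d} (hh : h.1 ∈ SO d) {y a : E d} (hy : y ∈ B)
    (hne : a ≠ act h y) (hmin : ∀ y' ∈ B, ‖a - act h y‖ ≤ ‖a - act h y'‖) :
    y ∈ frontier B ∧ a = act h y + ‖a - act h y‖ • h.1 (normal B y) := by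
  set r := ‖a - act h y‖ with hr
  have hr0 : 0 < r := norm_pos_iff.2 (sub_ne_zero.2 hne)
  set N : E d → ℝ := fun y => ‖y‖ ^ 2 - r ^ 2 with hN
  have hNs : ∀ x, ContDiffAt ℝ ∞ N x := fun x => ((contDiff_norm_sq ℝ).sub contDiff_const).contDiffAt
  set k : E d → ℝ := fun y => N (h.1 y + (h.2 - a)) with hk
  have hkc : ContDiffAt ℝ ∞ k y := contDiffAt_pull (hNs _)
  have hsub : ∀ y, h.1 y + (h.2 - a) = act h y - a := fun y => by simp only [act]; abel
  have hkg : gradient k y = (2 : ℝ) • inv h.1 (act h y - a) := by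
    rw [hk, gradient_pull ((hNs _).differentiableAt (by simp)), gradient_normSq, map_smul, hsub]
  have hk0 : k y = 0 := by simp only [hk, hN, hsub, hr, norm_sub_rev a, sub_self]
  have hkB : ∀ y' ∈ B, 0 ≤ k y' := by
    intro y' hy'
    simp only [hk, hN, hsub, sub_nonneg]
    rw [norm_sub_rev]
    exact pow_le_pow_left₀ hr0.le (hmin y' hy') 2
  have hngk : ‖inv h.1 (act h y - a)‖ = r := by rw [SO_inv_norm hh, hr, norm_sub_rev]
  have hgk : gradient k y ≠ 0 := by
    rw [hkg]
    exact smul_ne_zero two_ne_zero (norm_pos_iff.1 (hngk ▸ hr0))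
  have hyf : y ∈ frontier B := by
    refine ⟨subset_closure hy, fun hi => hgk ?_⟩
    have hloc : IsLocalMin k y := by
      filter_upwards [mem_interior_iff_mem_nhds.1 hi] with y' hy'
      rw [hk0]; exact hkB y' hy'
    refine ext_inner_right ℝ fun v => ?_
    rw [← fderiv_eq_inner, hloc.fderiv_eq_zero]; simp
  refine ⟨hyf, ?_⟩
  obtain ⟨U, f, hc, hyU⟩ := hB.exists_chart hyf
  have hf0 := (hc.mem_frontier_iff hyU).1 hyf
  have hopp := unit_gradient_opposite (hc.contDiffAt hyU) hkc hf0 hk0 (hc.grad_ne y hyU) hgk (by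
    filter_upwards [hc.isOpen.mem_nhds hyU] with y' hy'
    rintro ⟨h1, h2⟩
    exact absurd (hkB y' ((hc.mem_iff y' hy').2 h1.le)) (not_le.2 h2))
  have hnorm : normal B y = ‖gradient f y‖⁻¹ • gradient f y := hc.normal_eq hyU hf0
  rw [← hnorm, hkg, norm_smul, hngk, Real.norm_eq_abs, abs_two, smul_smul] at hopp
  have h3 : normal B y = r⁻¹ • inv h.1 (a - act h y) := by
    rw [← neg_neg (normal B y), ← hopp, ← smul_neg, ← map_neg, neg_sub]
    congr 1
    field_simp
  rw [h3, map_smul, SO_apply_inv hh, smul_smul, mul_inv_cancel₀ hr0.ne', one_smul]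
  abel

theorem isSolution_of_nearest (hB₁ : IsBody B₁) (hB₂ : IsBody B₂) (hg : g ∈ GG d) {x₁ x₂ : E d}
    (hx₁ : x₁ ∈ B₁) (hx₂ : x₂ ∈ B₂) (hne : act g.1 x₁ ≠ act g.2 x₂)
    (hmin : ∀ y₁ ∈ B₁, ∀ y₂ ∈ B₂, ‖act g.2 x₂ - act g.1 x₁‖ ≤ ‖act g.2 y₂ - act g.1 y₁‖) :
    IsSolution B₁ B₂ g x₁ x₂ ‖act g.2 x₂ - act g.1 x₁‖ := by
  obtain ⟨h1, h2⟩ := nearest_point hB₁ hg.1 hx₁ hne.symm (fun y hy => hmin y hy x₂ hx₂)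
  obtain ⟨h3, h4⟩ := nearest_point hB₂ hg.2 hx₂ hne (fun y hy => by
    rw [norm_sub_rev, norm_sub_rev (act g.1 x₁)]; exact hmin x₁ hx₁ y hy)
  refine ⟨h1, h3, h2, ?_⟩
  rw [norm_sub_rev] at h4
  have hr : ‖act g.2 x₂ - act g.1 x₁‖ ≠ 0 := norm_ne_zero_iff.2 (sub_ne_zero.2 hne.symm)
  refine smul_right_injective _ hr ?_
  have e1 : ‖act g.2 x₂ - act g.1 x₁‖ • g.2.1 (normal B₂ x₂) = act g.1 x₁ - act g.2 x₂ :=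
    eq_sub_of_add_eq' h4.symm
  have e2 : ‖act g.2 x₂ - act g.1 x₁‖ • g.1.1 (normal B₁ x₁) = act g.2 x₂ - act g.1 x₁ :=
    eq_sub_of_add_eq' h2.symm
  dsimp only
  rw [smul_neg, e1, e2, neg_sub]

end

/-! ### Collision charts: the signed gap near a collision -/

section

variable {d : ℕ} {B₁ B₂ : Set (E d)} {b₁ b₂ : E d} {q : Amb d} {g g₀ : Aff d × Aff d}
  {O : Set (Aff d × Aff d)} {β : Aff d × Aff d → E d × E d × ℝ}

/-- Near the collision configuration `g₀` the bodies have a smooth pair of nearest points `(β g).1`,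
`(β g).2.1`, with a signed distance `(β g).2.2`. -/
structure IsCollisionChart (B₁ B₂ : Set (E d)) (g₀ : Aff d × Aff d) (O : Set (Aff d × Aff d))
    (β : Aff d × Aff d → E d × E d × ℝ) : Prop where
  isOpen : IsOpen O
  mem : g₀ ∈ O
  smooth : ContDiffOn ℝ ∞ β O
  gap_eq : (β g₀).2.2 = 0
  solves : ∀ g ∈ GG d, g ∈ O → IsSolution B₁ B₂ g (β g).1 (β g).2.1 (β g).2.2
  unique : ∃ N ∈ 𝓝 (β g₀), ∀ g ∈ GG d, g ∈ O → ∀ p ∈ N, IsSolution B₁ B₂ g p.1 p.2.1 p.2.2 → p = β g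
  eventually_shift : ∀ g ∈ GG d, g ∈ O → ∀ᶠ t in 𝓝 (0 : ℝ),
    β (shift g (g.1.1 (normal B₁ (β g).1)) t) = ((β g).1, (β g).2.1, (β g).2.2 + t)
  not_mem : ∀ g ∈ GG d, g ∈ O → (β g).2.2 < 0 → g ∉ M B₁ B₂
  mem₀ : ∀ g ∈ GG d, g ∈ O → 0 < (β g).2.2 → g ∈ M₀ B₁ B₂
  nearest : ∀ g ∈ GG d, g ∈ O → 0 < (β g).2.2 → ∀ x₁ ∈ B₁, ∀ x₂ ∈ B₂,
    ‖act g.2 x₂ - act g.1 x₁‖ ≤ (β g).2.2 → x₁ = (β g).1 ∧ x₂ = (β g).2.1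
  contact : ∀ g ∈ M B₁ B₂, g ∈ O → ∀ x₁ ∈ B₁, ∀ x₂ ∈ B₂, act g.1 x₁ = act g.2 x₂ →
    x₁ = (β g).1 ∧ x₂ = (β g).2.1

theorem dist_shift (g : Aff d × Aff d) {u : E d} (hu : ‖u‖ = 1) (t : ℝ) :
    dist (shift g u t) g = |t| := by
  simp [shift, Prod.dist_eq, norm_smul, hu]

theorem exists_closest_pair (hB₁ : IsClosed B₁) (hB₂ : IsClosed B₂)
    {K : Set (E d × E d)} (hK : IsCompact K) {ε : ℝ}
    (hloc : ∀ x₁ ∈ B₁, ∀ x₂ ∈ B₂, ‖act g.2 x₂ - act g.1 x₁‖ ≤ ε → (x₁, x₂) ∈ K) {x₁ x₂ : E d}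
    (hx₁ : x₁ ∈ B₁) (hx₂ : x₂ ∈ B₂) (hx : ‖act g.2 x₂ - act g.1 x₁‖ ≤ ε) :
    ∃ y₁ ∈ B₁, ∃ y₂ ∈ B₂, ∀ z₁ ∈ B₁, ∀ z₂ ∈ B₂,
      ‖act g.2 y₂ - act g.1 y₁‖ ≤ ‖act g.2 z₂ - act g.1 z₁‖ := by
  have hcont : Continuous (fun x : E d × E d => ‖act g.2 x.2 - act g.1 x.1‖) :=
    ((((g.2.1.continuous.comp continuous_snd).add continuous_const).sub
      ((g.1.1.continuous.comp continuous_fst).add continuous_const))).norm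
  obtain ⟨⟨y₁, y₂⟩, ⟨-, hy₁, hy₂⟩, hmin⟩ := (hK.inter_right
    (hB₁.prod hB₂)).exists_isMinOn ⟨(x₁, x₂), hloc x₁ hx₁ x₂ hx₂ hx, hx₁, hx₂⟩
    hcont.continuousOn
  have hmin' : ∀ z₁ ∈ B₁, ∀ z₂ ∈ B₂, (z₁, z₂) ∈ K →
      ‖act g.2 y₂ - act g.1 y₁‖ ≤ ‖act g.2 z₂ - act g.1 z₁‖ := fun z₁ hz₁ z₂ hz₂ hz =>
    isMinOn_iff.1 hmin (z₁, z₂) ⟨hz, hz₁, hz₂⟩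
  refine ⟨y₁, hy₁, y₂, hy₂, fun z₁ hz₁ z₂ hz₂ => ?_⟩
  have hyx := hmin' x₁ hx₁ x₂ hx₂ (hloc x₁ hx₁ x₂ hx₂ hx)
  by_contra! hlt
  exact absurd (hmin' z₁ hz₁ z₂ hz₂ (hloc z₁ hz₁ z₂ hz₂ (hlt.le.trans (hyx.trans hx))))
    (not_le.2 hlt)

/-- The absence of contacts in a compact set after a shift along the normal is an open condition. -/
theorem eventually_no_contact_shift (hB₁ : IsBody B₁) {O : Set (Aff d × Aff d)}
    {β : Aff d × Aff d → E d} (hβ : ContinuousAt β g₀) (hO : O ∈ 𝓝 g₀)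
    (hmem : ∀ g ∈ GG d, g ∈ O → β g ∈ frontier B₁) (hg₀ : g₀ ∈ GG d) {K : Set (E d × E d)}
    (hK : IsCompact K) {T : ℝ}
    (h : ∀ x ∈ K, act (shift g₀ (g₀.1.1 (normal B₁ (β g₀))) T).1 x.1 ≠
      act (shift g₀ (g₀.1.1 (normal B₁ (β g₀))) T).2 x.2) :
    ∀ᶠ g in 𝓝 g₀, g ∈ GG d → ∀ x ∈ K, act (shift g (g.1.1 (normal B₁ (β g))) T).1 x.1 ≠
      act (shift g (g.1.1 (normal B₁ (β g))) T).2 x.2 := by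
  have hb := hmem g₀ hg₀ (mem_of_mem_nhds hO)
  obtain ⟨U, f, hc, hbU⟩ := hB₁.exists_chart hb
  have hn : ∀ y ∈ U, y ∈ frontier B₁ → normal B₁ y = unitGrad f y := fun y hy hyf =>
    hc.normal_eq hy ((hc.mem_frontier_iff hy).1 hyf)
  rw [hn _ hbU hb] at h
  have h1 : Tendsto (fun g => unitGrad f (β g)) (𝓝 g₀) (𝓝 (unitGrad f (β g₀))) :=
    (contDiffAt_unitGrad (hc.contDiffAt hbU) (hc.grad_ne _ hbU)).continuousAt.tendsto.comp
      hβ.tendsto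
  have h2 : Tendsto (fun g : Aff d × Aff d => g.1.1) (𝓝 g₀) (𝓝 g₀.1.1) :=
    (continuous_fst.comp continuous_fst).tendsto g₀
  have h3 : Tendsto (fun g : Aff d × Aff d => shift g (g.1.1 (unitGrad f (β g))) T) (𝓝 g₀)
      (𝓝 (shift g₀ (g₀.1.1 (unitGrad f (β g₀))) T)) :=
    (continuous_fst.tendsto g₀).prodMk_nhds
      (((continuous_fst.comp continuous_snd).tendsto g₀).prodMk_nhds
        (((continuous_snd.comp continuous_snd).tendsto g₀).add
          ((tendsto_clm_apply h2 h1).const_smul T)))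
  filter_upwards [h3.eventually (eventually_no_contact hK h), hO,
    hβ.eventually (hc.isOpen.mem_nhds hbU)] with g hg hgO hgU hgG
  rw [hn _ hgU (hmem g hgG hgO)]
  exact hg

/-- The local solution at the contact is combined with the control of almost touching points: near
g₀ every contact or nearest pair lies in one compact set near (b₁, b₂). Such pairs solve the contact
equations, so local uniqueness identifies them with β. -/
theorem exists_collisionChart (hd : 1 ≤ d) (hB₁ : IsBody B₁) (hB₂ : IsBody B₂)
    (hN : Nonsingular B₁ B₂) (hg₀ : g₀ ∈ M B₁ B₂) (hs : IsSolution B₁ B₂ g₀ b₁ b₂ 0)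
    (huniq : ∀ x₁ ∈ B₁, ∀ x₂ ∈ B₂, act g₀.1 x₁ = act g₀.2 x₂ → x₁ = b₁ ∧ x₂ = b₂) :
    ∃ O β, IsCollisionChart B₁ B₂ g₀ O β ∧ (β g₀).1 = b₁ ∧ (β g₀).2.1 = b₂ := by
  have hg₀G := M_subset_GG hg₀
  obtain ⟨q₀, hq₀, hΨ, hq₁, hq₂, hgap⟩ := exists_lift hd hB₁ hg₀G hs le_rfl
  have hunit : IsUnit (combined B₁ B₂ q₀) := by
    rw [combined_of_gap_eq_zero hgap]; exact hN q₀ ⟨hq₀, hgap⟩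
  obtain ⟨O₁, β, N, hL⟩ := exists_localSolution hB₁ hB₂ hq₀ hunit
  have hbase := hL.base
  have hnhds := hL.nhds
  have hmem := hL.mem
  rw [hΨ, hq₁, hq₂, hgap] at hbase
  rw [hq₁, hq₂, hgap] at hnhds
  rw [hΨ] at hmem
  have hβc : ContinuousAt β g₀ := hL.smooth.continuousOn.continuousAt (hL.isOpen.mem_nhds hmem)
  obtain ⟨r₀, hr₀, hr₀N⟩ := Metric.mem_nhds_iff.1 hnhds
  obtain ⟨ρ₁, hρ₁, hno⟩ := exists_no_contact_shift hB₁ hB₂ hg₀ hs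
  set ρ := min r₀ ρ₁ / 2 with hρ
  have hρ0 : 0 < ρ := by positivity
  have hρr : ρ < r₀ := by have := min_le_left r₀ ρ₁; linarith
  have hρρ : ρ < ρ₁ := by have := min_le_right r₀ ρ₁; linarith
  -- almost touching points
  obtain ⟨ε, hε, hev⟩ := exists_eventually_near_contact hd hB₁ hB₂ hN hg₀ hs huniq
    (Metric.ball_mem_nhds (b₁, b₂) hρ0)
  obtain ⟨r₁, hr₁, hr₁O⟩ := Metric.mem_nhds_iff.1 (inter_mem (hL.isOpen.mem_nhds hmem) hev)
  -- Small enough that shifts by at most T stay where almost touching points are controlled and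
  -- where the solution is unique, and that the shift by exactly T removes the contacts near (b₁,
  -- b₂).
  set T := min r₁ ρ / 2 with hTdef
  have hT0 : 0 < T := by positivity
  have hTr : T ≤ r₁ / 2 := by have := min_le_left r₁ ρ; linarith
  have hTρ : T ≤ ρ / 2 := by have := min_le_right r₁ ρ; linarith
  set K : Set (E d × E d) := Metric.closedBall (b₁, b₂) ρ ∩ B₁ ×ˢ B₂ with hK
  have hKc : IsCompact K :=
    (isCompact_closedBall _ _).inter_right (hB₁.isClosed.prod hB₂.isClosed)
  have hKloc : ∀ g ∈ GG d, g ∈ Metric.ball g₀ r₁ → ∀ x₁ ∈ B₁, ∀ x₂ ∈ B₂,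
      ‖act g.2 x₂ - act g.1 x₁‖ ≤ ε → (x₁, x₂) ∈ K := fun g hg hgr x₁ hx₁ x₂ hx₂ hx =>
    ⟨Metric.ball_subset_closedBall ((hr₁O hgr).2 hg x₁ hx₁ x₂ hx₂ hx), hx₁, hx₂⟩
  have hKN : ∀ x ∈ K, ∀ s : ℝ, |s| < r₀ → (x.1, x.2, s) ∈ N := by
    intro x hx s hs'
    refine hr₀N ?_
    have h1 : dist x (b₁, b₂) ≤ ρ := hx.1
    rw [Prod.dist_eq, max_le_iff] at h1
    simp only [Metric.mem_ball, Prod.dist_eq, max_lt_iff]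
    exact ⟨h1.1.trans_lt hρr, h1.2.trans_lt hρr, by simpa [Real.dist_eq] using hs'⟩
  -- the end configuration of the shift
  have hβ₁ : ContinuousAt (fun g => (β g).1) g₀ := hβc.fst
  have hend : ∀ᶠ g in 𝓝 g₀, g ∈ GG d →
      ∀ x ∈ K, act (shift g (g.1.1 (normal B₁ (β g).1)) T).1 x.1 ≠
        act (shift g (g.1.1 (normal B₁ (β g).1)) T).2 x.2 := by
    refine eventually_no_contact_shift hB₁ hβ₁ (hL.isOpen.mem_nhds hmem)
      (fun g hg hgO => (hL.solves g hg hgO).mem₁) hg₀G hKc fun x hx => ?_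
    rw [hbase]
    have h1 : dist x (b₁, b₂) ≤ ρ := hx.1
    rw [Prod.dist_eq, max_le_iff] at h1
    exact hno T ⟨hT0, by linarith⟩ x.1 hx.2.1 x.2 hx.2.2 (h1.2.trans_lt hρρ)
  have hβN : ∀ᶠ g in 𝓝 g₀, dist (β g) (b₁, b₂, 0) < min ρ ε / 2 := by
    have h1 : Metric.ball (b₁, b₂, (0 : ℝ)) (min ρ ε / 2) ∈ 𝓝 (β g₀) := by
      rw [hbase]; exact Metric.ball_mem_nhds _ (by positivity)
    exact hβc.eventually h1
  have hneg : ∀ᶠ g in 𝓝 g₀, ∀ k ∈ GG d, ∀ b₂', IsSolution B₁ B₂ k (β g).1 b₂' (β g).2.2 →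
      (β g).2.2 < 0 → k ∉ M B₁ B₂ := by
    have h1 : ContinuousAt (fun g => ((β g).1, (β g).2.2)) g₀ := hβc.fst.prodMk hβc.snd.snd
    refine h1.eventually (p := fun p : E d × ℝ => ∀ k ∈ GG d, ∀ b₂',
      IsSolution B₁ B₂ k p.1 b₂' p.2 → p.2 < 0 → k ∉ M B₁ B₂) ?_
    dsimp only
    rw [hbase]
    exact eventually_not_mem_M hB₁ hB₂ hs.mem₁
  obtain ⟨r₂, hr₂, hr₂O⟩ := Metric.mem_nhds_iff.1 (hend.and (hβN.and hneg))
  set r := min r₂ (r₁ / 2) with hr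
  have hr0 : 0 < r := by positivity
  have hrr₁ : ∀ g ∈ Metric.ball g₀ r, g ∈ Metric.ball g₀ r₁ := fun g hg =>
    Metric.ball_subset_ball ((min_le_right _ _).trans (by linarith)) hg
  have hrO₁ : ∀ g ∈ Metric.ball g₀ r, g ∈ O₁ := fun g hg => (hr₁O (hrr₁ g hg)).1
  have hrP := fun g (hg : g ∈ Metric.ball g₀ r) =>
    hr₂O (Metric.ball_subset_ball (min_le_left _ _) hg)
  have hβclose : ∀ g ∈ Metric.ball g₀ r, dist (β g).1 b₁ < ρ ∧ dist (β g).2.1 b₂ < ρ ∧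
      |(β g).2.2| < ρ / 2 ∧ |(β g).2.2| < ε := by
    intro g hg
    have h1 := (hrP g hg).2.1
    simp only [Prod.dist_eq, max_lt_iff, Real.dist_eq, sub_zero] at h1
    have h2 := min_le_left ρ ε
    have h3 := min_le_right ρ ε
    exact ⟨by linarith [h1.1], by linarith [h1.2.1], by linarith [h1.2.2], by linarith [h1.2.2]⟩
  have hunit_u : ∀ g ∈ GG d, g ∈ Metric.ball g₀ r → ‖g.1.1 (normal B₁ (β g).1)‖ = 1 := by
    intro g hg hgr
    rw [SO_norm hg.1, hB₁.norm_normal (hL.solves g hg (hrO₁ g hgr)).mem₁]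
  have hshiftN : ∀ g ∈ GG d, g ∈ Metric.ball g₀ r → ∀ t : ℝ, |t| ≤ T →
      shift g (g.1.1 (normal B₁ (β g).1)) t ∈ Metric.ball g₀ r₁ ∧
      ((β g).1, (β g).2.1, (β g).2.2 + t) =
        β (shift g (g.1.1 (normal B₁ (β g).1)) t) := by
    intro g hg hgr t ht
    have h1 : shift g (g.1.1 (normal B₁ (β g).1)) t ∈ Metric.ball g₀ r₁ := by
      rw [Metric.mem_ball] at hgr ⊢
      have h2 := dist_triangle (shift g (g.1.1 (normal B₁ (β g).1)) t) g g₀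
      rw [dist_shift g (hunit_u g hg hgr)] at h2
      have h3 := min_le_right r₂ (r₁ / 2)
      linarith
    refine ⟨h1, hL.unique _ (shift_mem_GG hg _ _) (hr₁O h1).1 _ (hr₀N ?_)
      ((hL.solves g hg (hrO₁ g hgr)).shift t)⟩
    obtain ⟨k1, k2, k3, -⟩ := hβclose g hgr
    simp only [Metric.mem_ball, Prod.dist_eq, max_lt_iff, Real.dist_eq, sub_zero]
    refine ⟨by linarith, by linarith, ?_⟩
    have := abs_add_le (β g).2.2 t
    linarith
  have hM₀ : ∀ g ∈ GG d, g ∈ Metric.ball g₀ r → 0 < (β g).2.2 → g ∈ M₀ B₁ B₂ := by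
    intro g hg hgr hpos
    by_contra hcon
    rw [mem_M₀_iff] at hcon
    push Not at hcon
    obtain ⟨x₁, hx₁, x₂, hx₂, hx⟩ := hcon hg
    -- If the bodies met despite a positive gap, separating them would lead to a last contact in M
    -- after some t ≥ 0. It is a solution with gap 0, but by uniqueness the gap there is the
    -- original one plus t, which is positive.
    obtain ⟨t, ht, htM, y, hy, hyt⟩ := exists_last_contact (B₁ := B₁) (B₂ := B₂) hKc hg hT0.le
      (fun t ht y₁ hy₁ y₂ hy₂ hyy => hKloc _ (shift_mem_GG hg _ _)
        (hshiftN g hg hgr t (by rw [abs_of_nonneg ht.1]; exact ht.2)).1 y₁ hy₁ y₂ hy₂ (by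
          rw [hyy, sub_self, norm_zero]; exact hε.le))
      ((hrP g hgr).1 hg) ⟨(x₁, x₂), hKloc g hg (hrr₁ g hgr) x₁ hx₁ x₂ hx₂ (by
        rw [hx, sub_self, norm_zero]; exact hε.le), hx⟩
    obtain ⟨h1, h2⟩ := hshiftN g hg hgr t (by rw [abs_of_nonneg ht.1]; exact ht.2)
    have h3 := hL.unique _ (shift_mem_GG hg _ _) (hr₁O h1).1 (y.1, y.2, 0)
      (hKN y hy 0 (by simpa using hr₀)) (isSolution_of_contact hB₁ hB₂ htM hy.2.1 hy.2.2 hyt)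
    rw [← h2] at h3
    have h4 : 0 = (β g).2.2 + t := congrArg (fun p : E d × E d × ℝ => p.2.2) h3
    linarith [ht.1]
  refine ⟨Metric.ball g₀ r, β, ⟨Metric.isOpen_ball, Metric.mem_ball_self hr0,
    hL.smooth.mono hrO₁, by rw [hbase], fun g hg hgr => hL.solves g hg (hrO₁ g hgr),
    ⟨N, by rw [hbase]; exact hnhds, fun g hg hgr => hL.unique g hg (hrO₁ g hgr)⟩, ?_, ?_, hM₀, ?_, ?_⟩,
    by rw [hbase], by rw [hbase]⟩
  · intro g hg hgr
    have : ∀ᶠ t : ℝ in 𝓝 0, |t| < T := by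
      have := Metric.ball_mem_nhds (0 : ℝ) hT0
      filter_upwards [this] with t ht
      simpa [Real.dist_eq] using ht
    exact this.mono fun t ht => (hshiftN g hg hgr t ht.le).2.symm
  · intro g hg hgr hlt
    exact (hrP g hgr).2.2 g hg _ (hL.solves g hg (hrO₁ g hgr)) hlt
  · intro g hg hgr hpos x₁ hx₁ x₂ hx₂ hx
    obtain ⟨-, -, k3, k4⟩ := hβclose g hgr
    rw [abs_of_pos hpos] at k3 k4
    have hg0 := hM₀ g hg hgr hpos
    have hnoc := (mem_M₀_iff.1 hg0).2
    have hl := hKloc g hg (hrr₁ g hgr)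
    -- A closest pair solves the contact equations with its distance as the gap, so it must be β.
    -- Any pair at distance at most the gap is then itself closest, and the same argument applies to
    -- it.
    have key : ∀ y₁ ∈ B₁, ∀ y₂ ∈ B₂, (∀ z₁ ∈ B₁, ∀ z₂ ∈ B₂,
        ‖act g.2 y₂ - act g.1 y₁‖ ≤ ‖act g.2 z₂ - act g.1 z₁‖) →
        ‖act g.2 y₂ - act g.1 y₁‖ ≤ (β g).2.2 →
        (y₁, y₂, ‖act g.2 y₂ - act g.1 y₁‖) = β g := by
      intro y₁ hy₁ y₂ hy₂ hmin hle
      have h1 := isSolution_of_nearest hB₁ hB₂ hg hy₁ hy₂ (hnoc y₁ hy₁ y₂ hy₂) hmin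
      refine hL.unique g hg (hrO₁ g hgr) _ (hKN (y₁, y₂) (hl y₁ hy₁ y₂ hy₂ (hle.trans k4.le)) _ ?_) h1
      rw [abs_of_nonneg (norm_nonneg _)]
      linarith
    obtain ⟨y₁, hy₁, y₂, hy₂, hmin⟩ := exists_closest_pair hB₁.isClosed hB₂.isClosed hKc hl hx₁ hx₂ (hx.trans k4.le)
    have h1 := key y₁ hy₁ y₂ hy₂ hmin ((hmin x₁ hx₁ x₂ hx₂).trans hx)
    have h2 : ‖act g.2 y₂ - act g.1 y₁‖ = (β g).2.2 := congrArg (fun p : E d × E d × ℝ => p.2.2) h1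
    have h3 := key x₁ hx₁ x₂ hx₂ (fun z₁ hz₁ z₂ hz₂ => hx.trans (h2 ▸ hmin z₁ hz₁ z₂ hz₂)) hx
    exact ⟨congrArg (fun p : E d × E d × ℝ => p.1) h3, congrArg (fun p : E d × E d × ℝ => p.2.1) h3⟩
  · intro g hgM hgr x₁ hx₁ x₂ hx₂ hx
    have hg := M_subset_GG hgM
    have h1 := hKloc g hg (hrr₁ g hgr) x₁ hx₁ x₂ hx₂ (by rw [hx, sub_self, norm_zero]; exact hε.le)
    have h3 := hL.unique g hg (hrO₁ g hgr) (x₁, x₂, 0) (hKN _ h1 0 (by simpa using hr₀))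
      (isSolution_of_contact hB₁ hB₂ hgM hx₁ hx₂ hx)
    exact ⟨congrArg (fun p : E d × E d × ℝ => p.1) h3, congrArg (fun p : E d × E d × ℝ => p.2.1) h3⟩

end

/-! ### Smoothness of the boundary of M and of the contact points -/

section

variable {d : ℕ} {B₁ B₂ : Set (E d)} {b₁ b₂ : E d} {q : Amb d} {g g₀ : Aff d × Aff d}
  {O : Set (Aff d × Aff d)} {β : Aff d × Aff d → E d × E d × ℝ}

theorem act_injective {h : Aff d} (hh : h.1 ∈ SO d) {x y : E d} (hxy : act h x = act h y) : x = y := by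
  rw [← inv_act_eq hh hxy, inv_act_eq hh rfl]

theorem exists_contact (hB₁ : IsBody B₁) (hB₂ : IsBody B₂) (hc : SingleContactAtBoundary B₁ B₂)
    (hg : g ∈ bdM B₁ B₂) : ∃ b₁ b₂, IsSolution B₁ B₂ g b₁ b₂ 0 ∧
      ∀ x₁ ∈ B₁, ∀ x₂ ∈ B₂, act g.1 x₁ = act g.2 x₂ → x₁ = b₁ ∧ x₂ = b₂ := by
  have hgG := M_subset_GG hg.1
  obtain ⟨x, hx⟩ := hc g hg
  obtain ⟨⟨b₁, hb₁, e₁⟩, b₂, hb₂, e₂⟩ : x ∈ act g.1 '' B₁ ∩ act g.2 '' B₂ := by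
    rw [hx]; exact mem_singleton x
  refine ⟨b₁, b₂, isSolution_of_contact hB₁ hB₂ hg.1 hb₁ hb₂ (e₁.trans e₂.symm), ?_⟩
  intro x₁ hx₁ x₂ hx₂ hxx
  have h1 : act g.1 x₁ ∈ act g.1 '' B₁ ∩ act g.2 '' B₂ :=
    ⟨mem_image_of_mem _ hx₁, hxx ▸ mem_image_of_mem _ hx₂⟩
  rw [hx, mem_singleton_iff] at h1
  exact ⟨act_injective hgG.1 (h1.trans e₁.symm), act_injective hgG.2 ((hxx ▸ h1).trans e₂.symm)⟩

theorem exists_collisionChart_of_condition₁ (hd : 1 ≤ d) (hB₁ : IsBody B₁) (hB₂ : IsBody B₂)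
    (hc : Condition₁ B₁ B₂) (hg : g ∈ bdM B₁ B₂) : ∃ O β, IsCollisionChart B₁ B₂ g O β := by
  obtain ⟨b₁, b₂, hs, huniq⟩ := exists_contact hB₁ hB₂ hc.1 hg
  obtain ⟨O, β, h, -⟩ := exists_collisionChart hd hB₁ hB₂ hc.2 hg.1 hs huniq
  exact ⟨O, β, h⟩

namespace IsCollisionChart

theorem continuousAt (h : IsCollisionChart B₁ B₂ g₀ O β) (hgO : g ∈ O) : ContinuousAt β g :=
  h.smooth.continuousOn.continuousAt (h.isOpen.mem_nhds hgO)

theorem eventually_gap_shift (h : IsCollisionChart B₁ B₂ g₀ O β) (hg : g ∈ GG d) (hgO : g ∈ O) :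
    ∀ᶠ t in 𝓝 (0 : ℝ), shift g (g.1.1 (normal B₁ (β g).1)) t ∈ O ∧
      (β (shift g (g.1.1 (normal B₁ (β g).1)) t)).2.2 = (β g).2.2 + t := by
  have h1 : ∀ᶠ t in 𝓝 (0 : ℝ), shift g (g.1.1 (normal B₁ (β g).1)) t ∈ O :=
    eventually_mem_open (continuous_shift g _).continuousAt h.isOpen (shift_zero g _) hgO
  filter_upwards [h1, h.eventually_shift g hg hgO] with t ht1 ht2
  exact ⟨ht1, by rw [ht2]⟩

theorem mem_M_iff (h : IsCollisionChart B₁ B₂ g₀ O β) (hg : g ∈ GG d) (hgO : g ∈ O) :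
    g ∈ M B₁ B₂ ↔ 0 ≤ (β g).2.2 := by
  refine ⟨fun hM => ?_, fun h0 => ?_⟩
  · by_contra hneg
    exact h.not_mem g hg hgO (not_le.1 hneg) hM
  · have hlim : Tendsto (shift g (g.1.1 (normal B₁ (β g).1))) (𝓝[>] 0) (𝓝 g) := by
      have := (continuous_shift g (g.1.1 (normal B₁ (β g).1))).tendsto 0
      rw [shift_zero] at this
      exact this.mono_left nhdsWithin_le_nhds
    refine mem_closure_of_tendsto hlim ?_
    filter_upwards [(h.eventually_gap_shift hg hgO).filter_mono nhdsWithin_le_nhds,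
      (self_mem_nhdsWithin : Ioi (0 : ℝ) ∈ 𝓝[>] 0)] with t ht ht0
    have ht0' : 0 < t := ht0
    exact h.mem₀ _ (shift_mem_GG hg _ _) ht.1 (by rw [ht.2]; linarith)

theorem mem_bdM_iff (h : IsCollisionChart B₁ B₂ g₀ O β) (hg : g ∈ GG d) (hgO : g ∈ O) :
    g ∈ bdM B₁ B₂ ↔ (β g).2.2 = 0 := by
  refine ⟨fun hbd => ?_, fun h0 => ⟨(h.mem_M_iff hg hgO).2 h0.ge, ?_⟩⟩
  · refine le_antisymm (le_of_not_gt fun hpos => ?_) ((h.mem_M_iff hg hgO).1 hbd.1)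
    have hev : ∀ᶠ k in 𝓝 g, 0 < (β k).2.2 :=
      (h.continuousAt hgO).snd.snd.tendsto.eventually_const_lt hpos
    obtain ⟨k, ⟨hkG, hkM⟩, hk, hkO⟩ := ((mem_closure_iff_frequently.1 hbd.2).and_eventually
      (hev.and (h.isOpen.mem_nhds hgO))).exists
    exact hkM ((h.mem_M_iff hkG hkO).2 hk.le)
  · have hlim : Tendsto (shift g (g.1.1 (normal B₁ (β g).1))) (𝓝[<] 0) (𝓝 g) := by
      have := (continuous_shift g (g.1.1 (normal B₁ (β g).1))).tendsto 0
      rw [shift_zero] at this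
      exact this.mono_left nhdsWithin_le_nhds
    refine mem_closure_of_tendsto hlim ?_
    filter_upwards [(h.eventually_gap_shift hg hgO).filter_mono nhdsWithin_le_nhds,
      (self_mem_nhdsWithin : Iio (0 : ℝ) ∈ 𝓝[<] 0)] with t ht ht0
    have ht0' : t < 0 := ht0
    exact ⟨shift_mem_GG hg _ _, h.not_mem _ (shift_mem_GG hg _ _) ht.1 (by rw [ht.2]; linarith)⟩

theorem nearest_of_nonneg (h : IsCollisionChart B₁ B₂ g₀ O β) (hg : g ∈ GG d) (hgO : g ∈ O)
    (h0 : 0 ≤ (β g).2.2) {x₁ x₂ : E d} (hx₁ : x₁ ∈ B₁) (hx₂ : x₂ ∈ B₂)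
    (hx : ‖act g.2 x₂ - act g.1 x₁‖ ≤ (β g).2.2) : x₁ = (β g).1 ∧ x₂ = (β g).2.1 := by
  rcases h0.eq_or_lt with h1 | h1
  · rw [← h1, norm_le_zero_iff, sub_eq_zero] at hx
    exact h.contact g ((h.mem_M_iff hg hgO).2 h0) hgO x₁ hx₁ x₂ hx₂ hx.symm
  · exact h.nearest g hg hgO h1 x₁ hx₁ x₂ hx₂ hx

end IsCollisionChart

theorem hasDerivAt_shift (g : Aff d × Aff d) (u : E d) :
    HasDerivAt (shift g u) ((0, (0, u)) : Aff d × Aff d) 0 := by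
  have h : HasDerivAt (fun t : ℝ => g.2.2 + t • u) u 0 := by
    simpa using ((hasDerivAt_id (0 : ℝ)).smul_const u).const_add g.2.2
  exact (hasDerivAt_const _ _).prodMk ((hasDerivAt_const _ _).prodMk h)

/-- The gap component of β is the defining function. Translating the second body along the common
normal raises it at unit rate, so its differential is nonzero on that tangent vector. -/
theorem hasSmoothBoundary_of_condition₁ (hd : 1 ≤ d) (hB₁ : IsBody B₁) (hB₂ : IsBody B₂)
    (hc : Condition₁ B₁ B₂) : HasSmoothBoundary B₁ B₂ := by
  intro g hg
  obtain ⟨O, β, h⟩ := exists_collisionChart_of_condition₁ hd hB₁ hB₂ hc hg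
  have hgG := M_subset_GG hg.1
  set u := g.1.1 (normal B₁ (β g).1) with hu
  have hf : ContDiffOn ℝ ∞ (fun g => (β g).2.2) O := h.smooth.snd.snd
  refine ⟨O, fun g => (β g).2.2, h.isOpen, h.mem, hf, fun x hx => h.mem_M_iff hx.1 hx.2,
    fun x hx => h.mem_bdM_iff hx.1 hx.2, (0, (0, u)), ?_, ?_⟩
  · exact mem_tangentSpaceAt (mem_tangentConeAt_of_curve (shift_zero g u) (hasDerivAt_shift g u)
      (Eventually.of_forall fun t => shift_mem_GG hgG u t))
  · have h1 : DifferentiableAt ℝ (fun g => (β g).2.2) g :=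
      (hf.contDiffAt (h.isOpen.mem_nhds h.mem)).differentiableAt (by simp)
    have h2 : HasFDerivAt (fun g => (β g).2.2) (fderiv ℝ (fun g => (β g).2.2) g) (shift g u 0) := by
      rw [shift_zero]; exact h1.hasFDerivAt
    have h3 := h2.comp_hasDerivAt (0 : ℝ) (hasDerivAt_shift g u)
    have h4 : HasDerivAt ((fun g => (β g).2.2) ∘ shift g u) 1 0 := by
      refine ((hasDerivAt_id (0 : ℝ)).const_add (β g).2.2).congr_of_eventuallyEq ?_
      filter_upwards [h.eventually_gap_shift hgG h.mem] with t ht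
      exact ht.2
    rw [h3.unique h4]
    exact one_ne_zero

theorem hasSmoothContactPoints_of_condition₁ (hd : 1 ≤ d) (hB₁ : IsBody B₁) (hB₂ : IsBody B₂)
    (hc : Condition₁ B₁ B₂) : HasSmoothContactPoints B₁ B₂ := by
  have hex : ∀ g, ∃ p : E d × E d, g ∈ bdM B₁ B₂ → IsSolution B₁ B₂ g p.1 p.2 0 ∧
      ∀ x₁ ∈ B₁, ∀ x₂ ∈ B₂, act g.1 x₁ = act g.2 x₂ → x₁ = p.1 ∧ x₂ = p.2 := by
    intro g
    by_cases hg : g ∈ bdM B₁ B₂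
    · obtain ⟨b₁, b₂, h⟩ := exists_contact hB₁ hB₂ hc.1 hg
      exact ⟨(b₁, b₂), fun _ => h⟩
    · exact ⟨0, fun h => absurd h hg⟩
  choose p hp using hex
  have hact : ∀ g ∈ bdM B₁ B₂, act g.1 (p g).1 = act g.2 (p g).2 := fun g hg => by
    simpa using (hp g hg).1.act_eq.symm
  have heq : ∀ g₀ ∈ bdM B₁ B₂, ∃ β : Aff d × Aff d → E d × E d × ℝ, ContDiffAt ℝ ∞ β g₀ ∧
      ∀ᶠ g in 𝓝 g₀, g ∈ bdM B₁ B₂ → p g = ((β g).1, (β g).2.1) := by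
    intro g₀ hg₀
    obtain ⟨O, β, h⟩ := exists_collisionChart_of_condition₁ hd hB₁ hB₂ hc hg₀
    refine ⟨β, h.smooth.contDiffAt (h.isOpen.mem_nhds h.mem), ?_⟩
    filter_upwards [h.isOpen.mem_nhds h.mem] with g hgO hg
    have := h.contact g hg.1 hgO _ (hB₁.isClosed.frontier_subset (hp g hg).1.mem₁) _
      (hB₂.isClosed.frontier_subset (hp g hg).1.mem₂) (hact g hg)
    exact Prod.ext this.1 this.2
  refine ⟨fun g => (p g).1, fun g => (p g).2, fun g hg => ?_, fun g hg => ?_, fun g hg =>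
    ⟨(hp g hg).1.mem₁, (hp g hg).1.mem₂, hact g hg, (hp g hg).2⟩⟩
  · obtain ⟨β, hβ, hev⟩ := heq g hg
    refine hβ.fst.contDiffWithinAt.congr_of_eventuallyEq_of_mem ?_ hg
    filter_upwards [self_mem_nhdsWithin, nhdsWithin_le_nhds hev] with k hk hk'
    rw [hk' hk]
  · obtain ⟨β, hβ, hev⟩ := heq g hg
    refine hβ.snd.fst.contDiffWithinAt.congr_of_eventuallyEq_of_mem ?_ hg
    filter_upwards [self_mem_nhdsWithin, nhdsWithin_le_nhds hev] with k hk hk'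
    rw [hk' hk]

/-! ### The bundle over a neighbourhood of the collision configurations -/

/-- `b₁`, `b₂` are the only points of the bodies at distance at most `s`. -/
def IsTight (B₁ B₂ : Set (E d)) (q : Amb d) : Prop := ∀ x₁ ∈ B₁, ∀ x₂ ∈ B₂,
  ‖act (Psi q).2 x₂ - act (Psi q).1 x₁‖ ≤ gap q → x₁ = q.1.1 ∧ x₂ = q.2.1.1

theorem Psi_leftAct (h : Aff d) (q : Amb d) :
    Psi (leftAct h q) = (mulAff h (Psi q).1, mulAff h (Psi q).2) := by
  simp only [Psi, leftAct, mulAff, map_sub, map_add, map_smul, ContinuousLinearMap.comp_assoc,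
    ContinuousLinearMap.comp_apply]
  refine Prod.ext (Prod.ext rfl ?_) (Prod.ext rfl ?_) <;> (dsimp only; abel)

theorem act_mulAff (h k : Aff d) (x : E d) : act (mulAff h k) x = act h (act k x) := by
  simp [act, mulAff, add_assoc]

theorem IsTight.leftAct {h : Aff d} (hh : h ∈ SE d) (hq : IsTight B₁ B₂ q) :
    IsTight B₁ B₂ (leftAct h q) := by
  intro x₁ hx₁ x₂ hx₂ hx
  rw [Psi_leftAct, act_mulAff, act_mulAff, act_sub, SO_norm hh] at hx
  exact hq x₁ hx₁ x₂ hx₂ hx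

theorem IsTight.rightAct {h : L d} (hh : h ∈ H d) (hq : IsTight B₁ B₂ q) :
    IsTight B₁ B₂ (rightAct q h) := by
  intro x₁ hx₁ x₂ hx₂ hx
  rw [Psi_rightAct _ hh] at hx
  exact hq x₁ hx₁ x₂ hx₂ hx

theorem norm_act_sub (hB₁ : IsBody B₁) (hq : q ∈ Me B₁ B₂) :
    ‖act (Psi q).2 q.2.1.1 - act (Psi q).1 q.1.1‖ = gap q := by
  rw [(isSolution_Psi hq).act_eq, add_sub_cancel_left, norm_smul, SO_norm (Psi_mem_GG hq).1,
    hB₁.norm_normal hq.1.1, mul_one, Real.norm_eq_abs, abs_of_nonneg hq.2.2.2]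

/-- For p near q the data of p are the solution β at `Psi p`, by local uniqueness; and β is the only
pair within its gap, by the contact and nearest-point properties of the collision chart. -/
theorem eventually_isTight (hd : 1 ≤ d) (hB₁ : IsBody B₁) (hB₂ : IsBody B₂) (hc : Condition₁ B₁ B₂)
    (hq : q ∈ bdMe B₁ B₂) (hΨ : Psi q ∈ bdM B₁ B₂) :
    ∀ᶠ p in 𝓝[Me B₁ B₂] q, IsTight B₁ B₂ p := by
  obtain ⟨O, β, h⟩ := exists_collisionChart_of_condition₁ hd hB₁ hB₂ hc hΨ
  obtain ⟨N, hN, huniq⟩ := h.unique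
  have hcont : Continuous (Psi (d := d)) := contDiff_Psi.continuous
  have hβ : β (Psi q) = (q.1.1, q.2.1.1, gap q) := by
    have hs := isSolution_Psi hq.1
    have hact := hs.act_eq
    rw [hq.2, zero_smul, add_zero] at hact
    have h1 := h.contact _ hΨ.1 h.mem _ (hB₁.isClosed.frontier_subset hs.mem₁) _
      (hB₂.isClosed.frontier_subset hs.mem₂) hact.symm
    have h2 : (q.1.1, q.2.1.1, gap q) = β (Psi q) :=
      Prod.ext h1.1 (Prod.ext h1.2 (hq.2.trans h.gap_eq.symm))
    exact h2.symm
  rw [hβ] at hN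
  have hc2 : ContinuousAt (fun p : Amb d => (p.1.1, p.2.1.1, gap p)) q :=
    (by fun_prop : Continuous fun p : Amb d => (p.1.1, p.2.1.1, p.2.2.2)).continuousAt
  filter_upwards [self_mem_nhdsWithin, nhdsWithin_le_nhds (hc2.eventually hN),
    nhdsWithin_le_nhds (hcont.continuousAt.eventually (h.isOpen.mem_nhds h.mem))] with p hp hpN hpO
  have hpG := Psi_mem_GG hp
  have h2 := huniq _ hpG hpO _ hpN (isSolution_Psi hp)
  intro x₁ hx₁ x₂ hx₂ hx
  have h3 : gap p = (β (Psi p)).2.2 := congrArg (fun p : E d × E d × ℝ => p.2.2) h2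
  have h4 := h.nearest_of_nonneg hpG hpO (h3 ▸ hp.2.2.2) hx₁ hx₂ (h3 ▸ hx)
  rw [← h2] at h4
  exact h4

theorem mulAff_inv {h : Aff d} (hh : h ∈ SE d) (k : Aff d) :
    mulAff h (mulAff (inv h.1, -inv h.1 h.2) k) = k := by
  refine Prod.ext ?_ ?_
  · ext1 x; exact SO_apply_inv hh _
  · simp only [mulAff, map_add, map_neg]
    rw [SO_apply_inv hh, SO_apply_inv hh]; abel

theorem mulAff_inv' {h : Aff d} (hh : h ∈ SE d) (k : Aff d) :
    mulAff (inv h.1, -inv h.1 h.2) (mulAff h k) = k := by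
  refine Prod.ext ?_ ?_
  · ext1 x; exact SO_inv_apply hh _
  · simp only [mulAff, map_add]
    rw [SO_inv_apply hh]; abel

theorem leftAct_leftAct_inv {h : Aff d} (hh : h ∈ SE d) (q : Amb d) :
    leftAct h (leftAct (inv h.1, -inv h.1 h.2) q) = q := by
  simp only [leftAct, mulAff_inv hh]

theorem leftAct_inv_leftAct {h : Aff d} (hh : h ∈ SE d) (q : Amb d) :
    leftAct (inv h.1, -inv h.1 h.2) (leftAct h q) = q := by
  simp only [leftAct, mulAff_inv' hh]

theorem continuous_leftAct (h : Aff d) : Continuous (leftAct h) := by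
  have h1 : Continuous (fun q : Amb d => h.1 ∘L q.2.2.1.1) :=
    continuous_const.clm_comp (by fun_prop)
  have h2 : Continuous (fun q : Amb d => h.1 q.2.2.1.2 + h.2) := by fun_prop
  exact continuous_fst.prodMk (Continuous.prodMk (by fun_prop)
    ((h1.prodMk h2).prodMk (by fun_prop)))

theorem rightAct_rightAct (q : Amb d) {h k : L d} (hhk : h ∘L k = 1) :
    rightAct (rightAct q h) k = q := by
  have h1 : ∀ σ : L d, (σ ∘L h) ∘L k = σ := fun σ => by
    rw [ContinuousLinearMap.comp_assoc, hhk]; rfl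
  refine Prod.ext (Prod.ext rfl (h1 _)) (Prod.ext (Prod.ext rfl (h1 _))
    (Prod.ext (Prod.ext (h1 _) ?_) rfl))
  simp [rightAct, mulAff]

theorem continuous_rightAct (h : L d) : Continuous (fun q : Amb d => rightAct q h) :=
  contDiff_rightAct.continuous.comp (continuous_id.prodMk continuous_const)

theorem tendsto_nhdsWithin_self {X : Type*} [TopologicalSpace X] {F : X → X} {s : Set X} {x y : X}
    (hF : Continuous F) (hs : ∀ z ∈ s, F z ∈ s) (hxy : F x = y) : Tendsto F (𝓝[s] x) (𝓝[s] y) := by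
  rw [← hxy]
  exact tendsto_nhdsWithin_iff.2 ⟨(hF.tendsto x).mono_left nhdsWithin_le_nhds,
    eventually_mem_nhdsWithin.mono hs⟩

/-- U consists of the points of R near which tightness holds. Tightness is invariant under both
groups, makes `Psi` injective up to H, and keeps the bodies disjoint after any small increase of the
gap. -/
theorem exists_isCollisionBundle (hd : 1 ≤ d) (hB₁ : IsBody B₁) (hB₂ : IsBody B₂)
    (hc : Condition₁ B₁ B₂) {R : Set (Amb d)} (hR : IsRelOpen R (Me B₁ B₂)) (hbd : bdMe B₁ B₂ ⊆ R)
    (hl : ∀ g ∈ SE d, ∀ q ∈ R, leftAct g q ∈ R) (hr : ∀ q ∈ R, ∀ h ∈ H d, rightAct q h ∈ R)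
    (hu : ∀ q ∈ R, IsUnit (combined B₁ B₂ q)) : ∃ U ⊆ R, IsCollisionBundle B₁ B₂ U := by
  set U : Set (Amb d) := {q | q ∈ R ∧ ∀ᶠ p in 𝓝[Me B₁ B₂] q, IsTight B₁ B₂ p} with hU
  have hbdU : ∀ q ∈ bdMe B₁ B₂, Psi q ∈ bdM B₁ B₂ → q ∈ U := fun q hq hΨ =>
    ⟨hbd hq, eventually_isTight hd hB₁ hB₂ hc hq hΨ⟩
  have hMe : ∀ q ∈ U, q ∈ Me B₁ B₂ := fun q hq => hR.subset hq.1
  have htight : ∀ q ∈ U, IsTight B₁ B₂ q := fun q hq => hq.2.self_of_nhdsWithin (hMe q hq)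
  refine ⟨U, fun q hq => hq.1, isCollisionBundle_of hB₁ hB₂ ?_ hbdU ?_ ?_ (fun q hq => hu q hq.1) ?_
    ?_ ?_⟩
  · refine isRelOpen_of_nhdsWithin hMe fun q hq => ?_
    filter_upwards [hR.mem_nhdsWithin hq.1, eventually_eventually_nhdsWithin.2 hq.2] with p hp hp'
    exact ⟨hp, hp'⟩
  · rintro h hh q hq
    refine ⟨hl h hh q hq.1, ?_⟩
    have hinv : ((inv h.1, -inv h.1 h.2) : Aff d) ∈ SE d := SO_inv_mem hh
    have hcont : Tendsto (leftAct ((inv h.1, -inv h.1 h.2) : Aff d)) (𝓝[Me B₁ B₂] (leftAct h q))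
        (𝓝[Me B₁ B₂] q) := tendsto_nhdsWithin_self (continuous_leftAct _)
      (fun p hp => leftAct_mem_Me hinv hp) (leftAct_inv_leftAct hh q)
    filter_upwards [hcont.eventually hq.2] with p hp
    have := hp.leftAct hh
    rwa [leftAct_leftAct_inv hh] at this
  · rintro q hq h hh
    refine ⟨hr q hq.1 h hh, ?_⟩
    have hcont : Tendsto (fun p => rightAct p (inv h)) (𝓝[Me B₁ B₂] (rightAct q h))
        (𝓝[Me B₁ B₂] q) := tendsto_nhdsWithin_self (continuous_rightAct _)
      (fun p hp => rightAct_mem_Me (H_inv_mem hh) hp) (rightAct_rightAct q (SO_comp_inv hh.1))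
    filter_upwards [hcont.eventually hq.2] with p hp
    have := hp.rightAct hh
    rwa [rightAct_rightAct p (SO_inv_comp hh.1)] at this
  · intro q hq q' hq' hΨ
    -- The pair with the smaller gap lies within the gap of the other point, whose tightness then
    -- identifies the two pairs.
    rcases le_total (gap q') (gap q) with hle | hle
    · have h1 := norm_act_sub hB₁ (hMe q' hq')
      rw [← hΨ] at h1
      have := htight q hq _ (hB₁.isClosed.frontier_subset (hMe q' hq').1.1) _
        (hB₂.isClosed.frontier_subset (hMe q' hq').2.1.1) (h1.le.trans hle)
      exact ⟨this.1.symm, this.2.symm⟩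
    · have h1 := norm_act_sub hB₁ (hMe q hq)
      rw [hΨ] at h1
      exact htight q' hq' _ (hB₁.isClosed.frontier_subset (hMe q hq).1.1) _
        (hB₂.isClosed.frontier_subset (hMe q hq).2.1.1) (h1.le.trans hle)
  · intro q hq
    -- Raising s by t > 0 keeps tightness for small t. A contact would then have to occur at the
    -- designated points, which are at positive distance, so the bodies are disjoint and q is mapped
    -- into the closure.
    have hcont : Continuous (fun t : ℝ => ((q.1, q.2.1, q.2.2.1, gap q + t) : Amb d)) := by fun_prop
    have hlim : Tendsto (fun t : ℝ => ((q.1, q.2.1, q.2.2.1, gap q + t) : Amb d)) (𝓝[>] 0) (𝓝 q) := by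
      have := hcont.tendsto 0
      rw [add_zero] at this
      exact this.mono_left nhdsWithin_le_nhds
    have hmem : ∀ᶠ t : ℝ in 𝓝[>] 0, ((q.1, q.2.1, q.2.2.1, gap q + t) : Amb d) ∈ Me B₁ B₂ := by
      filter_upwards [(self_mem_nhdsWithin : Ioi (0 : ℝ) ∈ 𝓝[>] 0)] with t ht
      have ht' : 0 < t := ht
      exact ⟨(hMe q hq).1, (hMe q hq).2.1, (hMe q hq).2.2.1, add_nonneg (hMe q hq).2.2.2 ht'.le⟩
    have hlim' := tendsto_nhdsWithin_iff.2 ⟨hlim, hmem⟩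
    refine mem_closure_of_tendsto ((contDiff_Psi (d := d)).continuous.continuousAt.tendsto.comp hlim) ?_
    filter_upwards [hlim'.eventually hq.2, hmem,
      (self_mem_nhdsWithin : Ioi (0 : ℝ) ∈ 𝓝[>] 0)] with t ht htM ht0
    have hpos : 0 < gap q + t := add_pos_of_nonneg_of_pos (hMe q hq).2.2.2 ht0
    refine mem_M₀_iff.2 ⟨Psi_mem_GG htM, fun x₁ hx₁ x₂ hx₂ hx => ?_⟩
    have h1 := ht x₁ hx₁ x₂ hx₂ (by
      rw [Function.comp_apply] at hx
      rw [hx, sub_self, norm_zero]; exact hpos.le)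
    have h2 := norm_act_sub hB₁ htM
    rw [← h1.1, ← h1.2] at h2
    rw [Function.comp_apply] at hx
    rw [hx, sub_self, norm_zero] at h2
    exact hpos.ne h2
  · intro g hg
    obtain ⟨b₁, b₂, hs, -⟩ := exists_contact hB₁ hB₂ hc.1 hg
    obtain ⟨q, hq, hΨ, -, -, hgap⟩ := exists_lift hd hB₁ (M_subset_GG hg.1) hs le_rfl
    exact ⟨q, hbdU q ⟨hq, hgap⟩ (hΨ ▸ hg), hΨ⟩

end

end RigidBodies

end

open RigidBodies in
theorem mainTheorem6 (d : ℕ) (hd : 1 ≤ d) (B₁ B₂ : Set (E d)) (hB₁ : IsBody B₁) (hB₂ : IsBody B₂) :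
    (Condition₁ B₁ B₂ →
      IsSubmersionNhd B₁ B₂ (region₁ B₁ B₂) ∧
        ∃ U ⊆ region₁ B₁ B₂, IsCollisionBundle B₁ B₂ U) ∧
    (Condition₂ B₁ B₂ →
      IsSubmersionNhd B₁ B₂ (region₂ B₁ B₂) ∧
        ∃ U ⊆ region₂ B₁ B₂, IsCollisionBundle B₁ B₂ U) ∧
    (Condition₃ B₁ B₂ →
      IsSubmersionNhd B₁ B₂ (Me B₁ B₂) ∧ IsCollisionBundle B₁ B₂ (Me B₁ B₂)) ∧
    (Condition₁ B₁ B₂ ∨ Condition₂ B₁ B₂ ∨ Condition₃ B₁ B₂ →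
      HasSmoothBoundary B₁ B₂ ∧ HasSmoothContactPoints B₁ B₂) := by
  have h₁ : Condition₁ B₁ B₂ → HasSmoothBoundary B₁ B₂ ∧ HasSmoothContactPoints B₁ B₂ := fun hc =>
    ⟨hasSmoothBoundary_of_condition₁ hd hB₁ hB₂ hc,
      hasSmoothContactPoints_of_condition₁ hd hB₁ hB₂ hc⟩
  refine ⟨fun hc => ?_, fun hc => ?_, fun hc => ⟨isSubmersionNhd_Me hB₁ hB₂ hc,
    isCollisionBundle_Me hd hB₁ hB₂ hc⟩, ?_⟩
  · have h := isSubmersionNhd_region₁ hB₁ hB₂ hc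
    exact ⟨h, exists_isCollisionBundle hd hB₁ hB₂ hc h.relOpen h.bdMe_subset h.leftAct_mem
      (fun q hq k hk => region₁_rightAct hB₁ hB₂ hq hk) fun q hq => (mem_region₁_iff.1 hq).2.2.2⟩
  · have h := isSubmersionNhd_region₂ hB₁ hB₂ hc
    exact ⟨h, exists_isCollisionBundle hd hB₁ hB₂ (condition₁_of_condition₂ hc) h.relOpen
      h.bdMe_subset h.leftAct_mem (fun q hq k hk => region₂_rightAct hB₁ hB₂ hq hk)
      fun q hq => ((mem_region₂_iff hB₁ hB₂).1 hq).2.2⟩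
  · rintro (hc | hc | hc)
    · exact h₁ hc
    · exact h₁ (condition₁_of_condition₂ hc)
    · exact h₁ (condition₁_of_condition₃ hd hB₁ hB₂ hc)
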